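/- Let $R\subset E^*\cong E=\mathbb R^r$ be a (reduced) root system of a finite real reflection group $W$, with positive roots $R_+$, let $\mathfrak h=E_{\mathbb C}$, and let $c$ be a real-valued $W$-invariant function on $R$. Let $\mathsf H_c$ be the rational Cherednik algebra at $t=1$, with $[y,x]=\langle x,y\rangle-\sum_{\alpha>0}c_\alpha\langle\alpha,y\rangle\langle x,\alpha^\vee\rangle s_\alpha$ ($y\in\mathfrak h$, $x\in\mathfrak h^*$). For $\sigma\in\widehat W$ let $N_c(\sigma)$ be the scalar by which $\sum_{\alpha>0}c_\alpha s_\alpha$ acts on $V(\sigma)$, and let $M_c(\tau)$ be the standard module of $\tau\in\widehat W$. Let $\mathcal C$ be the Clifford algebra of $\mathfrak h\oplus\mathfrak h^*$ with relation $vv'+v'v=B(v,v')$ ($B$ the natural pairing), acting on $\bigwedge\mathfrak h^*$ by wedge product and contraction, and put $K_c(\tau)=M_c(\tau)\otimes\bigwedge\mathfrak h^*$, an $\mathsf H_c\otimes\mathcal C$-module with the diagonal $W$-action, bigraded by $K_m^l=\mathbb C[\mathfrak h]_m\otimes V(\tau)\otimes\bigwedge^l\mathfrak h^*$. Let $*$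 be the conjugate-linear anti-involution of $\mathsf H_c\otimes\mathcal C$ given by the Hermitian structure on $\mathfrak h$ ($y\mapsto y^*\in\mathfrak h^*$) and by $w^*=w^{-1}$. With dual orthonormal bases $x_i,y_i$ and $\Omega_c=\sum_{\alpha>0}c_\alpha s_\alpha\otimes(1-\alpha\alpha^\vee)$, the Lie superalgebra $\mathfrak g=\mathfrak{spo}(2|2,\mathbb C)$, with basis $h,z,e_1^\pm$ (even), $e_2^\pm,e_3^\pm$ (odd), acts on $K_c(\tau)$ through $h\mapsto\frac12\sum(x_iy_i+y_ix_i)\otimes1$, $z\mapsto\frac12\sum 1\otimes(x_iy_i-y_ix_i)+\Omega_c$, $e_1^+\mapsto-\frac12\sum x_i^2\otimes1$, $e_1^-\mapsto\frac12\sum y_i^2\otimes1$, $e_2^+\mapsto\sum y_i\otimes x_i$, $e_2^-\mapsto\sum x_i\otimes y_i$, $e_3^+\mapsto-\sum x_i\otimes x_i$, $e_3^-\mapsto-\sum y_i\otimes y_i$. Let $\mathcal R_c$ be the centraliser of the image of $\mathfrak g$ in $\mathsf H_c\otimes\mathcal C$. A lowest weight vector is a nonzero vector killed by $\mathfrak n^-=\langle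 e_1^-,e_2^-,e_3^-\rangle$; for a weight $\lambda=(\lambda(h),\lambda(z))$ let $\mathbb V(\lambda)=U(\mathfrak g)\otimes_{U(\mathfrak b^-)}\mathbb C_\lambda$ with $\mathfrak b^-=\langle h,z\rangle\oplus\mathfrak n^-$, and let $L(\lambda)$ be its irreducible quotient. Let $\mathcal M_c(\tau,\sigma)_m^l$ be the space of vectors of $K_m^l$ that lie in the $\sigma$-isotypic component of $K_c(\tau)$ and are killed by $\mathfrak n^-$, and put $\lambda_{m,l,\sigma}=(m+\frac r2-N_c(\tau),\,l-\frac r2+N_c(\sigma))$. Let $B(r)=\{(0,0),(1,r-1)\}\cup\{(m,l): m\ge1,\ 0\le l\le r-2\}$, and let $H(r)$ be the set of hook partitions $\lambda$ with $\lambda_1'+\lambda_2'\le r$. Let $\Gamma=\bigwedge[e_2,e_3]$ act on $\mathfrak g$-modules by $e_2\mapsto e_2^+$, $e_3\mapsto e_3^+$. For $\delta\in\{0,1\}$ let $L(+\infty,\delta)$ be the $\Gamma$-module with generators $x_j$ $(j\ge0)$ and relations $e_3x_j=e_2x_{j+1}$, $(1-\delta)e_2x_0=0$. **Theorem.** Let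 $\tau\in\widehat W$ and let $c$ be such that $M_c(\tau)$ is $*$-unitary, $\frac r2-N_c(\tau)\notin\mathbb Z_{\le0}$, and $N_c(\tau)-N_c(\sigma)\notin\mathbb Z_{\ge0}$ for all $\sigma\in\widehat W\setminus\{\tau\}$. Then: 1. The map $\lambda\mapsto(m(\lambda),l(\lambda))=(\lambda_1,\lambda_1'-1)$, with $(0)\mapsto(0,0)$, is a bijection $H(r)\to B(r)$. 2. All $\mathcal M_c(\tau,\sigma)_m^l$ are finite-dimensional, and there is an isomorphism of $\mathfrak g$-modules $$K_c(\tau)\cong\bigoplus_{\sigma\in\widehat W}\ \bigoplus_{(m,l)\in B(r)}\mathcal M_c(\tau,\sigma)_m^l\boxtimes L(\lambda_{m,l,\sigma})$$ that identifies $\theta\otimes(\text{lowest weight vector})$ with $\theta$ and the $\sigma$-part of the right-hand side with the $\sigma$-isotypic component of $K_c(\tau)$. It is compatible with $\mathcal R_c$: if $X\in\mathcal R_c$ maps $\theta\in\mathcal M_c(\tau,\sigma)_m^l$ into the same space, then $X$ maps $\theta\otimes u$ to $X\theta\otimes u$. 3. Let $(m,l)\in B(r)$ with $\mathcal M_c(\tau,\sigma)_m^l\ne0$.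 Then $L(\lambda_{m,l,\sigma})$ is an irreducible $\mathfrak g$-module. As a $\Gamma$-module it is isomorphic to $L(+\infty,0)$ (type $L_0$) if $(m,l)=(0,0)$ and to $L(+\infty,1)$ (type $L_1$) if $(m,l)=(1,r-1)$; otherwise it is a free $\Gamma$-module and is isomorphic to $\mathbb V(\lambda_{m,l,\sigma})$ as a $\mathfrak g$-module. In each case the generators $x_j$, respectively free generators $x_j$ $(j\ge 0)$, can be taken of weight $\lambda_{m,l,\sigma}+(2j,0)$. 4. If $\sigma\in\widehat W$ satisfies $N_c(\sigma)-N_c(\sigma')\notin\mathbb Z$ for all $\sigma'\in\widehat W\setminus\{\sigma\}$, then each $\mathcal M_c(\tau,\sigma)_m^l$ is stable under $\mathcal R_c$ and is a $*$-unitary $\mathcal R_c$-module. In particular, if this holds for all $\sigma$, the decomposition in 2 is one of $(\mathcal R_c,\mathfrak g)$-modules with finite-dimensional unitary multiplicity spaces. 5. Without the separation condition in 4: for every weight $\mu$, the space of all vectors of $K_c(\tau)$ of weight $\mu$ that are killed by $\mathfrak n^-$ equals the sum of the $\mathcal M_c(\tau,\sigma)_m^l$ with $(m,l)\in B(r)$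 and $\lambda_{m,l,\sigma}=\mu$, and it is a finite-dimensional $*$-unitary $\mathcal R_c$-module. -/

import Mathlib

open scoped TensorProduct Matrix ComplexConjugate DirectSum

noncomputable section

namespace DunklHowe

/-! ## Real reflection groups -/

/-- The matrix of the reflection `v ↦ v - 2 (v,α)/(α,α) α` of Euclidean space `ℝ^r`. -/
def reflMatrix {r : ℕ} (α : Fin r → ℝ) : Matrix (Fin r) (Fin r) ℝ :=
  1 - (2 / (α ⬝ᵥ α)) • Matrix.vecMulVec α α

theorem reflMatrix_transpose {r : ℕ} (α : Fin r → ℝ) : (reflMatrix α)ᵀ = reflMatrix α := by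
  simp [reflMatrix, Matrix.transpose_sub, Matrix.transpose_smul, Matrix.transpose_vecMulVec]

theorem reflMatrix_mul_self {r : ℕ} (α : Fin r → ℝ) : reflMatrix α * reflMatrix α = 1 := by
  have h : Matrix.vecMulVec α α * Matrix.vecMulVec α α = (α ⬝ᵥ α) • Matrix.vecMulVec α α := by
    rw [Matrix.vecMulVec_mul_vecMulVec]
    ext i j
    simp [Matrix.vecMulVec_apply]
    ring
  simp only [reflMatrix, sub_mul, mul_sub, one_mul, mul_one, smul_mul_assoc, mul_smul_comm, h,
    smul_smul]
  by_cases h0 : α ⬝ᵥ α = 0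
  · simp [h0]
  · have : 2 / (α ⬝ᵥ α) * (α ⬝ᵥ α) = 2 := div_mul_cancel₀ 2 h0
    rw [this, two_smul]
    module

/-- The reflection `s_α` as an element of the orthogonal group. -/
def refl {r : ℕ} (α : Fin r → ℝ) : Matrix.orthogonalGroup (Fin r) ℝ :=
  ⟨reflMatrix α, by
    rw [Matrix.mem_orthogonalGroup_iff, reflMatrix_transpose, reflMatrix_mul_self]⟩

/-- A (reduced, not necessarily crystallographic, not necessarily spanning) root system in the
Euclidean space `E = ℝ^r`, together with a choice of positive roots. The space `E` and its dual
are identified by the Euclidean structure. -/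
structure RootSys (r : ℕ) where
  roots : Finset (Fin r → ℝ)
  ne_zero : ∀ α ∈ roots, α ≠ 0
  refl_mem : ∀ α ∈ roots, ∀ β ∈ roots, reflMatrix α *ᵥ β ∈ roots
  reduced : ∀ α ∈ roots, ∀ t : ℝ, t • α ∈ roots → t = 1 ∨ t = -1
  pos : Finset (Fin r → ℝ)
  pos_spec : ∃ v : Fin r → ℝ, (∀ α ∈ roots, v ⬝ᵥ α ≠ 0) ∧
    ∀ α, α ∈ pos ↔ α ∈ roots ∧ 0 < v ⬝ᵥ α

namespace RootSys

variable {r : ℕ} (D : RootSys r)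

/-- The reflection group `W` generated by the reflections in the roots. -/
def W : Subgroup (Matrix.orthogonalGroup (Fin r) ℝ) :=
  Subgroup.closure {w | ∃ α ∈ D.roots, w = refl α}

/-- The reflection `s_α` in `W`, for a positive root `α`. -/
def s (α : {α // α ∈ D.pos}) : D.W :=
  ⟨refl α.1, Subgroup.subset_closure ⟨α.1, by
    obtain ⟨v, -, h⟩ := D.pos_spec
    exact ((h α.1).1 α.2).1, rfl⟩⟩

end RootSys

/-- A real-valued `W`-invariant parameter function on the roots (values off the roots are not
used). -/
structure Param {r : ℕ} (D : RootSys r) where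
  val : (Fin r → ℝ) → ℝ
  inv : ∀ w ∈ D.W, ∀ α ∈ D.roots, val ((w : Matrix (Fin r) (Fin r) ℝ) *ᵥ α) = val α

/-- `Vec r = ℂ^r` is used both for `𝔥 = E_ℂ` (coordinates in the standard orthonormal basis `y_i`)
and for `𝔥^*` (coordinates in the dual basis `x_i`). The pairing `𝔥^* × 𝔥 → ℂ` is `x ⬝ᵥ y`. -/
abbrev Vec (r : ℕ) : Type := Fin r → ℂ

/-- The complex-linear action of an orthogonal matrix on `𝔥`. As the matrix is real orthogonal,
the contragredient action on `𝔥^*` is given by the same matrix in the dual basis. -/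
def act {r : ℕ} (w : Matrix.orthogonalGroup (Fin r) ℝ) : Vec r →ₗ[ℂ] Vec r :=
  Matrix.mulVecLin ((w : Matrix (Fin r) (Fin r) ℝ).map Complex.ofReal)

/-- The root `α` as an element of `𝔥^*`. -/
def rt {r : ℕ} (α : Fin r → ℝ) : Vec r := fun i => (α i : ℂ)

/-- The coroot `α^∨ = 2α/(α,α)` as an element of `𝔥`. -/
def cort {r : ℕ} (α : Fin r → ℝ) : Vec r := fun i => ((2 / (α ⬝ᵥ α) * α i : ℝ) : ℂ)

/-- The conjugate-linear bijections `* : 𝔥 → 𝔥^*` and `* : 𝔥^* → 𝔥`; both are complex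
conjugation of coordinates. -/
def cj {r : ℕ} (v : Vec r) : Vec r := fun i => conj (v i)

/-! ## The rational Cherednik algebra -/

/-- Generators: `y ∈ 𝔥`, `x ∈ 𝔥^*`, `w ∈ W`. -/
inductive Gen {r : ℕ} (D : RootSys r) : Type
  | y (v : Vec r) : Gen D
  | x (v : Vec r) : Gen D
  | g (w : D.W) : Gen D

variable {r : ℕ} {D : RootSys r}

section free
open FreeAlgebra

/-- Defining relations of the rational Cherednik algebra: linearity of the generators in `𝔥` and
`𝔥^*`, the relations of the skew group algebra `T(𝔥 ⊕ 𝔥^*) # W`, and the commutation relations. -/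
inductive Rel (c : Param D) : FreeAlgebra ℂ (Gen D) → FreeAlgebra ℂ (Gen D) → Prop
  | y_add (v v' : Vec r) : Rel c (ι ℂ (Gen.y (v + v'))) (ι ℂ (Gen.y v) + ι ℂ (Gen.y v'))
  | y_smul (a : ℂ) (v : Vec r) : Rel c (ι ℂ (Gen.y (a • v))) (a • ι ℂ (Gen.y v))
  | x_add (v v' : Vec r) : Rel c (ι ℂ (Gen.x (v + v'))) (ι ℂ (Gen.x v) + ι ℂ (Gen.x v'))
  | x_smul (a : ℂ) (v : Vec r) : Rel c (ι ℂ (Gen.x (a • v))) (a • ι ℂ (Gen.x v))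
  | g_one : Rel c (ι ℂ (Gen.g 1)) 1
  | g_mul (w w' : D.W) : Rel c (ι ℂ (Gen.g (w * w'))) (ι ℂ (Gen.g w) * ι ℂ (Gen.g w'))
  | g_y (w : D.W) (v : Vec r) : Rel c (ι ℂ (Gen.g w) * ι ℂ (Gen.y v))
      (ι ℂ (Gen.y (act w.1 v)) * ι ℂ (Gen.g w))
  | g_x (w : D.W) (v : Vec r) : Rel c (ι ℂ (Gen.g w) * ι ℂ (Gen.x v))
      (ι ℂ (Gen.x (act w.1 v)) * ι ℂ (Gen.g w))
  | yy (v v' : Vec r) : Rel c (ι ℂ (Gen.y v) * ι ℂ (Gen.y v')) (ι ℂ (Gen.y v') * ι ℂ (Gen.y v))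
  | xx (v v' : Vec r) : Rel c (ι ℂ (Gen.x v) * ι ℂ (Gen.x v')) (ι ℂ (Gen.x v') * ι ℂ (Gen.x v))
  | yx (v u : Vec r) : Rel c
      (ι ℂ (Gen.y v) * ι ℂ (Gen.x u) - ι ℂ (Gen.x u) * ι ℂ (Gen.y v))
      ((u ⬝ᵥ v) • 1 - ∑ α : {α // α ∈ D.pos},
        ((c.val α.1 : ℂ) * (rt α.1 ⬝ᵥ v) * (u ⬝ᵥ cort α.1)) • ι ℂ (Gen.g (D.s α)))

end free

/-- The rational Cherednik algebra `H_c(W, 𝔥)` (with `t = 1`). -/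
def RCA (c : Param D) : Type := RingQuot (Rel c)

instance (c : Param D) : Ring (RCA c) := inferInstanceAs (Ring (RingQuot (Rel c)))
instance (c : Param D) : Algebra ℂ (RCA c) := inferInstanceAs (Algebra ℂ (RingQuot (Rel c)))

namespace RCA

variable (c : Param D)

/-- The quotient map from the free algebra. -/
def mk : FreeAlgebra ℂ (Gen D) →ₐ[ℂ] RCA c := RingQuot.mkAlgHom ℂ (Rel c)

/-- The generator of `H_c` given by `v ∈ 𝔥`. -/
def y (v : Vec r) : RCA c := mk c (FreeAlgebra.ι ℂ (Gen.y v))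
/-- The generator of `H_c` given by `v ∈ 𝔥^*`. -/
def x (v : Vec r) : RCA c := mk c (FreeAlgebra.ι ℂ (Gen.x v))
/-- The generator of `H_c` given by `w ∈ W`. -/
def g (w : D.W) : RCA c := mk c (FreeAlgebra.ι ℂ (Gen.g w))

theorem mk_rel {a b : FreeAlgebra ℂ (Gen D)} (h : Rel c a b) : mk c a = mk c b :=
  RingQuot.mkAlgHom_rel ℂ h

theorem y_add (v v' : Vec r) : y c (v + v') = y c v + y c v' := by
  simpa [y] using mk_rel c (Rel.y_add v v')
theorem y_smul (a : ℂ) (v : Vec r) : y c (a • v) = a • y c v := by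
  simpa [y] using mk_rel c (Rel.y_smul a v)
theorem x_add (v v' : Vec r) : x c (v + v') = x c v + x c v' := by
  simpa [x] using mk_rel c (Rel.x_add v v')
theorem x_smul (a : ℂ) (v : Vec r) : x c (a • v) = a • x c v := by
  simpa [x] using mk_rel c (Rel.x_smul a v)
theorem g_one : g c (1 : D.W) = 1 := by
  simpa [g] using mk_rel c Rel.g_one
theorem g_mul (w w' : D.W) : g c (w * w') = g c w * g c w' := by
  simpa [g] using mk_rel c (Rel.g_mul w w')
theorem g_y (w : D.W) (v : Vec r) : g c w * y c v = y c (act w.1 v) * g c w := by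
  simpa [g, y] using mk_rel c (Rel.g_y w v)
theorem g_x (w : D.W) (v : Vec r) : g c w * x c v = x c (act w.1 v) * g c w := by
  simpa [g, x] using mk_rel c (Rel.g_x w v)
theorem yy (v v' : Vec r) : y c v * y c v' = y c v' * y c v := by
  simpa [y] using mk_rel c (Rel.yy v v')
theorem xx (v v' : Vec r) : x c v * x c v' = x c v' * x c v := by
  simpa [x] using mk_rel c (Rel.xx v v')
theorem yx (v u : Vec r) : y c v * x c u - x c u * y c v =
    (u ⬝ᵥ v) • (1 : RCA c) - ∑ α : {α // α ∈ D.pos},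
        ((c.val α.1 : ℂ) * (rt α.1 ⬝ᵥ v) * (u ⬝ᵥ cort α.1)) • g c (D.s α) := by
  simpa [g, x, y] using mk_rel c (Rel.yx v u)

end RCA

/-! ## Conjugate-linear anti-involutions -/

/-- The opposite algebra of `A` with the complex-conjugate scalar multiplication: an algebra
homomorphism `A → ConjOp B` is a conjugate-linear anti-homomorphism `A → B`. -/
def ConjOp (A : Type) : Type := Aᵐᵒᵖ

set_option linter.unusedSectionVars false

namespace ConjOp

variable {A : Type} [Ring A] [Algebra ℂ A]

instance : Ring (ConjOp A) := inferInstanceAs (Ring Aᵐᵒᵖ)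

instance : Algebra ℂ (ConjOp A) :=
  RingHom.toAlgebra' (S := ConjOp A) ((algebraMap ℂ Aᵐᵒᵖ).comp (starRingEnd ℂ))
    (fun a b => Algebra.commutes (A := Aᵐᵒᵖ) (conj a) b)

/-- `a` as an element of `ConjOp A`. -/
def op (a : A) : ConjOp A := MulOpposite.op a
/-- The underlying element of `A`. -/
def unop (a : ConjOp A) : A := MulOpposite.unop (α := A) a

theorem op_unop (a : ConjOp A) : op (unop a) = a := rfl
theorem unop_op (a : A) : unop (op a) = a := rfl
theorem op_add (a b : A) : op (a + b) = op a + op b := rfl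
theorem op_sub (a b : A) : op (a - b) = op a - op b := rfl
theorem op_one : op (1 : A) = 1 := rfl
theorem op_mul (a b : A) : op (a * b) = op b * op a := rfl
theorem unop_add (a b : ConjOp A) : unop (a + b) = unop a + unop b := rfl
theorem unop_mul (a b : ConjOp A) : unop (a * b) = unop b * unop a := rfl
theorem smul_op (z : ℂ) (a : A) : z • op a = op (conj z • a) := by
  rw [Algebra.smul_def, Algebra.smul_def, op_mul, Algebra.commutes]
  rfl
theorem unop_smul (z : ℂ) (a : ConjOp A) : unop (z • a) = conj z • unop a := by
  conv_lhs => rw [← op_unop a, smul_op, unop_op]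
theorem op_sum {ι : Type} (s : Finset ι) (f : ι → A) : op (∑ i ∈ s, f i) = ∑ i ∈ s, op (f i) :=
  map_sum (MulOpposite.opAddEquiv (α := A)) f s

/-- The conjugate-linear map underlying an algebra homomorphism into `ConjOp A`. -/
def toConjLinear {B : Type} [Ring B] [Algebra ℂ B] (f : B →ₐ[ℂ] ConjOp A) : B →ₗ⋆[ℂ] A where
  toFun b := unop (f b)
  map_add' a b := by rw [map_add, unop_add]
  map_smul' z b := by rw [map_smul, unop_smul]

end ConjOp

theorem cj_add (v v' : Vec r) : cj (v + v') = cj v + cj v' := by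
  ext i; simp [cj]
theorem cj_smul (a : ℂ) (v : Vec r) : cj (a • v) = conj a • cj v := by
  ext i; simp [cj]
theorem cj_act (w : Matrix.orthogonalGroup (Fin r) ℝ) (v : Vec r) : cj (act w v) = act w (cj v) := by
  ext i; simp [cj, act, Matrix.mulVec, dotProduct]
theorem cj_dotProduct (u v : Vec r) : cj u ⬝ᵥ cj v = conj (u ⬝ᵥ v) := by
  simp [cj, dotProduct]
theorem cj_rt (α : Fin r → ℝ) : cj (rt α) = rt α := by
  ext i; simp [cj, rt]
theorem cj_cort (α : Fin r → ℝ) : cj (cort α) = cort α := by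
  ext i; simp only [cj, cort, Complex.conj_ofReal]
theorem cort_eq (α : Fin r → ℝ) : cort α = ((2 / (α ⬝ᵥ α) : ℝ) : ℂ) • rt α := by
  ext i; simp [cort, rt]

theorem act_act_inv (w : D.W) (v : Vec r) : act w.1 (act (w⁻¹).1 v) = v := by
  have h : ((w : Matrix.orthogonalGroup (Fin r) ℝ) : Matrix (Fin r) (Fin r) ℝ) *
      ((w⁻¹ : D.W) : Matrix.orthogonalGroup (Fin r) ℝ).1 = 1 := by
    have := congrArg (fun u : Matrix.orthogonalGroup (Fin r) ℝ => u.1)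
      (congrArg (fun u : D.W => u.1) (mul_inv_cancel w))
    simpa using this
  have h2 := congrArg (fun A : Matrix (Fin r) (Fin r) ℝ => A.map Complex.ofRealHom) h
  simp only [Matrix.map_mul] at h2
  simp only [act, Matrix.mulVecLin_apply, Matrix.mulVec_mulVec]
  have h3 : ((w.1.1).map Complex.ofReal) * (((w⁻¹).1.1).map Complex.ofReal) = 1 := by
    refine h2.trans ?_
    simp
  rw [h3, Matrix.one_mulVec]

theorem s_inv (α : {α // α ∈ D.pos}) : (D.s α)⁻¹ = D.s α := by
  rw [inv_eq_iff_mul_eq_one]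
  apply Subtype.ext
  apply Subtype.ext
  exact reflMatrix_mul_self α.1

namespace RCA

variable (c : Param D)

/-- `y ↦ y^*`, `x ↦ x^*`, `w ↦ w⁻¹` on generators. -/
def starGen : Gen D → ConjOp (RCA c)
  | Gen.y v => ConjOp.op (x c (cj v))
  | Gen.x v => ConjOp.op (y c (cj v))
  | Gen.g w => ConjOp.op (g c w⁻¹)

theorem starGen_rel {a b : FreeAlgebra ℂ (Gen D)} (h : Rel c a b) :
    FreeAlgebra.lift ℂ (starGen c) a = FreeAlgebra.lift ℂ (starGen c) b := by
  induction h with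
  | y_add v v' => simp [starGen, cj_add, x_add, ConjOp.op_add]
  | y_smul a v => simp [starGen, cj_smul, x_smul, ConjOp.smul_op]
  | x_add v v' => simp [starGen, cj_add, y_add, ConjOp.op_add]
  | x_smul a v => simp [starGen, cj_smul, y_smul, ConjOp.smul_op]
  | g_one => simp [starGen, g_one, ConjOp.op_one]
  | g_mul w w' => simp [starGen, g_mul, ConjOp.op_mul]
  | g_y w v =>
    simp only [map_mul, FreeAlgebra.lift_ι_apply, starGen, ← ConjOp.op_mul]
    rw [cj_act]
    congr 1
    have := g_x c w⁻¹ (act w.1 (cj v))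
    rw [this]
    congr 2
    simpa using (act_act_inv w⁻¹ (cj v)).symm
  | g_x w v =>
    simp only [map_mul, FreeAlgebra.lift_ι_apply, starGen, ← ConjOp.op_mul]
    rw [cj_act]
    congr 1
    have := g_y c w⁻¹ (act w.1 (cj v))
    rw [this]
    congr 2
    simpa using (act_act_inv w⁻¹ (cj v)).symm
  | yy v v' =>
    simp only [map_mul, FreeAlgebra.lift_ι_apply, starGen, ← ConjOp.op_mul]
    rw [xx]
  | xx v v' =>
    simp only [map_mul, FreeAlgebra.lift_ι_apply, starGen, ← ConjOp.op_mul]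
    rw [yy]
  | yx v u =>
    simp only [map_mul, map_sub, map_sum, map_smul, map_one, FreeAlgebra.lift_ι_apply, starGen,
      ← ConjOp.op_mul, ← ConjOp.op_sub, ← ConjOp.op_one, ConjOp.smul_op, ← ConjOp.op_sum, s_inv]
    rw [yx c (cj u) (cj v)]
    congr 2
    · rw [← cj_dotProduct, dotProduct_comm]
    · refine Finset.sum_congr rfl fun α _ => ?_
      congr 1
      simp only [map_mul, Complex.conj_ofReal, ← cj_dotProduct, cj_rt, cort_eq,
        dotProduct_smul, smul_eq_mul]
      rw [dotProduct_comm (rt α.1) (cj u), dotProduct_comm (rt α.1) (cj v)]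
      ring

/-- The conjugate-linear anti-involution `*` of `H_c`, as a homomorphism into `ConjOp H_c`. -/
def starHom : RCA c →ₐ[ℂ] ConjOp (RCA c) :=
  RingQuot.liftAlgHom ℂ ⟨FreeAlgebra.lift ℂ (starGen c), fun _ _ h => starGen_rel c h⟩

/-- The conjugate-linear anti-involution `*` of `H_c`. -/
def star : RCA c →ₗ⋆[ℂ] RCA c := ConjOp.toConjLinear (starHom c)

end RCA

/-! ## The Clifford algebra and the spin module -/

/-- The quadratic form `(x, y) ↦ ⟨x, y⟩` on `𝔥^* ⊕ 𝔥`; it makes the Clifford relation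
`v v' + v' v = B(v, v')`. -/
def cliffQ (r : ℕ) : QuadraticForm ℂ (Vec r × Vec r) :=
  LinearMap.BilinMap.toQuadraticMap
    ((dotProductBilin ℂ ℂ (m := Fin r) (A := ℂ)).compl₁₂ (LinearMap.fst ℂ (Vec r) (Vec r))
      (LinearMap.snd ℂ (Vec r) (Vec r)))

theorem cliffQ_apply (p : Vec r × Vec r) : cliffQ r p = p.1 ⬝ᵥ p.2 := rfl

/-- The Clifford algebra of `𝔥^* ⊕ 𝔥`. -/
abbrev Cliff (r : ℕ) : Type := CliffordAlgebra (cliffQ r)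

/-- `x ∈ 𝔥^*` in the Clifford algebra. -/
def cx (v : Vec r) : Cliff r := CliffordAlgebra.ι (cliffQ r) (v, 0)
/-- `y ∈ 𝔥` in the Clifford algebra. -/
def cy (v : Vec r) : Cliff r := CliffordAlgebra.ι (cliffQ r) (0, v)

/-- `(x, y) ↦ (y^*, x^*)`, as a linear map into the conjugate-opposite algebra. -/
def cliffStarLin (r : ℕ) : Vec r × Vec r →ₗ[ℂ] ConjOp (Cliff r) where
  toFun p := ConjOp.op (CliffordAlgebra.ι (cliffQ r) (cj p.2, cj p.1))
  map_add' p q := by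
    rw [← ConjOp.op_add, ← map_add]; simp [cj_add]
  map_smul' z p := by
    rw [RingHom.id_apply, ConjOp.smul_op, ← map_smul]; simp [cj_smul]

/-- The conjugate-linear anti-involution `*` of the Clifford algebra, as a homomorphism into the
conjugate-opposite algebra. -/
def cliffStarHom (r : ℕ) : Cliff r →ₐ[ℂ] ConjOp (Cliff r) :=
  CliffordAlgebra.lift (cliffQ r) ⟨cliffStarLin r, fun p => by
    change ConjOp.op _ * ConjOp.op _ = _
    rw [← ConjOp.op_mul, CliffordAlgebra.ι_sq_scalar, cliffQ_apply, cliffQ_apply,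
      Algebra.algebraMap_eq_smul_one, Algebra.algebraMap_eq_smul_one, ← ConjOp.op_one,
      ConjOp.smul_op, cj_dotProduct, dotProduct_comm]⟩

/-- The conjugate-linear anti-involution `*` of the Clifford algebra. -/
def cliffStar (r : ℕ) : Cliff r →ₗ⋆[ℂ] Cliff r := ConjOp.toConjLinear (cliffStarHom r)

/-- The spin module `𝕊 = ∧ 𝔥^*`. -/
abbrev Spin (r : ℕ) : Type := ExteriorAlgebra ℂ (Vec r)

/-- `(x, y)` acts on `∧ 𝔥^*` as `x ∧ -` plus contraction by `y`. -/
def spinLin (r : ℕ) : Vec r × Vec r →ₗ[ℂ] Module.End ℂ (Spin r) :=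
  (LinearMap.mul ℂ (Spin r) ∘ₗ ExteriorAlgebra.ι ℂ ∘ₗ LinearMap.fst ℂ _ _) +
  (CliffordAlgebra.contractLeft (Q := (0 : QuadraticForm ℂ (Vec r))) ∘ₗ
    (dotProductBilin ℂ ℂ (m := Fin r) (A := ℂ)) ∘ₗ LinearMap.snd ℂ _ _)

theorem spinLin_apply (p : Vec r × Vec r) (ω : Spin r) : spinLin r p ω =
    ExteriorAlgebra.ι ℂ p.1 * ω +
      CliffordAlgebra.contractLeft (Q := (0 : QuadraticForm ℂ (Vec r)))
        (dotProductBilin ℂ ℂ (m := Fin r) (A := ℂ) p.2) ω := rfl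

/-- The Clifford action on the spin module. -/
def spinAct (r : ℕ) : Cliff r →ₐ[ℂ] Module.End ℂ (Spin r) :=
  CliffordAlgebra.lift (cliffQ r) ⟨spinLin r, fun p => by
    refine LinearMap.ext fun ω => ?_
    have h1 : ExteriorAlgebra.ι ℂ p.1 * (ExteriorAlgebra.ι ℂ p.1 * ω) = 0 := by
      rw [← mul_assoc, ExteriorAlgebra.ι_sq_zero, zero_mul]
    have h2 := CliffordAlgebra.contractLeft_ι_mul (Q := (0 : QuadraticForm ℂ (Vec r)))
      (d := dotProductBilin ℂ ℂ (m := Fin r) (A := ℂ) p.2) p.1 ω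
    have h3 : (dotProductBilin ℂ ℂ (m := Fin r) (A := ℂ) p.2) p.1 = p.1 ⬝ᵥ p.2 :=
      dotProduct_comm p.2 p.1
    rw [Module.End.mul_apply, spinLin_apply, spinLin_apply, mul_add, h1, map_add,
      CliffordAlgebra.contractLeft_contractLeft, add_zero, zero_add]
    erw [h2]
    rw [h3, cliffQ_apply, Module.algebraMap_end_apply]
    exact add_sub_cancel _ _⟩

/-! ## Standard modules and `K_c(τ)` -/

section modules

variable (c : Param D) {V : Type} [AddCommGroup V] [Module ℂ V] (τ : Representation ℂ D.W V)

/-- The relations `w ⊗ v = 1 ⊗ τ(w) v` and `y ⊗ v = 0` imposed on `H_c ⊗ V(τ)`. -/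
def stdRel : Submodule (RCA c) (RCA c ⊗[ℂ] V) :=
  Submodule.span (RCA c)
    ({u | ∃ (w : D.W) (v : V), u = RCA.g c w ⊗ₜ[ℂ] v - (1 : RCA c) ⊗ₜ[ℂ] (τ w v)} ∪
     {u | ∃ (a : Vec r) (v : V), u = RCA.y c a ⊗ₜ[ℂ] v})

/-- The standard module `M_c(τ) = H_c ⊗_{ℂ[𝔥^*] # W} V(τ)`, with `𝔥` acting on `V(τ)` by zero. -/
abbrev StdMod : Type := (RCA c ⊗[ℂ] V) ⧸ stdRel c τ

/-- The action of `H_c` on `M_c(τ)`. -/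
def stdAct : RCA c →ₐ[ℂ] Module.End ℂ (StdMod c τ) := Algebra.lsmul ℂ ℂ (StdMod c τ)

/-- The vector `1 ⊗ v` of `M_c(τ)`. -/
def stdVec (v : V) : StdMod c τ := Submodule.Quotient.mk ((1 : RCA c) ⊗ₜ[ℂ] v)

/-- The homogeneous part `ℂ[𝔥]_m ⊗ V(τ)` of degree `m` of `M_c(τ)`. -/
def stdDeg (m : ℕ) : Submodule ℂ (StdMod c τ) :=
  Submodule.span ℂ {u | ∃ (ξ : Fin m → Vec r) (v : V),
    u = (List.ofFn fun i => RCA.x c (ξ i)).prod • stdVec c τ v}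

/-- The algebra `H_c ⊗ 𝒞`. -/
abbrev HC : Type := RCA c ⊗[ℂ] Cliff r

/-- The conjugate-linear anti-involution `*` on `H_c ⊗ 𝒞`. -/
def HCstar : HC c →ₗ⋆[ℂ] HC c := TensorProduct.map (RCA.star c) (cliffStar r)

/-- `K_c(τ) = M_c(τ) ⊗ ∧ 𝔥^*`. -/
abbrev KMod : Type := StdMod c τ ⊗[ℂ] Spin r

/-- The action of `H_c ⊗ 𝒞` on `K_c(τ)`. -/
def KAct : HC c →ₐ[ℂ] Module.End ℂ (KMod c τ) :=
  (Module.endTensorEndAlgHom (R := ℂ) (S := ℂ) (A := ℂ) (M := StdMod c τ) (N := Spin r)).comp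
    (Algebra.TensorProduct.map (stdAct c τ) (spinAct r))

/-- The diagonal action of `w ∈ W` on `K_c(τ)`. -/
def KW (w : D.W) : Module.End ℂ (KMod c τ) :=
  TensorProduct.map (stdAct c τ (RCA.g c w)) (ExteriorAlgebra.map (act w.1)).toLinearMap

/-- The bihomogeneous part `K_m^l = ℂ[𝔥]_m ⊗ V(τ) ⊗ ∧^l 𝔥^*`. -/
def KDeg (m l : ℕ) : Submodule ℂ (KMod c τ) :=
  Submodule.map₂ (TensorProduct.mk ℂ (StdMod c τ) (Spin r)) (stdDeg c τ m) (⋀[ℂ]^l (Vec r))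

/-- The isotypic component of `K_c(τ)` of type `σ`: the sum of the images of all `W`-maps
`V(σ) → K_c(τ)`. -/
def KIso {U : Type} [AddCommGroup U] [Module ℂ U] (σ : Representation ℂ D.W U) :
    Submodule ℂ (KMod c τ) :=
  ⨆ f : {f : U →ₗ[ℂ] KMod c τ // ∀ w u, f (σ w u) = KW c τ w (f u)}, LinearMap.range f.1

/-- The scalar `N_c(σ)` by which the central element `∑_{α>0} c_α s_α` acts on the irreducible
module `V(σ)`. -/
def Nc {U : Type} [AddCommGroup U] [Module ℂ U] (σ : Representation ℂ D.W U) : ℂ :=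
  Classical.epsilon fun z : ℂ =>
    ∀ u : U, ∑ α : {α // α ∈ D.pos}, (c.val α.1 : ℂ) • σ (D.s α) u = z • u

end modules

/-- A complex vector space on which `A` acts by operators is unitary with respect to
`st : A → A` when it has a positive definite Hermitian form for which `a` and `st a` are
adjoint. -/
def IsStarUnitary {A V : Type} [AddCommGroup V] [Module ℂ V] (st : A → A)
    (π : A → Module.End ℂ V) : Prop :=
  ∃ β : V →ₗ⋆[ℂ] V →ₗ[ℂ] ℂ,
    (∀ u v, conj (β u v) = β v u) ∧ (∀ u, u ≠ 0 → 0 < (β u u).re) ∧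
    ∀ a u v, β (π a u) v = β u (π (st a) v)

/-! ## The Lie superalgebra `spo(2|2)` -/

/-- The space of matrices `(a b y u; c -a -v -x; x u d 0; v y 0 -d)`. -/
def spo : Submodule ℂ (Matrix (Fin 4) (Fin 4) ℂ) where
  carrier := {X | X 1 1 = -X 0 0 ∧ X 3 3 = -X 2 2 ∧ X 2 3 = 0 ∧ X 3 2 = 0 ∧
    X 1 3 = -X 2 0 ∧ X 3 1 = X 0 2 ∧ X 2 1 = X 0 3 ∧ X 1 2 = -X 3 0}
  add_mem' := by
    rintro X Y ⟨a1, a2, a3, a4, a5, a6, a7, a8⟩ ⟨b1, b2, b3, b4, b5, b6, b7, b8⟩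
    refine ⟨?_, ?_, ?_, ?_, ?_, ?_, ?_, ?_⟩ <;> simp only [Matrix.add_apply, *] <;> ring
  zero_mem' := by simp
  smul_mem' := by
    rintro z X ⟨a1, a2, a3, a4, a5, a6, a7, a8⟩
    refine ⟨?_, ?_, ?_, ?_, ?_, ?_, ?_, ?_⟩ <;>
      simp only [Matrix.smul_apply, smul_eq_mul, *] <;> ring

/-- Even elements: block diagonal matrices. -/
def IsEven (X : spo) : Prop :=
  ∀ i j : Fin 4, (i.1 < 2 ∧ 2 ≤ j.1) ∨ (2 ≤ i.1 ∧ j.1 < 2) → X.1 i j = 0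

/-- Odd elements: block off-diagonal matrices. -/
def IsOdd (X : spo) : Prop :=
  ∀ i j : Fin 4, (i.1 < 2 ∧ j.1 < 2) ∨ (2 ≤ i.1 ∧ 2 ≤ j.1) → X.1 i j = 0

/-- `h = E₁₁ - E₂₂`. -/
def gh : spo := ⟨!![1, 0, 0, 0; 0, -1, 0, 0; 0, 0, 0, 0; 0, 0, 0, 0], by simp [spo]⟩
/-- `z = E₃₃ - E₄₄`. -/
def gz : spo := ⟨!![0, 0, 0, 0; 0, 0, 0, 0; 0, 0, 1, 0; 0, 0, 0, -1], by simp [spo]⟩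
/-- `e₁⁻ = E₂₁`. -/
def e1m : spo := ⟨!![0, 0, 0, 0; 1, 0, 0, 0; 0, 0, 0, 0; 0, 0, 0, 0], by simp [spo]⟩
/-- `e₂⁺ = E₃₁ - E₂₄`. -/
def e2p : spo := ⟨!![0, 0, 0, 0; 0, 0, 0, -1; 1, 0, 0, 0; 0, 0, 0, 0], by simp [spo]⟩
/-- `e₂⁻ = E₁₃ + E₄₂`. -/
def e2m : spo := ⟨!![0, 0, 1, 0; 0, 0, 0, 0; 0, 0, 0, 0; 0, 1, 0, 0], by simp [spo]⟩
/-- `e₃⁺ = E₁₄ + E₃₂`. -/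
def e3p : spo := ⟨!![0, 0, 0, 1; 0, 0, 0, 0; 0, 1, 0, 0; 0, 0, 0, 0], by simp [spo]⟩
/-- `e₃⁻ = E₄₁ - E₂₃`. -/
def e3m : spo := ⟨!![0, 0, 0, 0; 0, 0, -1, 0; 0, 0, 0, 0; 1, 0, 0, 0], by simp [spo]⟩

/-- Relations of the universal enveloping algebra: `XY - YX = [X, Y]` when `X` is even and
`XY + YX = [X, Y]` when `X`, `Y` are odd. -/
inductive URel : TensorAlgebra ℂ spo → TensorAlgebra ℂ spo → Prop
  | even (X Y Z : spo) : IsEven X → Z.1 = X.1 * Y.1 - Y.1 * X.1 →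
      URel (TensorAlgebra.ι ℂ X * TensorAlgebra.ι ℂ Y - TensorAlgebra.ι ℂ Y * TensorAlgebra.ι ℂ X)
        (TensorAlgebra.ι ℂ Z)
  | odd (X Y Z : spo) : IsOdd X → IsOdd Y → Z.1 = X.1 * Y.1 + Y.1 * X.1 →
      URel (TensorAlgebra.ι ℂ X * TensorAlgebra.ι ℂ Y + TensorAlgebra.ι ℂ Y * TensorAlgebra.ι ℂ X)
        (TensorAlgebra.ι ℂ Z)

/-- The universal enveloping algebra `U(𝔤)` of `𝔤 = spo(2|2, ℂ)`. -/
def Ug : Type := RingQuot URel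

instance : Ring Ug := inferInstanceAs (Ring (RingQuot URel))
instance : Algebra ℂ Ug := inferInstanceAs (Algebra ℂ (RingQuot URel))

/-- The canonical map `𝔤 → U(𝔤)`. -/
def toU : spo →ₗ[ℂ] Ug := (RingQuot.mkAlgHom ℂ URel).toLinearMap ∘ₗ TensorAlgebra.ι ℂ

/-! ## Lowest weight modules. A weight `λ = aδ + bε` is the pair `(a, b) = (λ(h), λ(z))`. -/

/-- The left ideal of `U(𝔤)` generated by `h - λ(h)`, `z - λ(z)` and `𝔫⁻`. -/
def vermaIdeal (wt : ℂ × ℂ) : Submodule Ug Ug :=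
  Submodule.span Ug {toU gh - algebraMap ℂ Ug wt.1, toU gz - algebraMap ℂ Ug wt.2,
    toU e1m, toU e2m, toU e3m}

/-- The standard (lowest weight Verma) module `𝕍(λ) = U(𝔤) ⊗_{U(𝔟⁻)} ℂ_λ`. -/
abbrev Verma (wt : ℂ × ℂ) : Type := Ug ⧸ vermaIdeal wt

/-- The sum of all proper submodules of `𝕍(λ)`, which is its unique maximal submodule. -/
def vermaRad (wt : ℂ × ℂ) : Submodule Ug (Verma wt) := sSup {N | N ≠ ⊤}

/-- The irreducible lowest weight module `L(λ)`. -/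
abbrev Irr (wt : ℂ × ℂ) : Type := Verma wt ⧸ vermaRad wt

/-- The canonical lowest weight vector of `L(λ)`. -/
def lwVec (wt : ℂ × ℂ) : Irr wt := Submodule.Quotient.mk (Submodule.Quotient.mk (1 : Ug))

/-! ## Modules over the Grassmann algebra in two generators -/

/-- The Grassmann algebra `Γ = ∧[e₂, e₃]`. -/
abbrev Gam : Type := ExteriorAlgebra ℂ (Fin 2 → ℂ)

/-- The generator `e₂`. -/
def ge2 : Gam := ExteriorAlgebra.ι ℂ (Pi.single 0 1)
/-- The generator `e₃`. -/
def ge3 : Gam := ExteriorAlgebra.ι ℂ (Pi.single 1 1)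

/-- The relations `e₃ x_j = e₂ x_{j+1}` and `(1-δ) e₂ x₀ = 0`. -/
def flashRel (δ : ℂ) : Submodule Gam (ℕ →₀ Gam) :=
  Submodule.span Gam
    ({u | ∃ j : ℕ, u = Finsupp.single j ge3 - Finsupp.single (j + 1) ge2} ∪
     {Finsupp.single 0 ((1 - δ) • ge2)})

/-- The lightning-flash module `L(+∞, δ)`. -/
abbrev Flash (δ : ℂ) : Type := (ℕ →₀ Gam) ⧸ flashRel δ

/-- `L(λ)` has type `L_δ(λ)`: as a `Γ`-module through `e₂ ↦ e₂⁺`, `e₃ ↦ e₃⁺` it is isomorphic to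
the lightning-flash module `L(+∞, δ)`, the generator `x_j` being of weight `λ + 2jδ`. -/
def IsFlash (wt : ℂ × ℂ) (δ : ℂ) : Prop :=
  ∃ f : Irr wt ≃ₗ[ℂ] Flash δ,
    (∀ u, f (toU e2p • u) = ge2 • f u) ∧ (∀ u, f (toU e3p • u) = ge3 • f u) ∧
    ∀ j : ℕ, ∀ u, f u = Submodule.Quotient.mk (Finsupp.single j 1) →
      toU gh • u = (wt.1 + 2 * j) • u ∧ toU gz • u = wt.2 • u

/-- `L(λ)` is a free `Γ`-module, with free generators `x_j` of weight `λ + 2jδ`, `j ≥ 0`. -/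
def IsFreeGam (wt : ℂ × ℂ) : Prop :=
  ∃ f : Irr wt ≃ₗ[ℂ] (ℕ →₀ Gam),
    (∀ u, f (toU e2p • u) = ge2 • f u) ∧ (∀ u, f (toU e3p • u) = ge3 • f u) ∧
    ∀ j : ℕ, ∀ u, f u = Finsupp.single j 1 →
      toU gh • u = (wt.1 + 2 * j) • u ∧ toU gz • u = wt.2 • u

/-! ## The realisation of `𝔤` in `H_c ⊗ 𝒞` -/

section realisation

variable (c : Param D)

/-- Standard basis vector. -/
def bv (i : Fin r) : Vec r := Pi.single i 1

/-- `Ω_c = ∑_{α>0} c_α s_α ⊗ τ_α`, with `τ_α = 1 - α α^∨` in the Clifford algebra. -/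
def Omega : HC c :=
  ∑ α : {α // α ∈ D.pos}, (c.val α.1 : ℂ) •
    (RCA.g c (D.s α) ⊗ₜ[ℂ] (1 - cx (rt α.1) * cy (cort α.1)))

def opH : HC c := ∑ i : Fin r, (1 / 2 : ℂ) •
  ((RCA.x c (bv i) * RCA.y c (bv i) + RCA.y c (bv i) * RCA.x c (bv i)) ⊗ₜ[ℂ] (1 : Cliff r))
def opZ : HC c := ∑ i : Fin r, (1 / 2 : ℂ) •
  ((1 : RCA c) ⊗ₜ[ℂ] (cx (bv i) * cy (bv i) - cy (bv i) * cx (bv i))) + Omega c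
def opE1p : HC c := -∑ i : Fin r, (1 / 2 : ℂ) • ((RCA.x c (bv i) ^ 2) ⊗ₜ[ℂ] (1 : Cliff r))
def opE1m : HC c := ∑ i : Fin r, (1 / 2 : ℂ) • ((RCA.y c (bv i) ^ 2) ⊗ₜ[ℂ] (1 : Cliff r))
def opE2p : HC c := ∑ i : Fin r, RCA.y c (bv i) ⊗ₜ[ℂ] cx (bv i)
def opE2m : HC c := ∑ i : Fin r, RCA.x c (bv i) ⊗ₜ[ℂ] cy (bv i)
def opE3p : HC c := -∑ i : Fin r, RCA.x c (bv i) ⊗ₜ[ℂ] cx (bv i)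
def opE3m : HC c := -∑ i : Fin r, RCA.y c (bv i) ⊗ₜ[ℂ] cy (bv i)

/-- The linear map `𝔤 → H_c ⊗ 𝒞` with `h ↦ H`, `z ↦ Z`, `e_i^± ↦ E_i^±`. -/
def realise : spo →ₗ[ℂ] HC c where
  toFun X := X.1 0 0 • opH c + X.1 2 2 • opZ c + X.1 0 1 • opE1p c + X.1 1 0 • opE1m c +
    X.1 2 0 • opE2p c + X.1 0 2 • opE2m c + X.1 0 3 • opE3p c + X.1 3 0 • opE3m c
  map_add' X Y := by simp only [Submodule.coe_add, Matrix.add_apply, add_smul]; abel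
  map_smul' a X := by
    simp only [Submodule.coe_smul, Matrix.smul_apply, smul_eq_mul, mul_smul, smul_add,
      RingHom.id_apply]

/-- The centraliser `ℛ_c` of `𝔤` in `H_c ⊗ 𝒞`. -/
def Rc : Subalgebra ℂ (HC c) := Subalgebra.centralizer ℂ (Set.range (realise c))

variable {V : Type} [AddCommGroup V] [Module ℂ V] (τ : Representation ℂ D.W V)

/-- The action of `𝔤` on `K_c(τ)`. -/
def gAct (X : spo) : Module.End ℂ (KMod c τ) := KAct c τ (realise c X)

/-- The space of vectors of `K_c(τ)` killed by `𝔫⁻`. -/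
def lw : Submodule ℂ (KMod c τ) :=
  LinearMap.ker (gAct c τ e1m) ⊓ LinearMap.ker (gAct c τ e2m) ⊓ LinearMap.ker (gAct c τ e3m)

/-- `ℳ_c(τ,σ)_m^l`: lowest weight vectors of bidegree `(m, l)` and of `W`-type `σ`. -/
def lwDeg {U : Type} [AddCommGroup U] [Module ℂ U] (σ : Representation ℂ D.W U) (m l : ℕ) :
    Submodule ℂ (KMod c τ) :=
  lw c τ ⊓ (KDeg c τ m l ⊓ KIso c τ σ)

/-- The space of all lowest weight vectors of weight `wt`. -/
def lwWeight (wt : ℂ × ℂ) : Submodule ℂ (KMod c τ) :=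
  lw c τ ⊓ (LinearMap.ker (gAct c τ gh - wt.1 • 1) ⊓ LinearMap.ker (gAct c τ gz - wt.2 • 1))

/-- The weight `(m + r/2 - N_c(τ), l - r/2 + N_c(σ))`. -/
def wtOf {U : Type} [AddCommGroup U] [Module ℂ U] (σ : Representation ℂ D.W U) (m l : ℕ) : ℂ × ℂ :=
  (m + r / 2 - Nc c τ, l - r / 2 + Nc c σ)

/-- The standard module `M_c(τ)` is unitary. -/
def StdUnitary : Prop := IsStarUnitary (RCA.star c) (stdAct c τ)

/-- The subspace `N` of `K_c(τ)` is stable under `ℛ_c` and is a `*`-unitary `ℛ_c`-module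
(the centraliser `ℛ_c` being closed under `*`). -/
def IsUnitaryRc (N : Submodule ℂ (KMod c τ)) : Prop :=
  ∃ (hs : ∀ X ∈ Rc c, HCstar c X ∈ Rc c)
    (hN : ∀ X ∈ Rc c, ∀ θ ∈ N, KAct c τ X θ ∈ N),
    IsStarUnitary (A := Rc c) (V := N) (fun X => ⟨HCstar c X.1, hs X.1 X.2⟩)
      (fun X => (KAct c τ X.1).restrict (hN X.1 X.2))

end realisation

/-! ## Irreducible representations and labels -/

/-- A complete and irredundant set of representatives of the isomorphism classes of irreducible
complex representations of a group `G`; for `G = W` its index set is `Ŵ`. -/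
structure IrrReps (G : Type) [Group G] where
  ι : Type
  V : ι → Type
  [addCommGroup : ∀ i, AddCommGroup (V i)]
  [module : ∀ i, Module ℂ (V i)]
  ρ : ∀ i, Representation ℂ G (V i)
  irreducible : ∀ i, (ρ i).IsIrreducible
  irredundant : ∀ i j, Nonempty ((ρ i).Equiv (ρ j)) → i = j
  complete : ∀ (U : Type) [AddCommGroup U] [Module ℂ U] (π : Representation ℂ G U),
    π.IsIrreducible → ∃ i, Nonempty ((ρ i).Equiv π)

attribute [instance] IrrReps.addCommGroup IrrReps.module

/-- The set `B(r) = {(0,0), (1,r-1)} ∪ {(m,l) | m ≥ 1, 0 ≤ l ≤ r-2}`. -/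
def B (r : ℕ) : Set (ℕ × ℕ) :=
  {p | p = (0, 0) ∨ (p.1 = 1 ∧ p.2 + 1 = r) ∨ (1 ≤ p.1 ∧ p.2 + 2 ≤ r)}

/-- The set `H(r)` of hook partitions `λ` with `λ'₁ + λ'₂ ≤ r`. -/
def Hook (r : ℕ) : Set YoungDiagram :=
  {μ | (∀ i, 1 ≤ i → μ.rowLen i ≤ 1) ∧ μ.colLen 0 + μ.colLen 1 ≤ r}

end DunklHowe

end

open DunklHowe

open scoped TensorProduct Matrix ComplexConjugate DirectSum

noncomputable section

namespace DunklHowe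

set_option linter.unusedSectionVars false

/-! The eight operators in `H_c ⊗ 𝒞` satisfy the relations of `spo(2|2)`. All the brackets come down
to the commutator `[y,x]`, to the Clifford relations and to the invariance of `∑ x_i ⊗ y_i` under
orthogonal maps. The term `Ω_c` in `z` absorbs the reflection part of `[y,x]`. Hence `U(𝔤)` acts on
`K_c(τ)` (`ugHom`).

Everything else rests on a positive definite form. The spin module carries a Hermitian form for
which the monomials in the basis vectors are orthonormal. Its product with the form on the unitary
module `M_c(τ)` is positive definite and has `*` as adjunction (`kForm_isContra`), so that `e_i^+`
and `e_i^-` are adjoint up to sign. Three consequences carry the decomposition.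

Irreducibility: the image of the maximal submodule of `𝕍(λ)` is orthogonal to the lowest weight
vector, hence to all that this vector generates, hence to itself; so it vanishes
(`vermaRad_le_ker`), and every nonzero lowest weight vector generates a copy of `L(λ)`.

Independence: orthogonal lowest weight vectors generate orthogonal submodules (`smul_smul_eq_zero`).
Vectors of equal `W`-type and different bidegree have different weights and are therefore
orthogonal; different `W`-types are separated by the isotypic components.

Generation: in the finite-dimensional space `K_m^l`, a vector orthogonal to the part generated so
far is killed by `𝔫⁻`, by induction on `m + 2l` (`KDeg_le_of_lwDeg_le`).

The restriction to `B(r)` comes from the identity `e_2^- e_2^+ θ = (m + l + N_c(σ) - N_c(τ)) θ` for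
a lowest weight vector `θ` (`e2m_e2p_of_mem`). By the assumption on `N_c(τ) - N_c(σ)`, the vector
`e_2^+ θ` can vanish only for `σ = τ`, `m = l = 0`. But `e_2^+ θ` does vanish for `m = 0`, for `l =
r`, and for `l = r-1`, `m ≥ 2`. In the last case it lies in the top exterior degree and is killed by
`e_3^-`, hence by all of `𝔥`, and unitarity excludes such vectors in positive degree.

The structure of `L(λ)` with `λ = (a,b)` is read off from the vectors `γ (e_1^+)^j v` with `γ ∈ Γ`.
If `a` is not in `ℤ_{≤0}` and `a + b`, `a - b - 2` are nonzero, then the vectors `e_2^+ e_3^+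
(e_1^+)^j v` are nonzero and `Γ` acts freely. If one of the two numbers is zero, a vector above `v`
is of lowest weight, hence zero in `L(λ)`, and the relation so obtained propagates to those of a
lightning-flash module. For `(m,l)` other than `(0,0)` and `(1,r-1)` both numbers are nonzero; for
the second one the assumption is applied to the twist of `σ` by the determinant, for which `N_c`
changes sign.

Finally `ℛ_c` commutes with `𝔤`, so it preserves the spaces of lowest weight vectors of given
weight, and the form restricts to them. If `σ` is separated from the other types modulo integers,
the weight determines `σ` and the bidegree. -/

variable {r : ℕ} {D : RootSys r}

/-- A shortcut for instance search. -/
local instance monoidW : Monoid D.W := inferInstance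

/-- A shortcut for instance search. -/
local instance groupW : Group D.W := inferInstance

/-- A shortcut for instance search. -/
local instance spinAddCommMonoid : AddCommMonoid (Spin r) := inferInstance


/-! ### Orthonormal coordinates and reflections on `𝔥` and `𝔥^*` -/

theorem dotProduct_bv (v : Vec r) (i : Fin r) : v ⬝ᵥ bv i = v i := by simp [bv]

theorem bv_dotProduct (v : Vec r) (i : Fin r) : bv i ⬝ᵥ v = v i := by simp [bv]

theorem sum_smul_bv (v : Vec r) : ∑ i, v i • bv i = v := by
  ext j; simp [bv, Pi.single_apply]

theorem map_eq_sum_bv {M : Type*} [AddCommGroup M] [Module ℂ M] (f : Vec r →ₗ[ℂ] M) (v : Vec r) :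
    f v = ∑ i, v i • f (bv i) := by
  conv_lhs => rw [← sum_smul_bv v]
  simp

theorem act_refl (α : Fin r → ℝ) (v : Vec r) :
    act (refl α) v = v - (v ⬝ᵥ cort α) • rt α := by
  ext i
  simp only [act, refl, reflMatrix, Matrix.mulVecLin_apply, Matrix.mulVec, dotProduct,
    Matrix.map_apply, Matrix.sub_apply, Matrix.smul_apply, Matrix.vecMulVec_apply, smul_eq_mul,
    Complex.ofReal_sub, Complex.ofReal_mul, sub_mul, Finset.sum_sub_distrib, Pi.sub_apply,
    Pi.smul_apply, cort, rt]
  congr 1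
  · rw [Finset.sum_eq_single i] <;> simp +contextual [eq_comm]
  · rw [Finset.sum_mul]
    exact Finset.sum_congr rfl fun j _ => by ring

/-- The rows of an orthogonal matrix are orthonormal, so the canonical tensor `∑ y_i ⊗ y_i` is
fixed. This is the source of the `W`-invariance of all the operators that realise `𝔤`. -/
theorem sum_act_act {M : Type*} [AddCommGroup M] [Module ℂ M] (f : Vec r →ₗ[ℂ] Vec r →ₗ[ℂ] M)
    (w : Matrix.orthogonalGroup (Fin r) ℝ) :
    ∑ i, f (act w (bv i)) (act w (bv i)) = ∑ i, f (bv i) (bv i) := by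
  have h1 : ∀ i j, act w (bv i) j = ((w.1 j i : ℝ) : ℂ) := fun i j => by
    simp [act, bv]
  have h2 : ∀ j k, ∑ i, ((w.1 j i : ℝ) : ℂ) * ((w.1 k i : ℝ) : ℂ) = if j = k then 1 else 0 := by
    intro j k
    have := (Matrix.mem_orthogonalGroup_iff (Fin r) ℝ).1 w.2
    have := congrFun (congrFun this j) k
    rw [Matrix.mul_apply] at this
    simp only [Matrix.transpose_apply, Matrix.one_apply] at this
    rw [← Finset.sum_congr rfl fun i _ => Complex.ofReal_mul _ _, ← Complex.ofReal_sum, this]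
    split_ifs <;> simp
  have h3 : ∀ i, f (act w (bv i)) (act w (bv i)) = ∑ j, ∑ k,
      (((w.1 j i : ℝ) : ℂ) * ((w.1 k i : ℝ) : ℂ)) • f (bv j) (bv k) := by
    intro i
    rw [map_eq_sum_bv f, LinearMap.sum_apply]
    refine Finset.sum_congr rfl fun j _ => ?_
    rw [LinearMap.smul_apply, map_eq_sum_bv (f (bv j)), Finset.smul_sum]
    refine Finset.sum_congr rfl fun k _ => ?_
    rw [h1, h1, smul_smul]
  simp_rw [h3]
  rw [Finset.sum_comm]
  refine Finset.sum_congr rfl fun j _ => ?_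
  rw [Finset.sum_comm]
  simp_rw [← Finset.sum_smul, h2, ite_smul, zero_smul, one_smul]
  simp

theorem RootSys.pos_ne_zero (α : {α // α ∈ D.pos}) : α.1 ≠ 0 := by
  obtain ⟨v, -, h⟩ := D.pos_spec
  exact D.ne_zero _ ((h α.1).1 α.2).1

theorem rt_dotProduct_cort {α : Fin r → ℝ} (h : α ≠ 0) : rt α ⬝ᵥ cort α = 2 := by
  have h0 : α ⬝ᵥ α ≠ 0 := by simpa using h
  have : rt α ⬝ᵥ cort α = ((2 / (α ⬝ᵥ α) * (α ⬝ᵥ α) : ℝ) : ℂ) := by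
    rw [cort_eq, dotProduct_smul, Complex.ofReal_mul, smul_eq_mul]
    congr 1
    simp [rt, dotProduct]
  rw [this, div_mul_cancel₀ _ h0]
  norm_num

/-! ### Commutators in the rational Cherednik algebra -/

namespace RCA

variable (c : Param D)

/-- The generators `x` as a linear map. -/
def xL : Vec r →ₗ[ℂ] RCA c where
  toFun := x c
  map_add' := x_add c
  map_smul' := x_smul c

/-- The generators `y` as a linear map. -/
def yL : Vec r →ₗ[ℂ] RCA c where
  toFun := y c
  map_add' := y_add c
  map_smul' := y_smul c

theorem x_eq_sum (v : Vec r) : x c v = ∑ i, v i • x c (bv i) := map_eq_sum_bv (xL c) v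

theorem y_eq_sum (v : Vec r) : y c v = ∑ i, v i • y c (bv i) := map_eq_sum_bv (yL c) v

theorem x_cort (α : Fin r → ℝ) : x c (cort α) = ((2 / (α ⬝ᵥ α) : ℝ) : ℂ) • x c (rt α) := by
  rw [cort_eq, x_smul]

theorem y_cort (α : Fin r → ℝ) : y c (cort α) = ((2 / (α ⬝ᵥ α) : ℝ) : ℂ) • y c (rt α) := by
  rw [cort_eq, y_smul]

/-- The coroot is a scalar multiple of the root, so the factor `2/(α,α)` may sit on either side.
This reconciles the formulas for `s_α` on `𝔥` and on `𝔥^*`, which share one matrix. -/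
theorem dot_cort_smul {M : Type*} [AddCommGroup M] [Module ℂ M] (f : Vec r →ₗ[ℂ] M)
    (v : Vec r) (α : Fin r → ℝ) : (v ⬝ᵥ cort α) • f (rt α) = (rt α ⬝ᵥ v) • f (cort α) := by
  rw [cort_eq, map_smul, dotProduct_smul, smul_smul, smul_eq_mul, dotProduct_comm v, mul_comm]

theorem s_x (α : {α // α ∈ D.pos}) (v : Vec r) :
    g c (D.s α) * x c v = x c v * g c (D.s α) - (v ⬝ᵥ cort α.1) • (x c (rt α.1) * g c (D.s α)) := by
  have h : act (D.s α).1 v = v - (v ⬝ᵥ cort α.1) • rt α.1 := act_refl α.1 v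
  have : x c (act (D.s α).1 v) = x c v - (v ⬝ᵥ cort α.1) • x c (rt α.1) := by
    rw [h]; exact ((xL c).map_sub _ _).trans (by rw [map_smul]; rfl)
  rw [g_x, this, sub_mul, smul_mul_assoc]

theorem s_y (α : {α // α ∈ D.pos}) (v : Vec r) :
    g c (D.s α) * y c v =
      y c v * g c (D.s α) - (rt α.1 ⬝ᵥ v) • (y c (cort α.1) * g c (D.s α)) := by
  have h : act (D.s α).1 v = v - (v ⬝ᵥ cort α.1) • rt α.1 := act_refl α.1 v
  have : y c (act (D.s α).1 v) = y c v - (rt α.1 ⬝ᵥ v) • y c (cort α.1) := by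
    rw [h, show (rt α.1 ⬝ᵥ v) • y c (cort α.1) = (v ⬝ᵥ cort α.1) • y c (rt α.1) from
      (dot_cort_smul (yL c) v α.1).symm]
    exact ((yL c).map_sub _ _).trans (by rw [map_smul]; rfl)
  rw [g_y, this, sub_mul, smul_mul_assoc]

theorem y_cort_s (α : {α // α ∈ D.pos}) :
    g c (D.s α) * y c (cort α.1) = - (y c (cort α.1) * g c (D.s α)) := by
  rw [s_y, rt_dotProduct_cort (RootSys.pos_ne_zero α), two_smul]
  abel

theorem x_rt_s (α : {α // α ∈ D.pos}) :
    g c (D.s α) * x c (rt α.1) = - (x c (rt α.1) * g c (D.s α)) := by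
  rw [s_x, rt_dotProduct_cort (RootSys.pos_ne_zero α), two_smul]
  abel

/-- The class sum `∑ c_α s_α`. -/
def cs : RCA c := ∑ α : {α // α ∈ D.pos}, (c.val α.1 : ℂ) • g c (D.s α)

/-- The Euler element `∑ x_i y_i - ∑ c_α s_α`. -/
def eu : RCA c := ∑ i : Fin r, x c (bv i) * y c (bv i) - cs c

theorem cs_comm_x (v : Vec r) : cs c * x c v - x c v * cs c =
    -∑ α : {α // α ∈ D.pos}, ((c.val α.1 : ℂ) * (v ⬝ᵥ cort α.1)) • (x c (rt α.1) * g c (D.s α)) := by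
  rw [cs, Finset.sum_mul, Finset.mul_sum, ← Finset.sum_sub_distrib, ← Finset.sum_neg_distrib]
  refine Finset.sum_congr rfl fun α _ => ?_
  rw [smul_mul_assoc, mul_smul_comm, s_x, smul_sub, smul_smul]
  abel

theorem cs_comm_y (v : Vec r) : cs c * y c v - y c v * cs c =
    -∑ α : {α // α ∈ D.pos}, ((c.val α.1 : ℂ) * (rt α.1 ⬝ᵥ v)) •
      (y c (cort α.1) * g c (D.s α)) := by
  rw [cs, Finset.sum_mul, Finset.mul_sum, ← Finset.sum_sub_distrib, ← Finset.sum_neg_distrib]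
  refine Finset.sum_congr rfl fun α _ => ?_
  rw [smul_mul_assoc, mul_smul_comm, s_y, smul_sub, smul_smul]
  abel

/-- The reflection part of `[y,x]` contributes `-∑ c_α ⟨v,α^∨⟩ α s_α` to `[∑ x_i y_i, v]`, and the
commutator of `∑ c_α s_α` with `v` is the same expression. Subtracting the class sum cancels it. -/
theorem eu_comm_x (v : Vec r) : eu c * x c v - x c v * eu c = x c v := by
  have h1 : (∑ i : Fin r, x c (bv i) * y c (bv i)) * x c v -
      x c v * (∑ i : Fin r, x c (bv i) * y c (bv i)) =
      x c v - ∑ α : {α // α ∈ D.pos}, ((c.val α.1 : ℂ) * (v ⬝ᵥ cort α.1)) •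
        (x c (rt α.1) * g c (D.s α)) := by
    have h : ∀ i : Fin r, x c (bv i) * y c (bv i) * x c v - x c v * (x c (bv i) * y c (bv i)) =
        v i • x c (bv i) - ∑ α : {α // α ∈ D.pos}, ((c.val α.1 : ℂ) * (v ⬝ᵥ cort α.1)) •
        ((rt α.1 i • x c (bv i)) * g c (D.s α)) := by
      intro i
      rw [← mul_assoc (x c v), xx c v (bv i), mul_assoc, mul_assoc, ← mul_sub, yx, mul_sub,
        Finset.mul_sum, dotProduct_bv, mul_smul_comm, mul_one]
      congr 1
      refine Finset.sum_congr rfl fun α _ => ?_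
      rw [dotProduct_bv, mul_smul_comm, smul_mul_assoc, smul_smul]
      congr 1; ring
    rw [Finset.sum_mul, Finset.mul_sum, ← Finset.sum_sub_distrib, Finset.sum_congr rfl fun i _ => h i,
      Finset.sum_sub_distrib, ← x_eq_sum, Finset.sum_comm]
    congr 1
    refine Finset.sum_congr rfl fun α _ => ?_
    rw [← Finset.smul_sum, ← Finset.sum_mul, ← x_eq_sum]
  have h2 := cs_comm_x c v
  rw [eu, sub_mul, mul_sub, sub_sub_sub_comm, h1, h2]
  abel

/-- The cancellation is that of `eu_comm_x`, except that the reflections now stand to the left of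
`α^∨`. Moving them to the right costs a sign, because `s_α` negates `α^∨`. -/
theorem eu_comm_y (v : Vec r) : eu c * y c v - y c v * eu c = - y c v := by
  have h1 : (∑ i : Fin r, x c (bv i) * y c (bv i)) * y c v -
      y c v * (∑ i : Fin r, x c (bv i) * y c (bv i)) =
      - y c v - ∑ α : {α // α ∈ D.pos}, ((c.val α.1 : ℂ) * (rt α.1 ⬝ᵥ v)) •
        (y c (cort α.1) * g c (D.s α)) := by
    have h : ∀ i : Fin r, x c (bv i) * y c (bv i) * y c v - y c v * (x c (bv i) * y c (bv i)) =
        -(v i • y c (bv i)) + ∑ α : {α // α ∈ D.pos}, ((c.val α.1 : ℂ) * (rt α.1 ⬝ᵥ v)) •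
        (g c (D.s α) * (cort α.1 i • y c (bv i))) := by
      intro i
      rw [mul_assoc, yy c (bv i) v, ← mul_assoc, ← mul_assoc, ← sub_mul, ← neg_sub, yx, neg_mul,
        sub_mul, Finset.sum_mul, bv_dotProduct, smul_mul_assoc, one_mul, neg_sub, neg_add_eq_sub]
      congr 1
      refine Finset.sum_congr rfl fun α _ => ?_
      rw [bv_dotProduct, mul_smul_comm, smul_mul_assoc, smul_smul]
    rw [Finset.sum_mul, Finset.mul_sum, ← Finset.sum_sub_distrib, Finset.sum_congr rfl fun i _ => h i,
      Finset.sum_add_distrib, Finset.sum_neg_distrib, ← y_eq_sum, Finset.sum_comm, sub_eq_add_neg,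
      ← Finset.sum_neg_distrib]
    congr 1
    refine Finset.sum_congr rfl fun α _ => ?_
    rw [← Finset.smul_sum, ← Finset.mul_sum, ← y_eq_sum, y_cort_s, smul_neg]
  have h2 := cs_comm_y c v
  rw [eu, sub_mul, mul_sub, sub_sub_sub_comm, h1, h2]
  abel

theorem sum_y_x : ∑ i : Fin r, y c (bv i) * x c (bv i) =
    ∑ i : Fin r, x c (bv i) * y c (bv i) + (r : ℂ) • 1 - (2 : ℂ) • cs c := by
  have h : ∀ i : Fin r, y c (bv i) * x c (bv i) = x c (bv i) * y c (bv i) + ((1 : ℂ) • 1 -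
      ∑ α : {α // α ∈ D.pos}, ((c.val α.1 : ℂ) * (rt α.1 i * cort α.1 i)) • g c (D.s α)) := by
    intro i
    rw [← sub_eq_iff_eq_add', yx]
    simp [mul_assoc, bv]
  rw [Finset.sum_congr rfl fun i _ => h i, Finset.sum_add_distrib, Finset.sum_sub_distrib,
    Finset.sum_comm, ← add_sub_assoc]
  congr 1
  · simp [Nat.cast_smul_eq_nsmul]
  · rw [cs, Finset.smul_sum]
    refine Finset.sum_congr rfl fun α _ => ?_
    rw [← Finset.sum_smul, ← Finset.mul_sum, smul_smul, mul_comm]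
    congr 2
    exact rt_dotProduct_cort (RootSys.pos_ne_zero α)

/-- After summation over the basis the reflection terms appear as `s_α α + α s_α` up to a scalar,
which is zero since `s_α α = -α`. Only the constant part of `[y,x]` survives, once for each factor
of the square. -/
theorem sum_x_sq_comm_y (v : Vec r) : (∑ i : Fin r, x c (bv i) ^ 2) * y c v -
    y c v * (∑ i : Fin r, x c (bv i) ^ 2) = -(2 : ℂ) • x c v := by
  have h : ∀ i : Fin r, x c (bv i) ^ 2 * y c v - y c v * x c (bv i) ^ 2 =
      -((2 : ℂ) • (v i • x c (bv i))) +
      ∑ α : {α // α ∈ D.pos}, ((c.val α.1 : ℂ) * (rt α.1 ⬝ᵥ v)) •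
        (g c (D.s α) * (cort α.1 i • x c (bv i)) + (cort α.1 i • x c (bv i)) * g c (D.s α)) := by
    intro i
    have e : x c (bv i) ^ 2 * y c v - y c v * x c (bv i) ^ 2 =
      -((y c v * x c (bv i) - x c (bv i) * y c v) * x c (bv i) +
        x c (bv i) * (y c v * x c (bv i) - x c (bv i) * y c v)) := by noncomm_ring
    rw [e, yx, bv_dotProduct, sub_mul, mul_sub, Finset.sum_mul, Finset.mul_sum]
    have e2 : ∀ α : {α // α ∈ D.pos}, ((c.val α.1 : ℂ) * (rt α.1 ⬝ᵥ v)) •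
        (g c (D.s α) * (cort α.1 i • x c (bv i)) + (cort α.1 i • x c (bv i)) * g c (D.s α)) =
        (((c.val α.1 : ℂ) * (rt α.1 ⬝ᵥ v)) * (bv i ⬝ᵥ cort α.1)) • g c (D.s α) * x c (bv i) +
        x c (bv i) * (((c.val α.1 : ℂ) * (rt α.1 ⬝ᵥ v)) * (bv i ⬝ᵥ cort α.1)) • g c (D.s α) := by
      intro α
      rw [bv_dotProduct, mul_smul_comm, smul_mul_assoc, smul_mul_assoc, mul_smul_comm, smul_add,
        smul_smul, smul_smul]
    rw [Finset.sum_congr rfl fun α _ => e2 α, Finset.sum_add_distrib, smul_mul_assoc,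
      mul_smul_comm, one_mul, mul_one, two_smul]
    abel
  rw [Finset.sum_mul, Finset.mul_sum, ← Finset.sum_sub_distrib, Finset.sum_congr rfl fun i _ => h i,
    Finset.sum_add_distrib, Finset.sum_neg_distrib, ← Finset.smul_sum, ← x_eq_sum, Finset.sum_comm,
    neg_smul]
  refine add_eq_left.2 (Finset.sum_eq_zero fun α _ => ?_)
  rw [← Finset.smul_sum, Finset.sum_add_distrib, ← Finset.mul_sum, ← Finset.sum_mul, ← x_eq_sum,
    x_cort, mul_smul_comm, x_rt_s, smul_mul_assoc, smul_neg, neg_add_cancel, smul_zero]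

theorem sum_y_sq_comm_x (u : Vec r) : (∑ i : Fin r, y c (bv i) ^ 2) * x c u -
    x c u * (∑ i : Fin r, y c (bv i) ^ 2) = (2 : ℂ) • y c u := by
  have h : ∀ i : Fin r, y c (bv i) ^ 2 * x c u - x c u * y c (bv i) ^ 2 =
      (2 : ℂ) • (u i • y c (bv i)) -
      ∑ α : {α // α ∈ D.pos}, ((c.val α.1 : ℂ) * (u ⬝ᵥ cort α.1)) •
        (g c (D.s α) * (rt α.1 i • y c (bv i)) + (rt α.1 i • y c (bv i)) * g c (D.s α)) := by
    intro i
    have e : y c (bv i) ^ 2 * x c u - x c u * y c (bv i) ^ 2 =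
      (y c (bv i) * x c u - x c u * y c (bv i)) * y c (bv i) +
        y c (bv i) * (y c (bv i) * x c u - x c u * y c (bv i)) := by noncomm_ring
    rw [e, yx, dotProduct_bv, sub_mul, mul_sub, Finset.sum_mul, Finset.mul_sum]
    have e2 : ∀ α : {α // α ∈ D.pos}, ((c.val α.1 : ℂ) * (u ⬝ᵥ cort α.1)) •
        (g c (D.s α) * (rt α.1 i • y c (bv i)) + (rt α.1 i • y c (bv i)) * g c (D.s α)) =
        (((c.val α.1 : ℂ) * (rt α.1 ⬝ᵥ bv i)) * (u ⬝ᵥ cort α.1)) • g c (D.s α) * y c (bv i) +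
        y c (bv i) * (((c.val α.1 : ℂ) * (rt α.1 ⬝ᵥ bv i)) * (u ⬝ᵥ cort α.1)) • g c (D.s α) := by
      intro α
      rw [dotProduct_bv, mul_smul_comm, smul_mul_assoc, smul_mul_assoc, mul_smul_comm, smul_add,
        smul_smul, smul_smul]
      congr 2 <;> ring
    rw [Finset.sum_congr rfl fun α _ => e2 α, Finset.sum_add_distrib, smul_mul_assoc,
      mul_smul_comm, one_mul, mul_one, two_smul]
    abel
  rw [Finset.sum_mul, Finset.mul_sum, ← Finset.sum_sub_distrib, Finset.sum_congr rfl fun i _ => h i,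
    Finset.sum_sub_distrib, ← Finset.smul_sum, ← y_eq_sum, Finset.sum_comm]
  refine sub_eq_self.2 (Finset.sum_eq_zero fun α _ => ?_)
  -- `y_cort_s` concerns the coroot; the nonzero factor `2/(α,α)` is divided out to reach the root.
  have e3 : g c (D.s α) * y c (rt α.1) = - (y c (rt α.1) * g c (D.s α)) := by
    have h0 : ((2 / (α.1 ⬝ᵥ α.1) : ℝ) : ℂ) ≠ 0 := by
      have : α.1 ⬝ᵥ α.1 ≠ 0 := by simpa using RootSys.pos_ne_zero α
      exact_mod_cast div_ne_zero two_ne_zero this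
    have := y_cort_s c α
    rw [y_cort, mul_smul_comm, smul_mul_assoc, ← smul_neg] at this
    exact smul_right_injective _ h0 this
  rw [← Finset.smul_sum, Finset.sum_add_distrib, ← Finset.mul_sum, ← Finset.sum_mul, ← y_eq_sum,
    e3, neg_add_cancel, smul_zero]

end RCA

/-! ### Relations in the Clifford algebra -/

theorem cx_cx (u v : Vec r) : cx u * cx v + cx v * cx u = 0 := by
  rw [cx, cx, CliffordAlgebra.ι_mul_ι_add_swap]
  simp [QuadraticMap.polar, cliffQ_apply]

theorem cy_cy (u v : Vec r) : cy u * cy v + cy v * cy u = 0 := by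
  rw [cy, cy, CliffordAlgebra.ι_mul_ι_add_swap]
  simp [QuadraticMap.polar, cliffQ_apply]

theorem cx_cy (u v : Vec r) : cx u * cy v + cy v * cx u = (u ⬝ᵥ v) • 1 := by
  rw [cx, cy, CliffordAlgebra.ι_mul_ι_add_swap, ← Algebra.algebraMap_eq_smul_one]
  simp [QuadraticMap.polar, cliffQ_apply]

theorem cx_sq (u : Vec r) : cx u * cx u = 0 := by
  have := cx_cx u u
  rw [← two_smul ℂ] at this
  simpa using this

theorem cy_sq (u : Vec r) : cy u * cy u = 0 := by
  have := cy_cy u u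
  rw [← two_smul ℂ] at this
  simpa using this

/-- The generators `x` of the Clifford algebra as a linear map. -/
def cxL (r : ℕ) : Vec r →ₗ[ℂ] Cliff r := CliffordAlgebra.ι (cliffQ r) ∘ₗ LinearMap.inl ℂ _ _

/-- The generators `y` of the Clifford algebra as a linear map. -/
def cyL (r : ℕ) : Vec r →ₗ[ℂ] Cliff r := CliffordAlgebra.ι (cliffQ r) ∘ₗ LinearMap.inr ℂ _ _

theorem cxL_apply (v : Vec r) : cxL r v = cx v := rfl

theorem cyL_apply (v : Vec r) : cyL r v = cy v := rfl

/-- The element `1 - α α^∨` of the Clifford algebra. -/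
def cliffRefl (α : Fin r → ℝ) : Cliff r := 1 - cx (rt α) * cy (cort α)

/-- Moving `α^∨` past `v` leaves `⟨v,α^∨⟩`, which is the correction term of the reflection; the
remaining products agree because `α` anticommutes with `v` and squares to zero. No sign arises,
which is why `1 - α α^∨` can act on `∧ 𝔥^*` as `s_α` itself. -/
theorem cliffRefl_cx {α : Fin r → ℝ} (v : Vec r) :
    cliffRefl α * cx v = cx (act (refl α) v) * cliffRefl α := by
  have h1 : cy (cort α) * cx v = (v ⬝ᵥ cort α) • 1 - cx v * cy (cort α) := by
    rw [← cx_cy, add_sub_cancel_left]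
  have h2 : cx v * cx (rt α) = - (cx (rt α) * cx v) := eq_neg_of_add_eq_zero_left (cx_cx _ _)
  rw [act_refl, ← cxL_apply (_ - _), map_sub, map_smul, cxL_apply, cxL_apply, cliffRefl]
  have e1 : (1 - cx (rt α) * cy (cort α)) * cx v =
      cx v - (v ⬝ᵥ cort α) • cx (rt α) + cx (rt α) * cx v * cy (cort α) := by
    rw [sub_mul, one_mul, mul_assoc, h1, mul_sub, mul_smul_comm, mul_one, mul_assoc]
    abel
  have e2 : (cx v - (v ⬝ᵥ cort α) • cx (rt α)) * (1 - cx (rt α) * cy (cort α)) =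
      cx v - (v ⬝ᵥ cort α) • cx (rt α) + cx (rt α) * cx v * cy (cort α) := by
    rw [mul_sub, mul_one, sub_mul, ← mul_assoc, h2, smul_mul_assoc, ← mul_assoc, cx_sq, zero_mul,
      smul_zero, neg_mul]
    abel
  rw [e1, e2]

theorem cliffRefl_cy {α : Fin r → ℝ} (v : Vec r) :
    cliffRefl α * cy v = cy (act (refl α) v) * cliffRefl α := by
  have h1 : cy v * cx (rt α) = (rt α ⬝ᵥ v) • 1 - cx (rt α) * cy v := by
    rw [← cx_cy, add_sub_cancel_left]
  have h0 : cy (cort α) * cx (rt α) = (rt α ⬝ᵥ cort α) • 1 - cx (rt α) * cy (cort α) := by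
    rw [← cx_cy, add_sub_cancel_left]
  have h2 : cy (cort α) * cy v = - (cy v * cy (cort α)) := eq_neg_of_add_eq_zero_left (cy_cy _ _)
  rw [act_refl, ← cyL_apply (_ - _), map_sub, map_smul, cyL_apply,
    show (v ⬝ᵥ cort α) • cyL r (rt α) = (rt α ⬝ᵥ v) • cy (cort α) from
      RCA.dot_cort_smul (cyL r) v α, cliffRefl]
  -- For `α = 0` the convention `2/0 = 0` makes the coroot zero; the argument below needs `⟨α,α^∨⟩ =
  -- 2`.
  by_cases hα : α = 0
  · subst hα
    have : cort (0 : Fin r → ℝ) = 0 := by ext; simp [cort]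
    rw [this, show cy (0 : Vec r) = 0 from (cyL r).map_zero]
    simp
  have e1 : (1 - cx (rt α) * cy (cort α)) * cy v =
      cy v + cx (rt α) * cy v * cy (cort α) := by
    rw [sub_mul, one_mul, mul_assoc, h2, mul_neg, mul_assoc]
    abel
  have e2 : (cy v - (rt α ⬝ᵥ v) • cy (cort α)) * (1 - cx (rt α) * cy (cort α)) =
      cy v + cx (rt α) * cy v * cy (cort α) := by
    rw [mul_sub, mul_one, sub_mul, ← mul_assoc, h1, smul_mul_assoc, ← mul_assoc, h0,
      rt_dotProduct_cort hα, sub_mul, sub_mul, smul_mul_assoc, smul_mul_assoc, one_mul, 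
      mul_assoc (cx (rt α)) (cy (cort α)), cy_sq, mul_zero, sub_zero, two_smul, smul_add]
    abel
  rw [e1, e2]

theorem cx_rt_cx_cort (α : Fin r → ℝ) : cx (rt α) * cx (cort α) = 0 := by
  rw [cort_eq, ← cxL_apply (_ • _), map_smul, cxL_apply, mul_smul_comm, cx_sq, smul_zero]

theorem cy_rt_cy_cort (α : Fin r → ℝ) : cy (rt α) * cy (cort α) = 0 := by
  rw [cort_eq, ← cyL_apply (_ • _), map_smul, cyL_apply, mul_smul_comm, cy_sq, smul_zero]

/-- The number operator `∑ x_i y_i` of the Clifford algebra. -/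
def cliffN (r : ℕ) : Cliff r := ∑ i : Fin r, cx (bv i) * cy (bv i)

theorem cliffN_comm_cx (v : Vec r) : cliffN r * cx v - cx v * cliffN r = cx v := by
  have h : ∀ i : Fin r, cx (bv i) * cy (bv i) * cx v - cx v * (cx (bv i) * cy (bv i)) =
      v i • cx (bv i) := by
    intro i
    have e : cx (bv i) * cy (bv i) * cx v - cx v * (cx (bv i) * cy (bv i)) =
        cx (bv i) * (cx v * cy (bv i) + cy (bv i) * cx v) -
        (cx (bv i) * cx v + cx v * cx (bv i)) * cy (bv i) := by noncomm_ring
    rw [e, cx_cx, cx_cy, dotProduct_bv]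
    simp
  rw [cliffN, Finset.sum_mul, Finset.mul_sum, ← Finset.sum_sub_distrib,
    Finset.sum_congr rfl fun i _ => h i]
  exact (map_eq_sum_bv (cxL r) v).symm

theorem cliffN_comm_cy (v : Vec r) : cliffN r * cy v - cy v * cliffN r = - cy v := by
  have h : ∀ i : Fin r, cx (bv i) * cy (bv i) * cy v - cy v * (cx (bv i) * cy (bv i)) =
      - (v i • cy (bv i)) := by
    intro i
    have e : cx (bv i) * cy (bv i) * cy v - cy v * (cx (bv i) * cy (bv i)) =
        cx (bv i) * (cy (bv i) * cy v + cy v * cy (bv i)) -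
        (cx (bv i) * cy v + cy v * cx (bv i)) * cy (bv i) := by noncomm_ring
    rw [e, cy_cy, cx_cy, bv_dotProduct]
    simp
  rw [cliffN, Finset.sum_mul, Finset.mul_sum, ← Finset.sum_sub_distrib,
    Finset.sum_congr rfl fun i _ => h i, Finset.sum_neg_distrib]
  exact congrArg _ (map_eq_sum_bv (cyL r) v).symm

/-! ### Brackets of sums of tensors in `H_c ⊗ 𝒞` -/

section HC

variable (c : Param D)

open RCA

/-- Termwise, `{a ⊗ b, a' ⊗ b'} = [a,a'] ⊗ b b' + a' a ⊗ {b,b'}`. The second summand survives only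
on the diagonal, as the anticommutators of the Clifford factors are scalars supported there. -/
theorem anticomm_sum (a a' : Fin r → RCA c) (b b' : Fin r → Cliff r) (k : ℂ)
    (h : ∀ i j, b i * b' j + b' j * b i = if i = j then k • 1 else 0) :
    (∑ i, a i ⊗ₜ[ℂ] b i) * (∑ j, a' j ⊗ₜ[ℂ] b' j) + (∑ j, a' j ⊗ₜ[ℂ] b' j) * (∑ i, a i ⊗ₜ[ℂ] b i) =
      ∑ i, ∑ j, (a i * a' j - a' j * a i) ⊗ₜ[ℂ] (b i * b' j) +
        (k • ∑ i, a' i * a i) ⊗ₜ[ℂ] (1 : Cliff r) := by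
  have e : ∀ i j, (a i * a' j) ⊗ₜ[ℂ] (b i * b' j) + (a' j * a i) ⊗ₜ[ℂ] (b' j * b i) =
      (a i * a' j - a' j * a i) ⊗ₜ[ℂ] (b i * b' j) +
      (if i = j then (k • (a' j * a i)) ⊗ₜ[ℂ] (1 : Cliff r) else 0) := by
    intro i j
    rw [TensorProduct.sub_tmul]
    have := congrArg (fun t => (a' j * a i) ⊗ₜ[ℂ] t) (h i j)
    simp only [TensorProduct.tmul_add] at this
    rw [sub_add_eq_add_sub, eq_sub_iff_add_eq, add_assoc, add_comm (_ ⊗ₜ[ℂ] (b' j * b i)), this]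
    split_ifs
    · rw [TensorProduct.smul_tmul]
    · simp
  rw [Finset.sum_mul_sum, Finset.sum_mul_sum, Finset.sum_comm (f := fun i j => 
    (a' i ⊗ₜ[ℂ] b' i) * (a j ⊗ₜ[ℂ] b j)), ← Finset.sum_add_distrib]
  simp_rw [← Finset.sum_add_distrib, Algebra.TensorProduct.tmul_mul_tmul, e,
    Finset.sum_add_distrib]
  simp [TensorProduct.sum_tmul, Finset.smul_sum]

theorem comm_left_sum (a : RCA c) (a' : Fin r → RCA c) (b' : Fin r → Cliff r) :
    (a ⊗ₜ[ℂ] (1 : Cliff r)) * (∑ j, a' j ⊗ₜ[ℂ] b' j) - (∑ j, a' j ⊗ₜ[ℂ] b' j) * (a ⊗ₜ[ℂ] 1) =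
      ∑ j, (a * a' j - a' j * a) ⊗ₜ[ℂ] b' j := by
  simp [Finset.sum_mul, Finset.mul_sum, ← Finset.sum_sub_distrib, TensorProduct.sub_tmul]

theorem comm_right_sum (b : Cliff r) (a' : Fin r → RCA c) (b' : Fin r → Cliff r) :
    ((1 : RCA c) ⊗ₜ[ℂ] b) * (∑ j, a' j ⊗ₜ[ℂ] b' j) - (∑ j, a' j ⊗ₜ[ℂ] b' j) * (1 ⊗ₜ[ℂ] b) =
      ∑ j, a' j ⊗ₜ[ℂ] (b * b' j - b' j * b) := by
  simp [Finset.sum_mul, Finset.mul_sum, ← Finset.sum_sub_distrib, TensorProduct.tmul_sub]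

/-- The constant part of `[y_i,x_j]` yields the trace of `F`, and the coefficients of `s_α` are the
coordinates of `α` and `α^∨`, so that bilinearity reassembles `F(α,α^∨)`. The odd brackets that mix
`x` and `y` in the first factor all reduce to this sum. -/
theorem sum_comm_yx (F : Vec r →ₗ[ℂ] Vec r →ₗ[ℂ] Cliff r) :
    ∑ i, ∑ j, (y c (bv i) * x c (bv j) - x c (bv j) * y c (bv i)) ⊗ₜ[ℂ] F (bv i) (bv j) =
      (1 : RCA c) ⊗ₜ[ℂ] (∑ i, F (bv i) (bv i)) - ∑ α : {α // α ∈ D.pos},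
        (c.val α.1 : ℂ) • (g c (D.s α) ⊗ₜ[ℂ] F (rt α.1) (cort α.1)) := by
  have e : ∀ i j, (y c (bv i) * x c (bv j) - x c (bv j) * y c (bv i)) ⊗ₜ[ℂ]
      F (bv i) (bv j) = (if i = j then (1 : RCA c) ⊗ₜ[ℂ] F (bv i) (bv j) else 0) -
      ∑ α : {α // α ∈ D.pos}, (c.val α.1 : ℂ) • (g c (D.s α) ⊗ₜ[ℂ]
        (cort α.1 j • rt α.1 i • F (bv i) (bv j))) := by
    intro i j
    rw [yx, TensorProduct.sub_tmul, TensorProduct.sum_tmul]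
    congr 1
    · rw [dotProduct_bv]
      by_cases h : i = j <;> simp [bv, h]
    · refine Finset.sum_congr rfl fun α _ => ?_
      rw [dotProduct_bv, bv_dotProduct, TensorProduct.tmul_smul, TensorProduct.tmul_smul,
        ← TensorProduct.smul_tmul', smul_smul, smul_smul]
      congr 1
      ring
  simp_rw [e, Finset.sum_sub_distrib]
  congr 1
  · simp [TensorProduct.tmul_sum]
  · rw [Finset.sum_congr rfl fun i _ => Finset.sum_comm, Finset.sum_comm]
    refine Finset.sum_congr rfl fun α _ => ?_
    rw [map_eq_sum_bv (F (rt α.1)), map_eq_sum_bv F]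
    simp_rw [LinearMap.sum_apply, LinearMap.smul_apply, Finset.smul_sum, TensorProduct.tmul_sum,
      Finset.smul_sum]
    exact Finset.sum_comm

/-- The element `s_α ⊗ (1 - α α^∨)`. -/
def hcRefl (α : {α // α ∈ D.pos}) : HC c := g c (D.s α) ⊗ₜ[ℂ] cliffRefl α.1

theorem Omega_eq : Omega c = ∑ α : {α // α ∈ D.pos}, (c.val α.1 : ℂ) • hcRefl c α := rfl

/-- Passing `s_α ⊗ (1 - α α^∨)` through the sum applies `s_α` to both members of each pair of basis
vectors, and by `sum_act_act` the sum does not depend on the orthonormal basis. -/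
theorem hcRefl_comm_mixed (a : Vec r →ₗ[ℂ] RCA c) (b : Vec r →ₗ[ℂ] Cliff r)
    (α : {α // α ∈ D.pos})
    (ha : ∀ v, g c (D.s α) * a v = a (act (refl α.1) v) * g c (D.s α))
    (hb : ∀ v, cliffRefl α.1 * b v = b (act (refl α.1) v) * cliffRefl α.1) :
    Commute (hcRefl c α) (∑ i, a (bv i) ⊗ₜ[ℂ] b (bv i)) := by
  rw [Commute, SemiconjBy, hcRefl, Finset.mul_sum]
  simp_rw [Algebra.TensorProduct.tmul_mul_tmul, ha, hb, ← Algebra.TensorProduct.tmul_mul_tmul]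
  rw [← Finset.sum_mul]
  congr 1
  exact sum_act_act ((TensorProduct.mk ℂ (RCA c) (Cliff r)).compl₁₂ a b) (refl α.1)

theorem hcRefl_comm_left (a a' : Vec r →ₗ[ℂ] RCA c) (α : {α // α ∈ D.pos})
    (ha : ∀ v, g c (D.s α) * a v = a (act (refl α.1) v) * g c (D.s α))
    (ha' : ∀ v, g c (D.s α) * a' v = a' (act (refl α.1) v) * g c (D.s α)) :
    Commute (hcRefl c α) ((∑ i, a (bv i) * a' (bv i)) ⊗ₜ[ℂ] 1) := by
  rw [Commute, SemiconjBy, hcRefl, Algebra.TensorProduct.tmul_mul_tmul,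
    Algebra.TensorProduct.tmul_mul_tmul, mul_one, one_mul]
  congr 1
  rw [Finset.mul_sum]
  simp_rw [← mul_assoc, ha, mul_assoc, ha', ← mul_assoc]
  rw [← Finset.sum_mul]
  congr 1
  exact sum_act_act ((LinearMap.mul ℂ (RCA c)).compl₁₂ a a') (refl α.1)

theorem hcRefl_comm_right (b b' : Vec r →ₗ[ℂ] Cliff r) (α : {α // α ∈ D.pos})
    (hb : ∀ v, cliffRefl α.1 * b v = b (act (refl α.1) v) * cliffRefl α.1)
    (hb' : ∀ v, cliffRefl α.1 * b' v = b' (act (refl α.1) v) * cliffRefl α.1) :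
    Commute (hcRefl c α) ((1 : RCA c) ⊗ₜ[ℂ] (∑ i, b (bv i) * b' (bv i))) := by
  rw [Commute, SemiconjBy, hcRefl, Algebra.TensorProduct.tmul_mul_tmul,
    Algebra.TensorProduct.tmul_mul_tmul, mul_one, one_mul]
  congr 1
  rw [Finset.mul_sum]
  simp_rw [← mul_assoc, hb, mul_assoc, hb', ← mul_assoc]
  rw [← Finset.sum_mul]
  congr 1
  exact sum_act_act ((LinearMap.mul ℂ (Cliff r)).compl₁₂ b b') (refl α.1)

end HC

/-- `e₁⁺ = E₁₂`. -/
def e1p : spo := ⟨!![0, 1, 0, 0; 0, 0, 0, 0; 0, 0, 0, 0; 0, 0, 0, 0], by simp [spo]⟩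

/-! ### The bracket table of `spo(2|2)` in `H_c ⊗ 𝒞` -/

section table

variable (c : Param D)

open RCA

/-- The number operator of the Clifford algebra, in `H_c ⊗ 𝒞`. -/
def hcN : HC c := (1 : RCA c) ⊗ₜ[ℂ] cliffN r

/-- By `sum_y_x` the two orderings of `∑ x_i y_i` differ by `r - 2 ∑ c_α s_α`; half of this is the
shift `r/2` together with the class sum in the Euler element. -/
theorem opH_eq : opH c = (eu c + (r / 2 : ℂ) • 1) ⊗ₜ[ℂ] 1 := by
  rw [opH, ← Finset.smul_sum, ← TensorProduct.sum_tmul, TensorProduct.smul_tmul',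
    Finset.sum_add_distrib, sum_y_x, eu]
  congr 1
  module

theorem opZ_eq : opZ c = hcN c - (r / 2 : ℂ) • 1 + Omega c := by
  rw [opZ]
  congr 1
  have h : ∀ i : Fin r, (1 / 2 : ℂ) • ((1 : RCA c) ⊗ₜ[ℂ] (cx (bv i) * cy (bv i) -
      cy (bv i) * cx (bv i))) = 1 ⊗ₜ[ℂ] (cx (bv i) * cy (bv i)) - (1 / 2 : ℂ) • 1 := by
    intro i
    have : cy (bv i) * cx (bv i) = (1 : ℂ) • 1 - cx (bv i) * cy (bv i) := by
      rw [eq_sub_iff_add_eq, add_comm, cx_cy, dotProduct_bv]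
      simp [bv]
    rw [this, one_smul, sub_sub_eq_add_sub, TensorProduct.tmul_sub, TensorProduct.tmul_add,
      Algebra.TensorProduct.one_def]
    module
  rw [Finset.sum_congr rfl fun i _ => h i, Finset.sum_sub_distrib, hcN, cliffN,
    TensorProduct.tmul_sum]
  simp [← Nat.cast_smul_eq_nsmul ℂ, smul_smul, div_eq_mul_inv]

theorem opE1p_eq : opE1p c = -(1 / 2 : ℂ) • ((∑ i, x c (bv i) ^ 2) ⊗ₜ[ℂ] 1) := by
  rw [opE1p, TensorProduct.sum_tmul, Finset.smul_sum, ← Finset.sum_neg_distrib]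
  simp

theorem opE1m_eq : opE1m c = (1 / 2 : ℂ) • ((∑ i, y c (bv i) ^ 2) ⊗ₜ[ℂ] 1) := by
  rw [opE1m, TensorProduct.sum_tmul, Finset.smul_sum]

theorem hcRefl_comm_H (α : {α // α ∈ D.pos}) : Commute (hcRefl c α) (opH c) := by
  rw [opH, ← Finset.smul_sum, ← TensorProduct.sum_tmul, Finset.sum_add_distrib,
    TensorProduct.add_tmul]
  exact ((hcRefl_comm_left c (xL c) (yL c) α (g_x c _) (g_y c _)).add_right
    (hcRefl_comm_left c (yL c) (xL c) α (g_y c _) (g_x c _))).smul_right _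

theorem hcRefl_comm_N (α : {α // α ∈ D.pos}) : Commute (hcRefl c α) (hcN c) :=
  hcRefl_comm_right c (cxL r) (cyL r) α cliffRefl_cx cliffRefl_cy

theorem hcRefl_comm_E1p (α : {α // α ∈ D.pos}) : Commute (hcRefl c α) (opE1p c) := by
  rw [opE1p_eq]
  simp_rw [sq]
  exact (hcRefl_comm_left c (xL c) (xL c) α (g_x c _) (g_x c _)).smul_right _

theorem hcRefl_comm_E1m (α : {α // α ∈ D.pos}) : Commute (hcRefl c α) (opE1m c) := by
  rw [opE1m_eq]
  simp_rw [sq]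
  exact (hcRefl_comm_left c (yL c) (yL c) α (g_y c _) (g_y c _)).smul_right _

theorem hcRefl_comm_E2p (α : {α // α ∈ D.pos}) : Commute (hcRefl c α) (opE2p c) :=
  hcRefl_comm_mixed c (yL c) (cxL r) α (g_y c _) cliffRefl_cx

theorem hcRefl_comm_E2m (α : {α // α ∈ D.pos}) : Commute (hcRefl c α) (opE2m c) :=
  hcRefl_comm_mixed c (xL c) (cyL r) α (g_x c _) cliffRefl_cy

theorem hcRefl_comm_E3p (α : {α // α ∈ D.pos}) : Commute (hcRefl c α) (opE3p c) :=
  (hcRefl_comm_mixed c (xL c) (cxL r) α (g_x c _) cliffRefl_cx).neg_right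

theorem hcRefl_comm_E3m (α : {α // α ∈ D.pos}) : Commute (hcRefl c α) (opE3m c) :=
  (hcRefl_comm_mixed c (yL c) (cyL r) α (g_y c _) cliffRefl_cy).neg_right

theorem Omega_comm {X : HC c} (h : ∀ α, Commute (hcRefl c α) X) : Omega c * X = X * Omega c := by
  rw [Omega_eq]
  exact Commute.sum_left _ _ _ fun α _ => (h α).smul_left _

/-! Brackets with the two grading elements. -/

theorem tmul_one_comm_N (a : RCA c) : Commute (a ⊗ₜ[ℂ] (1 : Cliff r)) (hcN c) := by
  simp [Commute, SemiconjBy, hcN]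

theorem H_comm_sum (k : ℂ) (a : Fin r → RCA c) (b : Fin r → Cliff r)
    (h : ∀ i, eu c * a i - a i * eu c = k • a i) :
    opH c * (∑ i, a i ⊗ₜ[ℂ] b i) - (∑ i, a i ⊗ₜ[ℂ] b i) * opH c = k • ∑ i, a i ⊗ₜ[ℂ] b i := by
  rw [opH_eq, comm_left_sum, Finset.smul_sum]
  refine Finset.sum_congr rfl fun i _ => ?_
  rw [add_mul, mul_add, smul_mul_assoc, one_mul, mul_smul_comm, mul_one, add_sub_add_right_eq_sub,
    h, TensorProduct.smul_tmul']

theorem N_comm_sum (k : ℂ) (a : Fin r → RCA c) (b : Fin r → Cliff r)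
    (h : ∀ i, cliffN r * b i - b i * cliffN r = k • b i) :
    hcN c * (∑ i, a i ⊗ₜ[ℂ] b i) - (∑ i, a i ⊗ₜ[ℂ] b i) * hcN c = k • ∑ i, a i ⊗ₜ[ℂ] b i := by
  rw [hcN, comm_right_sum, Finset.smul_sum]
  refine Finset.sum_congr rfl fun i _ => ?_
  rw [h, TensorProduct.tmul_smul]

/-- Up to a constant, `z` is the number operator plus `Ω_c`, and `Ω_c` commutes with whatever
commutes with each `s_α ⊗ (1 - α α^∨)`. Hence `z` has the same brackets with the root vectors as the
number operator. -/
theorem Z_comm_of {X : HC c} {k : ℂ} (h : hcN c * X - X * hcN c = k • X)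
    (h' : ∀ α, Commute (hcRefl c α) X) : opZ c * X - X * opZ c = k • X := by
  rw [opZ_eq, add_mul, mul_add, Omega_comm c h', sub_mul, mul_sub, smul_mul_assoc, one_mul,
    mul_smul_comm, mul_one, ← h]
  abel

theorem eu_sq_comm (k : ℂ) (a : RCA c) (h : eu c * a - a * eu c = k • a) :
    eu c * a ^ 2 - a ^ 2 * eu c = (2 * k) • a ^ 2 := by
  have : eu c * a ^ 2 - a ^ 2 * eu c = (eu c * a - a * eu c) * a + a * (eu c * a - a * eu c) := by
    noncomm_ring
  rw [this, h, smul_mul_assoc, mul_smul_comm, mul_smul, two_smul, sq]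

theorem eu_comm_x' (v : Vec r) : eu c * x c v - x c v * eu c = (1 : ℂ) • x c v := by
  rw [eu_comm_x, one_smul]

theorem eu_comm_y' (v : Vec r) : eu c * y c v - y c v * eu c = (-1 : ℂ) • y c v := by
  rw [eu_comm_y, neg_one_smul]

theorem cliffN_comm_cx' (v : Vec r) : cliffN r * cx v - cx v * cliffN r = (1 : ℂ) • cx v := by
  rw [cliffN_comm_cx, one_smul]

theorem cliffN_comm_cy' (v : Vec r) : cliffN r * cy v - cy v * cliffN r = (-1 : ℂ) • cy v := by
  rw [cliffN_comm_cy, neg_one_smul]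

theorem comm_smul_arg {X E : HC c} {k s : ℂ} (h : E * X - X * E = k • X) :
    E * (s • X) - (s • X) * E = k • (s • X) := by
  rw [mul_smul_comm, smul_mul_assoc, ← smul_sub, h, smul_comm]

theorem comm_neg_arg {X E : HC c} {k : ℂ} (h : E * X - X * E = k • X) :
    E * (-X) - (-X) * E = k • (-X) := by
  rw [mul_neg, neg_mul, ← neg_sub', h, smul_neg]

theorem H_E1p : opH c * opE1p c - opE1p c * opH c = (2 : ℂ) • opE1p c := by
  rw [opE1p_eq]
  refine comm_smul_arg c ?_
  rw [TensorProduct.sum_tmul]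
  refine H_comm_sum c 2 _ _ fun i => ?_
  simpa using eu_sq_comm c 1 _ (eu_comm_x' c (bv i))

theorem H_E1m : opH c * opE1m c - opE1m c * opH c = (-2 : ℂ) • opE1m c := by
  rw [opE1m_eq]
  refine comm_smul_arg c ?_
  rw [TensorProduct.sum_tmul]
  refine H_comm_sum c (-2) _ _ fun i => ?_
  simpa using eu_sq_comm c (-1) _ (eu_comm_y' c (bv i))

theorem H_E2p : opH c * opE2p c - opE2p c * opH c = (-1 : ℂ) • opE2p c :=
  H_comm_sum c _ _ _ fun _ => eu_comm_y' c _

theorem H_E2m : opH c * opE2m c - opE2m c * opH c = (1 : ℂ) • opE2m c :=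
  H_comm_sum c _ _ _ fun _ => eu_comm_x' c _

theorem H_E3p : opH c * opE3p c - opE3p c * opH c = (1 : ℂ) • opE3p c :=
  comm_neg_arg c (H_comm_sum c _ _ _ fun _ => eu_comm_x' c _)

theorem H_E3m : opH c * opE3m c - opE3m c * opH c = (-1 : ℂ) • opE3m c :=
  comm_neg_arg c (H_comm_sum c _ _ _ fun _ => eu_comm_y' c _)

theorem N_tmul_one (a : RCA c) : hcN c * (a ⊗ₜ[ℂ] 1) - (a ⊗ₜ[ℂ] 1) * hcN c =
    (0 : ℂ) • (a ⊗ₜ[ℂ] (1 : Cliff r)) := by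
  rw [(tmul_one_comm_N c a).eq, sub_self, zero_smul]

theorem N_H : hcN c * opH c - opH c * hcN c = (0 : ℂ) • opH c := by
  rw [opH_eq]; exact N_tmul_one c _

theorem N_E1p : hcN c * opE1p c - opE1p c * hcN c = (0 : ℂ) • opE1p c := by
  rw [opE1p_eq]; exact comm_smul_arg c (N_tmul_one c _)

theorem N_E1m : hcN c * opE1m c - opE1m c * hcN c = (0 : ℂ) • opE1m c := by
  rw [opE1m_eq]; exact comm_smul_arg c (N_tmul_one c _)

theorem N_E2p : hcN c * opE2p c - opE2p c * hcN c = (1 : ℂ) • opE2p c :=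
  N_comm_sum c _ _ _ fun _ => cliffN_comm_cx' _

theorem N_E2m : hcN c * opE2m c - opE2m c * hcN c = (-1 : ℂ) • opE2m c :=
  N_comm_sum c _ _ _ fun _ => cliffN_comm_cy' _

theorem N_E3p : hcN c * opE3p c - opE3p c * hcN c = (1 : ℂ) • opE3p c :=
  comm_neg_arg c (N_comm_sum c _ _ _ fun _ => cliffN_comm_cx' _)

theorem N_E3m : hcN c * opE3m c - opE3m c * hcN c = (-1 : ℂ) • opE3m c :=
  comm_neg_arg c (N_comm_sum c _ _ _ fun _ => cliffN_comm_cy' _)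

theorem Z_H : opZ c * opH c - opH c * opZ c = (0 : ℂ) • opH c :=
  Z_comm_of c (N_H c) (hcRefl_comm_H c)

theorem Z_E1p : opZ c * opE1p c - opE1p c * opZ c = (0 : ℂ) • opE1p c :=
  Z_comm_of c (N_E1p c) (hcRefl_comm_E1p c)

theorem Z_E1m : opZ c * opE1m c - opE1m c * opZ c = (0 : ℂ) • opE1m c :=
  Z_comm_of c (N_E1m c) (hcRefl_comm_E1m c)

theorem Z_E2p : opZ c * opE2p c - opE2p c * opZ c = (1 : ℂ) • opE2p c :=
  Z_comm_of c (N_E2p c) (hcRefl_comm_E2p c)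

theorem Z_E2m : opZ c * opE2m c - opE2m c * opZ c = (-1 : ℂ) • opE2m c :=
  Z_comm_of c (N_E2m c) (hcRefl_comm_E2m c)

theorem Z_E3p : opZ c * opE3p c - opE3p c * opZ c = (1 : ℂ) • opE3p c :=
  Z_comm_of c (N_E3p c) (hcRefl_comm_E3p c)

theorem Z_E3m : opZ c * opE3m c - opE3m c * opZ c = (-1 : ℂ) • opE3m c :=
  Z_comm_of c (N_E3m c) (hcRefl_comm_E3m c)

/-! Brackets of `e₁^±` with the root vectors. -/

theorem comm_smul_left {X E Y : HC c} {s : ℂ} (h : E * X - X * E = Y) :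
    (s • E) * X - X * (s • E) = s • Y := by
  rw [mul_smul_comm, smul_mul_assoc, ← smul_sub, h]

theorem E1p_E2p : opE1p c * opE2p c - opE2p c * opE1p c = - opE3p c := by
  rw [opE1p_eq, opE2p, comm_smul_left c (comm_left_sum c _ _ _), opE3p, neg_neg, Finset.smul_sum]
  refine Finset.sum_congr rfl fun i _ => ?_
  rw [sum_x_sq_comm_y, ← TensorProduct.smul_tmul', smul_smul]
  norm_num

theorem sum_x_sq_comm_x (v : Vec r) : (∑ i : Fin r, x c (bv i) ^ 2) * x c v -
    x c v * (∑ i : Fin r, x c (bv i) ^ 2) = 0 := by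
  rw [sub_eq_zero]
  exact Commute.sum_left _ _ _ fun i _ => Commute.pow_left (xx c _ _) 2

theorem sum_y_sq_comm_y (v : Vec r) : (∑ i : Fin r, y c (bv i) ^ 2) * y c v -
    y c v * (∑ i : Fin r, y c (bv i) ^ 2) = 0 := by
  rw [sub_eq_zero]
  exact Commute.sum_left _ _ _ fun i _ => Commute.pow_left (yy c _ _) 2

theorem E1p_E2m : opE1p c * opE2m c - opE2m c * opE1p c = 0 := by
  rw [opE1p_eq, opE2m, comm_smul_left c (comm_left_sum c _ _ _)]
  simp [sum_x_sq_comm_x]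

theorem E1p_E3p : opE1p c * opE3p c - opE3p c * opE1p c = 0 := by
  rw [opE3p, mul_neg, neg_mul, ← neg_sub', opE1p_eq, comm_smul_left c (comm_left_sum c _ _ _)]
  simp [sum_x_sq_comm_x]

theorem E1p_E3m : opE1p c * opE3m c - opE3m c * opE1p c = - opE2m c := by
  rw [opE3m, mul_neg, neg_mul, ← neg_sub', opE1p_eq, comm_smul_left c (comm_left_sum c _ _ _),
    opE2m, Finset.smul_sum]
  congr 1
  refine Finset.sum_congr rfl fun i _ => ?_
  rw [sum_x_sq_comm_y, ← TensorProduct.smul_tmul', smul_smul]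
  norm_num

theorem E1m_E2p : opE1m c * opE2p c - opE2p c * opE1m c = 0 := by
  rw [opE1m_eq, opE2p, comm_smul_left c (comm_left_sum c _ _ _)]
  simp [sum_y_sq_comm_y]

theorem E1m_E2m : opE1m c * opE2m c - opE2m c * opE1m c = - opE3m c := by
  rw [opE1m_eq, opE2m, comm_smul_left c (comm_left_sum c _ _ _), opE3m, neg_neg, Finset.smul_sum]
  refine Finset.sum_congr rfl fun i _ => ?_
  rw [sum_y_sq_comm_x, ← TensorProduct.smul_tmul', smul_smul]
  norm_num

theorem E1m_E3p : opE1m c * opE3p c - opE3p c * opE1m c = - opE2p c := by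
  rw [opE3p, mul_neg, neg_mul, ← neg_sub', opE1m_eq, comm_smul_left c (comm_left_sum c _ _ _),
    opE2p, Finset.smul_sum]
  congr 1
  refine Finset.sum_congr rfl fun i _ => ?_
  rw [sum_y_sq_comm_x, ← TensorProduct.smul_tmul', smul_smul]
  norm_num

theorem E1m_E3m : opE1m c * opE3m c - opE3m c * opE1m c = 0 := by
  rw [opE3m, mul_neg, neg_mul, ← neg_sub', opE1m_eq, comm_smul_left c (comm_left_sum c _ _ _)]
  simp [sum_y_sq_comm_y]

theorem E1p_E1m : opE1p c * opE1m c - opE1m c * opE1p c = opH c := by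
  have h : (∑ i : Fin r, x c (bv i) ^ 2) * (∑ i : Fin r, y c (bv i) ^ 2) -
      (∑ i : Fin r, y c (bv i) ^ 2) * (∑ i : Fin r, x c (bv i) ^ 2) =
      -(2 : ℂ) • ∑ i : Fin r, (x c (bv i) * y c (bv i) + y c (bv i) * x c (bv i)) := by
    rw [Finset.mul_sum (s := Finset.univ) (f := fun i => y c (bv i) ^ 2),
      Finset.sum_mul (s := Finset.univ) (f := fun i => y c (bv i) ^ 2), ← Finset.sum_sub_distrib,
      Finset.smul_sum]
    refine Finset.sum_congr rfl fun i _ => ?_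
    have e : ∀ S Y : RCA c, S * Y ^ 2 - Y ^ 2 * S = (S * Y - Y * S) * Y + Y * (S * Y - Y * S) :=
      fun S Y => by noncomm_ring
    rw [e, sum_x_sq_comm_y, smul_mul_assoc, mul_smul_comm, ← smul_add]
  rw [opE1p_eq, opE1m_eq, smul_mul_smul_comm, smul_mul_smul_comm, mul_comm (1 / 2 : ℂ), ← smul_sub,
    Algebra.TensorProduct.tmul_mul_tmul, Algebra.TensorProduct.tmul_mul_tmul, one_mul,
    ← TensorProduct.sub_tmul, h, opH, ← Finset.smul_sum, ← TensorProduct.sum_tmul,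
    ← TensorProduct.smul_tmul', smul_smul]
  norm_num

/-! Brackets of odd root vectors. -/

theorem cy_cx_bv (i j : Fin r) : cx (bv i) * cy (bv j) + cy (bv j) * cx (bv i) =
    if i = j then (1 : ℂ) • 1 else 0 := by
  rw [cx_cy, dotProduct_bv]
  split_ifs with h
  · subst h; simp [bv]
  · simp [bv, h, eq_comm]

theorem cy_cx_bv' (i j : Fin r) : cy (bv i) * cx (bv j) + cx (bv j) * cy (bv i) =
    if i = j then (1 : ℂ) • 1 else 0 := by
  rw [add_comm, cy_cx_bv]
  simp [eq_comm]

theorem sum_sum_comm_zero {a a' : Fin r → RCA c} (h : ∀ i j, a i * a' j = a' j * a i)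
    (b b' : Fin r → Cliff r) :
    ∑ i, ∑ j, (a i * a' j - a' j * a i) ⊗ₜ[ℂ] (b i * b' j) = 0 := by
  simp [h]

theorem zero_rel {b b' : Cliff r} (i j : Fin r) (h : b * b' + b' * b = 0) :
    b * b' + b' * b = if i = j then (0 : ℂ) • 1 else 0 := by
  rw [h]; simp

theorem E2p_E2p : opE2p c * opE2p c + opE2p c * opE2p c = 0 := by
  rw [opE2p, anticomm_sum c _ _ _ _ 0 fun i j => zero_rel i j (cx_cx _ _),
    sum_sum_comm_zero c fun i j => yy c _ _]
  simp

theorem E2m_E2m : opE2m c * opE2m c + opE2m c * opE2m c = 0 := by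
  rw [opE2m, anticomm_sum c _ _ _ _ 0 fun i j => zero_rel i j (cy_cy _ _),
    sum_sum_comm_zero c fun i j => xx c _ _]
  simp

theorem E3p_E3p : opE3p c * opE3p c + opE3p c * opE3p c = 0 := by
  rw [opE3p, neg_mul_neg, anticomm_sum c _ _ _ _ 0 fun i j => zero_rel i j (cx_cx _ _),
    sum_sum_comm_zero c fun i j => xx c _ _]
  simp

theorem E3m_E3m : opE3m c * opE3m c + opE3m c * opE3m c = 0 := by
  rw [opE3m, neg_mul_neg, anticomm_sum c _ _ _ _ 0 fun i j => zero_rel i j (cy_cy _ _),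
    sum_sum_comm_zero c fun i j => yy c _ _]
  simp

theorem E2p_E3m : opE2p c * opE3m c + opE3m c * opE2p c = -(2 : ℂ) • opE1m c := by
  rw [opE3m, mul_neg, neg_mul, ← neg_add, opE2p, anticomm_sum c _ _ _ _ 1 cy_cx_bv,
    sum_sum_comm_zero c fun i j => yy c _ _, opE1m_eq, smul_smul]
  simp [sq]

theorem E2m_E3p : opE2m c * opE3p c + opE3p c * opE2m c = (2 : ℂ) • opE1p c := by
  rw [opE3p, mul_neg, neg_mul, ← neg_add, opE2m, anticomm_sum c _ _ _ _ 1 cy_cx_bv',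
    sum_sum_comm_zero c fun i j => xx c _ _, opE1p_eq, smul_smul]
  simp [sq]

/-- The reflection terms are multiples of `α ∧ α^∨`, which vanishes as `α^∨` is proportional to `α`;
the constant terms are squares of `x_i` in the Clifford algebra. -/
theorem E2p_E3p : opE2p c * opE3p c + opE3p c * opE2p c = 0 := by
  rw [opE3p, mul_neg, neg_mul, ← neg_add, opE2p,
    anticomm_sum c _ _ _ _ 0 fun i j => zero_rel i j (cx_cx _ _)]
  have := sum_comm_yx c ((LinearMap.mul ℂ (Cliff r)).compl₁₂ (cxL r) (cxL r))
  simp only [LinearMap.compl₁₂_apply, LinearMap.mul_apply', cxL_apply, cx_rt_cx_cort, cx_sq] at this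
  rw [this]
  simp

theorem E2m_E3m : opE2m c * opE3m c + opE3m c * opE2m c = 0 := by
  rw [opE3m, mul_neg, neg_mul, ← neg_add, opE2m, add_comm,
    anticomm_sum c _ _ _ _ 0 fun i j => zero_rel i j (cy_cy _ _)]
  have := sum_comm_yx c ((LinearMap.mul ℂ (Cliff r)).compl₁₂ (cyL r) (cyL r))
  simp only [LinearMap.compl₁₂_apply, LinearMap.mul_apply', cyL_apply, cy_rt_cy_cort, cy_sq] at this
  rw [this]
  simp

theorem Omega_eq_sub : Omega c = cs c ⊗ₜ[ℂ] 1 - ∑ α : {α // α ∈ D.pos},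
    (c.val α.1 : ℂ) • (g c (D.s α) ⊗ₜ[ℂ] (cx (rt α.1) * cy (cort α.1))) := by
  rw [Omega, cs, TensorProduct.sum_tmul, ← Finset.sum_sub_distrib]
  refine Finset.sum_congr rfl fun α _ => ?_
  rw [TensorProduct.tmul_sub, smul_sub, TensorProduct.smul_tmul']

/-- The reflection part of `[y,x]` enters as `-∑ c_α s_α ⊗ α α^∨ = Ω_c - (∑ c_α s_α) ⊗ 1`, so it
completes the number operator to `z`. This dictates the form of `Ω_c`; the leftover class sum
cancels against that of the Euler element in `E2p_E2m`. -/
theorem sum_comm_yx_cxcy : ∑ i, ∑ j, (y c (bv i) * x c (bv j) - x c (bv j) * y c (bv i)) ⊗ₜ[ℂ]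
    (cx (bv i) * cy (bv j)) = opZ c + (r / 2 : ℂ) • 1 - cs c ⊗ₜ[ℂ] 1 := by
  refine (sum_comm_yx c ((LinearMap.mul ℂ (Cliff r)).compl₁₂ (cxL r) (cyL r))).trans ?_
  rw [opZ_eq, Omega_eq_sub, hcN, cliffN]
  simp only [LinearMap.compl₁₂_apply, LinearMap.mul_apply', cxL_apply, cyL_apply]
  abel

theorem E2p_E2m : opE2p c * opE2m c + opE2m c * opE2p c = opH c + opZ c := by
  rw [opE2p, opE2m, anticomm_sum c _ _ _ _ 1 cy_cx_bv, sum_comm_yx_cxcy, opH_eq, eu, one_smul,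
    TensorProduct.add_tmul, TensorProduct.sub_tmul, ← TensorProduct.smul_tmul',
    Algebra.TensorProduct.one_def]
  abel

theorem E3p_E3m : opE3p c * opE3m c + opE3m c * opE3p c = opH c - opZ c := by
  have h : ∑ i, ∑ j, (x c (bv i) * y c (bv j) - y c (bv j) * x c (bv i)) ⊗ₜ[ℂ]
      (cx (bv i) * cy (bv j)) = - (opZ c + (r / 2 : ℂ) • 1 - cs c ⊗ₜ[ℂ] 1) := by
    have h1 : ∀ α : Fin r → ℝ, cx (cort α) * cy (rt α) = cx (rt α) * cy (cort α) := fun α => by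
      rw [cort_eq, ← cxL_apply (_ • _), ← cyL_apply (_ • _), map_smul, map_smul, smul_mul_assoc,
        mul_smul_comm, cxL_apply, cyL_apply]
    have h2 := sum_comm_yx c ((LinearMap.mul ℂ (Cliff r)).compl₁₂ (cxL r) (cyL r)).flip
    simp only [LinearMap.flip_apply, LinearMap.compl₁₂_apply, LinearMap.mul_apply', cxL_apply,
      cyL_apply, h1] at h2
    rw [Finset.sum_comm, ← Finset.sum_congr rfl fun i _ => Finset.sum_congr rfl fun j _ => 
      congrArg (· ⊗ₜ[ℂ] (cx (bv j) * cy (bv i))) (neg_sub (y c (bv i) * x c (bv j)) _)]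
    simp_rw [TensorProduct.neg_tmul, Finset.sum_neg_distrib]
    rw [h2, opZ_eq, Omega_eq_sub, hcN, cliffN]
    abel
  rw [opE3p, opE3m, neg_mul_neg, neg_mul_neg, anticomm_sum c _ _ _ _ 1 cy_cx_bv, h, opH_eq, eu,
    one_smul, sum_y_x, TensorProduct.add_tmul, TensorProduct.sub_tmul, TensorProduct.sub_tmul,
    TensorProduct.add_tmul, ← TensorProduct.smul_tmul', ← TensorProduct.smul_tmul',
    ← TensorProduct.smul_tmul', ← Algebra.TensorProduct.one_def]
  module

end table

/-! ### The realisation as a homomorphism from `U(𝔤)` -/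

theorem realise_gh (c : Param D) : realise c gh = opH c := by simp [realise, gh]
theorem realise_gz (c : Param D) : realise c gz = opZ c := by simp [realise, gz]
theorem realise_e1p (c : Param D) : realise c e1p = opE1p c := by simp [realise, e1p]
theorem realise_e1m (c : Param D) : realise c e1m = opE1m c := by simp [realise, e1m]
theorem realise_e2p (c : Param D) : realise c e2p = opE2p c := by simp [realise, e2p]
theorem realise_e2m (c : Param D) : realise c e2m = opE2m c := by simp [realise, e2m]
theorem realise_e3p (c : Param D) : realise c e3p = opE3p c := by simp [realise, e3p]
theorem realise_e3m (c : Param D) : realise c e3m = opE3m c := by simp [realise, e3m]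

/-- The coordinates of an element of `𝔤` in the basis `h, z, e_i^±`. -/
theorem spo_eq (X : spo) : X = X.1 0 0 • gh + X.1 2 2 • gz + X.1 0 1 • e1p + X.1 1 0 • e1m +
    X.1 2 0 • e2p + X.1 0 2 • e2m + X.1 0 3 • e3p + X.1 3 0 • e3m := by
  obtain ⟨X, a1, a2, a3, a4, a5, a6, a7, a8⟩ := X
  apply Subtype.ext
  ext i j
  fin_cases i <;> fin_cases j <;> simp [gh, gz, e1p, e1m, e2p, e2m, e3p, e3m, *]

/-- An element of `𝔤` is determined by eight matrix entries, and those of the bracket are bilinear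
in the entries of `X` and `Y`. The identity is therefore the combination of the bracket table with
these products of entries as coefficients. -/
theorem realise_even (c : Param D) (X Y Z : spo) (hX : IsEven X)
    (hZ : Z.1 = X.1 * Y.1 - Y.1 * X.1) :
    realise c X * realise c Y - realise c Y * realise c X = realise c Z := by
  have x20 : X.1 2 0 = 0 := hX 2 0 (by simp)
  have x02 : X.1 0 2 = 0 := hX 0 2 (by simp)
  have x03 : X.1 0 3 = 0 := hX 0 3 (by simp)
  have x30 : X.1 3 0 = 0 := hX 3 0 (by simp)
  obtain ⟨a1, a2, a3, a4, a5, a6, a7, a8⟩ := X.2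
  obtain ⟨b1, b2, b3, b4, b5, b6, b7, b8⟩ := Y.2
  have z00 := congrFun (congrFun hZ 0) 0
  have z22 := congrFun (congrFun hZ 2) 2
  have z01 := congrFun (congrFun hZ 0) 1
  have z10 := congrFun (congrFun hZ 1) 0
  have z20 := congrFun (congrFun hZ 2) 0
  have z02 := congrFun (congrFun hZ 0) 2
  have z03 := congrFun (congrFun hZ 0) 3
  have z30 := congrFun (congrFun hZ 3) 0
  simp only [Matrix.sub_apply, Matrix.mul_apply, Fin.sum_univ_four, a1, a2, a3, a4, a5, a6, a7, a8,
    b1, b2, b3, b4, b5, b6, b7, b8, x20, x02, x03, x30] at z00 z22 z01 z10 z20 z02 z03 z30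
  simp only [realise, LinearMap.coe_mk, AddHom.coe_mk, z00, z22, z01, z10, z20, z02, z03, z30,
    x20, x02, x03, x30, zero_smul, add_zero]
  simp only [mul_add, add_mul, smul_mul_smul_comm]
  linear_combination (norm := module)
    -(X.1 2 2 * Y.1 0 0 - X.1 0 0 * Y.1 2 2) • (-Z_H c)
    + (X.1 0 0 * Y.1 0 1 - X.1 0 1 * Y.1 0 0) • H_E1p c
    + (X.1 0 0 * Y.1 1 0 - X.1 1 0 * Y.1 0 0) • H_E1m c
    + (X.1 0 0 * Y.1 2 0) • H_E2p c + (X.1 0 0 * Y.1 0 2) • H_E2m c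
    + (X.1 0 0 * Y.1 0 3) • H_E3p c + (X.1 0 0 * Y.1 3 0) • H_E3m c
    + (X.1 2 2 * Y.1 0 1 - X.1 0 1 * Y.1 2 2) • Z_E1p c
    + (X.1 2 2 * Y.1 1 0 - X.1 1 0 * Y.1 2 2) • Z_E1m c
    + (X.1 2 2 * Y.1 2 0) • Z_E2p c + (X.1 2 2 * Y.1 0 2) • Z_E2m c
    + (X.1 2 2 * Y.1 0 3) • Z_E3p c + (X.1 2 2 * Y.1 3 0) • Z_E3m c
    + (X.1 0 1 * Y.1 1 0 - X.1 1 0 * Y.1 0 1) • E1p_E1m c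
    + (X.1 0 1 * Y.1 2 0) • E1p_E2p c + (X.1 0 1 * Y.1 0 2) • E1p_E2m c
    + (X.1 0 1 * Y.1 0 3) • E1p_E3p c + (X.1 0 1 * Y.1 3 0) • E1p_E3m c
    + (X.1 1 0 * Y.1 2 0) • E1m_E2p c + (X.1 1 0 * Y.1 0 2) • E1m_E2m c
    + (X.1 1 0 * Y.1 0 3) • E1m_E3p c + (X.1 1 0 * Y.1 3 0) • E1m_E3m c

theorem realise_odd (c : Param D) (X Y Z : spo) (hX : IsOdd X) (hY : IsOdd Y)
    (hZ : Z.1 = X.1 * Y.1 + Y.1 * X.1) :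
    realise c X * realise c Y + realise c Y * realise c X = realise c Z := by
  have x00 : X.1 0 0 = 0 := hX 0 0 (by simp)
  have x22 : X.1 2 2 = 0 := hX 2 2 (by simp)
  have x01 : X.1 0 1 = 0 := hX 0 1 (by simp)
  have x10 : X.1 1 0 = 0 := hX 1 0 (by simp)
  have y00 : Y.1 0 0 = 0 := hY 0 0 (by simp)
  have y22 : Y.1 2 2 = 0 := hY 2 2 (by simp)
  have y01 : Y.1 0 1 = 0 := hY 0 1 (by simp)
  have y10 : Y.1 1 0 = 0 := hY 1 0 (by simp)
  obtain ⟨a1, a2, a3, a4, a5, a6, a7, a8⟩ := X.2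
  obtain ⟨b1, b2, b3, b4, b5, b6, b7, b8⟩ := Y.2
  have z00 := congrFun (congrFun hZ 0) 0
  have z22 := congrFun (congrFun hZ 2) 2
  have z01 := congrFun (congrFun hZ 0) 1
  have z10 := congrFun (congrFun hZ 1) 0
  have z20 := congrFun (congrFun hZ 2) 0
  have z02 := congrFun (congrFun hZ 0) 2
  have z03 := congrFun (congrFun hZ 0) 3
  have z30 := congrFun (congrFun hZ 3) 0
  simp only [Matrix.add_apply, Matrix.mul_apply, Fin.sum_univ_four, a1, a2, a3, a4, a5, a6, a7, a8,
    b1, b2, b3, b4, b5, b6, b7, b8, x00, x22, x01, x10, y00, y22, y01, y10]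
    at z00 z22 z01 z10 z20 z02 z03 z30
  simp only [realise, LinearMap.coe_mk, AddHom.coe_mk, z00, z22, z01, z10, z20, z02, z03, z30,
    x00, x22, x01, x10, y00, y22, y01, y10, zero_smul, zero_add]
  simp only [mul_add, add_mul, smul_mul_smul_comm]
  linear_combination (norm := module)
    (X.1 2 0 * Y.1 2 0) • E2p_E2p c + (X.1 0 2 * Y.1 0 2) • E2m_E2m c
    + (X.1 0 3 * Y.1 0 3) • E3p_E3p c + (X.1 3 0 * Y.1 3 0) • E3m_E3m c
    + (X.1 2 0 * Y.1 0 2 + X.1 0 2 * Y.1 2 0) • E2p_E2m c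
    + (X.1 2 0 * Y.1 0 3 + X.1 0 3 * Y.1 2 0) • E2p_E3p c
    + (X.1 2 0 * Y.1 3 0 + X.1 3 0 * Y.1 2 0) • E2p_E3m c
    + (X.1 0 2 * Y.1 0 3 + X.1 0 3 * Y.1 0 2) • E2m_E3p c
    + (X.1 0 2 * Y.1 3 0 + X.1 3 0 * Y.1 0 2) • E2m_E3m c
    + (X.1 0 3 * Y.1 3 0 + X.1 3 0 * Y.1 0 3) • E3p_E3m c

/-- The quotient map onto `U(𝔤)`. -/
def ugMk : TensorAlgebra ℂ spo →ₐ[ℂ] Ug := RingQuot.mkAlgHom ℂ URel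

theorem ugMk_ι (X : spo) : ugMk (TensorAlgebra.ι ℂ X) = toU X := rfl

theorem ugMk_rel {a b : TensorAlgebra ℂ spo} (h : URel a b) : ugMk a = ugMk b :=
  RingQuot.mkAlgHom_rel ℂ h

/-- The homomorphism `U(𝔤) → H_c ⊗ 𝒞`. -/
def ugHom (c : Param D) : Ug →ₐ[ℂ] HC c :=
  RingQuot.liftAlgHom ℂ ⟨TensorAlgebra.lift ℂ (realise c), fun a b h => by
    induction h with
    | even X Y Z hX hZ => simpa using realise_even c X Y Z hX hZ
    | odd X Y Z hX hY hZ => simpa using realise_odd c X Y Z hX hY hZ⟩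

theorem ugHom_toU (c : Param D) (X : spo) : ugHom c (toU X) = realise c X := by
  refine (RingQuot.liftAlgHom_mkAlgHom_apply ℂ (TensorAlgebra.lift ℂ (realise c)) _ _).trans ?_
  exact TensorAlgebra.lift_ι_apply _ _

theorem toU_even (X Y Z : spo) (hX : IsEven X) (hZ : Z.1 = X.1 * Y.1 - Y.1 * X.1) :
    toU X * toU Y = toU Y * toU X + toU Z := by
  rw [← sub_eq_iff_eq_add']
  simpa [ugMk_ι] using ugMk_rel (URel.even X Y Z hX hZ)

theorem toU_odd (X Y Z : spo) (hX : IsOdd X) (hY : IsOdd Y) (hZ : Z.1 = X.1 * Y.1 + Y.1 * X.1) :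
    toU X * toU Y = -(toU Y * toU X) + toU Z := by
  rw [← sub_eq_iff_eq_add', sub_neg_eq_add]
  simpa [ugMk_ι] using ugMk_rel (URel.odd X Y Z hX hY hZ)

theorem Ug_induction {p : Ug → Prop} (h1 : ∀ z : ℂ, p (algebraMap ℂ Ug z))
    (hadd : ∀ a b, p a → p b → p (a + b)) (hmul : ∀ a b, p a → p b → p (a * b))
    (h : ∀ X, p (toU X)) (a : Ug) : p a := by
  obtain ⟨t, rfl⟩ : ∃ t, ugMk t = a := RingQuot.mkAlgHom_surjective ℂ URel a
  induction t using TensorAlgebra.induction with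
  | algebraMap z => rw [AlgHom.commutes]; exact h1 z
  | ι X => exact h X
  | mul a b ha hb => rw [map_mul]; exact hmul _ _ ha hb
  | add a b ha hb => rw [map_add]; exact hadd _ _ ha hb

theorem isEven_gh : IsEven gh := by
  intro i j; fin_cases i <;> fin_cases j <;> simp [gh]
theorem isEven_gz : IsEven gz := by
  intro i j; fin_cases i <;> fin_cases j <;> simp [gz]
theorem isEven_e1p : IsEven e1p := by
  intro i j; fin_cases i <;> fin_cases j <;> simp [e1p]
theorem isEven_e1m : IsEven e1m := by
  intro i j; fin_cases i <;> fin_cases j <;> simp [e1m]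
theorem isOdd_e2p : IsOdd e2p := by
  intro i j; fin_cases i <;> fin_cases j <;> simp [e2p]
theorem isOdd_e2m : IsOdd e2m := by
  intro i j; fin_cases i <;> fin_cases j <;> simp [e2m]
theorem isOdd_e3p : IsOdd e3p := by
  intro i j; fin_cases i <;> fin_cases j <;> simp [e3p]
theorem isOdd_e3m : IsOdd e3m := by
  intro i j; fin_cases i <;> fin_cases j <;> simp [e3m]

/-! ## Lowest weight vectors in `U(𝔤)`-modules -/

section modules

variable {N : Type*} [AddCommGroup N] [Module ℂ N] [Module Ug N] [IsScalarTower ℂ Ug N]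

theorem even_smul (X Y Z : spo) (hX : IsEven X) (hZ : Z.1 = X.1 * Y.1 - Y.1 * X.1) (u : N) :
    toU X • toU Y • u = toU Y • toU X • u + toU Z • u := by
  rw [smul_smul, toU_even X Y Z hX hZ, add_smul, mul_smul]

theorem odd_smul (X Y Z : spo) (hX : IsOdd X) (hY : IsOdd Y) (hZ : Z.1 = X.1 * Y.1 + Y.1 * X.1)
    (u : N) : toU X • toU Y • u = -(toU Y • toU X • u) + toU Z • u := by
  rw [smul_smul, toU_odd X Y Z hX hY hZ, add_smul, neg_smul, mul_smul]

theorem toU_smul_smul (z : ℂ) (X : spo) (u : N) : toU (z • X) • u = z • toU X • u := by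
  rw [map_smul, smul_assoc]

theorem h_e1p (u : N) : toU gh • toU e1p • u = toU e1p • toU gh • u + (2 : ℂ) • toU e1p • u := by
  rw [← toU_smul_smul]
  refine even_smul _ _ _ isEven_gh ?_ u
  simp [gh, e1p]; norm_num

theorem h_e2p (u : N) : toU gh • toU e2p • u = toU e2p • toU gh • u + (-1 : ℂ) • toU e2p • u := by
  rw [← toU_smul_smul]
  refine even_smul _ _ _ isEven_gh ?_ u
  simp [gh, e2p]

theorem h_e3p (u : N) : toU gh • toU e3p • u = toU e3p • toU gh • u + (1 : ℂ) • toU e3p • u := by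
  rw [← toU_smul_smul]
  refine even_smul _ _ _ isEven_gh ?_ u
  simp [gh, e3p]

theorem z_e1p (u : N) : toU gz • toU e1p • u = toU e1p • toU gz • u + (0 : ℂ) • toU e1p • u := by
  rw [← toU_smul_smul]
  refine even_smul _ _ _ isEven_gz ?_ u
  ext i j; fin_cases i <;> fin_cases j <;> simp [gz, e1p]

theorem z_e2p (u : N) : toU gz • toU e2p • u = toU e2p • toU gz • u + (1 : ℂ) • toU e2p • u := by
  rw [← toU_smul_smul]
  refine even_smul _ _ _ isEven_gz ?_ u
  simp [gz, e2p]

theorem z_e3p (u : N) : toU gz • toU e3p • u = toU e3p • toU gz • u + (1 : ℂ) • toU e3p • u := by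
  rw [← toU_smul_smul]
  refine even_smul _ _ _ isEven_gz ?_ u
  simp [gz, e3p]

theorem e1m_e1p (u : N) : toU e1m • toU e1p • u = toU e1p • toU e1m • u - toU gh • u := by
  rw [sub_eq_add_neg, ← neg_one_smul ℂ (toU gh • u), ← toU_smul_smul]
  refine even_smul _ _ _ isEven_e1m ?_ u
  simp [gh, e1p, e1m]

theorem e1p_e2p (u : N) : toU e1p • toU e2p • u = toU e2p • toU e1p • u - toU e3p • u := by
  rw [sub_eq_add_neg, ← neg_one_smul ℂ (toU e3p • u), ← toU_smul_smul]
  refine even_smul _ _ _ isEven_e1p ?_ u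
  simp [e3p, e1p, e2p]

theorem e1p_e3p (u : N) : toU e1p • toU e3p • u = toU e3p • toU e1p • u := by
  have := even_smul e1p e3p 0 isEven_e1p (by
    ext i j; fin_cases i <;> fin_cases j <;> simp [e3p, e1p]) u
  simpa using this

theorem e2m_e1p (u : N) : toU e2m • toU e1p • u = toU e1p • toU e2m • u := by
  have := even_smul e1p e2m 0 isEven_e1p (by
    ext i j; fin_cases i <;> fin_cases j <;> simp [e2m, e1p]) u
  simpa using this.symm

theorem e3m_e1p (u : N) : toU e3m • toU e1p • u = toU e1p • toU e3m • u + toU e2m • u := by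
  have := even_smul e1p e3m ((-1 : ℂ) • e2m) isEven_e1p (by
    simp [e2m, e1p, e3m]) u
  rw [this, toU_smul_smul, neg_one_smul]
  abel

theorem e1m_e2p (u : N) : toU e1m • toU e2p • u = toU e2p • toU e1m • u := by
  have := even_smul e1m e2p 0 isEven_e1m (by
    ext i j; fin_cases i <;> fin_cases j <;> simp [e2p, e1m]) u
  simpa using this

theorem e1m_e3p (u : N) : toU e1m • toU e3p • u = toU e3p • toU e1m • u - toU e2p • u := by
  rw [sub_eq_add_neg, ← neg_one_smul ℂ (toU e2p • u), ← toU_smul_smul]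
  refine even_smul _ _ _ isEven_e1m ?_ u
  simp [e3p, e1m, e2p]

theorem eq_zero_of_eq_neg_self {u : N} (h : u = -u) : u = 0 := by
  have : (2 : ℂ) • u = 0 := by rw [two_smul]; nth_rewrite 1 [h]; simp
  simpa using this

theorem toU_zero_smul (u : N) : toU 0 • u = 0 := by simp

theorem e2p_e2p (u : N) : toU e2p • toU e2p • u = 0 := by
  have := odd_smul e2p e2p 0 isOdd_e2p isOdd_e2p (by
    ext i j; fin_cases i <;> fin_cases j <;> simp [e2p]) u
  rw [toU_zero_smul, add_zero] at this
  exact eq_zero_of_eq_neg_self this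

theorem e3p_e3p (u : N) : toU e3p • toU e3p • u = 0 := by
  have := odd_smul e3p e3p 0 isOdd_e3p isOdd_e3p (by
    ext i j; fin_cases i <;> fin_cases j <;> simp [e3p]) u
  rw [toU_zero_smul, add_zero] at this
  exact eq_zero_of_eq_neg_self this

theorem e3p_e2p (u : N) : toU e3p • toU e2p • u = -(toU e2p • toU e3p • u) := by
  have := odd_smul e3p e2p 0 isOdd_e3p isOdd_e2p (by
    ext i j; fin_cases i <;> fin_cases j <;> simp [e3p, e2p]) u
  simpa using this

theorem e2m_e2p (u : N) :
    toU e2m • toU e2p • u = -(toU e2p • toU e2m • u) + (toU gh • u + toU gz • u) := by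
  rw [← add_smul, ← map_add]
  refine odd_smul _ _ _ isOdd_e2m isOdd_e2p ?_ u
  simp [gh, gz, e2p, e2m]

theorem e2m_e3p (u : N) :
    toU e2m • toU e3p • u = -(toU e3p • toU e2m • u) + (2 : ℂ) • toU e1p • u := by
  rw [← toU_smul_smul]
  refine odd_smul _ _ _ isOdd_e2m isOdd_e3p ?_ u
  simp [e1p, e3p, e2m]; norm_num

theorem e3m_e2p (u : N) :
    toU e3m • toU e2p • u = -(toU e2p • toU e3m • u) + (-2 : ℂ) • toU e1m • u := by
  rw [← toU_smul_smul]
  refine odd_smul _ _ _ isOdd_e3m isOdd_e2p ?_ u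
  simp [e1m, e2p, e3m]; norm_num

theorem e3m_e3p (u : N) :
    toU e3m • toU e3p • u = -(toU e3p • toU e3m • u) + (toU gh • u - toU gz • u) := by
  rw [← sub_smul, ← map_sub]
  refine odd_smul _ _ _ isOdd_e3m isOdd_e3p ?_ u
  ext i j; fin_cases i <;> fin_cases j <;> simp [gh, gz, e3p, e3m]

/-- `v` is a (possibly zero) lowest weight vector of weight `wt`. -/
structure IsLW (wt : ℂ × ℂ) (v : N) : Prop where
  h : toU gh • v = wt.1 • v
  z : toU gz • v = wt.2 • v
  m1 : toU e1m • v = 0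
  m2 : toU e2m • v = 0
  m3 : toU e3m • v = 0

/-- `(e₁⁺)^j v`. -/
def vA (v : N) (j : ℕ) : N := toU e1p ^ j • v
/-- `e₂⁺ (e₁⁺)^j v`. -/
def vB (v : N) (j : ℕ) : N := toU e2p • vA v j
/-- `e₃⁺ (e₁⁺)^j v`. -/
def vC (v : N) (j : ℕ) : N := toU e3p • vA v j
/-- `e₂⁺ e₃⁺ (e₁⁺)^j v`. -/
def vD (v : N) (j : ℕ) : N := toU e2p • toU e3p • vA v j

theorem vA_zero (v : N) : vA v 0 = v := by simp [vA]
theorem vA_succ (v : N) (j : ℕ) : vA v (j + 1) = toU e1p • vA v j := by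
  rw [vA, pow_succ', mul_smul, vA]

theorem e1p_vA (v : N) (j : ℕ) : toU e1p • vA v j = vA v (j + 1) := (vA_succ v j).symm
theorem e1p_vB (v : N) (j : ℕ) : toU e1p • vB v j = vB v (j + 1) - vC v j := by
  rw [vB, e1p_e2p, e1p_vA, vB, vC]
theorem e1p_vC (v : N) (j : ℕ) : toU e1p • vC v j = vC v (j + 1) := by
  rw [vC, e1p_e3p, e1p_vA, vC]
theorem e1p_vD (v : N) (j : ℕ) : toU e1p • vD v j = vD v (j + 1) := by
  rw [vD, e1p_e2p, e1p_e3p, e1p_vA, e3p_e3p, sub_zero, vD]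
theorem e2p_vA (v : N) (j : ℕ) : toU e2p • vA v j = vB v j := rfl
theorem e2p_vB (v : N) (j : ℕ) : toU e2p • vB v j = 0 := by rw [vB, e2p_e2p]
theorem e2p_vC (v : N) (j : ℕ) : toU e2p • vC v j = vD v j := rfl
theorem e2p_vD (v : N) (j : ℕ) : toU e2p • vD v j = 0 := by rw [vD, e2p_e2p]
theorem e3p_vA (v : N) (j : ℕ) : toU e3p • vA v j = vC v j := rfl
theorem e3p_vB (v : N) (j : ℕ) : toU e3p • vB v j = - vD v j := by rw [vB, e3p_e2p, vD]
theorem e3p_vC (v : N) (j : ℕ) : toU e3p • vC v j = 0 := by rw [vC, e3p_e3p]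
theorem e3p_vD (v : N) (j : ℕ) : toU e3p • vD v j = 0 := by
  rw [vD, e3p_e2p, e3p_e3p, smul_zero, neg_zero]

namespace IsLW

variable {wt : ℂ × ℂ} {v : N} (hv : IsLW wt v)

include hv

theorem h_vA (j : ℕ) : toU gh • vA v j = (wt.1 + 2 * j) • vA v j := by
  induction j with
  | zero => simp [vA_zero, hv.h]
  | succ j ih =>
    rw [vA_succ, h_e1p, ih, smul_comm, ← add_smul]
    congr 1; push_cast; ring

theorem z_vA (j : ℕ) : toU gz • vA v j = wt.2 • vA v j := by
  induction j with
  | zero => simp [vA_zero, hv.z]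
  | succ j ih => rw [vA_succ, z_e1p, ih, smul_comm, zero_smul, add_zero]

/-- Each step adds the `h`-weight `a + 2i` with a minus sign, and `∑_{i ≤ j} (a + 2i) = (j+1)(a+j)`.
The coefficient vanishes for some `j` only if `a ∈ ℤ_{≤0}`, which is what the assumption on `r/2 -
N_c(τ)` excludes. -/
theorem e1m_vA_succ (j : ℕ) :
    toU e1m • vA v (j + 1) = (-((j + 1) * (wt.1 + j)) : ℂ) • vA v j := by
  induction j with
  | zero => 
    rw [vA_succ, vA_zero, e1m_e1p, hv.m1, hv.h]
    simp
  | succ j ih =>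
    rw [vA_succ, e1m_e1p, ih, smul_comm, ← vA_succ, hv.h_vA, ← sub_smul]
    congr 1; push_cast; ring

theorem e1m_vA_zero : toU e1m • vA v 0 = 0 := by rw [vA_zero, hv.m1]

theorem e2m_vA (j : ℕ) : toU e2m • vA v j = 0 := by
  induction j with
  | zero => rw [vA_zero, hv.m2]
  | succ j ih => rw [vA_succ, e2m_e1p, ih, smul_zero]

theorem e3m_vA (j : ℕ) : toU e3m • vA v j = 0 := by
  induction j with
  | zero => rw [vA_zero, hv.m3]
  | succ j ih => rw [vA_succ, e3m_e1p, ih, smul_zero, hv.e2m_vA, add_zero]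

theorem h_vB (j : ℕ) : toU gh • vB v j = (wt.1 + 2 * j - 1) • vB v j := by
  rw [vB, h_e2p, hv.h_vA, smul_comm, ← add_smul]; rfl
theorem z_vB (j : ℕ) : toU gz • vB v j = (wt.2 + 1) • vB v j := by
  rw [vB, z_e2p, hv.z_vA, smul_comm, ← add_smul]
theorem h_vC (j : ℕ) : toU gh • vC v j = (wt.1 + 2 * j + 1) • vC v j := by
  rw [vC, h_e3p, hv.h_vA, smul_comm, ← add_smul]
theorem z_vC (j : ℕ) : toU gz • vC v j = (wt.2 + 1) • vC v j := by
  rw [vC, z_e3p, hv.z_vA, smul_comm, ← add_smul]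
theorem h_vD (j : ℕ) : toU gh • vD v j = (wt.1 + 2 * j) • vD v j := by
  rw [← e2p_vC, h_e2p, hv.h_vC, smul_comm, ← add_smul]; congr 1; ring
theorem z_vD (j : ℕ) : toU gz • vD v j = (wt.2 + 2) • vD v j := by
  rw [← e2p_vC, z_e2p, hv.z_vC, smul_comm, ← add_smul]; congr 1; ring

theorem e1m_vB_succ (j : ℕ) :
    toU e1m • vB v (j + 1) = (-((j + 1) * (wt.1 + j)) : ℂ) • vB v j := by
  rw [vB, e1m_e2p, hv.e1m_vA_succ, smul_comm, vB]
theorem e1m_vB_zero : toU e1m • vB v 0 = 0 := by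
  rw [vB, e1m_e2p, hv.e1m_vA_zero, smul_zero]
theorem e2m_vB (j : ℕ) : toU e2m • vB v j = (wt.1 + wt.2 + 2 * j) • vA v j := by
  rw [vB, e2m_e2p, hv.e2m_vA, smul_zero, hv.h_vA, hv.z_vA]; module
theorem e3m_vB (j : ℕ) : toU e3m • vB v j = (-2 : ℂ) • toU e1m • vA v j := by
  rw [vB, e3m_e2p, hv.e3m_vA]; simp
theorem e1m_vC_succ (j : ℕ) :
    toU e1m • vC v (j + 1) = (-((j + 1) * (wt.1 + j)) : ℂ) • vC v j - vB v (j + 1) := by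
  rw [vC, e1m_e3p, hv.e1m_vA_succ, smul_comm, vC, vB]
theorem e1m_vC_zero : toU e1m • vC v 0 = - vB v 0 := by
  rw [vC, e1m_e3p, hv.e1m_vA_zero, smul_zero, zero_sub, vB]
theorem e2m_vC (j : ℕ) : toU e2m • vC v j = (2 : ℂ) • vA v (j + 1) := by
  rw [vC, e2m_e3p, hv.e2m_vA, vA_succ]; simp
theorem e3m_vC (j : ℕ) : toU e3m • vC v j = (wt.1 - wt.2 + 2 * j) • vA v j := by
  rw [vC, e3m_e3p, hv.e3m_vA, smul_zero, hv.h_vA, hv.z_vA]; module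
theorem e1m_vD_succ (j : ℕ) :
    toU e1m • vD v (j + 1) = (-((j + 1) * (wt.1 + j)) : ℂ) • vD v j := by
  rw [← e2p_vC, e1m_e2p, hv.e1m_vC_succ, smul_sub, e2p_vB, smul_comm, sub_zero, e2p_vC]
theorem e1m_vD_zero : toU e1m • vD v 0 = 0 := by
  rw [← e2p_vC, e1m_e2p, hv.e1m_vC_zero, smul_neg, e2p_vB, neg_zero]
theorem e2m_vD (j : ℕ) :
    toU e2m • vD v j = (wt.1 + wt.2 + 2 * j + 2) • vC v j - (2 : ℂ) • vB v (j + 1) := by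
  rw [← e2p_vC, e2m_e2p, hv.e2m_vC, hv.h_vC, hv.z_vC, smul_comm (toU e2p), e2p_vA]; module
theorem e3m_vD (j : ℕ) :
    toU e3m • vD v j = -(wt.1 - wt.2 + 2 * j) • vB v j - (2 : ℂ) • toU e1m • vC v j := by
  rw [← e2p_vC, e3m_e2p, hv.e3m_vC, smul_comm (toU e2p), e2p_vA]
  generalize toU e1m • vC v j = t
  module

end IsLW

end modules

/-! ## Submodules stable under a diagonalisable operator -/

section eigen

variable {V : Type*} [AddCommGroup V] [Module ℂ V]

/-- A subspace stable under `T` contains the components of its elements with respect to a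
decomposition into eigenvectors with distinct eigenvalues. -/
theorem eigen_components_mem {ι : Type*} [DecidableEq ι] (T : V →ₗ[ℂ] V) (p : Submodule ℂ V)
    (hp : ∀ u ∈ p, T u ∈ p) (μ : ι → ℂ) (s : Finset ι) (hμ : Set.InjOn μ s) (u : ι → V)
    (hu : ∀ i ∈ s, T (u i) = μ i • u i) (hsum : ∑ i ∈ s, u i ∈ p) : ∀ i ∈ s, u i ∈ p := by
  induction s using Finset.induction_on generalizing u with
  | empty => simp
  | insert k s hk ih =>
    have hs : ∀ i ∈ s, u i ∈ p := by
      -- The operator `T - μ_k` removes the `k`-th component and rescales the others by nonzero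
      -- factors, which puts them within reach of the induction hypothesis.
      have h1 : ∑ i ∈ s, (μ i - μ k) • u i ∈ p := by
        have : ∑ i ∈ s, (μ i - μ k) • u i =
            T (∑ i ∈ insert k s, u i) - μ k • ∑ i ∈ insert k s, u i := by
          rw [map_sum, Finset.sum_congr rfl hu, Finset.smul_sum, ← Finset.sum_sub_distrib,
            Finset.sum_insert hk, sub_self, zero_add]
          exact Finset.sum_congr rfl fun i _ => sub_smul _ _ _
        rw [this]
        exact p.sub_mem (hp _ hsum) (p.smul_mem _ hsum)
      have h2 := ih (hμ.mono (by simp)) (fun i => (μ i - μ k) • u i)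
        (fun i hi => by rw [map_smul, hu i (Finset.mem_insert_of_mem hi), smul_comm]) h1
      intro i hi
      have hne : μ i - μ k ≠ 0 := sub_ne_zero.2 fun h => hk <| by
        have := hμ (by simp [hi]) (by simp) h
        rwa [this] at hi
      have := p.smul_mem (μ i - μ k)⁻¹ (h2 i hi)
      rwa [smul_smul, inv_mul_cancel₀ hne, one_smul] at this
    intro i hi
    rcases Finset.mem_insert.1 hi with rfl | hi
    · rw [Finset.sum_insert hk] at hsum
      exact (p.add_mem_iff_left (p.sum_mem hs)).1 hsum
    · exact hs i hi

theorem le_iSup_inf_eigen {ι : Type*} (T : V →ₗ[ℂ] V) (p : Submodule ℂ V)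
    (hp : ∀ u ∈ p, T u ∈ p) (μ : ι → ℂ) (hμ : Function.Injective μ) (E : ι → Submodule ℂ V)
    (hE : ∀ i, ∀ u ∈ E i, T u = μ i • u) (hle : p ≤ ⨆ i, E i) : p ≤ ⨆ i, p ⊓ E i := by
  classical
  intro u hu
  obtain ⟨f, hf, rfl⟩ := (Submodule.mem_iSup_iff_exists_finsupp _ _).1 (hle hu)
  refine Submodule.sum_mem _ fun i hi => Submodule.mem_iSup_of_mem i ⟨?_, hf i⟩
  exact eigen_components_mem T p hp μ f.support hμ.injOn f (fun i _ => hE i _ (hf i)) hu i hi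

theorem mem_of_add_mem_iSup {ι : Type*} (T : V →ₗ[ℂ] V) (p : Submodule ℂ V)
    (hp : ∀ u ∈ p, T u ∈ p) (μ : ι → ℂ) (hμ : Function.Injective μ) (E : ι → Submodule ℂ V)
    (hE : ∀ i, ∀ u ∈ E i, T u = μ i • u) (μ₀ : ℂ) (h0 : ∀ i, μ i ≠ μ₀) {u w : V}
    (hu : T u = μ₀ • u) (hw : w ∈ ⨆ i, E i) (h : u + w ∈ p) : u ∈ p := by
  classical
  obtain ⟨f, hf, rfl⟩ := (Submodule.mem_iSup_iff_exists_finsupp _ _).1 hw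
  -- The eigenvalue `μ₀` is adjoined as the index `none`.
  have := eigen_components_mem T p hp (fun i : Option ι => i.elim μ₀ μ)
    (Finset.insertNone f.support) (by
      refine Function.Injective.injOn ?_
      rintro (_ | i) (_ | j) hij
      · rfl
      · exact absurd hij.symm (h0 j)
      · exact absurd hij (h0 i)
      · exact congrArg some (hμ hij)) (fun i => i.elim u f) (by
      rintro (_ | i) _
      · exact hu
      · exact hE i _ (hf i)) (by simpa [Finset.sum_insertNone, Finsupp.sum] using h) none (by simp)
  simpa using this

end eigen

/-! ## The structure of lowest weight modules -/

section cyclic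

variable {N : Type*} [AddCommGroup N] [Module ℂ N] [Module Ug N] [IsScalarTower ℂ Ug N]

/-- The span of all `Γ (e₁⁺)^j v` other than `v` itself. -/
def upper (v : N) : Submodule ℂ N :=
  Submodule.span ℂ (Set.range (fun j => vA v (j + 1)) ∪ Set.range (vB v) ∪ Set.range (vC v) ∪
    Set.range (vD v))

theorem vA_succ_mem (v : N) (j : ℕ) : vA v (j + 1) ∈ upper v :=
  Submodule.subset_span (.inl (.inl (.inl ⟨j, rfl⟩)))
theorem vB_mem (v : N) (j : ℕ) : vB v j ∈ upper v :=
  Submodule.subset_span (.inl (.inl (.inr ⟨j, rfl⟩)))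
theorem vC_mem (v : N) (j : ℕ) : vC v j ∈ upper v :=
  Submodule.subset_span (.inl (.inr ⟨j, rfl⟩))
theorem vD_mem (v : N) (j : ℕ) : vD v j ∈ upper v :=
  Submodule.subset_span (.inr ⟨j, rfl⟩)

theorem upper_le {v : N} {p : Submodule ℂ N} (hA : ∀ j, vA v (j + 1) ∈ p) (hB : ∀ j, vB v j ∈ p)
    (hC : ∀ j, vC v j ∈ p) (hD : ∀ j, vD v j ∈ p) : upper v ≤ p := by
  refine Submodule.span_le.2 ?_
  rintro _ (((⟨j, rfl⟩ | ⟨j, rfl⟩) | ⟨j, rfl⟩) | ⟨j, rfl⟩)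
  exacts [hA j, hB j, hC j, hD j]

variable (N) in
/-- The action of `a ∈ U(𝔤)` as a linear map. -/
def ugLin (a : Ug) : N →ₗ[ℂ] N where
  toFun u := a • u
  map_add' := smul_add a
  map_smul' z u := smul_comm a z u

theorem ugLin_apply (a : Ug) (u : N) : ugLin N a u = a • u := rfl

/-- The span of all `Γ (e₁⁺)^j v`. -/
def whole (v : N) : Submodule ℂ N := Submodule.span ℂ {v} ⊔ upper v

theorem upper_le_whole (v : N) : upper v ≤ whole v := le_sup_right

theorem self_mem_whole (v : N) : v ∈ whole v :=
  Submodule.mem_sup_left (Submodule.mem_span_singleton_self v)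

theorem vA_mem_whole (v : N) (j : ℕ) : vA v j ∈ whole v := by
  cases j with
  | zero => rw [vA_zero]; exact self_mem_whole v
  | succ j => exact upper_le_whole v (vA_succ_mem v j)

theorem whole_le {v : N} {p : Submodule ℂ N} (hA : ∀ j, vA v j ∈ p) (hB : ∀ j, vB v j ∈ p)
    (hC : ∀ j, vC v j ∈ p) (hD : ∀ j, vD v j ∈ p) : whole v ≤ p := by
  refine sup_le ?_ (upper_le (fun j => hA _) hB hC hD)
  rw [Submodule.span_singleton_le_iff_mem, ← vA_zero v]
  exact hA 0

theorem e1p_upper {v u : N} (hu : u ∈ upper v) : toU e1p • u ∈ upper v := by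
  have : upper v ≤ (upper v).comap (ugLin N (toU e1p)) :=
    upper_le (fun j => by simpa [ugLin_apply, e1p_vA] using vA_succ_mem v (j + 1))
      (fun j => by
        simpa [ugLin_apply, e1p_vB] using Submodule.sub_mem _ (vB_mem v (j + 1)) (vC_mem v j))
      (fun j => by simpa [ugLin_apply, e1p_vC] using vC_mem v (j + 1))
      (fun j => by simpa [ugLin_apply, e1p_vD] using vD_mem v (j + 1))
  exact this hu

theorem e2p_upper {v u : N} (hu : u ∈ upper v) : toU e2p • u ∈ upper v := by
  have : upper v ≤ (upper v).comap (ugLin N (toU e2p)) :=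
    upper_le (fun j => by simpa [ugLin_apply, e2p_vA] using vB_mem v (j + 1))
      (fun j => by simp [ugLin_apply, e2p_vB])
      (fun j => by simpa [ugLin_apply, e2p_vC] using vD_mem v j)
      (fun j => by simp [ugLin_apply, e2p_vD])
  exact this hu

theorem e3p_upper {v u : N} (hu : u ∈ upper v) : toU e3p • u ∈ upper v := by
  have : upper v ≤ (upper v).comap (ugLin N (toU e3p)) :=
    upper_le (fun j => by simpa [ugLin_apply, e3p_vA] using vC_mem v (j + 1))
      (fun j => by simpa [ugLin_apply, e3p_vB] using vD_mem v j)
      (fun j => by simp [ugLin_apply, e3p_vC])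
      (fun j => by simp [ugLin_apply, e3p_vD])
  exact this hu

/-- Only raising operators enter the spanning vectors of `upper w`, and `upper v` is stable under
these; `w` need not be a lowest weight vector. -/
theorem upper_le_upper {v w : N} (hw : w ∈ upper v) : upper w ≤ upper v := by
  have hA : ∀ j, vA w j ∈ upper v := fun j => by
    induction j with
    | zero => rwa [vA_zero]
    | succ j ih => rw [vA_succ]; exact e1p_upper ih
  exact upper_le (fun j => hA _) (fun j => e2p_upper (hA j)) (fun j => e3p_upper (hA j))
    (fun j => e2p_upper (e3p_upper (hA j)))

theorem whole_le_upper {v w : N} (hw : w ∈ upper v) : whole w ≤ upper v :=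
  sup_le ((Submodule.span_singleton_le_iff_mem _ _).2 hw) (upper_le_upper hw)

theorem mem_whole {v u : N} : u ∈ whole v ↔ ∃ k : ℂ, ∃ w ∈ upper v, u = k • v + w := by
  rw [whole, Submodule.mem_sup]
  constructor
  · rintro ⟨y, hy, w, hw, rfl⟩
    obtain ⟨k, rfl⟩ := Submodule.mem_span_singleton.1 hy
    exact ⟨k, w, hw, rfl⟩
  · rintro ⟨k, w, hw, rfl⟩
    exact ⟨_, Submodule.smul_mem _ k (Submodule.mem_span_singleton_self v), w, hw, rfl⟩

theorem smul_mem_of_toU {p : Submodule ℂ N} (h : ∀ X : spo, ∀ u ∈ p, toU X • u ∈ p) (a : Ug) :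
    ∀ u ∈ p, a • u ∈ p := by
  induction a using Ug_induction with
  | h1 z => intro u hu; rw [algebraMap_smul]; exact p.smul_mem z hu
  | hadd a b ha hb => intro u hu; rw [add_smul]; exact p.add_mem (ha u hu) (hb u hu)
  | hmul a b ha hb => intro u hu; rw [mul_smul]; exact ha _ (hb u hu)
  | h X => exact h X

theorem toU_smul_mem {p : Submodule ℂ N} {u : N} (h0 : toU gh • u ∈ p) (hz : toU gz • u ∈ p)
    (h1p : toU e1p • u ∈ p) (h1m : toU e1m • u ∈ p) (h2p : toU e2p • u ∈ p)
    (h2m : toU e2m • u ∈ p) (h3p : toU e3p • u ∈ p) (h3m : toU e3m • u ∈ p) (X : spo) :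
    toU X • u ∈ p := by
  rw [spo_eq X]
  simp only [map_add, add_smul, toU_smul_smul]
  exact p.add_mem (p.add_mem (p.add_mem (p.add_mem (p.add_mem (p.add_mem (p.add_mem
    (p.smul_mem _ h0) (p.smul_mem _ hz)) (p.smul_mem _ h1p)) (p.smul_mem _ h1m))
    (p.smul_mem _ h2p)) (p.smul_mem _ h2m)) (p.smul_mem _ h3p)) (p.smul_mem _ h3m)

/-- The operator `h + 2z`, which grades lowest weight modules. -/
def gradOp : N →ₗ[ℂ] N := ugLin N (toU gh) + (2 : ℂ) • ugLin N (toU gz)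

theorem gradOp_apply (u : N) : gradOp u = toU gh • u + (2 : ℂ) • toU gz • u := rfl

namespace IsLW

variable {wt : ℂ × ℂ} {v : N} (hv : IsLW wt v)

include hv

theorem e1m_vA_mem (j : ℕ) : toU e1m • vA v j ∈ whole v := by
  cases j with
  | zero => rw [hv.e1m_vA_zero]; exact zero_mem _
  | succ j => rw [hv.e1m_vA_succ]; exact Submodule.smul_mem _ _ (vA_mem_whole v j)

theorem e1m_vC_mem (j : ℕ) : toU e1m • vC v j ∈ whole v := by
  cases j with
  | zero => 
    rw [hv.e1m_vC_zero]; exact Submodule.neg_mem _ (upper_le_whole v (vB_mem v 0))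
  | succ j =>
    rw [hv.e1m_vC_succ]
    exact Submodule.sub_mem _ (Submodule.smul_mem _ _ (upper_le_whole v (vC_mem v j)))
      (upper_le_whole v (vB_mem v _))

/-- The raising formulas and the lowering formulas for the four strings of vectors close up on their
span. This plays the role of the identity `U(𝔤) v = U(𝔫⁺) v`. -/
theorem toU_mem_whole (X : spo) (u : N) (hu : u ∈ whole v) : toU X • u ∈ whole v := by
  have hA := vA_mem_whole v
  have hB := fun j => upper_le_whole v (vB_mem v j)
  have hC := fun j => upper_le_whole v (vC_mem v j)
  have hD := fun j => upper_le_whole v (vD_mem v j)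
  have z0 : (0 : N) ∈ whole v := zero_mem _
  have : whole v ≤ (whole v).comap (ugLin N (toU X)) := by
    refine whole_le (fun j => ?_) (fun j => ?_) (fun j => ?_) (fun j => ?_) <;>
      rw [Submodule.mem_comap, ugLin_apply] <;> refine toU_smul_mem ?_ ?_ ?_ ?_ ?_ ?_ ?_ ?_ X
    · rw [hv.h_vA]; exact Submodule.smul_mem _ _ (hA j)
    · rw [hv.z_vA]; exact Submodule.smul_mem _ _ (hA j)
    · rw [e1p_vA]; exact hA _
    · exact hv.e1m_vA_mem j
    · exact hB j
    · rwa [hv.e2m_vA]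
    · exact hC j
    · rwa [hv.e3m_vA]
    · rw [hv.h_vB]; exact Submodule.smul_mem _ _ (hB j)
    · rw [hv.z_vB]; exact Submodule.smul_mem _ _ (hB j)
    · rw [e1p_vB]; exact Submodule.sub_mem _ (hB _) (hC j)
    · cases j with
      | zero => rwa [hv.e1m_vB_zero]
      | succ j => rw [hv.e1m_vB_succ]; exact Submodule.smul_mem _ _ (hB j)
    · rwa [e2p_vB]
    · rw [hv.e2m_vB]; exact Submodule.smul_mem _ _ (hA j)
    · rw [e3p_vB]; exact Submodule.neg_mem _ (hD j)
    · rw [hv.e3m_vB]; exact Submodule.smul_mem _ _ (hv.e1m_vA_mem j)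
    · rw [hv.h_vC]; exact Submodule.smul_mem _ _ (hC j)
    · rw [hv.z_vC]; exact Submodule.smul_mem _ _ (hC j)
    · rw [e1p_vC]; exact hC _
    · exact hv.e1m_vC_mem j
    · rw [e2p_vC]; exact hD j
    · rw [hv.e2m_vC]; exact Submodule.smul_mem _ _ (hA _)
    · rwa [e3p_vC]
    · rw [hv.e3m_vC]; exact Submodule.smul_mem _ _ (hA j)
    · rw [hv.h_vD]; exact Submodule.smul_mem _ _ (hD j)
    · rw [hv.z_vD]; exact Submodule.smul_mem _ _ (hD j)
    · rw [e1p_vD]; exact hD _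
    · cases j with
      | zero => rwa [hv.e1m_vD_zero]
      | succ j => rw [hv.e1m_vD_succ]; exact Submodule.smul_mem _ _ (hD j)
    · rwa [e2p_vD]
    · rw [hv.e2m_vD]
      exact Submodule.sub_mem _ (Submodule.smul_mem _ _ (hC j)) (Submodule.smul_mem _ _ (hB _))
    · rwa [e3p_vD]
    · rw [hv.e3m_vD]
      exact Submodule.sub_mem _ (Submodule.smul_mem _ _ (hB j))
        (Submodule.smul_mem _ _ (hv.e1m_vC_mem j))
  exact this hu

theorem smul_mem_whole (a : Ug) {u : N} (hu : u ∈ whole v) : a • u ∈ whole v :=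
  smul_mem_of_toU hv.toU_mem_whole a u hu

theorem gradOp_self : gradOp v = (wt.1 + 2 * wt.2) • v := by
  rw [gradOp_apply, hv.h, hv.z]; module

/-- The operators `e_1^+`, `e_2^+`, `e_3^+` raise the eigenvalue of `h + 2z` by `2`, `1`, `3`. With
`h` alone the argument would fail, since `e_2^+` lowers it. -/
theorem upper_le_iSup : upper v ≤ ⨆ n : ℕ,
    LinearMap.ker (gradOp - (wt.1 + 2 * wt.2 + (n + 1)) • (1 : N →ₗ[ℂ] N)) := by
  have key : ∀ (n : ℕ) (u : N), gradOp u = (wt.1 + 2 * wt.2 + (n + 1)) • u →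
      u ∈ ⨆ n : ℕ, LinearMap.ker (gradOp - (wt.1 + 2 * wt.2 + (n + 1)) • (1 : N →ₗ[ℂ] N)) :=
    fun n u h => Submodule.mem_iSup_of_mem n (by simp [h])
  refine upper_le (fun j => key (2 * j + 1) _ ?_) (fun j => key (2 * j) _ ?_)
    (fun j => key (2 * j + 2) _ ?_) (fun j => key (2 * j + 3) _ ?_) <;> rw [gradOp_apply]
  · rw [hv.h_vA, hv.z_vA]; push_cast; module
  · rw [hv.h_vB, hv.z_vB]; push_cast; module
  · rw [hv.h_vC, hv.z_vC]; push_cast; module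
  · rw [hv.h_vD, hv.z_vD]; push_cast; module

theorem self_mem_of_add_mem (p : Submodule Ug N) {k : ℂ} {w : N} (hw : w ∈ upper v)
    (h : k • v + w ∈ p) : k • v ∈ p := by
  refine mem_of_add_mem_iSup gradOp (p.restrictScalars ℂ) (fun u hu => ?_)
    (fun n : ℕ => wt.1 + 2 * wt.2 + (n + 1)) ?_ _ ?_ (wt.1 + 2 * wt.2) ?_ (by rw [map_smul, hv.gradOp_self, smul_comm]) (hv.upper_le_iSup hw) h
  · rw [gradOp_apply]
    exact (p.restrictScalars ℂ).add_mem (p.smul_mem _ hu)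
      ((p.restrictScalars ℂ).smul_mem _ (p.smul_mem _ hu))
  · intro m n hmn
    simpa using hmn
  · intro n u hu
    simpa [sub_eq_zero] using hu
  · intro n hn
    have : ((n + 1 : ℕ) : ℂ) = 0 := by push_cast; simpa using hn
    exact Nat.cast_ne_zero.2 n.succ_ne_zero this

theorem self_notMem_upper (h0 : v ≠ 0) : v ∉ upper v := by
  intro h
  have := hv.self_mem_of_add_mem ⊥ (k := 1) (w := -v) (Submodule.neg_mem _ h) (by simp)
  exact h0 (by simpa using this)

/-- A submodule is stable under `h + 2z`, so if one of its elements had a nonzero component along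
`v`, then it would contain `v` and everything that `v` generates. -/
theorem mem_upper_of_proper (hcyc : whole v = ⊤) {p : Submodule Ug N} (hp : p ≠ ⊤) {u : N}
    (hu : u ∈ p) : u ∈ upper v := by
  obtain ⟨k, w, hw, rfl⟩ := mem_whole.1 (hcyc ▸ Submodule.mem_top : u ∈ whole v)
  have hk := hv.self_mem_of_add_mem p hw hu
  by_cases h0 : k = 0
  · simpa [h0] using hw
  · exfalso
    apply hp
    have hvp : v ∈ p := by
      have := (p.restrictScalars ℂ).smul_mem k⁻¹ hk
      rwa [smul_smul, inv_mul_cancel₀ h0, one_smul] at this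
    rw [eq_top_iff]
    have : whole v ≤ p.restrictScalars ℂ := by
      have hA : ∀ j, vA v j ∈ p.restrictScalars ℂ := fun j => p.smul_mem _ hvp
      exact whole_le hA (fun j => p.smul_mem _ (hA j)) (fun j => p.smul_mem _ (hA j))
        (fun j => p.smul_mem _ (p.smul_mem _ (hA j)))
    intro x _
    exact this (hcyc ▸ Submodule.mem_top)

end IsLW

/-- The largest submodule contained in a subspace. -/
def core (q : Submodule ℂ N) : Submodule Ug N where
  carrier := {u | ∀ a : Ug, a • u ∈ q}
  add_mem' hu hv a := by rw [smul_add]; exact q.add_mem (hu a) (hv a)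
  zero_mem' a := by simp
  smul_mem' b u hu a := by rw [smul_smul]; exact hu _

theorem le_core {q : Submodule ℂ N} {p : Submodule Ug N} (h : ∀ u ∈ p, u ∈ q) : p ≤ core q :=
  fun _ hu a => h _ (p.smul_mem a hu)

theorem core_subset {q : Submodule ℂ N} {u : N} (h : u ∈ core q) : u ∈ q := by
  simpa using h 1

end cyclic

/-! ### Standard modules and their irreducible quotients -/

section verma

/-- The canonical lowest weight vector of `𝕍(λ)`. -/
def vermaVec (wt : ℂ × ℂ) : Verma wt := Submodule.Quotient.mk (1 : Ug)

theorem vermaVec_smul (wt : ℂ × ℂ) (a : Ug) :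
    a • vermaVec wt = Submodule.Quotient.mk a := by
  rw [vermaVec, ← Submodule.Quotient.mk_smul, smul_eq_mul, mul_one]

theorem vermaVec_isLW (wt : ℂ × ℂ) : IsLW wt (vermaVec wt) := by
  have key : ∀ a ∈ ({toU gh - algebraMap ℂ Ug wt.1, toU gz - algebraMap ℂ Ug wt.2,
      toU e1m, toU e2m, toU e3m} : Set Ug), a • vermaVec wt = 0 := fun a ha => by
    rw [vermaVec_smul, Submodule.Quotient.mk_eq_zero]
    exact Submodule.subset_span ha
  have h1 := key _ (.inl rfl)
  have h2 := key _ (.inr (.inl rfl))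
  rw [sub_smul, algebraMap_smul, sub_eq_zero] at h1 h2
  exact ⟨h1, h2, key _ (.inr (.inr (.inl rfl))), key _ (.inr (.inr (.inr (.inl rfl)))),
    key _ (.inr (.inr (.inr (.inr rfl))))⟩

theorem whole_vermaVec (wt : ℂ × ℂ) : whole (vermaVec wt) = ⊤ := by
  refine eq_top_iff.2 fun u _ => ?_
  obtain ⟨a, rfl⟩ := Submodule.Quotient.mk_surjective _ u
  rw [← vermaVec_smul]
  exact (vermaVec_isLW wt).smul_mem_whole a (self_mem_whole _)

/-- The space `upper` need not be a submodule, as lowering may lead back to the lowest weight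
vector. The largest submodule inside it contains every proper submodule, hence their sum. -/
theorem mem_upper_of_mem_vermaRad {wt : ℂ × ℂ} {u : Verma wt} (hu : u ∈ vermaRad wt) :
    u ∈ upper (vermaVec wt) := by
  have : vermaRad wt ≤ core (upper (vermaVec wt)) := sSup_le fun p hp =>
    le_core fun u hu => (vermaVec_isLW wt).mem_upper_of_proper (whole_vermaVec wt) hp hu
  exact core_subset (this hu)

theorem vermaRad_ne_top {wt : ℂ × ℂ} (h : vermaVec wt ≠ 0) : vermaRad wt ≠ ⊤ := fun ht =>
  (vermaVec_isLW wt).self_notMem_upper h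
    (mem_upper_of_mem_vermaRad (ht ▸ Submodule.mem_top))

/-- The nonvanishing hypothesis replaces a Poincaré–Birkhoff–Witt theorem for `U(𝔤)`: wherever the
result is needed, a nonzero lowest weight vector in `K_c(τ)` provides it. -/
theorem irr_simple {wt : ℂ × ℂ} (h : vermaVec wt ≠ 0) : IsSimpleModule Ug (Irr wt) := by
  rw [isSimpleModule_iff_isCoatom]
  refine ⟨vermaRad_ne_top h, fun p hp => ?_⟩
  by_contra hne
  exact hp.not_ge (le_sSup hne)

theorem lwVec_eq (wt : ℂ × ℂ) : lwVec wt = (vermaRad wt).mkQ (vermaVec wt) := rfl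

theorem lwVec_isLW (wt : ℂ × ℂ) : IsLW wt (lwVec wt) := by
  have h := vermaVec_isLW wt
  rw [lwVec_eq]
  refine ⟨?_, ?_, ?_, ?_, ?_⟩ <;> rw [← map_smul]
  · rw [h.h]; rfl
  · rw [h.z]; rfl
  · rw [h.m1, map_zero]
  · rw [h.m2, map_zero]
  · rw [h.m3, map_zero]

theorem exists_smul_lwVec {wt : ℂ × ℂ} (u : Irr wt) : ∃ a : Ug, u = a • lwVec wt := by
  obtain ⟨w, rfl⟩ := Submodule.Quotient.mk_surjective _ u
  obtain ⟨a, rfl⟩ := Submodule.Quotient.mk_surjective _ w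
  refine ⟨a, ?_⟩
  rw [lwVec_eq, ← map_smul, vermaVec_smul]
  rfl

theorem whole_lwVec (wt : ℂ × ℂ) : whole (lwVec wt) = ⊤ := by
  refine eq_top_iff.2 fun u _ => ?_
  obtain ⟨a, rfl⟩ := exists_smul_lwVec u
  exact (lwVec_isLW wt).smul_mem_whole a (self_mem_whole _)

theorem lwVec_ne_zero {wt : ℂ × ℂ} (h : vermaVec wt ≠ 0) : lwVec wt ≠ 0 := by
  rw [lwVec_eq, Ne, Submodule.mkQ_apply, Submodule.Quotient.mk_eq_zero]
  exact fun hm => (vermaVec_isLW wt).self_notMem_upper h (mem_upper_of_mem_vermaRad hm)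

/-- In `L(λ)` a weight vector above `λ` that is killed by `𝔫⁻` vanishes. -/
theorem irr_eq_zero_of_isLW {wt wt' : ℂ × ℂ} (h : vermaVec wt ≠ 0) {w : Irr wt}
    (hw : w ∈ upper (lwVec wt)) (hlw : IsLW wt' w) : w = 0 := by
  have := irr_simple h
  let p : Submodule Ug (Irr wt) := Submodule.span Ug {w}
  have hp : ∀ u ∈ p, u ∈ upper (lwVec wt) := fun u hu => by
    obtain ⟨a, rfl⟩ := Submodule.mem_span_singleton.1 hu
    exact whole_le_upper hw (hlw.smul_mem_whole a (self_mem_whole w))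
  rcases eq_bot_or_eq_top p with h0 | h0
  · exact (Submodule.span_singleton_eq_bot).1 h0
  · exact absurd (hp _ (h0 ▸ Submodule.mem_top))
      ((lwVec_isLW wt).self_notMem_upper (lwVec_ne_zero h))

end verma

/-! ### Contravariant forms and complete reducibility -/

section forms

variable {N : Type*} [AddCommGroup N] [Module ℂ N] [Module Ug N] [IsScalarTower ℂ Ug N]

/-- A positive definite contravariant Hermitian form. -/
structure IsContra (β : N →ₗ⋆[ℂ] N →ₗ[ℂ] ℂ) : Prop where
  herm : ∀ u v, conj (β u v) = β v u
  pos : ∀ u, u ≠ 0 → 0 < (β u u).re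
  adj : ∀ X : spo, ∃ X' : spo, ∀ u v, β u (toU X • v) = β (toU X' • u) v
  adj1 : ∀ u v, β u (toU e1p • v) = - β (toU e1m • u) v
  adj2 : ∀ u v, β u (toU e2p • v) = β (toU e2m • u) v
  adj3 : ∀ u v, β u (toU e3p • v) = β (toU e3m • u) v

/-- The map `𝕍(λ) → N` given by a lowest weight vector of weight `λ`. -/
def vermaLift {wt : ℂ × ℂ} {v : N} (hv : IsLW wt v) : Verma wt →ₗ[Ug] N :=
  (vermaIdeal wt).liftQ (LinearMap.toSpanSingleton Ug N v) <| Submodule.span_le.2 <| by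
    rintro _ (rfl | rfl | rfl | rfl | rfl)
    · simp [sub_smul, hv.h, algebraMap_smul]
    · simp [sub_smul, hv.z, algebraMap_smul]
    · simp [hv.m1]
    · simp [hv.m2]
    · simp [hv.m3]

theorem vermaLift_vermaVec {wt : ℂ × ℂ} {v : N} (hv : IsLW wt v) :
    vermaLift hv (vermaVec wt) = v := by
  exact one_smul Ug v

theorem map_upper {M : Type*} [AddCommGroup M] [Module ℂ M] [Module Ug M] [IsScalarTower ℂ Ug M]
    (f : M →ₗ[Ug] N) (w : M) {u : M} (hu : u ∈ upper w) : f u ∈ upper (f w) := by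
  let g : M →ₗ[ℂ] N := f.restrictScalars ℂ
  have hA : ∀ j, f (vA w j) = vA (f w) j := fun j => map_smul f _ _
  have : upper w ≤ (upper (f w)).comap g := by
    refine upper_le (fun j => ?_) (fun j => ?_) (fun j => ?_) (fun j => ?_) <;>
      rw [Submodule.mem_comap]
    · exact (hA (j + 1)) ▸ vA_succ_mem _ j
    · have : g (vB w j) = vB (f w) j := by rw [vB, vB, ← hA]; exact map_smul f _ _
      rw [this]; exact vB_mem _ j
    · have : g (vC w j) = vC (f w) j := by rw [vC, vC, ← hA]; exact map_smul f _ _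
      rw [this]; exact vC_mem _ j
    · have : g (vD w j) = vD (f w) j := by
        rw [vD, vD, ← hA, ← map_smul, ← map_smul]; rfl
      rw [this]; exact vD_mem _ j
  exact this hu

/-- The orthogonal complement of a submodule under a contravariant form. -/
def orth {β : N →ₗ⋆[ℂ] N →ₗ[ℂ] ℂ} (hβ : IsContra β) (p : Submodule Ug N) : Submodule Ug N where
  carrier := {u | ∀ w ∈ p, β w u = 0}
  add_mem' hu hv w hw := by rw [map_add, hu w hw, hv w hw, add_zero]
  zero_mem' w _ := by simp
  smul_mem' a u hu := by
    let q : Submodule ℂ N := 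
      { carrier := {u | ∀ w ∈ p, β w u = 0}
        add_mem' := fun hu hv w hw => by rw [map_add, hu w hw, hv w hw, add_zero]
        zero_mem' := fun w _ => by simp
        smul_mem' := fun z u hu w hw => by rw [map_smul, hu w hw, smul_zero] }
    refine smul_mem_of_toU (p := q) (fun X u hu w hw => ?_) a u hu
    obtain ⟨X', hX⟩ := hβ.adj X
    rw [hX]
    exact hu _ (p.smul_mem _ hw)

namespace IsContra

variable {β : N →ₗ⋆[ℂ] N →ₗ[ℂ] ℂ} (hβ : IsContra β)

include hβ

theorem symm_zero {u v : N} (h : β u v = 0) : β v u = 0 := by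
  rw [← hβ.herm, h, map_zero]

theorem eq_zero {u : N} (h : β u u = 0) : u = 0 := by
  by_contra h0
  have := hβ.pos u h0
  simp [h] at this

/-- Each spanning vector of `upper θ'` lies in the image of some `e_i^+`, and the adjoint `e_i^-`
kills `θ`. Nothing is required of `θ'`. -/
theorem lw_upper {wt : ℂ × ℂ} {θ θ' u : N} (hθ : IsLW wt θ) (hu : u ∈ upper θ') : β θ u = 0 := by
  have : upper θ' ≤ LinearMap.ker (β θ) := by
    refine upper_le (fun j => ?_) (fun j => ?_) (fun j => ?_) (fun j => ?_) <;>
      rw [LinearMap.mem_ker]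
    · rw [vA_succ, hβ.adj1, hθ.m1]; simp
    · rw [vB, hβ.adj2, hθ.m2]; simp
    · rw [vC, hβ.adj3, hθ.m3]; simp
    · rw [vD, hβ.adj2, hθ.m2]; simp
  exact this hu

/-- A vector `b • θ'` is a multiple of `θ'` plus an element of `upper θ'`, and `θ` is orthogonal to
both. The orthogonal complement of a submodule is a submodule, so it contains all of `U(𝔤) θ`. -/
theorem smul_smul_eq_zero {wt wt' : ℂ × ℂ} {θ θ' : N} (hθ : IsLW wt θ) (hθ' : IsLW wt' θ')
    (h : β θ θ' = 0) (a b : Ug) : β (a • θ) (b • θ') = 0 := by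
  have h1 : θ ∈ orth hβ (Submodule.span Ug {θ'}) := fun w hw => by
    obtain ⟨b, rfl⟩ := Submodule.mem_span_singleton.1 hw
    apply hβ.symm_zero
    obtain ⟨k, x, hx, he⟩ := mem_whole.1 (hθ'.smul_mem_whole b (self_mem_whole θ'))
    rw [he, map_add, map_smul, h, smul_zero, hβ.lw_upper hθ hx, add_zero]
  exact hβ.symm_zero ((orth hβ _).smul_mem a h1 _
    (Submodule.mem_span_singleton.2 ⟨b, rfl⟩))

/-- The image `p` of the maximal submodule lies in `upper θ`, so `θ` is orthogonal to `p`; then so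
is the module generated by `θ`, which contains `p`. A subspace orthogonal to itself is zero by
definiteness. -/
theorem vermaRad_le_ker {wt : ℂ × ℂ} {θ : N} (hθ : IsLW wt θ) :
    vermaRad wt ≤ LinearMap.ker (vermaLift hθ) := by
  let p := (vermaRad wt).map (vermaLift hθ)
  have h1 : θ ∈ orth hβ p := by
    rintro _ ⟨w, hw, rfl⟩
    have := map_upper (vermaLift hθ) (vermaVec wt) (mem_upper_of_mem_vermaRad hw)
    rw [vermaLift_vermaVec] at this
    exact hβ.symm_zero (hβ.lw_upper hθ this)
  intro w hw
  have h2 : vermaLift hθ w ∈ orth hβ p := by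
    obtain ⟨a, rfl⟩ := Submodule.Quotient.mk_surjective _ w
    rw [← vermaVec_smul, map_smul, vermaLift_vermaVec]
    exact (orth hβ p).smul_mem a h1
  exact hβ.eq_zero (h2 _ (Submodule.mem_map_of_mem hw))

/-- The map `L(λ) → N` given by a lowest weight vector of weight `λ`. -/
def irrLift {wt : ℂ × ℂ} {θ : N} (hθ : IsLW wt θ) : Irr wt →ₗ[Ug] N :=
  (vermaRad wt).liftQ (vermaLift hθ) (hβ.vermaRad_le_ker hθ)

theorem irrLift_lwVec {wt : ℂ × ℂ} {θ : N} (hθ : IsLW wt θ) :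
    hβ.irrLift hθ (lwVec wt) = θ := vermaLift_vermaVec hθ

theorem irrLift_smul {wt : ℂ × ℂ} {θ : N} (hθ : IsLW wt θ) (a : Ug) :
    hβ.irrLift hθ (a • lwVec wt) = a • θ := by
  rw [map_smul, irrLift_lwVec]

omit hβ in
theorem vermaVec_ne_zero {wt : ℂ × ℂ} {θ : N} (hθ : IsLW wt θ) (h0 : θ ≠ 0) :
    vermaVec wt ≠ 0 := fun h => h0 <| by
  rw [← vermaLift_vermaVec hθ, h, map_zero]

theorem irrLift_injective {wt : ℂ × ℂ} {θ : N} (hθ : IsLW wt θ) (h0 : θ ≠ 0) :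
    Function.Injective (hβ.irrLift hθ) := by
  have := irr_simple (vermaVec_ne_zero hθ h0)
  refine (LinearMap.injective_or_eq_zero (hβ.irrLift hθ)).resolve_right fun h => h0 ?_
  rw [← hβ.irrLift_lwVec hθ, h, LinearMap.zero_apply]

end IsContra

end forms

/-! ## Restriction to the Grassmann algebra -/

/-- `e₂ ↦ e₂⁺`, `e₃ ↦ e₃⁺` as a linear map. -/
def gamLin : (Fin 2 → ℂ) →ₗ[ℂ] Ug :=
  (LinearMap.proj 0).smulRight (toU e2p) + (LinearMap.proj 1).smulRight (toU e3p)

theorem gamLin_apply (v : Fin 2 → ℂ) : gamLin v = v 0 • toU e2p + v 1 • toU e3p := rfl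

/-- The homomorphism `Γ → U(𝔤)` with `e₂ ↦ e₂⁺`, `e₃ ↦ e₃⁺`. -/
def gamHom : Gam →ₐ[ℂ] Ug := ExteriorAlgebra.lift ℂ ⟨gamLin, fun v => by
  have h22 : toU e2p * toU e2p = 0 := by simpa using e2p_e2p (1 : Ug)
  have h33 : toU e3p * toU e3p = 0 := by simpa using e3p_e3p (1 : Ug)
  have h32 : toU e3p * toU e2p = -(toU e2p * toU e3p) := by simpa using e3p_e2p (1 : Ug)
  rw [gamLin_apply]
  simp only [mul_add, add_mul, smul_mul_smul_comm, h22, h33, h32, smul_zero, smul_neg]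
  rw [mul_comm (v 1) (v 0)]
  abel⟩

theorem gamHom_ge2 : gamHom ge2 = toU e2p := by
  rw [gamHom, ge2, ExteriorAlgebra.lift_ι_apply]; simp [gamLin_apply]

theorem gamHom_ge3 : gamHom ge3 = toU e3p := by
  rw [gamHom, ge3, ExteriorAlgebra.lift_ι_apply]; simp [gamLin_apply]

theorem ge2_ge2 : ge2 * ge2 = 0 := ExteriorAlgebra.ι_sq_zero _
theorem ge3_ge3 : ge3 * ge3 = 0 := ExteriorAlgebra.ι_sq_zero _
theorem ge3_ge2 : ge3 * ge2 = -(ge2 * ge3) :=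
  eq_neg_of_add_eq_zero_left (ExteriorAlgebra.ι_add_mul_swap _ _)

theorem gam_ι (v : Fin 2 → ℂ) : ExteriorAlgebra.ι ℂ v = v 0 • ge2 + v 1 • ge3 := by
  rw [ge2, ge3, ← map_smul, ← map_smul, ← map_add]
  congr 1
  ext i; fin_cases i <;> simp

/-- Only spanning is needed: wherever freeness over `Γ` matters, it is detected by the action, and
the independence of the four monomials is never used. -/
theorem gam_span (γ : Gam) :
    ∃ a b c d : ℂ, γ = a • 1 + b • ge2 + c • ge3 + d • (ge2 * ge3) := by
  let p : Submodule ℂ Gam := Submodule.span ℂ {1, ge2, ge3, ge2 * ge3}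
  have m1 : (1 : Gam) ∈ p := Submodule.subset_span (.inl rfl)
  have m2 : ge2 ∈ p := Submodule.subset_span (.inr (.inl rfl))
  have m3 : ge3 ∈ p := Submodule.subset_span (.inr (.inr (.inl rfl)))
  have m4 : ge2 * ge3 ∈ p := Submodule.subset_span (.inr (.inr (.inr rfl)))
  have h2 : p ≤ p.comap (LinearMap.mulLeft ℂ ge2) := Submodule.span_le.2 <| by
    rintro _ (rfl | rfl | rfl | rfl)
    · simpa using m2
    · simp [ge2_ge2]
    · simpa using m4
    · simp [← mul_assoc, ge2_ge2]
  have h3 : p ≤ p.comap (LinearMap.mulLeft ℂ ge3) := Submodule.span_le.2 <| by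
    rintro _ (rfl | rfl | rfl | rfl)
    · simpa using m3
    · simpa [ge3_ge2] using m4
    · simp [ge3_ge3]
    · simp [← mul_assoc, ge3_ge2, mul_assoc ge2, ge3_ge3]
  have hγ : γ ∈ p := by
    induction γ using CliffordAlgebra.left_induction with
    | algebraMap z => rw [Algebra.algebraMap_eq_smul_one]; exact p.smul_mem z m1
    | add x y hx hy => exact p.add_mem hx hy
    | ι_mul x v hx =>
      have := gam_ι v
      rw [ExteriorAlgebra.ι] at this
      rw [this, add_mul, smul_mul_assoc, smul_mul_assoc]
      exact p.add_mem (p.smul_mem _ (h2 hx)) (p.smul_mem _ (h3 hx))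
  obtain ⟨a, y, hy, rfl⟩ := Submodule.mem_span_insert.1 hγ
  obtain ⟨b, y', hy', rfl⟩ := Submodule.mem_span_insert.1 hy
  obtain ⟨c, y'', hy'', rfl⟩ := Submodule.mem_span_insert.1 hy'
  obtain ⟨d, rfl⟩ := Submodule.mem_span_singleton.1 hy''
  exact ⟨a, b, c, d, by abel⟩

section gamMap

variable {N : Type*} [AddCommGroup N] [Module ℂ N] [Module Ug N] [IsScalarTower ℂ Ug N]

/-- The map from the free `Γ`-module on generators `j ≥ 0` that sends `j` to `x j`. -/
def gamMap (x : ℕ → N) : (ℕ →₀ Gam) →ₗ[ℂ] N :=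
  Finsupp.lsum ℂ fun j => (LinearMap.toSpanSingleton Ug N (x j)).restrictScalars ℂ ∘ₗ
    gamHom.toLinearMap

theorem gamMap_single (x : ℕ → N) (j : ℕ) (γ : Gam) :
    gamMap x (Finsupp.single j γ) = gamHom γ • x j := by
  simp [gamMap]

theorem gamMap_smul (x : ℕ → N) (γ : Gam) (f : ℕ →₀ Gam) :
    gamMap x (γ • f) = gamHom γ • gamMap x f := by
  induction f using Finsupp.induction_linear with
  | zero => simp
  | add f g hf hg => rw [smul_add, map_add, hf, hg, map_add, smul_add]
  | single j δ => rw [Finsupp.smul_single, gamMap_single, gamMap_single, smul_eq_mul, map_mul,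
      mul_smul]

theorem gamMap_eq_sum (x : ℕ → N) (f : ℕ →₀ Gam) :
    gamMap x f = ∑ j ∈ f.support, gamHom (f j) • x j := by
  simp [gamMap, Finsupp.sum]

theorem gamHom_smul (a b c d : ℂ) (u : N) :
    gamHom (a • 1 + b • ge2 + c • ge3 + d • (ge2 * ge3)) • u =
      a • u + b • toU e2p • u + c • toU e3p • u + d • toU e2p • toU e3p • u := by
  simp only [map_add, map_smul, map_one, map_mul, gamHom_ge2, gamHom_ge3, add_smul, smul_assoc,
    mul_smul, one_smul]

/-- The scalars `k j` leave room for the rescaled generators that the lightning-flash relations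
require. -/
theorem gamMap_surjective {v : N} (hcyc : whole v = ⊤) {x : ℕ → N} {k : ℕ → ℂ}
    (hk : ∀ j, k j ≠ 0) (hx : ∀ j, x j = k j • vA v j) : Function.Surjective (gamMap x) := by
  rw [← LinearMap.range_eq_top, ← top_le_iff, ← hcyc]
  have hA : ∀ j (γ : Gam), gamHom γ • vA v j ∈ LinearMap.range (gamMap x) := fun j γ => by
    refine ⟨Finsupp.single j ((k j)⁻¹ • γ), ?_⟩
    rw [gamMap_single, hx, map_smul, smul_assoc, smul_comm _ (k j), smul_smul,
      inv_mul_cancel₀ (hk j), one_smul]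
  refine whole_le (fun j => ?_) (fun j => ?_) (fun j => ?_) (fun j => ?_)
  · simpa using hA j 1
  · simpa [gamHom_ge2, vB] using hA j ge2
  · simpa [gamHom_ge3, vC] using hA j ge3
  · simpa [gamHom_ge2, gamHom_ge3, mul_smul, vD] using hA j (ge2 * ge3)

theorem linearIndependent_of_h {x : ℕ → N} (h0 : ∀ j, x j ≠ 0) (a : ℂ)
    (h : ∀ j : ℕ, toU gh • x j = (a + 2 * j) • x j) : LinearIndependent ℂ x := by
  refine Module.End.eigenvectors_linearIndependent' (ugLin N (toU gh)) (fun j : ℕ => a + 2 * j) ?_ x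
    fun j => ⟨by simpa [ugLin_apply] using h j, h0 j⟩
  intro i j hij
  simpa using hij

/-- Lowering by `e_1^-` returns a nonzero multiple of the preceding vector, so no vector of the
string can be the first to vanish. -/
theorem e1p_string_ne_zero {x : ℕ → N} (h0 : x 0 ≠ 0) {a : ℂ} (ha : ∀ n : ℕ, a ≠ -n)
    (h : ∀ j, toU e1m • x (j + 1) = (-((j + 1) * (a + j)) : ℂ) • x j) (j : ℕ) : x j ≠ 0 := by
  induction j with
  | zero => exact h0
  | succ j ih =>
    intro hz
    have := h j
    rw [hz, smul_zero] at this
    refine (smul_ne_zero ?_ ih) this.symm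
    refine neg_ne_zero.2 (mul_ne_zero (Nat.cast_add_one_ne_zero j) fun hh => ha j ?_)
    exact eq_neg_of_add_eq_zero_left hh

namespace IsLW

variable {wt : ℂ × ℂ} {v : N} (hv : IsLW wt v)

include hv

theorem vA_ne_zero (h0 : v ≠ 0) (ha : ∀ n : ℕ, wt.1 ≠ -n) (j : ℕ) : vA v j ≠ 0 :=
  e1p_string_ne_zero (by rwa [vA_zero]) ha hv.e1m_vA_succ j

/-- Write `wt = (a, b)`. Lowering `e_2^+ e_3^+ v` by `e_3^-` gives `-(a - b - 2) e_2^+ v`, and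
lowering this by `e_2^-` gives the further factor `a + b`. These are the two conditions for
typicality. -/
theorem vD_ne_zero (h0 : v ≠ 0) (ha : ∀ n : ℕ, wt.1 ≠ -n) (h1 : wt.1 + wt.2 ≠ 0)
    (h2 : wt.1 - wt.2 - 2 ≠ 0) (j : ℕ) : vD v j ≠ 0 := by
  refine e1p_string_ne_zero ?_ ha hv.e1m_vD_succ j
  intro h
  have e1 : toU e3m • vD v 0 = -(wt.1 - wt.2 - 2) • vB v 0 := by
    rw [hv.e3m_vD, hv.e1m_vC_zero]
    push_cast; module
  rw [h, smul_zero] at e1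
  have e2 := hv.e2m_vB 0
  rw [(smul_eq_zero.1 e1.symm).resolve_left (neg_ne_zero.2 h2), smul_zero, vA_zero] at e2
  exact smul_ne_zero (by simpa using h1) h0 e2.symm

/-- Multiplying a relation by `e_2 e_3`, `e_3`, `e_2` and `1` in turn moves the coefficients at `1`,
`e_2`, `e_3`, `e_2 e_3` to the vectors `e_2^+ e_3^+ (e_1^+)^j v`. These are independent, being
nonzero with distinct `h`-weights. -/
theorem gamMap_injective (h0 : v ≠ 0) (ha : ∀ n : ℕ, wt.1 ≠ -n) (h1 : wt.1 + wt.2 ≠ 0)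
    (h2 : wt.1 - wt.2 - 2 ≠ 0) : Function.Injective (gamMap (vA v)) := by
  have hli := linearIndependent_of_h (hv.vD_ne_zero h0 ha h1 h2) wt.1 hv.h_vD
  rw [← LinearMap.ker_eq_bot, LinearMap.ker_eq_bot']
  intro f hf
  choose a b c d hγ using fun j => gam_span (f j)
  have hsum : ∑ j ∈ f.support, (a j • vA v j + b j • vB v j + c j • vC v j + d j • vD v j) = 0 := by
    rw [← hf, gamMap_eq_sum]
    refine Finset.sum_congr rfl fun j _ => ?_
    conv_rhs => rw [hγ j]
    rw [gamHom_smul]; rfl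
  have hzero : ∀ k : ℕ → ℂ, ∑ j ∈ f.support, k j • vD v j = 0 → ∀ j ∈ f.support, k j = 0 :=
    fun k hk => (linearIndependent_iff'.1 hli) f.support k hk
  have ha0 := hzero a (by
    have := congrArg (fun u => toU e2p • toU e3p • u) hsum
    simpa [Finset.smul_sum, smul_add, smul_comm (toU e3p) (_ : ℂ), smul_comm (toU e2p) (_ : ℂ),
      e3p_vA, e3p_vB, e3p_vC, e3p_vD, e2p_vC, e2p_vD] using this)
  have hb0 := hzero (fun j => - b j) (by
    have := congrArg (fun u => toU e3p • u) hsum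
    rw [smul_zero, Finset.smul_sum] at this
    rw [← this]
    refine Finset.sum_congr rfl fun j hj => ?_
    simp [ha0 j hj, smul_comm (toU e3p) (_ : ℂ), e3p_vB, e3p_vC, e3p_vD])
  have hc0 := hzero c (by
    have := congrArg (fun u => toU e2p • u) hsum
    rw [smul_zero, Finset.smul_sum] at this
    rw [← this]
    refine Finset.sum_congr rfl fun j hj => ?_
    simp [ha0 j hj, smul_comm (toU e2p) (_ : ℂ), e2p_vB, e2p_vC, e2p_vD])
  have hd0 := hzero d (by
    rw [← hsum]
    refine Finset.sum_congr rfl fun j hj => ?_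
    have := hb0 j hj
    simp only [neg_eq_zero] at this
    simp [ha0 j hj, this, hc0 j hj])
  ext j : 1
  by_contra hj
  have hj' : j ∈ f.support := Finsupp.mem_support_iff.2 hj
  apply hj
  have := hb0 j hj'
  simp only [neg_eq_zero] at this
  rw [hγ j, ha0 j hj', this, hc0 j hj', hd0 j hj']
  simp

end IsLW

end gamMap

/-- The free `Γ`-module maps onto `𝕍(λ)`, and its composite with the quotient map to `L(λ)` is
injective. So the quotient map is injective as well. -/
theorem isFreeGam_of {wt : ℂ × ℂ} (h : vermaVec wt ≠ 0) (ha : ∀ n : ℕ, wt.1 ≠ -n)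
    (h1 : wt.1 + wt.2 ≠ 0) (h2 : wt.1 - wt.2 - 2 ≠ 0) :
    IsFreeGam wt ∧ Nonempty (Irr wt ≃ₗ[Ug] Verma wt) := by
  have hbi : Function.Bijective (gamMap (vA (lwVec wt))) :=
    ⟨(lwVec_isLW wt).gamMap_injective (lwVec_ne_zero h) ha h1 h2,
      gamMap_surjective (whole_lwVec wt) (k := fun _ => 1) (by simp) (by simp)⟩
  have hsV : Function.Surjective (gamMap (vA (vermaVec wt))) :=
    gamMap_surjective (whole_vermaVec wt) (k := fun _ => 1) (by simp) (by simp)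
  refine ⟨⟨(LinearEquiv.ofBijective _ hbi).symm, fun u => ?_, fun u => ?_, fun j u hu => ?_⟩, ⟨?_⟩⟩
  · obtain ⟨f, rfl⟩ := hbi.2 u
    rw [LinearEquiv.symm_apply_eq, LinearEquiv.ofBijective_symm_apply_apply]
    rw [LinearEquiv.ofBijective_apply, gamMap_smul, gamHom_ge2]
  · obtain ⟨f, rfl⟩ := hbi.2 u
    rw [LinearEquiv.symm_apply_eq, LinearEquiv.ofBijective_symm_apply_apply]
    rw [LinearEquiv.ofBijective_apply, gamMap_smul, gamHom_ge3]
  · rw [LinearEquiv.symm_apply_eq, LinearEquiv.ofBijective_apply, gamMap_single, map_one,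
      one_smul] at hu
    subst hu
    exact ⟨(lwVec_isLW wt).h_vA j, (lwVec_isLW wt).z_vA j⟩
  · refine (LinearEquiv.ofBijective (vermaRad wt).mkQ ⟨?_, Submodule.mkQ_surjective _⟩).symm
    have hcomp : ∀ f, (vermaRad wt).mkQ (gamMap (vA (vermaVec wt)) f) = gamMap (vA (lwVec wt)) f := by
      intro f
      rw [gamMap_eq_sum, gamMap_eq_sum, map_sum]
      refine Finset.sum_congr rfl fun j _ => ?_
      rw [map_smul, vA, map_smul, ← lwVec_eq, vA]
    intro u w huw
    obtain ⟨f, rfl⟩ := hsV u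
    obtain ⟨f', rfl⟩ := hsV w
    rw [hcomp, hcomp] at huw
    rw [hbi.1 huw]

/-! ### Lightning-flash modules -/

section flash

/-- Combinations of the generators and of their multiples by `E`. -/
def flashSec (E : Gam) : (ℕ →₀ ℂ) × (ℕ →₀ ℂ) →ₗ[ℂ] (ℕ →₀ Gam) :=
  (Finsupp.mapRange.linearMap (LinearMap.toSpanSingleton ℂ Gam 1)).coprod
    (Finsupp.mapRange.linearMap (LinearMap.toSpanSingleton ℂ Gam E))

theorem flashSec_inr (E : Gam) (j : ℕ) :
    flashSec E (0, Finsupp.single j 1) = Finsupp.single j E := by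
  simp [flashSec]

theorem flashSec_inl (E : Gam) (j : ℕ) :
    flashSec E (Finsupp.single j 1, 0) = Finsupp.single j 1 := by
  simp [flashSec]

variable {N : Type*} [AddCommGroup N] [Module ℂ N] [Module Ug N] [IsScalarTower ℂ Ug N]

theorem gamMap_flashSec (x : ℕ → N) (E : Gam) (a c : ℕ →₀ ℂ) : gamMap x (flashSec E (a, c)) =
    Finsupp.linearCombination ℂ x a +
      Finsupp.linearCombination ℂ (fun j => gamHom E • x j) c := by
  have h : ∀ (F : Gam) (a : ℕ →₀ ℂ), gamMap x
      (Finsupp.mapRange.linearMap (LinearMap.toSpanSingleton ℂ Gam F) a) =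
      Finsupp.linearCombination ℂ (fun j => gamHom F • x j) a := by
    intro F a
    induction a using Finsupp.induction_linear with
    | zero => simp
    | add f g hf hg => rw [map_add, map_add, hf, hg, map_add]
    | single j z => 
      rw [Finsupp.mapRange.linearMap_apply, Finsupp.mapRange_single, gamMap_single]
      simp [smul_assoc]
  rw [flashSec, LinearMap.coprod_apply, map_add, h, h]
  simp

/-- Multiplying the relation `e_3 x_j = e_2 x_{j+1}` by `e_2` kills its right-hand side. -/
theorem flash_mul_mem (δ : ℂ) (j : ℕ) : Finsupp.single j (ge2 * ge3) ∈ flashRel δ := by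
  have : ge2 • (Finsupp.single j ge3 - Finsupp.single (j + 1) ge2) ∈ flashRel δ :=
    (flashRel δ).smul_mem _ (Submodule.subset_span (.inl ⟨j, rfl⟩))
  simpa [smul_sub, ge2_ge2] using this

/-- The relations reduce the flash module to the span of the `x_j` and the `E x_j`, where `E` is one
of `e_2`, `e_3`. These vectors stay independent in `L(λ)`: since `E² = 0`, applying `E` kills the
second family and carries the first onto it. So the kernel contains nothing beyond the relations. -/
theorem isFlash_of {wt : ℂ × ℂ} (δ : ℂ) (E : Gam) (hE : E * E = 0) {x : ℕ → Irr wt} {k : ℕ → ℂ}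
    (hk : ∀ j, k j ≠ 0) (hx : ∀ j, x j = k j • vA (lwVec wt) j)
    (hrel : ∀ j, toU e3p • x j = toU e2p • x (j + 1))
    (hrel0 : (1 - δ) • toU e2p • x 0 = 0)
    (h2 : ∀ j, Finsupp.single j ge2 ∈ LinearMap.range (flashSec E) ⊔ (flashRel δ).restrictScalars ℂ)
    (h3 : ∀ j, Finsupp.single j ge3 ∈ LinearMap.range (flashSec E) ⊔ (flashRel δ).restrictScalars ℂ)
    (hli : LinearIndependent ℂ fun j => gamHom E • x j) : IsFlash wt δ := by
  have hker : ∀ f ∈ flashRel δ, gamMap x f = 0 := by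
    intro f hf
    induction hf using Submodule.span_induction with
    | mem f hf =>
      rcases hf with ⟨j, rfl⟩ | rfl
      · rw [map_sub, gamMap_single, gamMap_single, gamHom_ge2, gamHom_ge3, hrel, sub_self]
      · rw [gamMap_single, map_smul, gamHom_ge2, smul_assoc, hrel0]
    | zero => simp
    | add f g _ _ hf hg => rw [map_add, hf, hg, add_zero]
    | smul γ f _ hf => rw [gamMap_smul, hf, smul_zero]
  let g : Flash δ →ₗ[ℂ] Irr wt :=
    (((flashRel δ).restrictScalars ℂ).liftQ (gamMap x) hker) ∘ₗ
      (Submodule.Quotient.restrictScalarsEquiv ℂ (flashRel δ)).symm.toLinearMap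
  have hg : ∀ f, g (Submodule.Quotient.mk f) = gamMap x f := fun f => rfl
  have hspan : ∀ f, f ∈ LinearMap.range (flashSec E) ⊔ (flashRel δ).restrictScalars ℂ := by
    intro f
    induction f using Finsupp.induction_linear with
    | zero => exact zero_mem _
    | add f g hf hg => exact Submodule.add_mem _ hf hg
    | single j γ =>
      obtain ⟨a, b, c, d, rfl⟩ := gam_span γ
      simp only [Finsupp.single_add, ← Finsupp.smul_single]
      refine Submodule.add_mem _ (Submodule.add_mem _ (Submodule.add_mem _ ?_ ?_) ?_) ?_ <;>
        refine Submodule.smul_mem _ _ ?_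
      · exact Submodule.mem_sup_left ⟨_, flashSec_inl E j⟩
      · exact h2 j
      · exact h3 j
      · exact Submodule.mem_sup_right (flash_mul_mem δ j)
  have hbi : Function.Bijective g := by
    constructor
    · rw [← LinearMap.ker_eq_bot, LinearMap.ker_eq_bot']
      intro u hu
      obtain ⟨f, rfl⟩ := Submodule.Quotient.mk_surjective _ u
      rw [hg] at hu
      obtain ⟨_, ⟨⟨a, c⟩, rfl⟩, ρ, hρ, rfl⟩ := Submodule.mem_sup.1 (hspan f)
      rw [map_add, hker ρ hρ, add_zero, gamMap_flashSec] at hu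
      have ha : a = 0 := by
        have := congrArg (fun u => gamHom E • u) hu
        refine (linearIndependent_iff.1 hli) a ?_
        have e2 : gamHom E • Finsupp.linearCombination ℂ (fun j => gamHom E • x j) c = 0 := by
          rw [Finsupp.linearCombination_apply, Finsupp.sum, Finset.smul_sum]
          refine Finset.sum_eq_zero fun j _ => ?_
          rw [smul_comm, smul_smul, ← map_mul, hE, map_zero, zero_smul, smul_zero]
        have e1 : gamHom E • Finsupp.linearCombination ℂ x a =
            Finsupp.linearCombination ℂ (fun j => gamHom E • x j) a := by
          rw [Finsupp.linearCombination_apply, Finsupp.linearCombination_apply, Finsupp.sum,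
            Finsupp.sum, Finset.smul_sum]
          exact Finset.sum_congr rfl fun j _ => smul_comm _ _ _
        simp only [smul_add, e2, smul_zero, add_zero] at this
        rw [← e1, this]
      subst ha
      have hc : c = 0 := (linearIndependent_iff.1 hli) c (by simpa using hu)
      subst hc
      rw [Submodule.Quotient.mk_eq_zero]
      exact (flashRel δ).add_mem (by rw [Prod.mk_zero_zero, map_zero]; exact zero_mem _) hρ
    · intro u
      obtain ⟨f, rfl⟩ := gamMap_surjective (whole_lwVec wt) hk hx u
      exact ⟨_, hg f⟩
  refine ⟨(LinearEquiv.ofBijective g hbi).symm, fun u => ?_, fun u => ?_, fun j u hu => ?_⟩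
  · obtain ⟨w, rfl⟩ := hbi.2 u
    obtain ⟨f, rfl⟩ := Submodule.Quotient.mk_surjective _ w
    rw [LinearEquiv.symm_apply_eq, LinearEquiv.ofBijective_symm_apply_apply]
    rw [LinearEquiv.ofBijective_apply, ← Submodule.Quotient.mk_smul, hg, hg, gamMap_smul,
      gamHom_ge2]
  · obtain ⟨w, rfl⟩ := hbi.2 u
    obtain ⟨f, rfl⟩ := Submodule.Quotient.mk_surjective _ w
    rw [LinearEquiv.symm_apply_eq, LinearEquiv.ofBijective_symm_apply_apply]
    rw [LinearEquiv.ofBijective_apply, ← Submodule.Quotient.mk_smul, hg, hg, gamMap_smul,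
      gamHom_ge3]
  · rw [LinearEquiv.symm_apply_eq, LinearEquiv.ofBijective_apply, hg, gamMap_single, map_one,
      one_smul, hx] at hu
    subst hu
    refine ⟨?_, ?_⟩
    · rw [smul_comm, (lwVec_isLW wt).h_vA j, smul_comm]
    · rw [smul_comm, (lwVec_isLW wt).z_vA j, smul_comm]

/-- For `a + b = 0` the vector `e_2^+ v` is killed by `𝔫⁻`, hence zero in `L(λ)`. Raising this
relation by `e_1^+` expresses each `e_2^+ (e_1^+)^{j+1} v` through `e_3^+ (e_1^+)^j v`. -/
theorem isFlash_zero {wt : ℂ × ℂ} (h : vermaVec wt ≠ 0) (ha : ∀ n : ℕ, wt.1 ≠ -n)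
    (h1 : wt.1 + wt.2 = 0) : IsFlash wt 0 := by
  have hv := lwVec_isLW wt
  have hB0 : vB (lwVec wt) 0 = 0 := by
    refine irr_eq_zero_of_isLW (wt' := (wt.1 - 1, wt.2 + 1)) h (vB_mem _ 0) ⟨?_, ?_, ?_, ?_, ?_⟩
    · rw [hv.h_vB]; simp
    · rw [hv.z_vB]
    · exact hv.e1m_vB_zero
    · rw [hv.e2m_vB, h1]; simp
    · rw [hv.e3m_vB, hv.e1m_vA_zero, smul_zero]
  have hB : ∀ j : ℕ, vB (lwVec wt) (j + 1) = ((j : ℂ) + 1) • vC (lwVec wt) j := by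
    intro j
    induction j with
    | zero =>
      have := e1p_vB (lwVec wt) 0
      rw [hB0, smul_zero, eq_comm, sub_eq_zero] at this
      simpa using this
    | succ j ih =>
      have := e1p_vB (lwVec wt) (j + 1)
      rw [eq_sub_iff_add_eq] at this
      rw [← this, ih, smul_comm, e1p_vC]
      push_cast; module
  have hfac : ∀ j : ℕ, ((j.factorial : ℂ))⁻¹ ≠ 0 := fun j =>
    inv_ne_zero (Nat.cast_ne_zero.2 j.factorial_ne_zero)
  have hmem : ∀ j, Finsupp.single j ge3 ∈
      LinearMap.range (flashSec ge3) ⊔ (flashRel 0).restrictScalars ℂ := fun j =>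
    Submodule.mem_sup_left ⟨_, flashSec_inr ge3 j⟩
  -- The divided powers `(e_1^+)^j v / j!` absorb the factor `j + 1` in `hB`.
  refine isFlash_of 0 ge3 ge3_ge3 (x := fun j => ((j.factorial : ℂ))⁻¹ • vA (lwVec wt) j) hfac
    (fun _ => rfl) (fun j => ?_) ?_ (fun j => ?_) hmem ?_
  · rw [smul_comm (toU e3p), smul_comm (toU e2p), e3p_vA, e2p_vA, hB, smul_smul, Nat.factorial_succ]
    congr 1
    have h1 : (j.factorial : ℂ) ≠ 0 := Nat.cast_ne_zero.2 j.factorial_ne_zero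
    have h2 : (j : ℂ) + 1 ≠ 0 := Nat.cast_add_one_ne_zero j
    push_cast
    field_simp
  · rw [smul_comm (toU e2p), e2p_vA, hB0]; simp
  · cases j with
    | zero => exact Submodule.mem_sup_right (Submodule.subset_span (.inr (by simp)))
    | succ j =>
      have := Submodule.sub_mem _ (hmem j) (Submodule.mem_sup_right
        (show Finsupp.single j ge3 - Finsupp.single (j + 1) ge2 ∈
          (flashRel 0).restrictScalars ℂ from Submodule.subset_span (.inl ⟨j, rfl⟩)))
      simpa using this
  · have e : ∀ j : ℕ, gamHom ge3 • ((j.factorial : ℂ))⁻¹ • vA (lwVec wt) j =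
        ((j.factorial : ℂ))⁻¹ • vC (lwVec wt) j := fun j => by
      rw [gamHom_ge3, smul_comm, e3p_vA]
    simp_rw [e]
    refine linearIndependent_of_h (fun j => smul_ne_zero (hfac j) fun hc => ?_) (wt.1 + 1)
      fun j => ?_
    -- Lowering by `e_3^-` gives the factor `a - b + 2j`, which equals `2(a + j)` as `b = -a`.
    · have := hv.e3m_vC j
      rw [hc, smul_zero] at this
      refine smul_ne_zero ?_ (hv.vA_ne_zero (lwVec_ne_zero h) ha j) this.symm
      intro hz
      apply ha j
      linear_combination hz / 2 + h1 / 2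
    · rw [smul_comm, hv.h_vC, smul_comm]
      congr 1; ring

/-- For `a - b = 2` the vector `e_2^+ e_1^+ v - a e_3^+ v` is killed by `𝔫⁻`, hence zero in `L(λ)`.
Here `e_2^+ v` itself survives, which is the difference between the types `δ = 1` and `δ = 0`. -/
theorem isFlash_one {wt : ℂ × ℂ} (h : vermaVec wt ≠ 0) (ha : ∀ n : ℕ, wt.1 - 1 ≠ -n)
    (h1 : wt.1 - wt.2 - 2 = 0) : IsFlash wt 1 := by
  have hv := lwVec_isLW wt
  have ha' : ∀ n : ℕ, wt.1 ≠ -n := fun n hn => ha (n + 1) (by rw [hn]; push_cast; ring)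
  have hw : vB (lwVec wt) 1 - wt.1 • vC (lwVec wt) 0 = 0 := by
    refine irr_eq_zero_of_isLW (wt' := (wt.1 + 1, wt.2 + 1)) h
      (Submodule.sub_mem _ (vB_mem _ 1) (Submodule.smul_mem _ _ (vC_mem _ 0))) ⟨?_, ?_, ?_, ?_, ?_⟩
    · rw [smul_sub, smul_comm (toU gh) wt.1, hv.h_vB, hv.h_vC]; push_cast; module
    · rw [smul_sub, smul_comm (toU gz) wt.1, hv.z_vB, hv.z_vC]; module
    · rw [smul_sub, smul_comm (toU e1m) wt.1, hv.e1m_vC_zero, hv.e1m_vB_succ]; push_cast; module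
    · rw [smul_sub, smul_comm (toU e2m) wt.1, hv.e2m_vC, hv.e2m_vB, smul_smul, ← sub_smul]
      have : wt.1 + wt.2 + 2 * ((1 : ℕ) : ℂ) - wt.1 * 2 = 0 := by
        push_cast; linear_combination -h1
      rw [this, zero_smul]
    · rw [smul_sub, smul_comm (toU e3m) wt.1, hv.e3m_vC, hv.e3m_vB, hv.e1m_vA_succ, smul_smul,
        smul_smul, ← sub_smul]
      have : (-2 * -(((0 : ℕ) + 1) * (wt.1 + (0 : ℕ))) - wt.1 * (wt.1 - wt.2 + 2 * ((0 : ℕ) : ℂ)) : ℂ)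
          = 0 := by
        push_cast; linear_combination -wt.1 * h1
      rw [this, zero_smul]
  have hB : ∀ j : ℕ, vB (lwVec wt) (j + 1) = (wt.1 + j) • vC (lwVec wt) j := by
    intro j
    induction j with
    | zero => simpa [sub_eq_zero] using hw
    | succ j ih =>
      have := e1p_vB (lwVec wt) (j + 1)
      rw [eq_sub_iff_add_eq] at this
      rw [← this, ih, smul_comm, e1p_vC]
      push_cast; module
  have hne : ∀ j : ℕ, wt.1 + j ≠ 0 := fun j hj => ha' j (eq_neg_of_add_eq_zero_left hj)
  have hfac : ∀ j : ℕ, (∏ i ∈ Finset.range j, (wt.1 + i))⁻¹ ≠ 0 := fun j =>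
    inv_ne_zero (Finset.prod_ne_zero_iff.2 fun i _ => hne i)
  have hmem : ∀ j, Finsupp.single j ge2 ∈
      LinearMap.range (flashSec ge2) ⊔ (flashRel 1).restrictScalars ℂ := fun j =>
    Submodule.mem_sup_left ⟨_, flashSec_inr ge2 j⟩
  -- Dividing by `a (a+1) ⋯ (a+j-1)` absorbs the factor `a + j` in `hB`.
  refine isFlash_of 1 ge2 ge2_ge2
    (x := fun j => (∏ i ∈ Finset.range j, (wt.1 + i))⁻¹ • vA (lwVec wt) j) hfac
    (fun _ => rfl) (fun j => ?_) (by simp) hmem (fun j => ?_) ?_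
  · rw [smul_comm (toU e3p), smul_comm (toU e2p), e3p_vA, e2p_vA, hB, smul_smul, Finset.prod_range_succ, mul_inv,
      mul_assoc, inv_mul_cancel₀ (hne j), mul_one]
  · have := Submodule.add_mem _ (hmem (j + 1)) (Submodule.mem_sup_right
      (show Finsupp.single j ge3 - Finsupp.single (j + 1) ge2 ∈
        (flashRel 1).restrictScalars ℂ from Submodule.subset_span (.inl ⟨j, rfl⟩)))
    simpa using this
  · have e : ∀ j : ℕ, gamHom ge2 • (∏ i ∈ Finset.range j, (wt.1 + i))⁻¹ • vA (lwVec wt) j =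
        (∏ i ∈ Finset.range j, (wt.1 + i))⁻¹ • vB (lwVec wt) j := fun j => by
      rw [gamHom_ge2, smul_comm, e2p_vA]
    simp_rw [e]
    refine linearIndependent_of_h (fun j => smul_ne_zero (hfac j) fun hc => ?_) (wt.1 - 1)
      fun j => ?_
    -- Lowering by `e_2^-` gives `a + b + 2j = 2(a - 1 + j)`. The case `j = 0` is why the hypothesis
    -- concerns `a - 1` and not only `a`.
    · have := hv.e2m_vB j
      rw [hc, smul_zero] at this
      refine smul_ne_zero ?_ (hv.vA_ne_zero (lwVec_ne_zero h) ha' j) this.symm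
      intro hz
      apply ha j
      linear_combination hz / 2 + h1 / 2
    · rw [smul_comm, hv.h_vB, smul_comm]
      congr 1; ring

end flash

/-! ## The spin module -/

section spin

theorem spinAct_cx (v : Vec r) (ω : Spin r) : spinAct r (cx v) ω = ExteriorAlgebra.ι ℂ v * ω := by
  rw [cx, spinAct, CliffordAlgebra.lift_ι_apply, spinLin_apply]
  simp

theorem spinAct_cy_one (v : Vec r) : spinAct r (cy v) 1 = 0 := by
  rw [cy, spinAct, CliffordAlgebra.lift_ι_apply, spinLin_apply]
  simp [CliffordAlgebra.contractLeft_one]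

theorem spinAct_cy_cx (u v : Vec r) (ω : Spin r) : spinAct r (cy v) (spinAct r (cx u) ω) =
    (u ⬝ᵥ v) • ω - spinAct r (cx u) (spinAct r (cy v) ω) := by
  have h : cy v * cx u = (u ⬝ᵥ v) • 1 - cx u * cy v := by
    rw [← cx_cy, add_sub_cancel_left]
  rw [← Module.End.mul_apply, ← map_mul, h, map_sub, map_smul, map_one, map_mul]
  rfl

theorem spinAct_cx_cx (u v : Vec r) (ω : Spin r) : spinAct r (cx u) (spinAct r (cx v) ω) =
    - spinAct r (cx v) (spinAct r (cx u) ω) := by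
  rw [← Module.End.mul_apply, ← map_mul, eq_neg_of_add_eq_zero_left (cx_cx u v), map_neg, map_mul]
  rfl

theorem spinAct_cx_sq (u : Vec r) (ω : Spin r) : spinAct r (cx u) (spinAct r (cx u) ω) = 0 := by
  rw [← Module.End.mul_apply, ← map_mul, cx_sq, map_zero, LinearMap.zero_apply]

theorem cliffStar_mul (a b : Cliff r) : cliffStar r (a * b) = cliffStar r b * cliffStar r a := by
  change ConjOp.unop (cliffStarHom r (a * b)) = _
  rw [map_mul, ConjOp.unop_mul]
  rfl

theorem cliffStar_one : cliffStar r 1 = 1 := by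
  change ConjOp.unop (cliffStarHom r 1) = _
  rw [map_one]
  rfl

theorem cliffStar_ι (p : Vec r × Vec r) : cliffStar r (CliffordAlgebra.ι (cliffQ r) p) =
    CliffordAlgebra.ι (cliffQ r) (cj p.2, cj p.1) := by
  change ConjOp.unop (cliffStarHom r _) = _
  rw [cliffStarHom, CliffordAlgebra.lift_ι_apply]
  rfl

theorem cj_zero : cj (0 : Vec r) = 0 := by ext; simp [cj]

theorem cj_cj (v : Vec r) : cj (cj v) = v := by ext; simp [cj]

theorem cj_bv (i : Fin r) : cj (bv i) = bv i := by
  ext j; by_cases h : j = i <;> simp [cj, bv, h]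

theorem cliffStar_cx (v : Vec r) : cliffStar r (cx v) = cy (cj v) := by
  rw [cx, cliffStar_ι, cj_zero]; rfl

theorem cliffStar_cy (v : Vec r) : cliffStar r (cy v) = cx (cj v) := by
  rw [cy, cliffStar_ι, cj_zero]; rfl

/-- The embedding of the exterior algebra of `𝔥^*` in the Clifford algebra. -/
def spinEmb (r : ℕ) : Spin r →ₐ[ℂ] Cliff r :=
  ExteriorAlgebra.lift ℂ ⟨cxL r, fun v => cx_sq v⟩

theorem spinEmb_ι (v : Vec r) : spinEmb r (ExteriorAlgebra.ι ℂ v) = cx v := by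
  exact ExteriorAlgebra.lift_ι_apply ℂ (cxL r) (fun v => cx_sq v) v

theorem spinEmb_cx (v : Vec r) (ω : Spin r) :
    spinEmb r (spinAct r (cx v) ω) = cx v * spinEmb r ω := by
  rw [spinAct_cx, map_mul, spinEmb_ι]

/-- The Hermitian form on the spin module, as a vacuum expectation value. -/
def spinForm (r : ℕ) : Spin r →ₗ⋆[ℂ] Spin r →ₗ[ℂ] ℂ :=
  LinearMap.mk₂'ₛₗ (starRingEnd ℂ) (RingHom.id ℂ)
    (fun ω ω' => ExteriorAlgebra.algebraMapInv (spinAct r (cliffStar r (spinEmb r ω)) ω'))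
    (fun a b ω => by simp only [map_add, LinearMap.add_apply])
    (fun z a ω => by
      simp only [map_smul, LinearMap.map_smulₛₗ, LinearMap.smul_apply])
    (fun a b ω => by simp only [map_add])
    (fun z a ω => by simp only [map_smul, RingHom.id_apply])

theorem spinForm_apply (ω ω' : Spin r) : spinForm r ω ω' =
    ExteriorAlgebra.algebraMapInv (spinAct r (cliffStar r (spinEmb r ω)) ω') := rfl

theorem spinForm_cx (v : Vec r) (ω ω' : Spin r) :
    spinForm r (spinAct r (cx v) ω) ω' = spinForm r ω (spinAct r (cy (cj v)) ω') := by
  rw [spinForm_apply, spinEmb_cx, cliffStar_mul, cliffStar_cx, map_mul]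
  rfl

theorem spinForm_one_cx (v : Vec r) (ω : Spin r) : spinForm r 1 (spinAct r (cx v) ω) = 0 := by
  rw [spinForm_apply, map_one (spinEmb r), cliffStar_one, map_one (spinAct r),
    Module.End.one_apply, spinAct_cx, map_mul]
  simp [ExteriorAlgebra.algebraMapInv]

theorem spinForm_one_one : spinForm r 1 1 = 1 := by
  rw [spinForm_apply, map_one (spinEmb r), cliffStar_one, map_one (spinAct r),
    Module.End.one_apply, map_one]

/-- The exterior product of the basis vectors indexed by a list. -/
def wedge : List (Fin r) → Spin r
  | [] => 1
  | i :: l => spinAct r (cx (bv i)) (wedge l)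

theorem bv_dotProduct_bv (i j : Fin r) : (bv i : Vec r) ⬝ᵥ bv j = if i = j then 1 else 0 := by
  rw [dotProduct_bv]
  simp [bv, Pi.single_apply, eq_comm]

theorem cy_wedge {i : Fin r} {l : List (Fin r)} (h : i ∉ l) :
    spinAct r (cy (bv i)) (wedge l) = 0 := by
  induction l with
  | nil => exact spinAct_cy_one _
  | cons j l ih =>
    rw [List.mem_cons, not_or] at h
    rw [wedge, spinAct_cy_cx, ih h.2, bv_dotProduct_bv, if_neg (Ne.symm h.1)]
    simp

theorem spinForm_wedge_cx {i : Fin r} {l : List (Fin r)} (h : i ∉ l) (ω : Spin r) :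
    spinForm r (wedge l) (spinAct r (cx (bv i)) ω) = 0 := by
  induction l generalizing ω with
  | nil => exact spinForm_one_cx _ _
  | cons j l ih =>
    rw [List.mem_cons, not_or] at h
    rw [wedge, spinForm_cx, cj_bv, spinAct_cy_cx, bv_dotProduct_bv, if_neg h.1, zero_smul,
      zero_sub, map_neg, ih h.2, neg_zero]

/-- A leading `x_i` moves to the other argument as the contraction `y_i`, which removes `x_i` there
if it is present and otherwise gives zero. Sublists of a list without repetitions encode subsets, so
that equality of lists is the right criterion. -/
theorem wedge_orthonormal {l : List (Fin r)} (hl : l.Nodup) {s t : List (Fin r)}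
    (hs : s.Sublist l) (ht : t.Sublist l) :
    spinForm r (wedge s) (wedge t) = if s = t then 1 else 0 := by
  induction l generalizing s t with
  | nil =>
    rw [List.sublist_nil.1 hs, List.sublist_nil.1 ht, if_pos rfl]
    exact spinForm_one_one
  | cons i l ih =>
    obtain ⟨hi, hl⟩ := List.nodup_cons.1 hl
    rcases List.sublist_cons_iff.1 hs with hs | ⟨s, rfl, hs'⟩ <;>
      rcases List.sublist_cons_iff.1 ht with ht | ⟨t, rfl, ht'⟩
    · exact ih hl hs ht
    · have his : i ∉ s := fun h => hi (hs.subset h)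
      rw [wedge, spinForm_wedge_cx his, if_neg]
      rintro rfl
      exact his (by simp)
    · have hit : i ∉ t := fun h => hi (ht.subset h)
      rw [wedge, spinForm_cx, cj_bv, cy_wedge hit, map_zero, if_neg]
      rintro rfl
      exact hit (by simp)
    · have hit : i ∉ t := fun h => hi (ht'.subset h)
      rw [wedge, wedge, spinForm_cx, cj_bv, spinAct_cy_cx, cy_wedge hit, bv_dotProduct_bv,
        if_pos rfl, one_smul, map_zero, sub_zero, ih hl hs' ht']
      simp

/-- A new factor is sorted into place: it is prepended, or killed by an equal head, or it
anticommutes past the head into the shorter list. -/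
theorem cx_span_wedge {l : List (Fin r)} {j : Fin r} (hj : j ∈ l) {ω : Spin r}
    (hω : ω ∈ Submodule.span ℂ (wedge '' {s | s.Sublist l})) :
    spinAct r (cx (bv j)) ω ∈ Submodule.span ℂ (wedge '' {s | s.Sublist l}) := by
  induction l generalizing j ω with
  | nil => simp at hj
  | cons i l ih =>
    have hmono : Submodule.span ℂ (wedge '' {s | s.Sublist l}) ≤
        Submodule.span ℂ (wedge '' {s | s.Sublist (i :: l)}) :=
      Submodule.span_mono (Set.image_mono fun s hs => List.Sublist.cons i hs)
    have hi : Submodule.span ℂ (wedge '' {s | s.Sublist l}) ≤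
        (Submodule.span ℂ (wedge '' {s | s.Sublist (i :: l)})).comap (spinAct r (cx (bv i))) := by
      refine Submodule.span_le.2 ?_
      rintro _ ⟨s, hs, rfl⟩
      exact Submodule.subset_span ⟨i :: s, List.Sublist.cons_cons i hs, rfl⟩
    have : Submodule.span ℂ (wedge '' {s | s.Sublist (i :: l)}) ≤
        (Submodule.span ℂ (wedge '' {s | s.Sublist (i :: l)})).comap (spinAct r (cx (bv j))) := by
      refine Submodule.span_le.2 ?_
      rintro _ ⟨s, hs, rfl⟩
      rw [SetLike.mem_coe, Submodule.mem_comap]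
      rcases List.sublist_cons_iff.1 hs with hs | ⟨s, rfl, hs''⟩
      · have hs' : wedge s ∈ Submodule.span ℂ (wedge '' {s | s.Sublist l}) :=
          Submodule.subset_span ⟨s, hs, rfl⟩
        rcases List.mem_cons.1 hj with rfl | hj
        · exact hi hs'
        · exact hmono (ih hj hs')
      · have hs' : wedge s ∈ Submodule.span ℂ (wedge '' {s | s.Sublist l}) :=
          Submodule.subset_span ⟨s, hs'', rfl⟩
        rcases List.mem_cons.1 hj with rfl | hj
        · rw [wedge, spinAct_cx_sq]; exact zero_mem _
        · rw [wedge, spinAct_cx_cx]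
          exact Submodule.neg_mem _ (hi (ih hj hs'))
    exact this hω

theorem spin_induction {p : Submodule ℂ (Spin r)} (h1 : (1 : Spin r) ∈ p)
    (h : ∀ (v : Vec r), ∀ ω ∈ p, spinAct r (cx v) ω ∈ p) (ω : Spin r) : ω ∈ p := by
  induction ω using CliffordAlgebra.left_induction with
  | algebraMap z => rw [Algebra.algebraMap_eq_smul_one]; exact p.smul_mem z h1
  | add x y hx hy => exact p.add_mem hx hy
  | ι_mul x v hx => have := h v x hx; rwa [spinAct_cx] at this

theorem spinAct_cx_eq_sum (v : Vec r) (ω : Spin r) :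
    spinAct r (cx v) ω = ∑ i, v i • spinAct r (cx (bv i)) ω := by
  rw [← cxL_apply, map_eq_sum_bv, map_sum, LinearMap.sum_apply]
  simp [cxL_apply]

theorem span_wedge : Submodule.span ℂ (wedge '' {s | s.Sublist (List.finRange r)}) = ⊤ := by
  refine eq_top_iff.2 fun ω _ => spin_induction ?_ ?_ ω
  · exact Submodule.subset_span ⟨[], List.nil_sublist _, rfl⟩
  · intro v ω hω
    rw [spinAct_cx_eq_sum]
    exact Submodule.sum_mem _ fun i _ => Submodule.smul_mem _ _
      (cx_span_wedge (List.mem_finRange i) hω)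

/-- The index set of the basis of the spin module. -/
def wedgeIdx (r : ℕ) : Finset (List (Fin r)) := (List.finRange r).sublists.toFinset

theorem mem_wedgeIdx {s : List (Fin r)} : s ∈ wedgeIdx r ↔ s.Sublist (List.finRange r) := by
  simp [wedgeIdx]

theorem tmul_wedge_expand {M : Type*} [AddCommGroup M] [Module ℂ M] (κ : M ⊗[ℂ] Spin r) :
    ∃ m : List (Fin r) → M, κ = ∑ s ∈ wedgeIdx r, m s ⊗ₜ[ℂ] wedge s := by
  induction κ with
  | zero => exact ⟨0, by simp⟩
  | add x y hx hy =>
    obtain ⟨m, rfl⟩ := hx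
    obtain ⟨n, rfl⟩ := hy
    exact ⟨m + n, by simp [TensorProduct.add_tmul, Finset.sum_add_distrib]⟩
  | tmul u ω =>
    have : ω ∈ Submodule.span ℂ (wedge '' {s | s.Sublist (List.finRange r)}) := by
      rw [span_wedge]; trivial
    induction this using Submodule.span_induction with
    | mem x hx =>
      obtain ⟨s, hs, rfl⟩ := hx
      refine ⟨Pi.single s u, ?_⟩
      rw [Finset.sum_eq_single s]
      · simp
      · intro t _ ht
        simp [Pi.single_eq_of_ne ht]
      · exact fun h => absurd (mem_wedgeIdx.2 hs) h
    | zero => exact ⟨0, by simp⟩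
    | add x y _ _ hx hy =>
      obtain ⟨m, hm⟩ := hx
      obtain ⟨n, hn⟩ := hy
      exact ⟨m + n, by
        rw [TensorProduct.tmul_add, hm, hn]
        simp [TensorProduct.add_tmul, Finset.sum_add_distrib]⟩
    | smul z x _ hx =>
      obtain ⟨m, hm⟩ := hx
      exact ⟨z • m, by
        rw [TensorProduct.tmul_smul, hm, Finset.smul_sum]
        exact Finset.sum_congr rfl fun s _ => by
          rw [Pi.smul_apply, TensorProduct.smul_tmul']⟩

/-- The definition treats the two arguments differently, so symmetry is not visible in it. It
suffices to check it on the spanning monomials, whose values under the form are real and symmetric.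
-/
theorem spinForm_herm (ω ω' : Spin r) : conj (spinForm r ω ω') = spinForm r ω' ω := by
  have mem : ∀ ω : Spin r, ω ∈ Submodule.span ℂ (wedge '' {s | s.Sublist (List.finRange r)}) :=
    fun ω => by rw [span_wedge]; trivial
  induction mem ω using Submodule.span_induction with
  | zero => simp
  | add x y _ _ hx hy => simp [hx, hy]
  | smul z x _ hx => simp [hx]
  | mem x hx =>
    obtain ⟨s, hs, rfl⟩ := hx
    induction mem ω' using Submodule.span_induction with
    | zero => simp
    | add x y _ _ hx hy => simp [hx, hy]
    | smul z x _ hx => simp [hx]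
    | mem x hx =>
      obtain ⟨t, ht, rfl⟩ := hx
      rw [wedge_orthonormal (List.nodup_finRange r) hs ht,
        wedge_orthonormal (List.nodup_finRange r) ht hs]
      by_cases h : s = t <;> simp [h, eq_comm]

/-- The definition gives the adjoint of multiplication by `𝔥^*`; the adjoint of a contraction
follows from Hermitian symmetry, and products follow since `*` reverses them. -/
theorem spinForm_adj (a : Cliff r) (ω ω' : Spin r) :
    spinForm r (spinAct r a ω) ω' = spinForm r ω (spinAct r (cliffStar r a) ω') := by
  have hcy : ∀ (v : Vec r) (ω ω' : Spin r), spinForm r (spinAct r (cy v) ω) ω' =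
      spinForm r ω (spinAct r (cx (cj v)) ω') := fun v ω ω' => by
    rw [← spinForm_herm, ← spinForm_herm _ ω, spinForm_cx, cj_cj]
  induction a using CliffordAlgebra.induction generalizing ω ω' with
  | algebraMap z =>
    rw [Algebra.algebraMap_eq_smul_one, LinearMap.map_smulₛₗ, cliffStar_one]
    simp
  | ι p =>
    have hp : CliffordAlgebra.ι (cliffQ r) p = cx p.1 + cy p.2 := by
      rw [cx, cy, ← map_add]; simp
    rw [hp, map_add, map_add, map_add, LinearMap.add_apply, map_add, LinearMap.add_apply,
      spinForm_cx, hcy, cliffStar_cx, cliffStar_cy, LinearMap.add_apply, map_add]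
  | mul a b ha hb =>
    rw [map_mul, Module.End.mul_apply, ha, hb, cliffStar_mul, map_mul]; rfl
  | add a b ha hb =>
    simp only [map_add, LinearMap.add_apply, ha, hb]

/-! The number operator. -/

theorem cliffN_cx (v : Vec r) (ω : Spin r) : spinAct r (cliffN r) (spinAct r (cx v) ω) =
    spinAct r (cx v) (spinAct r (cliffN r) ω) + spinAct r (cx v) ω := by
  have h : cliffN r * cx v = cx v * cliffN r + cx v := by
    rw [← sub_eq_iff_eq_add', cliffN_comm_cx]
  rw [← Module.End.mul_apply, ← map_mul, h, map_add, map_mul]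
  rfl

theorem cliffN_one : spinAct r (cliffN r) 1 = 0 := by
  simp [cliffN, spinAct_cy_one]

theorem cx_mem_exteriorPower {l : ℕ} (v : Vec r) {ω : Spin r} (hω : ω ∈ ⋀[ℂ]^l (Vec r)) :
    spinAct r (cx v) ω ∈ ⋀[ℂ]^(l + 1) (Vec r) := by
  rw [spinAct_cx, ExteriorAlgebra.exteriorPower, pow_succ']
  exact Submodule.mul_mem_mul (LinearMap.mem_range_self _ v) hω

theorem exteriorPower_induction {l : ℕ} {p : Submodule ℂ (Spin r)}
    (h : ∀ (v : Vec r), ∀ ω ∈ ⋀[ℂ]^l (Vec r), spinAct r (cx v) ω ∈ p) {ω : Spin r}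
    (hω : ω ∈ ⋀[ℂ]^(l + 1) (Vec r)) : ω ∈ p := by
  rw [ExteriorAlgebra.exteriorPower, pow_succ'] at hω
  induction hω using Submodule.mul_induction_on' with
  | mem_mul_mem m hm n hn =>
    obtain ⟨v, rfl⟩ := hm
    have := h v n hn
    rwa [spinAct_cx] at this
  | add x _ y _ hx hy => exact p.add_mem hx hy

theorem cliffN_exteriorPower {l : ℕ} {ω : Spin r} (hω : ω ∈ ⋀[ℂ]^l (Vec r)) :
    spinAct r (cliffN r) ω = (l : ℂ) • ω := by
  induction l generalizing ω with
  | zero =>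
    rw [ExteriorAlgebra.exteriorPower, pow_zero, Submodule.mem_one] at hω
    obtain ⟨z, rfl⟩ := hω
    rw [Algebra.algebraMap_eq_smul_one, map_smul, cliffN_one]
    simp
  | succ l ih =>
    have := exteriorPower_induction (p := LinearMap.ker (spinAct r (cliffN r) -
      ((l + 1 : ℕ) : ℂ) • 1)) (fun v ω h => by
        rw [LinearMap.mem_ker, LinearMap.sub_apply, cliffN_cx, ih h, map_smul, LinearMap.smul_apply,
          Module.End.one_apply]
        push_cast
        module) hω
    simpa [sub_eq_zero] using this

/-- Contraction lowers the degree by one; the two clauses avoid a truncated `l - 1` at `l = 0`. -/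
theorem cy_mem_exteriorPower {l : ℕ} (v : Vec r) {ω : Spin r} (hω : ω ∈ ⋀[ℂ]^l (Vec r)) :
    (l = 0 → spinAct r (cy v) ω = 0) ∧
      ∀ k, l = k + 1 → spinAct r (cy v) ω ∈ ⋀[ℂ]^k (Vec r) := by
  induction l generalizing ω with
  | zero =>
    rw [ExteriorAlgebra.exteriorPower, pow_zero, Submodule.mem_one] at hω
    obtain ⟨z, rfl⟩ := hω
    rw [Algebra.algebraMap_eq_smul_one, map_smul, spinAct_cy_one]
    simp
  | succ l ih =>
    refine ⟨by simp, ?_⟩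
    rintro k hk
    obtain rfl : l = k := by omega
    refine exteriorPower_induction (p := (⋀[ℂ]^l (Vec r)).comap (spinAct r (cy v)))
      (fun u ω h => ?_) hω
    rw [Submodule.mem_comap, spinAct_cy_cx]
    refine Submodule.sub_mem _ (Submodule.smul_mem _ _ h) ?_
    cases l with
    | zero => rw [(ih h).1 rfl, map_zero]; exact zero_mem _
    | succ l => exact cx_mem_exteriorPower u ((ih h).2 l rfl)

theorem wedge_mem (l : List (Fin r)) : wedge l ∈ ⋀[ℂ]^(l.length) (Vec r) := by
  induction l with
  | nil => rw [ExteriorAlgebra.exteriorPower, List.length_nil, pow_zero, Submodule.mem_one]; exact ⟨1, map_one _⟩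
  | cons i l ih => exact cx_mem_exteriorPower _ ih

theorem spin_mem_iSup (ω : Spin r) : ω ∈ ⨆ l : Fin (r + 1), ⋀[ℂ]^(l : ℕ) (Vec r) := by
  have : ω ∈ Submodule.span ℂ (wedge '' {s | s.Sublist (List.finRange r)}) := by
    rw [span_wedge]; trivial
  refine (Submodule.span_le.2 ?_ : Submodule.span ℂ _ ≤ _) this
  rintro _ ⟨s, hs, rfl⟩
  have hlen : s.length < r + 1 := by
    have := List.Sublist.length_le hs
    rw [List.length_finRange] at this
    omega
  exact Submodule.mem_iSup_of_mem (⟨s.length, hlen⟩ : Fin (r + 1)) (wedge_mem s)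

/-- Such a vector would have eigenvalue `l > r` for the number operator, while the spin module is
spanned by eigenvectors with eigenvalues `0, …, r`. -/
theorem exteriorPower_eq_zero {l : ℕ} (hl : r < l) {ω : Spin r} (hω : ω ∈ ⋀[ℂ]^l (Vec r)) :
    ω = 0 := by
  have := mem_of_add_mem_iSup (spinAct r (cliffN r)) ⊥ (by simp) (fun k : Fin (r + 1) => (k : ℂ))
    (fun i j hij => Fin.ext (by simpa using hij)) (fun k => ⋀[ℂ]^(k : ℕ) (Vec r))
    (fun k ω h => cliffN_exteriorPower h) (l : ℂ)
    (fun i hi => by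
      have : (i : ℕ) = l := by exact_mod_cast hi
      have := i.2
      omega)
    (cliffN_exteriorPower hω) (spin_mem_iSup (-ω)) (by simp)
  simpa using this

theorem exteriorPower_finite (l : ℕ) : FiniteDimensional ℂ (⋀[ℂ]^l (Vec r)) := inferInstance

end spin

/-! ## The Hermitian form on `K_c(τ)` -/

section tensorForm

variable {M N : Type*} [AddCommGroup M] [Module ℂ M] [AddCommGroup N] [Module ℂ N]

/-- The tensor product of two sesquilinear forms. -/
def tensorForm (β : M →ₗ⋆[ℂ] M →ₗ[ℂ] ℂ) (γ : N →ₗ⋆[ℂ] N →ₗ[ℂ] ℂ) :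
    M ⊗[ℂ] N →ₗ⋆[ℂ] M ⊗[ℂ] N →ₗ[ℂ] ℂ :=
  TensorProduct.lift (LinearMap.mk₂'ₛₗ (starRingEnd ℂ) (starRingEnd ℂ)
    (fun m n => LinearMap.mul' ℂ ℂ ∘ₗ TensorProduct.map (β m) (γ n))
    (fun m m' n => by rw [map_add, TensorProduct.map_add_left, LinearMap.comp_add])
    (fun z m n => by
      rw [LinearMap.map_smulₛₗ, TensorProduct.map_smul_left, LinearMap.comp_smul])
    (fun m n n' => by rw [map_add, TensorProduct.map_add_right, LinearMap.comp_add])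
    (fun z m n => by
      rw [LinearMap.map_smulₛₗ, TensorProduct.map_smul_right, LinearMap.comp_smul]))

variable (β : M →ₗ⋆[ℂ] M →ₗ[ℂ] ℂ) (γ : N →ₗ⋆[ℂ] N →ₗ[ℂ] ℂ)

theorem tensorForm_tmul (m m' : M) (n n' : N) :
    tensorForm β γ (m ⊗ₜ n) (m' ⊗ₜ n') = β m m' * γ n n' := rfl

theorem tensorForm_herm (hβ : ∀ u v, conj (β u v) = β v u) (hγ : ∀ u v, conj (γ u v) = γ v u)
    (u v : M ⊗[ℂ] N) : conj (tensorForm β γ u v) = tensorForm β γ v u := by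
  induction u with
  | zero => simp
  | add x y hx hy => simp only [map_add, LinearMap.add_apply, hx, hy]
  | tmul m n =>
    induction v with
    | zero => simp
    | add x y hx hy => simp only [map_add, LinearMap.add_apply, hx, hy]
    | tmul m' n' => rw [tensorForm_tmul, tensorForm_tmul, map_mul, hβ, hγ]

theorem tensorForm_adj {f f' : M →ₗ[ℂ] M} {g g' : N →ₗ[ℂ] N} (hf : ∀ u v, β (f u) v = β u (f' v))
    (hg : ∀ u v, γ (g u) v = γ u (g' v)) (u v : M ⊗[ℂ] N) :
    tensorForm β γ (TensorProduct.map f g u) v = tensorForm β γ u (TensorProduct.map f' g' v) := by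
  induction u with
  | zero => simp
  | add x y hx hy => simp only [map_add, LinearMap.add_apply, hx, hy]
  | tmul m n =>
    induction v with
    | zero => simp
    | add x y hx hy => simp only [map_add, hx, hy]
    | tmul m' n' =>
      rw [TensorProduct.map_tmul, TensorProduct.map_tmul, tensorForm_tmul, tensorForm_tmul, hf, hg]

end tensorForm

/-- Expanding in the orthonormal monomials of the spin factor turns the form into a sum of the
values `β(m_s, m_s)`. No orthonormal basis of the possibly infinite-dimensional factor is needed. -/
theorem tensorForm_spinForm_pos {M : Type*} [AddCommGroup M] [Module ℂ M]
    (β : M →ₗ⋆[ℂ] M →ₗ[ℂ] ℂ) (hβ : ∀ u, u ≠ 0 → 0 < (β u u).re) (u : M ⊗[ℂ] Spin r) (hu : u ≠ 0) :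
    0 < (tensorForm β (spinForm r) u u).re := by
  obtain ⟨m, rfl⟩ := tmul_wedge_expand u
  have key : tensorForm β (spinForm r) (∑ s ∈ wedgeIdx r, m s ⊗ₜ wedge s)
      (∑ s ∈ wedgeIdx r, m s ⊗ₜ wedge s) = ∑ s ∈ wedgeIdx r, β (m s) (m s) := by
    rw [map_sum (tensorForm β (spinForm r)), LinearMap.sum_apply]
    refine Finset.sum_congr rfl fun s hs => ?_
    rw [map_sum, Finset.sum_eq_single s]
    · rw [tensorForm_tmul, wedge_orthonormal (List.nodup_finRange r) (mem_wedgeIdx.1 hs)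
        (mem_wedgeIdx.1 hs), if_pos rfl, mul_one]
    · intro t ht hts
      rw [tensorForm_tmul, wedge_orthonormal (List.nodup_finRange r) (mem_wedgeIdx.1 hs)
        (mem_wedgeIdx.1 ht), if_neg (Ne.symm hts), mul_zero]
    · exact fun h => absurd hs h
  have hn : ∀ s, 0 ≤ (β (m s) (m s)).re := fun s => by
    by_cases h : m s = 0
    · simp [h]
    · exact (hβ _ h).le
  obtain ⟨s, hs, h0⟩ : ∃ s ∈ wedgeIdx r, m s ≠ 0 := by
    by_contra! h
    exact hu (Finset.sum_eq_zero fun s hs => by rw [h s hs, TensorProduct.zero_tmul])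
  rw [key, Complex.re_sum]
  exact Finset.sum_pos' (fun s _ => hn s) ⟨s, hs, hβ _ h0⟩

/-! ## The anti-involution -/

section anti

variable (c : Param D)

namespace RCA

theorem star_mul (a b : RCA c) : star c (a * b) = star c b * star c a := by
  change ConjOp.unop (starHom c (a * b)) = _
  rw [map_mul, ConjOp.unop_mul]
  rfl

theorem star_one : star c 1 = 1 := by
  change ConjOp.unop (starHom c 1) = _
  rw [map_one]
  rfl

theorem star_mk_ι (a : Gen D) : star c (mk c (FreeAlgebra.ι ℂ a)) = ConjOp.unop (starGen c a) := by
  refine congrArg ConjOp.unop ((RingQuot.liftAlgHom_mkAlgHom_apply ℂ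
    (FreeAlgebra.lift ℂ (starGen c)) (fun _ _ h => starGen_rel c h) _).trans ?_)
  exact FreeAlgebra.lift_ι_apply _ _

theorem star_x (v : Vec r) : star c (x c v) = y c (cj v) := star_mk_ι c _
theorem star_y (v : Vec r) : star c (y c v) = x c (cj v) := star_mk_ι c _
theorem star_g (w : D.W) : star c (g c w) = g c w⁻¹ := star_mk_ι c _

end RCA

theorem HCstar_tmul (a : RCA c) (b : Cliff r) :
    HCstar c (a ⊗ₜ b) = RCA.star c a ⊗ₜ cliffStar r b := rfl

theorem HCstar_mul (a b : HC c) : HCstar c (a * b) = HCstar c b * HCstar c a := by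
  induction a using TensorProduct.induction_on with
  | zero => simp
  | add x y hx hy => simp only [add_mul, mul_add, map_add, hx, hy]
  | tmul m n =>
    induction b using TensorProduct.induction_on with
    | zero => simp
    | add x y hx hy => simp only [add_mul, mul_add, map_add, hx, hy]
    | tmul m' n' =>
      rw [Algebra.TensorProduct.tmul_mul_tmul, HCstar_tmul, HCstar_tmul, HCstar_tmul,
        Algebra.TensorProduct.tmul_mul_tmul, RCA.star_mul, cliffStar_mul]

theorem conj_half : conj (1 / 2 : ℂ) = 1 / 2 := by
  rw [map_div₀, map_one, map_ofNat]

theorem HCstar_opH : HCstar c (opH c) = opH c := by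
  rw [opH, map_sum]
  refine Finset.sum_congr rfl fun i _ => ?_
  rw [LinearMap.map_smulₛₗ, conj_half, HCstar_tmul, map_add, RCA.star_mul, RCA.star_mul, RCA.star_x,
    RCA.star_y, cliffStar_one, cj_bv]

theorem HCstar_Omega : HCstar c (Omega c) = Omega c := by
  rw [Omega, map_sum]
  refine Finset.sum_congr rfl fun α _ => ?_
  have hα : cx (cort α.1) * cy (rt α.1) = cx (rt α.1) * cy (cort α.1) := by
    rw [cort_eq, ← cxL_apply, ← cyL_apply (_ • _), map_smul, map_smul, cxL_apply, cyL_apply,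
      smul_mul_assoc, mul_smul_comm]
  rw [LinearMap.map_smulₛₗ, HCstar_tmul, map_sub, cliffStar_mul, cliffStar_cx, cliffStar_cy,
    cliffStar_one, RCA.star_g, s_inv, cj_rt, cj_cort, hα, Complex.conj_ofReal]

theorem HCstar_opZ : HCstar c (opZ c) = opZ c := by
  rw [opZ, map_add, HCstar_Omega, map_sum]
  congr 1
  refine Finset.sum_congr rfl fun i _ => ?_
  rw [LinearMap.map_smulₛₗ, conj_half, HCstar_tmul, map_sub, cliffStar_mul, cliffStar_mul, cliffStar_cx,
    cliffStar_cy, RCA.star_one, cj_bv]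

theorem HCstar_opE1p : HCstar c (opE1p c) = -opE1m c := by
  rw [opE1p, opE1m, map_neg, map_sum]
  congr 1
  refine Finset.sum_congr rfl fun i _ => ?_
  rw [LinearMap.map_smulₛₗ, conj_half, HCstar_tmul, sq, sq, RCA.star_mul, RCA.star_x, cliffStar_one, cj_bv]

theorem HCstar_opE1m : HCstar c (opE1m c) = -opE1p c := by
  rw [opE1p, opE1m, map_sum, neg_neg]
  refine Finset.sum_congr rfl fun i _ => ?_
  rw [LinearMap.map_smulₛₗ, conj_half, HCstar_tmul, sq, sq, RCA.star_mul, RCA.star_y, cliffStar_one, cj_bv]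

theorem HCstar_opE2p : HCstar c (opE2p c) = opE2m c := by
  rw [opE2p, opE2m, map_sum]
  exact Finset.sum_congr rfl fun i _ => by
    rw [HCstar_tmul, RCA.star_y, cliffStar_cx, cj_bv]

theorem HCstar_opE2m : HCstar c (opE2m c) = opE2p c := by
  rw [opE2p, opE2m, map_sum]
  exact Finset.sum_congr rfl fun i _ => by
    rw [HCstar_tmul, RCA.star_x, cliffStar_cy, cj_bv]

theorem HCstar_opE3p : HCstar c (opE3p c) = opE3m c := by
  rw [opE3p, opE3m, map_neg, map_sum]
  congr 1
  exact Finset.sum_congr rfl fun i _ => by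
    rw [HCstar_tmul, RCA.star_x, cliffStar_cx, cj_bv]

theorem HCstar_opE3m : HCstar c (opE3m c) = opE3p c := by
  rw [opE3p, opE3m, map_neg, map_sum]
  congr 1
  exact Finset.sum_congr rfl fun i _ => by
    rw [HCstar_tmul, RCA.star_y, cliffStar_cy, cj_bv]

/-- The anti-involution permutes the basis of the image of `𝔤` up to sign, the sign occurring only
for `e_1^±`. This gives both the contravariance of the form and the stability of the centraliser
under `*`. -/
theorem exists_HCstar_realise (X : spo) :
    ∃ X' : spo, HCstar c (realise c X') = realise c X := by
  refine ⟨conj (X.1 0 0) • gh + conj (X.1 2 2) • gz + conj (-X.1 0 1) • e1m +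
    conj (-X.1 1 0) • e1p + conj (X.1 2 0) • e2m + conj (X.1 0 2) • e2p + conj (X.1 0 3) • e3m +
    conj (X.1 3 0) • e3p, ?_⟩
  simp only [map_add, map_smul, LinearMap.map_smulₛₗ, realise_gh, realise_gz, realise_e1m,
    realise_e1p, realise_e2m, realise_e2p, realise_e3m, realise_e3p, HCstar_opH, HCstar_opZ,
    HCstar_opE1m, HCstar_opE1p, HCstar_opE2m, HCstar_opE2p, HCstar_opE3m, HCstar_opE3p,
    Complex.conj_conj, smul_neg, neg_smul, neg_neg]
  rfl

theorem HCstar_mem_Rc {X : HC c} (hX : X ∈ Rc c) : HCstar c X ∈ Rc c := by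
  rw [Rc, Subalgebra.mem_centralizer_iff] at hX ⊢
  rintro _ ⟨Y, rfl⟩
  obtain ⟨Y', hY⟩ := exists_HCstar_realise c Y
  rw [← hY, ← HCstar_mul, ← HCstar_mul, hX _ ⟨Y', rfl⟩]

end anti

/-! ## `K_c(τ)` as a `𝔤`-module -/

section kmod

variable (c : Param D) {V : Type} [AddCommGroup V] [Module ℂ V] (τ : Representation ℂ D.W V)

instance : Module Ug (KMod c τ) :=
  Module.compHom (KMod c τ) ((KAct c τ).comp (ugHom c)).toRingHom

theorem ug_smul (a : Ug) (u : KMod c τ) : a • u = KAct c τ (ugHom c a) u := rfl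

instance : IsScalarTower ℂ Ug (KMod c τ) :=
  ⟨fun z a u => by rw [ug_smul, ug_smul, map_smul, map_smul, LinearMap.smul_apply]⟩

theorem toU_smul (X : spo) (u : KMod c τ) : toU X • u = gAct c τ X u := by
  rw [ug_smul, ugHom_toU, gAct]

theorem KAct_tmul (a : RCA c) (b : Cliff r) :
    KAct c τ (a ⊗ₜ b) = TensorProduct.map (stdAct c τ a) (spinAct r b) := by
  rfl

theorem KAct_tmul_tmul (a : RCA c) (b : Cliff r) (m : StdMod c τ) (ω : Spin r) :
    KAct c τ (a ⊗ₜ b) (m ⊗ₜ ω) = (a • m) ⊗ₜ spinAct r b ω := rfl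

theorem KAct_mul (a b : HC c) (u : KMod c τ) : KAct c τ (a * b) u = KAct c τ a (KAct c τ b u) := by
  rw [map_mul, Module.End.mul_apply]

variable {c τ} in
/-- The form on `K_c(τ)` given by a form on `M_c(τ)`. -/
def kForm (β : StdMod c τ →ₗ⋆[ℂ] StdMod c τ →ₗ[ℂ] ℂ) : KMod c τ →ₗ⋆[ℂ] KMod c τ →ₗ[ℂ] ℂ :=
  tensorForm β (spinForm r)

variable {c τ} {β : StdMod c τ →ₗ⋆[ℂ] StdMod c τ →ₗ[ℂ] ℂ}

theorem kForm_adj (hβ : ∀ a u v, β (stdAct c τ a u) v = β u (stdAct c τ (RCA.star c a) v))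
    (a : HC c) (u v : KMod c τ) :
    kForm β (KAct c τ a u) v = kForm β u (KAct c τ (HCstar c a) v) := by
  induction a using TensorProduct.induction_on with
  | zero => simp
  | add x y hx hy => simp only [map_add, LinearMap.add_apply, hx, hy]
  | tmul m n =>
    rw [KAct_tmul, HCstar_tmul, KAct_tmul]
    exact tensorForm_adj _ _ (hβ m) (spinForm_adj n) u v

theorem kForm_isContra (h1 : ∀ u v, conj (β u v) = β v u) (h2 : ∀ u, u ≠ 0 → 0 < (β u u).re)
    (hβ : ∀ a u v, β (stdAct c τ a u) v = β u (stdAct c τ (RCA.star c a) v)) :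
    IsContra (kForm β) where
  herm := tensorForm_herm _ _ h1 spinForm_herm
  pos := tensorForm_spinForm_pos β h2
  adj X := by
    obtain ⟨X', h⟩ := exists_HCstar_realise c X
    refine ⟨X', fun u v => ?_⟩
    rw [toU_smul, toU_smul, gAct, gAct, kForm_adj hβ, h]
  adj1 u v := by
    rw [toU_smul, toU_smul, gAct, gAct, kForm_adj hβ, realise_e1m, realise_e1p, HCstar_opE1m,
      map_neg, LinearMap.neg_apply, map_neg, neg_neg]
  adj2 u v := by
    rw [toU_smul, toU_smul, gAct, gAct, kForm_adj hβ, realise_e2m, realise_e2p, HCstar_opE2m]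
  adj3 u v := by
    rw [toU_smul, toU_smul, gAct, gAct, kForm_adj hβ, realise_e3m, realise_e3p, HCstar_opE3m]

/-- An `ℛ_c`-stable subspace of `K_c(τ)` is unitary if `M_c(τ)` is. -/
theorem isUnitaryRc_of_stable (hU : StdUnitary c τ) {p : Submodule ℂ (KMod c τ)}
    (hp : ∀ X ∈ Rc c, ∀ θ ∈ p, KAct c τ X θ ∈ p) : IsUnitaryRc c τ p := by
  obtain ⟨β, h1, h2, h3⟩ := hU
  have hc := kForm_isContra h1 h2 h3
  refine ⟨fun X => HCstar_mem_Rc c, hp, ?_⟩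
  refine ⟨((kForm β).domRestrict p).compl₂ p.subtype, fun u v => hc.herm _ _,
    fun u hu => hc.pos _ fun h => hu (Subtype.ext h), fun X u v => kForm_adj h3 X.1 u.1 v.1⟩

end kmod

/-! ## Representations of finite groups -/

section rep

variable {G : Type} [Group G] {K : Type*} [AddCommGroup K] [Module ℂ K] (ρ : Representation ℂ G K)
  {U : Type*} [AddCommGroup U] [Module ℂ U] (σ : Representation ℂ G U)

/-- The isotypic component of type `σ`. -/
def isoComp : Submodule ℂ K :=
  ⨆ f : {f : U →ₗ[ℂ] K // ∀ w u, f (σ w u) = ρ w (f u)}, LinearMap.range f.1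

theorem mem_isoComp_of_intertwining (f : U →ₗ[ℂ] K) (hf : ∀ w u, f (σ w u) = ρ w (f u)) (u : U) :
    f u ∈ isoComp ρ σ :=
  Submodule.mem_iSup_of_mem (⟨f, hf⟩ : {f : U →ₗ[ℂ] K // ∀ w u, f (σ w u) = ρ w (f u)})
    (LinearMap.mem_range_self f u)

variable {ρ σ} in
theorem isoComp_le {p : Submodule ℂ K}
    (h : ∀ f : U →ₗ[ℂ] K, (∀ w u, f (σ w u) = ρ w (f u)) → ∀ u, f u ∈ p) : isoComp ρ σ ≤ p := by
  refine iSup_le ?_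
  rintro ⟨f, hf⟩ _ ⟨u, rfl⟩
  exact h f hf u

/-- Isotypic components are stable under operators commuting with the group. -/
theorem isoComp_le_comap (T : K →ₗ[ℂ] K) (hT : ∀ w u, T (ρ w u) = ρ w (T u)) :
    isoComp ρ σ ≤ (isoComp ρ σ).comap T :=
  isoComp_le fun f hf u => mem_isoComp_of_intertwining ρ σ (T ∘ₗ f)
    (fun w u => by rw [LinearMap.comp_apply, hf, hT]; rfl) u

theorem isoComp_stable (g : G) : isoComp ρ σ ≤ (isoComp ρ σ).comap (ρ g) :=
  isoComp_le fun f hf u => by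
    rw [Submodule.mem_comap, ← hf]
    exact mem_isoComp_of_intertwining ρ σ f hf _

variable {ρ} in
theorem subrep_eq_bot_iff {q : Subrepresentation ρ} : q = ⊥ ↔ q.toSubmodule = ⊥ :=
  ⟨fun h => by rw [h]; rfl, fun h => Subrepresentation.toSubmodule_injective h⟩

variable {ρ} in
theorem subrep_eq_top_iff {q : Subrepresentation ρ} : q = ⊤ ↔ q.toSubmodule = ⊤ :=
  ⟨fun h => by rw [h]; rfl, fun h => Subrepresentation.toSubmodule_injective h⟩

variable {ρ} in
theorem irreducible_of_isAtom {q : Subrepresentation ρ} (hq : IsAtom q) :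
    q.toRepresentation.IsIrreducible := by
  have key : ∀ s : Subrepresentation q.toRepresentation, s = ⊥ ∨ s = ⊤ := fun s => by
    let t : Subrepresentation ρ :=
      { toSubmodule := s.toSubmodule.map q.toSubmodule.subtype
        apply_mem_toSubmodule := by
          rintro g _ ⟨v, hv, rfl⟩
          exact ⟨_, s.apply_mem_toSubmodule g hv, rfl⟩ }
    have ht : t ≤ q := by
      rintro _ ⟨v, -, rfl⟩
      exact v.2
    rcases hq.le_iff.1 ht with h | h
    · left
      rw [subrep_eq_bot_iff] at h ⊢
      exact Submodule.map_injective_of_injective q.toSubmodule.injective_subtype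
        (h.trans (Submodule.map_bot _).symm)
    · right
      rw [subrep_eq_top_iff, eq_top_iff]
      intro v _
      have hv : (v : K) ∈ t := by rw [h]; exact v.2
      obtain ⟨v', hv', e⟩ := hv
      rwa [← Subtype.ext e]
  have : Nontrivial (Subrepresentation q.toRepresentation) := by
    refine ⟨⊥, ⊤, fun h => hq.1 ?_⟩
    rw [subrep_eq_bot_iff, eq_bot_iff]
    intro v hv
    have : (⟨v, hv⟩ : q.toSubmodule) ∈ (⊥ : Subrepresentation q.toRepresentation) := by
      rw [h]; exact Submodule.mem_top
    exact congrArg Subtype.val ((Submodule.mem_bot ℂ).1 this)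
  exact { eq_bot_or_eq_top := key }

/-- The subrepresentation generated by a vector. -/
def orbitSpan (v : K) : Subrepresentation ρ where
  toSubmodule := Submodule.span ℂ (Set.range fun g => ρ g v)
  apply_mem_toSubmodule g u hu := by
    have : Submodule.span ℂ (Set.range fun g => ρ g v) ≤
        (Submodule.span ℂ (Set.range fun g => ρ g v)).comap (ρ g) := by
      refine Submodule.span_le.2 ?_
      rintro _ ⟨w, rfl⟩
      refine Submodule.subset_span ⟨g * w, ?_⟩
      simp
    exact this hu

theorem self_mem_orbitSpan (v : K) : v ∈ (orbitSpan ρ v).toSubmodule :=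
  Submodule.subset_span ⟨1, by simp⟩

theorem orbitSpan_le {v : K} {p : Subrepresentation ρ} (hv : v ∈ p) : orbitSpan ρ v ≤ p := by
  change Submodule.span ℂ _ ≤ p.toSubmodule
  refine Submodule.span_le.2 ?_
  rintro _ ⟨g, rfl⟩
  exact p.apply_mem_toSubmodule g hv

theorem finiteDimensional_orbitSpan [Finite G] (v : K) :
    FiniteDimensional ℂ (orbitSpan ρ v).toSubmodule :=
  FiniteDimensional.span_of_finite ℂ (Set.finite_range _)

theorem irreducible_nontrivial (h : ρ.IsIrreducible) : ∃ v : K, v ≠ 0 := by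
  have hnt := h.toNontrivial
  by_contra! h0
  refine bot_ne_top (α := Subrepresentation ρ) ?_
  refine Subrepresentation.toSubmodule_injective (eq_top_iff.2 fun v _ => ?_)
  rw [h0 v]
  exact zero_mem _

theorem finiteDimensional_of_irreducible [Finite G] (h : ρ.IsIrreducible) :
    FiniteDimensional ℂ K := by
  obtain ⟨v, hv⟩ := irreducible_nontrivial ρ h
  have htop : orbitSpan ρ v = ⊤ := by
    refine (h.eq_bot_or_eq_top _).resolve_left fun hb => hv ?_
    have := self_mem_orbitSpan ρ v
    rwa [subrep_eq_bot_iff.1 hb, Submodule.mem_bot] at this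
  have := finiteDimensional_orbitSpan ρ v
  rw [subrep_eq_top_iff.1 htop] at this
  exact Module.Finite.equiv Submodule.topEquiv

/-- The representation may be infinite-dimensional, but the orbit of a vector under a finite group
spans a finite-dimensional subrepresentation, and one of least dimension exists. -/
theorem exists_atom_le [Finite G] {p : Subrepresentation ρ} (hp : p ≠ ⊥) :
    ∃ q : Subrepresentation ρ, IsAtom q ∧ q ≤ p := by
  obtain ⟨v, hv, h0⟩ := (Submodule.ne_bot_iff _).1 fun h => hp (subrep_eq_bot_iff.2 h)
  obtain ⟨q, ⟨hq0, hqp, hqf⟩, hmin⟩ := (measure fun q : Subrepresentation ρ =>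
    Module.finrank ℂ q.toSubmodule).wf.has_min
      {q | q ≠ ⊥ ∧ q ≤ p ∧ FiniteDimensional ℂ q.toSubmodule} ⟨orbitSpan ρ v, fun h => h0 (by
        have := self_mem_orbitSpan ρ v
        rwa [subrep_eq_bot_iff.1 h, Submodule.mem_bot] at this),
        orbitSpan_le ρ hv, finiteDimensional_orbitSpan ρ v⟩
  refine ⟨q, ⟨hq0, fun s hs => ?_⟩, hqp⟩
  by_contra hs0
  have hlt : s.toSubmodule < q.toSubmodule := hs
  exact hmin s ⟨hs0, hs.le.trans hqp, Submodule.finiteDimensional_of_le hlt.le⟩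
    (Submodule.finrank_lt_finrank_of_lt hlt)

/-- Schur's lemma. -/
theorem exists_scalar_of_commute [Finite G] (h : ρ.IsIrreducible) (T : K →ₗ[ℂ] K)
    (hT : ∀ w u, T (ρ w u) = ρ w (T u)) : ∃ z : ℂ, ∀ u, T u = z • u := by
  have := finiteDimensional_of_irreducible ρ h
  obtain ⟨v, hv⟩ := irreducible_nontrivial ρ h
  have : Nontrivial K := ⟨v, 0, hv⟩
  obtain ⟨z, hz⟩ := Module.End.exists_eigenvalue T
  obtain ⟨u, hu, hu0⟩ := hz.exists_hasEigenvector
  let q : Subrepresentation ρ :=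
    { toSubmodule := Module.End.eigenspace T z
      apply_mem_toSubmodule := fun g v hv => by
        rw [Module.End.mem_eigenspace_iff] at hv ⊢
        rw [hT, hv, map_smul] }
  have hq : q = ⊤ := (h.eq_bot_or_eq_top q).resolve_left fun hb => hu0 (by
    rw [subrep_eq_bot_iff] at hb
    have : u ∈ q.toSubmodule := hu
    rwa [hb, Submodule.mem_bot] at this)
  refine ⟨z, fun v => ?_⟩
  have : v ∈ q.toSubmodule := by rw [subrep_eq_top_iff.1 hq]; trivial
  exact Module.End.mem_eigenspace_iff.1 this

theorem subrep_isCompl {p q : Subrepresentation ρ} (h : IsCompl p q) :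
    IsCompl p.toSubmodule q.toSubmodule := by
  refine ⟨disjoint_iff.2 ?_, codisjoint_iff.2 ?_⟩
  · rw [← Subrepresentation.toSubmodule_inf]
    exact subrep_eq_bot_iff.1 (disjoint_iff.1 h.1)
  · rw [← Subrepresentation.toSubmodule_sup]
    exact subrep_eq_top_iff.1 (codisjoint_iff.1 h.2)

/-- The equivariant projection onto a direct summand. -/
theorem projection_equivariant {p q : Subrepresentation ρ} (h : IsCompl p q) (g : G) (u : K) :
    Submodule.projectionOnto _ _ (subrep_isCompl ρ h) (ρ g u) =
      p.toRepresentation g (Submodule.projectionOnto _ _ (subrep_isCompl ρ h) u) := by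
  obtain ⟨a, b, rfl⟩ : ∃ (a : p.toSubmodule) (b : q.toSubmodule), (a : K) + b = u := by
    have : u ∈ p.toSubmodule ⊔ q.toSubmodule := by
      rw [(subrep_isCompl ρ h).sup_eq_top]; trivial
    obtain ⟨a, ha, b, hb, rfl⟩ := Submodule.mem_sup.1 this
    exact ⟨⟨a, ha⟩, ⟨b, hb⟩, rfl⟩
  have e1 : ρ g (a : K) = (p.toRepresentation g a : p.toSubmodule) := rfl
  have e2 : ρ g (b : K) = (q.toRepresentation g b : q.toSubmodule) := rfl
  rw [map_add, e1, e2, map_add, map_add, Submodule.projectionOnto_apply_left,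
    Submodule.projectionOnto_apply_left, Submodule.projectionOnto_apply_right,
    Submodule.projectionOnto_apply_right, add_zero, add_zero]

variable [Finite G] (I : IrrReps G) {K : Type} [AddCommGroup K] [Module ℂ K]
  (ρ : Representation ℂ G K)

/-- By Maschke's theorem there is an equivariant projection onto `q`. By Schur's lemma it kills
every isotypic component of a type different from that of `q`, so it cannot be the identity on `q`
if all the types in `J` differ. -/
theorem exists_type_of_le {q : Subrepresentation ρ} (hq : IsAtom q) (J : Set I.ι)
    (h : q.toSubmodule ≤ ⨆ j ∈ J, isoComp ρ (I.ρ j)) :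
    ∃ j ∈ J, Nonempty ((I.ρ j).Equiv q.toRepresentation) := by
  obtain ⟨s, hs⟩ := exists_isCompl q
  by_contra! hJ
  have hirr := irreducible_of_isAtom hq
  have hker : ⨆ j ∈ J, isoComp ρ (I.ρ j) ≤
      LinearMap.ker (Submodule.projectionOnto _ _ (subrep_isCompl ρ hs)) := by
    refine iSup₂_le fun j hj => isoComp_le fun f hf u => ?_
    have hj' := I.irreducible j
    have hemp := hJ j hj
    let F : (I.ρ j).IntertwiningMap q.toRepresentation :=
      { toLinearMap := (Submodule.projectionOnto _ _ (subrep_isCompl ρ hs)) ∘ₗ f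
        isIntertwining' := fun g => LinearMap.ext fun u => by
          simp only [LinearMap.comp_apply]
          rw [hf]
          exact projection_equivariant ρ hs g (f u) }
    have hF : F = 0 := Subsingleton.elim _ _
    exact congrArg (fun F : (I.ρ j).IntertwiningMap q.toRepresentation => F.toLinearMap u) hF
  refine hq.1 (subrep_eq_bot_iff.2 (eq_bot_iff.2 fun v hv => ?_))
  have := hker (h hv)
  rw [LinearMap.mem_ker] at this
  have h2 := Submodule.projectionOnto_apply_left (subrep_isCompl ρ hs) ⟨v, hv⟩
  rw [this] at h2
  exact congrArg Subtype.val h2.symm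

/-- The isotypic components of a subrepresentation span it. -/
theorem le_iSup_inf_isoComp {p : Submodule ℂ K} (hp : ∀ g, ∀ u ∈ p, ρ g u ∈ p) :
    p ≤ ⨆ i, p ⊓ isoComp ρ (I.ρ i) := by
  let P : Subrepresentation ρ := ⟨p, fun g u hu => hp g u hu⟩
  let Q : Subrepresentation ρ := ⟨⨆ i, p ⊓ isoComp ρ (I.ρ i), fun g u hu => by
    have : ⨆ i, p ⊓ isoComp ρ (I.ρ i) ≤ (⨆ i, p ⊓ isoComp ρ (I.ρ i)).comap (ρ g) :=
      iSup_le fun i v hv => Submodule.mem_iSup_of_mem i ⟨hp g v hv.1, isoComp_stable ρ _ g hv.2⟩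
    exact this hu⟩
  obtain ⟨S, hS⟩ := exists_isCompl Q
  -- An irreducible subrepresentation of the intersection has some type by completeness, so it lies
  -- in the corresponding summand of `Q`, which meets `S` in zero.
  have hbot : P ⊓ S = ⊥ := by
    by_contra h0
    obtain ⟨q, hq, hqP⟩ := exists_atom_le ρ h0
    obtain ⟨i, ⟨e⟩⟩ := I.complete _ _ (irreducible_of_isAtom hq)
    have hqQ : q ≤ Q := fun v hv => by
      refine Submodule.mem_iSup_of_mem i ⟨(hqP hv).1, ?_⟩
      have := mem_isoComp_of_intertwining ρ (I.ρ i)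
        (q.toSubmodule.subtype ∘ₗ e.toLinearEquiv.toLinearMap) (fun w u => by
          have := LinearMap.congr_fun (e.isIntertwining' w) u
          exact congrArg Subtype.val this) (e.toLinearEquiv.symm ⟨v, hv⟩)
      rw [LinearMap.comp_apply, LinearEquiv.coe_coe, LinearEquiv.apply_symm_apply] at this
      exact this
    exact hq.1 (eq_bot_iff.2 (hS.1 hqQ (hqP.trans inf_le_right)))
  intro u hu
  have hS' := subrep_isCompl ρ hS
  have : u ∈ Q.toSubmodule ⊔ S.toSubmodule := by rw [hS'.sup_eq_top]; trivial
  obtain ⟨a, ha, b, hb, rfl⟩ := Submodule.mem_sup.1 this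
  have hap : a ∈ p := (iSup_le fun i => inf_le_left : (⨆ i, p ⊓ isoComp ρ (I.ρ i)) ≤ p) ha
  have hbp : b ∈ p := by simpa using p.sub_mem hu hap
  have hb0 : b ∈ (P ⊓ S).toSubmodule := ⟨hbp, hb⟩
  rw [hbot] at hb0
  rw [(Submodule.mem_bot ℂ).1 hb0, add_zero]
  exact ha

/-- An irreducible subrepresentation of the intersection would have type `i` and also a type in `J`,
against irredundancy. -/
theorem disjoint_isoComp (i : I.ι) (J : Set I.ι) (hi : i ∉ J) :
    Disjoint (isoComp ρ (I.ρ i)) (⨆ j ∈ J, isoComp ρ (I.ρ j)) := by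
  rw [disjoint_iff]
  let P : Subrepresentation ρ := ⟨isoComp ρ (I.ρ i) ⊓ ⨆ j ∈ J, isoComp ρ (I.ρ j), fun g u hu => by
    refine ⟨isoComp_stable ρ _ g hu.1, ?_⟩
    have : ⨆ j ∈ J, isoComp ρ (I.ρ j) ≤ (⨆ j ∈ J, isoComp ρ (I.ρ j)).comap (ρ g) :=
      iSup₂_le fun j hj v hv => Submodule.mem_iSup_of_mem j
        (Submodule.mem_iSup_of_mem hj (isoComp_stable ρ _ g hv))
    exact this hu.2⟩
  by_contra h0
  obtain ⟨q, hq, hqP⟩ := exists_atom_le ρ (p := P) fun h => h0 (subrep_eq_bot_iff.1 h)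
  have hqP' : q.toSubmodule ≤ P.toSubmodule := hqP
  obtain ⟨j, hj, ⟨e⟩⟩ := exists_type_of_le I ρ hq J (hqP'.trans inf_le_right)
  obtain ⟨k, rfl, ⟨e'⟩⟩ := exists_type_of_le I ρ hq {i} (hqP'.trans (inf_le_left.trans (by simp)))
  exact hi (I.irredundant _ _ ⟨e'.trans e.symm⟩ ▸ hj)

/-- The twist of a representation by a character. -/
def twist (χ : G →* ℂ) {U : Type} [AddCommGroup U] [Module ℂ U] (σ : Representation ℂ G U) :
    Representation ℂ G U where
  toFun g := χ g • σ g
  map_one' := by simp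
  map_mul' g h := by rw [map_mul, map_mul, smul_mul_smul_comm]

theorem twist_irreducible (χ : G →* ℂ) {U : Type} [AddCommGroup U] [Module ℂ U]
    {σ : Representation ℂ G U} (h : σ.IsIrreducible) : (twist χ σ).IsIrreducible := by
  have hχ : ∀ g, χ g ≠ 0 := fun g h0 => by
    have := map_mul χ g g⁻¹
    rw [mul_inv_cancel, map_one, h0, zero_mul] at this
    exact one_ne_zero this
  have key : ∀ s : Subrepresentation (twist χ σ), s = ⊥ ∨ s = ⊤ := fun s => by
    let t : Subrepresentation σ := ⟨s.toSubmodule, fun g v hv => by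
      have := s.toSubmodule.smul_mem (χ g)⁻¹ (s.apply_mem_toSubmodule g hv)
      change (χ g)⁻¹ • χ g • σ g v ∈ _ at this
      rwa [inv_smul_smul₀ (hχ g)] at this⟩
    rcases h.eq_bot_or_eq_top t with h | h
    · exact Or.inl (subrep_eq_bot_iff.2 (subrep_eq_bot_iff.1 h :))
    · exact Or.inr (subrep_eq_top_iff.2 (subrep_eq_top_iff.1 h :))
  obtain ⟨v, hv⟩ := irreducible_nontrivial σ h
  have : Nontrivial (Subrepresentation (twist χ σ)) := by
    refine ⟨⊥, ⊤, fun h => hv ?_⟩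
    have : v ∈ (⊥ : Subrepresentation (twist χ σ)) := by
      rw [h]; exact Submodule.mem_top
    exact (Submodule.mem_bot ℂ).1 this
  exact { eq_bot_or_eq_top := key }

end rep

/-! ## The reflection group -/

section refl

theorem reflMatrix_mulVec (α v : Fin r → ℝ) :
    reflMatrix α *ᵥ v = v - (2 / (α ⬝ᵥ α) * (α ⬝ᵥ v)) • α := by
  rw [reflMatrix, Matrix.sub_mulVec, Matrix.one_mulVec, Matrix.smul_mulVec, Matrix.vecMulVec_mulVec]
  ext i
  simp
  ring

theorem refl_inv (α : Fin r → ℝ) : (refl α)⁻¹ = refl α := by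
  rw [inv_eq_iff_mul_eq_one]
  exact Subtype.ext (reflMatrix_mul_self α)

theorem refl_neg (α : Fin r → ℝ) : refl (-α) = refl α := by
  apply Subtype.ext
  change reflMatrix (-α) = reflMatrix α
  simp [reflMatrix, Matrix.neg_vecMulVec, Matrix.vecMulVec_neg]

theorem orthogonal_mulVec (w : Matrix.orthogonalGroup (Fin r) ℝ) (u v : Fin r → ℝ) :
    (w.1 *ᵥ u) ⬝ᵥ (w.1 *ᵥ v) = u ⬝ᵥ v := by
  have h : w.1ᵀ * w.1 = 1 := (Matrix.mem_orthogonalGroup_iff' _ _).1 w.2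
  rw [Matrix.dotProduct_mulVec, ← Matrix.mulVec_transpose, Matrix.mulVec_mulVec, h,
    Matrix.one_mulVec]

theorem refl_conj (w : Matrix.orthogonalGroup (Fin r) ℝ) (α : Fin r → ℝ) :
    refl (w.1 *ᵥ α) = w * refl α * w⁻¹ := by
  have h : w.1 * w.1ᵀ = 1 := (Matrix.mem_orthogonalGroup_iff _ _).1 w.2
  apply Subtype.ext
  change reflMatrix (w.1 *ᵥ α) = w.1 * reflMatrix α * w.1ᵀ
  rw [reflMatrix, reflMatrix, orthogonal_mulVec, Matrix.mul_sub, Matrix.sub_mul, Matrix.mul_one, h,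
    Matrix.mul_smul, Matrix.smul_mul, Matrix.mul_vecMulVec, Matrix.vecMulVec_mul,
    Matrix.vecMul_transpose]

end refl

namespace RootSys

variable (D)

theorem pos_subset {α : Fin r → ℝ} (h : α ∈ D.pos) : α ∈ D.roots := by
  obtain ⟨v, -, hv⟩ := D.pos_spec
  exact ((hv α).1 h).1

theorem neg_mem {α : Fin r → ℝ} (h : α ∈ D.roots) : -α ∈ D.roots := by
  have h0 : α ⬝ᵥ α ≠ 0 := fun h' => D.ne_zero α h (dotProduct_self_eq_zero.1 h')
  have := D.refl_mem α h α h
  rw [reflMatrix_mulVec, div_mul_cancel₀ _ h0, two_smul] at this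
  simpa using this

theorem pos_or_neg {α : Fin r → ℝ} (h : α ∈ D.roots) : α ∈ D.pos ∨ -α ∈ D.pos := by
  obtain ⟨v, hv0, hv⟩ := D.pos_spec
  rcases lt_or_gt_of_ne (hv0 α h) with h1 | h1
  · exact Or.inr ((hv _).2 ⟨D.neg_mem h, by rw [dotProduct_neg]; linarith⟩)
  · exact Or.inl ((hv _).2 ⟨h, h1⟩)

theorem W_induction {P : D.W → Prop} (h1 : P 1) (hs : ∀ α w, P w → P (D.s α * w)) (w : D.W) :
    P w := by
  have hgen : ∀ α ∈ D.roots, ∃ β : {β // β ∈ D.pos}, refl α = (D.s β).1 := fun α hα => by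
    rcases D.pos_or_neg hα with h | h
    · exact ⟨⟨α, h⟩, rfl⟩
    · exact ⟨⟨-α, h⟩, (refl_neg α).symm⟩
  obtain ⟨w, hw⟩ := w
  induction hw using Subgroup.closure_induction_left with
  | one => exact h1
  | mul_left x hx y hy ih =>
    obtain ⟨α, hα, rfl⟩ := hx
    obtain ⟨β, hβ⟩ := hgen α hα
    convert hs β _ ih using 1
    exact Subtype.ext (congrArg (· * y) hβ)
  | inv_mul_cancel x hx y hy ih =>
    obtain ⟨α, hα, rfl⟩ := hx
    obtain ⟨β, hβ⟩ := hgen α hα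
    convert hs β _ ih using 1
    refine Subtype.ext ?_
    change (refl α)⁻¹ * y = (D.s β).1 * y
    rw [refl_inv, hβ]

theorem mulVec_mem_roots (w : D.W) : ∀ α ∈ D.roots, w.1.1 *ᵥ α ∈ D.roots := by
  induction w using D.W_induction with
  | h1 => intro α hα; simpa using hα
  | hs β w ih =>
    intro α hα
    have := D.refl_mem β.1 (D.pos_subset β.2) _ (ih α hα)
    rw [Matrix.mulVec_mulVec] at this
    exact this

theorem mulVec_sub_mem_span (w : D.W) (v : Fin r → ℝ) :
    w.1.1 *ᵥ v - v ∈ Submodule.span ℝ (D.roots : Set (Fin r → ℝ)) := by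
  induction w using D.W_induction with
  | h1 => simp
  | hs β w ih =>
    have h : (D.s β * w).1.1 *ᵥ v = reflMatrix β.1 *ᵥ (w.1.1 *ᵥ v) := by
      rw [Matrix.mulVec_mulVec]; rfl
    rw [h, reflMatrix_mulVec, sub_right_comm]
    exact Submodule.sub_mem _ ih
      (Submodule.smul_mem _ _ (Submodule.subset_span (D.pos_subset β.2)))

/-- The roots need not span. However, `w v - v` always lies in their span, and if `w` fixes the
roots it is also orthogonal to them; so it is zero. -/
theorem eq_one_of_fix (w : D.W) (h : ∀ α ∈ D.roots, w.1.1 *ᵥ α = α) : w = 1 := by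
  have hv : ∀ v, w.1.1 *ᵥ v = v := fun v => by
    have h1 : Submodule.span ℝ (D.roots : Set (Fin r → ℝ)) ≤
        LinearMap.ker (dotProductBilin ℝ ℝ (w.1.1 *ᵥ v - v)) := Submodule.span_le.2 fun α hα => by
      change (w.1.1 *ᵥ v - v) ⬝ᵥ α = 0
      rw [sub_dotProduct, ← orthogonal_mulVec w.1 v α, h α hα, sub_self]
    have h2 : (w.1.1 *ᵥ v - v) ⬝ᵥ (w.1.1 *ᵥ v - v) = 0 := h1 (D.mulVec_sub_mem_span w v)
    exact sub_eq_zero.1 (dotProduct_self_eq_zero.1 h2)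
  apply Subtype.ext
  apply Subtype.ext
  refine Matrix.ext_of_mulVec_single fun i => ?_
  rw [hv]
  exact (Matrix.one_mulVec _).symm

/-- The action on the finite set of roots is faithful by `eq_one_of_fix`. -/
instance : Finite D.W := by
  let f : D.W → ({α // α ∈ D.roots} → {α // α ∈ D.roots}) := fun w α =>
    ⟨w.1.1 *ᵥ α.1, D.mulVec_mem_roots w α.1 α.2⟩
  refine Finite.of_injective f fun w w' h => ?_
  have h1 : ∀ α ∈ D.roots, w.1.1 *ᵥ α = w'.1.1 *ᵥ α := fun α hα =>
    congrArg Subtype.val (congrFun h ⟨α, hα⟩)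
  have : w'⁻¹ * w = 1 := D.eq_one_of_fix _ fun α hα => by
    have e : (w'⁻¹ * w).1.1 *ᵥ α = w'⁻¹.1.1 *ᵥ (w.1.1 *ᵥ α) := by
      rw [Matrix.mulVec_mulVec]; rfl
    rw [e, h1 α hα, Matrix.mulVec_mulVec]
    have e2 : w'⁻¹.1.1 * w'.1.1 = 1 := congrArg (fun u : D.W => u.1.1) (inv_mul_cancel w')
    rw [e2, Matrix.one_mulVec]
  exact (inv_mul_eq_one.1 this).symm

/-- The reflection in a root, as an element of `W`. -/
def reflW (α : Fin r → ℝ) : D.W := by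
  classical
  exact if h : α ∈ D.roots then ⟨refl α, Subgroup.subset_closure ⟨α, h, rfl⟩⟩ else 1

theorem reflW_val {α : Fin r → ℝ} (h : α ∈ D.roots) : (D.reflW α).1 = refl α := by
  rw [reflW, dif_pos h]

theorem reflW_pos (α : {α // α ∈ D.pos}) : D.reflW α.1 = D.s α :=
  Subtype.ext (D.reflW_val (D.pos_subset α.2))

variable {D}

/-- The roots split into the positive ones and their negatives. The passage to all roots is made
because `W` permutes these but not the positive ones, as needed in `sum_conj`. -/
theorem two_smul_sum_pos {A : Type*} [AddCommGroup A] (G : (Fin r → ℝ) → A)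
    (hG : ∀ α ∈ D.roots, G (-α) = G α) : 2 • ∑ α ∈ D.pos, G α = ∑ α ∈ D.roots, G α := by
  classical
  obtain ⟨v, hv0, hv⟩ := D.pos_spec
  have hpos : D.roots.filter (fun α => 0 < v ⬝ᵥ α) = D.pos := by
    ext α; rw [Finset.mem_filter, hv]
  rw [← Finset.sum_filter_add_sum_filter_not D.roots (fun α => 0 < v ⬝ᵥ α), hpos, two_smul]
  congr 1
  refine Finset.sum_bij (fun α _ => -α) ?_ ?_ ?_ ?_
  · intro α hα
    rw [hv] at hα
    rw [Finset.mem_filter, dotProduct_neg]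
    exact ⟨D.neg_mem hα.1, by linarith [hα.2]⟩
  · intro α _ β _ h; exact neg_injective h
  · intro α hα
    rw [Finset.mem_filter] at hα
    refine ⟨-α, (hv _).2 ⟨D.neg_mem hα.1, ?_⟩, neg_neg α⟩
    rw [dotProduct_neg]
    rcases lt_or_gt_of_ne (hv0 α hα.1) with h | h
    · linarith
    · exact absurd h hα.2
  · intro α hα; rw [hG _ (D.pos_subset hα)]

end RootSys

theorem Param.val_neg (c : Param D) {α : Fin r → ℝ} (h : α ∈ D.roots) : c.val (-α) = c.val α := by
  have h0 : α ⬝ᵥ α ≠ 0 := fun h' => D.ne_zero α h (dotProduct_self_eq_zero.1 h')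
  have := c.inv (refl α) (Subgroup.subset_closure ⟨α, h, rfl⟩) α h
  have e : (refl α).1 *ᵥ α = -α := by
    change reflMatrix α *ᵥ α = -α
    rw [reflMatrix_mulVec, div_mul_cancel₀ _ h0, two_smul]
    simp
  rwa [e] at this

/-- `∑ c_α s_α` is invariant under conjugation. -/
theorem sum_conj (c : Param D) {A : Type*} [AddCommGroup A] [Module ℂ A] (F : D.W → A) (w : D.W) :
    ∑ α : {α // α ∈ D.pos}, (c.val α.1 : ℂ) • F (w * D.s α * w⁻¹) =
      ∑ α : {α // α ∈ D.pos}, (c.val α.1 : ℂ) • F (D.s α) := by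
  have key : ∀ G : D.W → A, ∑ α : {α // α ∈ D.pos}, (c.val α.1 : ℂ) • G (D.s α) =
      (1 / 2 : ℂ) • ∑ α ∈ D.roots, (c.val α : ℂ) • G (D.reflW α) := fun G => by
    rw [← RootSys.two_smul_sum_pos, ← Finset.sum_coe_sort D.pos, ← Nat.cast_smul_eq_nsmul ℂ,
      smul_smul]
    · norm_num [RootSys.reflW_pos]
    · intro α hα
      rw [c.val_neg hα]
      congr 2
      apply Subtype.ext
      rw [D.reflW_val hα, D.reflW_val (D.neg_mem hα), refl_neg]
  rw [key F, key fun u => F (w * u * w⁻¹)]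
  congr 1
  have hinj : Function.Injective fun α : Fin r → ℝ => w.1.1 *ᵥ α := fun α β h => by
    have h' : w⁻¹.1.1 *ᵥ (w.1.1 *ᵥ α) = w⁻¹.1.1 *ᵥ (w.1.1 *ᵥ β) := congrArg _ h
    have e2 : w⁻¹.1.1 * w.1.1 = 1 := congrArg (fun u : D.W => u.1.1) (inv_mul_cancel w)
    rwa [Matrix.mulVec_mulVec, Matrix.mulVec_mulVec, e2, Matrix.one_mulVec,
      Matrix.one_mulVec] at h'
  refine Finset.sum_bij (fun α _ => w.1.1 *ᵥ α) (fun α hα => D.mulVec_mem_roots w α hα)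
    (fun α _ β _ h => hinj h) ?_ ?_
  · intro α hα
    refine ⟨w⁻¹.1.1 *ᵥ α, D.mulVec_mem_roots w⁻¹ α hα, ?_⟩
    have e2 : w.1.1 * w⁻¹.1.1 = 1 := congrArg (fun u : D.W => u.1.1) (mul_inv_cancel w)
    rw [Matrix.mulVec_mulVec, e2, Matrix.one_mulVec]
  · intro α hα
    rw [c.inv w.1 w.2 α hα]
    congr 2
    apply Subtype.ext
    rw [D.reflW_val (D.mulVec_mem_roots w α hα), refl_conj, ← D.reflW_val hα]
    rfl

/-! ## The scalars `N_c(σ)` -/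

section Nc

variable (c : Param D) {U : Type} [AddCommGroup U] [Module ℂ U] {σ : Representation ℂ D.W U}

/-- The class sum commutes with `W` by `sum_conj`, so Schur's lemma provides a scalar and the choice
in the definition of `Nc` is effective. -/
theorem Nc_spec (h : σ.IsIrreducible) (u : U) :
    ∑ α : {α // α ∈ D.pos}, (c.val α.1 : ℂ) • σ (D.s α) u = Nc c σ • u := by
  have hex : ∃ z : ℂ, ∀ u : U, ∑ α : {α // α ∈ D.pos}, (c.val α.1 : ℂ) • σ (D.s α) u = z • u := by
    obtain ⟨z, hz⟩ := exists_scalar_of_commute σ h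
      (∑ α : {α // α ∈ D.pos}, (c.val α.1 : ℂ) • σ (D.s α)) (fun w u => by
        simp only [LinearMap.sum_apply, LinearMap.smul_apply, map_sum, map_smul]
        have := sum_conj c (fun g => σ g (σ w u)) w
        rw [← this]
        refine Finset.sum_congr rfl fun α _ => ?_
        rw [← Module.End.mul_apply, ← map_mul, ← Module.End.mul_apply, ← map_mul,
          inv_mul_cancel_right])
    refine ⟨z, fun u => ?_⟩
    rw [← hz]
    simp only [LinearMap.sum_apply, LinearMap.smul_apply]
  exact Classical.epsilon_spec hex u

theorem Nc_eq (h : σ.IsIrreducible) {z : ℂ}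
    (hz : ∀ u, ∑ α : {α // α ∈ D.pos}, (c.val α.1 : ℂ) • σ (D.s α) u = z • u) : Nc c σ = z := by
  obtain ⟨v, hv⟩ := irreducible_nontrivial σ h
  have : (Nc c σ - z) • v = 0 := by rw [sub_smul, ← Nc_spec c h, hz, sub_self]
  exact sub_eq_zero.1 ((smul_eq_zero.1 this).resolve_right hv)

theorem Nc_equiv {U' : Type} [AddCommGroup U'] [Module ℂ U'] {σ' : Representation ℂ D.W U'}
    (h : σ.IsIrreducible) (h' : σ'.IsIrreducible) (e : σ.Equiv σ') : Nc c σ = Nc c σ' := by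
  refine Nc_eq c h fun u => e.toLinearEquiv.injective ?_
  rw [map_sum, map_smul, ← Nc_spec c h']
  refine Finset.sum_congr rfl fun α _ => ?_
  rw [map_smul]
  exact congrArg _ (LinearMap.congr_fun (e.isIntertwining' (D.s α)) u)

variable (D) in
/-- The determinant character of `W`. -/
def detChar : D.W →* ℂ where
  toFun w := (w.1.1.det : ℂ)
  map_one' := by simp
  map_mul' a b := by
    rw [← Complex.ofReal_mul, ← Matrix.det_mul]; rfl

theorem detChar_s (α : {α // α ∈ D.pos}) : detChar D (D.s α) = -1 := by
  have h0 : α.1 ⬝ᵥ α.1 ≠ 0 := fun h' =>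
    D.ne_zero α.1 (D.pos_subset α.2) (dotProduct_self_eq_zero.1 h')
  change ((reflMatrix α.1).det : ℂ) = -1
  have : reflMatrix α.1 = 1 + Matrix.replicateCol Unit (-(2 / (α.1 ⬝ᵥ α.1)) • α.1) *
      Matrix.replicateRow Unit α.1 := by
    rw [← Matrix.vecMulVec_eq, Matrix.smul_vecMulVec, neg_smul, ← sub_eq_add_neg, reflMatrix]
  rw [this, Matrix.det_one_add_replicateCol_mul_replicateRow, dotProduct_smul, smul_eq_mul, neg_mul,
    div_mul_cancel₀ _ h0]
  norm_num

/-- Every reflection has determinant `-1`. The resulting symmetry turns an assumption on differences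
of scalars into one on sums, as the condition `a - b - 2 ≠ 0` requires. -/
theorem Nc_twist (h : σ.IsIrreducible) : Nc c (twist (detChar D) σ) = -Nc c σ := by
  refine Nc_eq c (twist_irreducible _ h) fun u => ?_
  rw [neg_smul, ← Nc_spec c h, ← Finset.sum_neg_distrib]
  refine Finset.sum_congr rfl fun α _ => ?_
  change (c.val α.1 : ℂ) • (detChar D (D.s α) • σ (D.s α) u) = _
  rw [detChar_s]
  simp

end Nc

/-! ## The action of `W` on `K_c(τ)` -/

theorem act_one : act (1 : Matrix.orthogonalGroup (Fin r) ℝ) = LinearMap.id := by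
  refine LinearMap.ext fun v => ?_
  rw [act, Matrix.mulVecLin_apply, show (1 : Matrix.orthogonalGroup (Fin r) ℝ).1 = 1 from rfl]
  simp

theorem act_mul (w w' : Matrix.orthogonalGroup (Fin r) ℝ) : act (w * w') = act w ∘ₗ act w' := by
  refine LinearMap.ext fun v => ?_
  simp only [act, LinearMap.comp_apply, Matrix.mulVecLin_apply, Matrix.mulVec_mulVec]
  congr 1
  exact Matrix.map_mul (f := Complex.ofRealHom)

/-- Both sides fix `1` and pass through multiplication by `v` in the same way. Hence `s_α ⊗ (1 - α
α^∨)` is the diagonal action of `s_α`, and `Ω_c` acts on the `σ`-isotypic component by `N_c(σ)`. -/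
theorem exteriorMap_refl (α : {α // α ∈ D.pos}) (ω : Spin r) :
    ExteriorAlgebra.map (act (refl α.1)) ω = spinAct r (cliffRefl α.1) ω := by
  refine spin_induction (p := LinearMap.eqLocus (ExteriorAlgebra.map (act (refl α.1))).toLinearMap
    (spinAct r (cliffRefl α.1))) ?_ ?_ ω
  · rw [LinearMap.mem_eqLocus, AlgHom.toLinearMap_apply, map_one (ExteriorAlgebra.map _), cliffRefl,
      map_sub, map_one (spinAct r), map_mul, LinearMap.sub_apply, Module.End.mul_apply, spinAct_cy_one, map_zero, sub_zero,
      Module.End.one_apply]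
  · intro v ω h
    rw [LinearMap.mem_eqLocus, AlgHom.toLinearMap_apply] at h ⊢
    rw [← Module.End.mul_apply, ← map_mul, cliffRefl_cx, map_mul, Module.End.mul_apply, ← h,
      spinAct_cx, map_mul, ExteriorAlgebra.map_apply_ι, spinAct_cx]

section KW

variable (c : Param D) {V : Type} [AddCommGroup V] [Module ℂ V] (τ : Representation ℂ D.W V)

theorem KW_tmul (w : D.W) (m : StdMod c τ) (ω : Spin r) :
    KW c τ w (m ⊗ₜ ω) = (RCA.g c w • m) ⊗ₜ ExteriorAlgebra.map (act w.1) ω := rfl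

theorem KW_one : KW c τ 1 = 1 := by
  refine TensorProduct.ext' fun m ω => ?_
  rw [KW_tmul, RCA.g_one, one_smul, show (1 : D.W).1 = 1 from rfl, act_one, ExteriorAlgebra.map_id]
  rfl

theorem KW_mul (w w' : D.W) : KW c τ (w * w') = KW c τ w * KW c τ w' := by
  refine TensorProduct.ext' fun m ω => ?_
  rw [Module.End.mul_apply, KW_tmul, KW_tmul, KW_tmul, RCA.g_mul, mul_smul,
    show (w * w').1 = w.1 * w'.1 from rfl, act_mul, ← ExteriorAlgebra.map_comp_map,
    AlgHom.comp_apply]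

/-- `K_c(τ)` as a representation of `W`. -/
def KWrep : Representation ℂ D.W (KMod c τ) where
  toFun := KW c τ
  map_one' := KW_one c τ
  map_mul' := KW_mul c τ

theorem KWrep_apply (w : D.W) : KWrep c τ w = KW c τ w := rfl

theorem KIso_eq {U : Type} [AddCommGroup U] [Module ℂ U] (σ : Representation ℂ D.W U) :
    KIso c τ σ = isoComp (KWrep c τ) σ := rfl

theorem KW_s (α : {α // α ∈ D.pos}) : KW c τ (D.s α) = KAct c τ (hcRefl c α) := by
  rw [hcRefl, KAct_tmul, KW]
  congr 1
  exact LinearMap.ext (exteriorMap_refl α)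

variable {c} in
theorem KAct_KW {X : HC c} (h : ∀ α, Commute (hcRefl c α) X) (w : D.W) (u : KMod c τ) :
    KAct c τ X (KW c τ w u) = KW c τ w (KAct c τ X u) := by
  induction w using D.W_induction generalizing u with
  | h1 => rw [← KWrep_apply, map_one]; rfl
  | hs α w ih =>
    rw [← KWrep_apply, map_mul, Module.End.mul_apply, Module.End.mul_apply, KWrep_apply,
      KWrep_apply, KW_s, ← KAct_mul, ← (h α).eq, KAct_mul, ih]

theorem KAct_Omega (u : KMod c τ) :
    KAct c τ (Omega c) u = ∑ α : {α // α ∈ D.pos}, (c.val α.1 : ℂ) • KWrep c τ (D.s α) u := by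
  rw [Omega_eq, map_sum, LinearMap.sum_apply]
  refine Finset.sum_congr rfl fun α _ => ?_
  rw [map_smul, LinearMap.smul_apply, KWrep_apply, KW_s]

theorem KAct_Omega_of_mem_KIso {U : Type} [AddCommGroup U] [Module ℂ U]
    {σ : Representation ℂ D.W U} (hσ : σ.IsIrreducible) {u : KMod c τ} (hu : u ∈ KIso c τ σ) :
    KAct c τ (Omega c) u = Nc c σ • u := by
  have : KIso c τ σ ≤ LinearMap.ker (KAct c τ (Omega c) - Nc c σ • 1) := by
    rw [KIso_eq]
    refine isoComp_le fun f hf u => ?_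
    rw [LinearMap.mem_ker, LinearMap.sub_apply, KAct_Omega, LinearMap.smul_apply,
      Module.End.one_apply, ← map_smul, ← Nc_spec c hσ, map_sum, sub_eq_zero]
    exact Finset.sum_congr rfl fun α _ => by rw [map_smul, hf]
  simpa [sub_eq_zero] using this hu

end KW

/-! ## The grading of the standard module -/

section std

variable (c : Param D) {V : Type} [AddCommGroup V] [Module ℂ V] (τ : Representation ℂ D.W V)

theorem mk_tmul (a : RCA c) (v : V) :
    (Submodule.Quotient.mk (a ⊗ₜ[ℂ] v) : StdMod c τ) = a • stdVec c τ v := by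
  rw [stdVec, ← Submodule.Quotient.mk_smul, TensorProduct.smul_tmul', smul_eq_mul, mul_one]

theorem g_stdVec (w : D.W) (v : V) : RCA.g c w • stdVec c τ v = stdVec c τ (τ w v) := by
  rw [← mk_tmul, stdVec, Submodule.Quotient.eq]
  exact Submodule.subset_span (Or.inl ⟨w, v, rfl⟩)

theorem y_stdVec (a : Vec r) (v : V) : RCA.y c a • stdVec c τ v = 0 := by
  rw [← mk_tmul, Submodule.Quotient.mk_eq_zero]
  exact Submodule.subset_span (Or.inr ⟨a, v, rfl⟩)

/-- `v ↦ 1 ⊗ v` as a linear map. -/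
def stdVecL : V →ₗ[ℂ] StdMod c τ where
  toFun := stdVec c τ
  map_add' u v := by
    rw [stdVec, TensorProduct.tmul_add]; rfl
  map_smul' z v := by
    rw [stdVec, TensorProduct.tmul_smul]; rfl

theorem stdDeg_zero : stdDeg c τ 0 = LinearMap.range (stdVecL c τ) := by
  refine le_antisymm (Submodule.span_le.2 ?_) ?_
  · rintro _ ⟨ξ, v, rfl⟩
    rw [List.ofFn_zero, List.prod_nil, one_smul]
    exact ⟨v, rfl⟩
  · rintro _ ⟨v, rfl⟩
    refine Submodule.subset_span ⟨Fin.elim0, v, ?_⟩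
    rw [List.ofFn_zero, List.prod_nil, one_smul]
    rfl

variable {c τ}

theorem x_mem_stdDeg {m : ℕ} (ξ : Vec r) {u : StdMod c τ} (hu : u ∈ stdDeg c τ m) :
    RCA.x c ξ • u ∈ stdDeg c τ (m + 1) := by
  have : stdDeg c τ m ≤ (stdDeg c τ (m + 1)).comap (stdAct c τ (RCA.x c ξ)) := by
    refine Submodule.span_le.2 ?_
    rintro _ ⟨η, v, rfl⟩
    refine Submodule.subset_span ⟨Fin.cons ξ η, v, ?_⟩
    rw [List.ofFn_succ, List.prod_cons, mul_smul]
    simp only [Fin.cons_zero, Fin.cons_succ]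
    rfl
  exact this hu

theorem stdDeg_induction {m : ℕ} {p : Submodule ℂ (StdMod c τ)}
    (h : ∀ (ξ : Vec r), ∀ u ∈ stdDeg c τ m, RCA.x c ξ • u ∈ p) {u : StdMod c τ}
    (hu : u ∈ stdDeg c τ (m + 1)) : u ∈ p := by
  have : stdDeg c τ (m + 1) ≤ p := by
    refine Submodule.span_le.2 ?_
    rintro _ ⟨η, v, rfl⟩
    rw [List.ofFn_succ, List.prod_cons, mul_smul]
    exact h _ _ (Submodule.subset_span ⟨_, v, rfl⟩)
  exact this hu

theorem g_mem_stdDeg {m : ℕ} (w : D.W) {u : StdMod c τ} (hu : u ∈ stdDeg c τ m) :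
    RCA.g c w • u ∈ stdDeg c τ m := by
  induction m generalizing u with
  | zero =>
    rw [stdDeg_zero] at hu ⊢
    obtain ⟨v, rfl⟩ := hu
    exact ⟨τ w v, (g_stdVec c τ w v).symm⟩
  | succ m ih =>
    refine stdDeg_induction (p := (stdDeg c τ (m + 1)).comap (stdAct c τ (RCA.g c w)))
      (fun ξ u h => ?_) hu
    change RCA.g c w • RCA.x c ξ • u ∈ stdDeg c τ (m + 1)
    rw [← mul_smul, RCA.g_x, mul_smul]
    exact x_mem_stdDeg _ (ih h)

theorem y_smul_x_smul (v ξ : Vec r) (u : StdMod c τ) : RCA.y c v • RCA.x c ξ • u =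
    RCA.x c ξ • RCA.y c v • u + ((ξ ⬝ᵥ v) • u - ∑ α : {α // α ∈ D.pos},
      ((c.val α.1 : ℂ) * (rt α.1 ⬝ᵥ v) * (ξ ⬝ᵥ cort α.1)) • RCA.g c (D.s α) • u) := by
  rw [← mul_smul, ← mul_smul, ← sub_eq_iff_eq_add', ← sub_smul, RCA.yx, sub_smul, Finset.sum_smul,
    smul_assoc, one_smul]
  congr 1
  exact Finset.sum_congr rfl fun α _ => smul_assoc _ _ _

theorem y_stdDeg_zero (a : Vec r) {u : StdMod c τ} (hu : u ∈ stdDeg c τ 0) :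
    RCA.y c a • u = 0 := by
  rw [stdDeg_zero] at hu
  obtain ⟨v, rfl⟩ := hu
  exact y_stdVec c τ a v

theorem y_mem_stdDeg {m : ℕ} (a : Vec r) {u : StdMod c τ} (hu : u ∈ stdDeg c τ (m + 1)) :
    RCA.y c a • u ∈ stdDeg c τ m := by
  have key : ∀ k, (k = 0 → ∀ u ∈ stdDeg c τ k, RCA.y c a • u = 0) ∧
      ∀ m, k = m + 1 → ∀ u ∈ stdDeg c τ k, RCA.y c a • u ∈ stdDeg c τ m := by
    intro k
    induction k with
    | zero => exact ⟨fun _ u hu => y_stdDeg_zero a hu, by simp⟩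
    | succ k ih =>
      refine ⟨by simp, fun m hm => ?_⟩
      obtain rfl : k = m := by omega
      intro u hu
      refine stdDeg_induction (p := (stdDeg c τ k).comap (stdAct c τ (RCA.y c a)))
        (fun ξ u h => ?_) hu
      change RCA.y c a • RCA.x c ξ • u ∈ stdDeg c τ k
      rw [y_smul_x_smul]
      refine Submodule.add_mem _ ?_ (Submodule.sub_mem _ (Submodule.smul_mem _ _ h)
        (Submodule.sum_mem _ fun α _ => Submodule.smul_mem _ _ (g_mem_stdDeg _ h)))
      cases k with
      | zero => rw [ih.1 rfl u h, smul_zero]; exact zero_mem _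
      | succ k => exact x_mem_stdDeg _ (ih.2 k rfl u h)
  exact (key (m + 1)).2 m rfl u hu

theorem cs_smul_stdDeg_zero (hτ : τ.IsIrreducible) {u : StdMod c τ} (hu : u ∈ stdDeg c τ 0) :
    RCA.cs c • u = Nc c τ • u := by
  rw [stdDeg_zero] at hu
  obtain ⟨v, rfl⟩ := hu
  rw [← LinearMap.map_smul (stdVecL c τ) (Nc c τ) v, ← Nc_spec c hτ, map_sum, RCA.cs, Finset.sum_smul]
  refine Finset.sum_congr rfl fun α _ => ?_
  rw [map_smul, smul_assoc]
  exact congrArg _ (g_stdVec c τ _ v)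

/-- In degree zero all `y` vanish and only the class sum acts; each `x` raises the eigenvalue by
one. -/
theorem eu_smul_stdDeg (hτ : τ.IsIrreducible) {m : ℕ} {u : StdMod c τ} (hu : u ∈ stdDeg c τ m) :
    RCA.eu c • u = (m - Nc c τ) • u := by
  induction m generalizing u with
  | zero =>
    rw [RCA.eu, sub_smul, cs_smul_stdDeg_zero hτ hu, Finset.sum_smul,
      Finset.sum_eq_zero fun i _ => by rw [mul_smul, y_stdDeg_zero _ hu, smul_zero]]
    simp
  | succ m ih =>
    have := stdDeg_induction (p := LinearMap.ker (stdAct c τ (RCA.eu c) -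
      (((m + 1 : ℕ) : ℂ) - Nc c τ) • 1)) (fun ξ u h => by
        rw [LinearMap.mem_ker, LinearMap.sub_apply, LinearMap.smul_apply, Module.End.one_apply]
        change RCA.eu c • RCA.x c ξ • u - _ = 0
        have h1 := RCA.eu_comm_x c ξ
        rw [sub_eq_iff_eq_add] at h1
        rw [← mul_smul, h1, add_smul, mul_smul, ih h, smul_comm (RCA.x c ξ)]
        generalize RCA.x c ξ • u = w
        push_cast
        module) hu
    rw [LinearMap.mem_ker, LinearMap.sub_apply, LinearMap.smul_apply, Module.End.one_apply,
      sub_eq_zero] at this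
    exact this

theorem RCA_induction {P : RCA c → Prop} (hz : ∀ z : ℂ, P (algebraMap ℂ _ z))
    (hy : ∀ v, P (RCA.y c v)) (hx : ∀ v, P (RCA.x c v)) (hg : ∀ w, P (RCA.g c w))
    (hadd : ∀ a b, P a → P b → P (a + b)) (hmul : ∀ a b, P a → P b → P (a * b)) (a : RCA c) :
    P a := by
  obtain ⟨a, rfl⟩ : ∃ b, RCA.mk c b = a := RingQuot.mkAlgHom_surjective ℂ (Rel c) a
  induction a using FreeAlgebra.induction with
  | grade0 z => rw [AlgHom.commutes]; exact hz z
  | grade1 s =>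
    cases s with
    | y v => exact hy v
    | x v => exact hx v
    | g w => exact hg w
  | mul a b ha hb => rw [map_mul]; exact hmul _ _ ha hb
  | add a b ha hb => rw [map_add]; exact hadd _ _ ha hb

/-- The sum of the homogeneous parts is stable under the generators of `H_c` and contains the
vectors `1 ⊗ v`. That the sum is direct is not needed here. -/
theorem std_mem_iSup (u : StdMod c τ) : u ∈ ⨆ m, stdDeg c τ m := by
  have hst : ∀ (a : RCA c), ∀ u ∈ ⨆ m, stdDeg c τ m, a • u ∈ ⨆ m, stdDeg c τ m := fun a => by
    have hgen : ∀ b : RCA c, (∀ m, ∀ u ∈ stdDeg c τ m, b • u ∈ ⨆ m, stdDeg c τ m) →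
        ∀ u ∈ ⨆ m, stdDeg c τ m, b • u ∈ ⨆ m, stdDeg c τ m := fun b hb => by
      have : ⨆ m, stdDeg c τ m ≤ (⨆ m, stdDeg c τ m).comap (stdAct c τ b) :=
        iSup_le fun m u hu => hb m u hu
      exact this
    induction a using RCA_induction with
    | hz z => intro u hu; rw [algebraMap_smul]; exact Submodule.smul_mem _ _ hu
    | hy v =>
      refine hgen _ fun m u hu => ?_
      cases m with
      | zero => rw [y_stdDeg_zero v hu]; exact zero_mem _
      | succ m => exact Submodule.mem_iSup_of_mem m (y_mem_stdDeg v hu)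
    | hx v => exact hgen _ fun m u hu => Submodule.mem_iSup_of_mem (m + 1) (x_mem_stdDeg v hu)
    | hg w => exact hgen _ fun m u hu => Submodule.mem_iSup_of_mem m (g_mem_stdDeg w hu)
    | hadd a b ha hb => intro u hu; rw [add_smul]; exact Submodule.add_mem _ (ha u hu) (hb u hu)
    | hmul a b ha hb => intro u hu; rw [mul_smul]; exact ha _ (hb _ hu)
  obtain ⟨t, rfl⟩ := Submodule.Quotient.mk_surjective _ u
  induction t using TensorProduct.induction_on with
  | zero => exact zero_mem _
  | add a b ha hb => exact Submodule.add_mem _ ha hb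
  | tmul a v =>
    rw [mk_tmul]
    refine hst a _ (Submodule.mem_iSup_of_mem 0 ?_)
    rw [stdDeg_zero]
    exact ⟨v, rfl⟩

theorem finiteDimensional_stdDeg [FiniteDimensional ℂ V] (m : ℕ) :
    FiniteDimensional ℂ (stdDeg c τ m) := by
  induction m with
  | zero => rw [stdDeg_zero]; infer_instance
  | succ m ih =>
    have : stdDeg c τ (m + 1) ≤ ⨆ i : Fin r, (stdDeg c τ m).map (stdAct c τ (RCA.x c (bv i))) :=
      fun u hu => stdDeg_induction (fun ξ u h => by
        rw [RCA.x_eq_sum, Finset.sum_smul]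
        refine Submodule.sum_mem _ fun i _ => ?_
        rw [smul_assoc]
        exact Submodule.smul_mem _ _ (Submodule.mem_iSup_of_mem i ⟨u, h, rfl⟩)) hu
    exact Submodule.finiteDimensional_of_le this

end std

/-! ## The bigrading of `K_c(τ)` -/

section kdeg

variable {c : Param D} {V : Type} [AddCommGroup V] [Module ℂ V] {τ : Representation ℂ D.W V}

theorem KDeg_le {m l : ℕ} {p : Submodule ℂ (KMod c τ)}
    (h : ∀ u ∈ stdDeg c τ m, ∀ ω ∈ ⋀[ℂ]^l (Vec r), u ⊗ₜ ω ∈ p) : KDeg c τ m l ≤ p :=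
  Submodule.map₂_le.2 h

theorem tmul_mem_KDeg {m l : ℕ} {u : StdMod c τ} (hu : u ∈ stdDeg c τ m) {ω : Spin r}
    (hω : ω ∈ ⋀[ℂ]^l (Vec r)) : u ⊗ₜ ω ∈ KDeg c τ m l :=
  Submodule.apply_mem_map₂ _ hu hω

theorem finiteDimensional_KDeg [FiniteDimensional ℂ V] (m l : ℕ) :
    FiniteDimensional ℂ (KDeg c τ m l) := by
  have h1 := finiteDimensional_stdDeg (c := c) (τ := τ) m
  have h2 := exteriorPower_finite (r := r) l
  rw [← Submodule.fg_iff_finiteDimensional] at h1 h2 ⊢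
  exact h1.map₂ _ h2

theorem KDeg_eq_zero {m l : ℕ} (hl : r < l) {u : KMod c τ} (hu : u ∈ KDeg c τ m l) : u = 0 := by
  have : KDeg c τ m l ≤ ⊥ := KDeg_le fun u _ ω hω => by
    rw [exteriorPower_eq_zero hl hω, TensorProduct.tmul_zero]; exact zero_mem _
  exact (Submodule.mem_bot ℂ).1 (this hu)

theorem mem_iSup_KDeg (u : KMod c τ) : u ∈ ⨆ m, ⨆ l, KDeg c τ m l := by
  induction u using TensorProduct.induction_on with
  | zero => exact zero_mem _
  | add a b ha hb => exact Submodule.add_mem _ ha hb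
  | tmul a ω =>
    have h1 : ⨆ m, stdDeg c τ m ≤
        (⨆ m, ⨆ l, KDeg c τ m l).comap ((TensorProduct.mk ℂ (StdMod c τ) (Spin r)).flip ω) := by
      refine iSup_le fun m a ha => ?_
      have h2 : ⨆ l : Fin (r + 1), ⋀[ℂ]^(l : ℕ) (Vec r) ≤
          (⨆ m, ⨆ l, KDeg c τ m l).comap (TensorProduct.mk ℂ (StdMod c τ) (Spin r) a) :=
        iSup_le fun l ω hω => Submodule.mem_iSup_of_mem m
          (Submodule.mem_iSup_of_mem (l : ℕ) (tmul_mem_KDeg ha hω))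
      exact h2 (spin_mem_iSup ω)
    exact h1 (std_mem_iSup a)

theorem KAct_mem_of_tmul {m l : ℕ} {p : Submodule ℂ (KMod c τ)} {X : HC c}
    (h : ∀ u ∈ stdDeg c τ m, ∀ ω ∈ ⋀[ℂ]^l (Vec r), KAct c τ X (u ⊗ₜ ω) ∈ p) {u : KMod c τ}
    (hu : u ∈ KDeg c τ m l) : KAct c τ X u ∈ p :=
  (KDeg_le h : KDeg c τ m l ≤ p.comap (KAct c τ X)) hu

theorem KAct_eq_of_tmul {m l : ℕ} {z : ℂ} {X : HC c}
    (h : ∀ u ∈ stdDeg c τ m, ∀ ω ∈ ⋀[ℂ]^l (Vec r), KAct c τ X (u ⊗ₜ ω) = z • (u ⊗ₜ ω))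
    {u : KMod c τ} (hu : u ∈ KDeg c τ m l) : KAct c τ X u = z • u := by
  have : KDeg c τ m l ≤ LinearMap.ker (KAct c τ X - z • 1) := KDeg_le fun u hu ω hω => by
    rw [LinearMap.mem_ker, LinearMap.sub_apply, h u hu ω hω, LinearMap.smul_apply,
      Module.End.one_apply, sub_self]
  simpa [sub_eq_zero] using this hu

theorem KAct_opH (hτ : τ.IsIrreducible) {m l : ℕ} {u : KMod c τ} (hu : u ∈ KDeg c τ m l) :
    KAct c τ (opH c) u = (m + r / 2 - Nc c τ) • u := by
  refine KAct_eq_of_tmul (fun u hu ω _ => ?_) hu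
  rw [opH_eq, KAct_tmul_tmul, map_one, Module.End.one_apply, add_smul, eu_smul_stdDeg hτ hu,
    smul_assoc, one_smul, ← add_smul, ← TensorProduct.smul_tmul']
  congr 1
  ring

theorem KAct_hcN {m l : ℕ} {u : KMod c τ} (hu : u ∈ KDeg c τ m l) :
    KAct c τ (hcN c) u = (l : ℂ) • u := by
  refine KAct_eq_of_tmul (fun u _ ω hω => ?_) hu
  rw [hcN, KAct_tmul_tmul, cliffN_exteriorPower hω, one_smul, TensorProduct.tmul_smul]

theorem KAct_opZ {m l : ℕ} {u : KMod c τ} (hu : u ∈ KDeg c τ m l) {U : Type} [AddCommGroup U]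
    [Module ℂ U] {σ : Representation ℂ D.W U} (hσ : σ.IsIrreducible) (hu' : u ∈ KIso c τ σ) :
    KAct c τ (opZ c) u = (l - r / 2 + Nc c σ) • u := by
  rw [opZ_eq, map_add, map_sub, map_smul, map_one, LinearMap.add_apply, LinearMap.sub_apply,
    KAct_hcN hu, KAct_Omega_of_mem_KIso c τ hσ hu', LinearMap.smul_apply, Module.End.one_apply]
  module

/-! The operators `e_i^±` and the bigrading. -/

theorem opE1p_mem {m l : ℕ} {u : KMod c τ} (hu : u ∈ KDeg c τ m l) :
    KAct c τ (opE1p c) u ∈ KDeg c τ (m + 2) l := by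
  refine KAct_mem_of_tmul (fun u hu ω hω => ?_) hu
  rw [opE1p, map_neg, map_sum, LinearMap.neg_apply, LinearMap.sum_apply]
  refine Submodule.neg_mem _ (Submodule.sum_mem _ fun i _ => ?_)
  rw [map_smul, LinearMap.smul_apply, KAct_tmul_tmul, sq, mul_smul, map_one, Module.End.one_apply]
  exact Submodule.smul_mem _ _ (tmul_mem_KDeg (x_mem_stdDeg _ (x_mem_stdDeg _ hu)) hω)

theorem opE1m_mem {m l : ℕ} {u : KMod c τ} (hu : u ∈ KDeg c τ (m + 2) l) :
    KAct c τ (opE1m c) u ∈ KDeg c τ m l := by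
  refine KAct_mem_of_tmul (fun u hu ω hω => ?_) hu
  rw [opE1m, map_sum, LinearMap.sum_apply]
  refine Submodule.sum_mem _ fun i _ => ?_
  rw [map_smul, LinearMap.smul_apply, KAct_tmul_tmul, sq, mul_smul, map_one, Module.End.one_apply]
  exact Submodule.smul_mem _ _ (tmul_mem_KDeg (y_mem_stdDeg _ (y_mem_stdDeg _ hu)) hω)

theorem opE1m_eq_zero {m l : ℕ} (hm : m < 2) {u : KMod c τ} (hu : u ∈ KDeg c τ m l) :
    KAct c τ (opE1m c) u = 0 := by
  rw [← zero_smul ℂ u]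
  refine KAct_eq_of_tmul (fun u hu ω hω => ?_) hu
  rw [opE1m, map_sum, LinearMap.sum_apply, zero_smul]
  refine Finset.sum_eq_zero fun i _ => ?_
  have : RCA.y c (bv i) • RCA.y c (bv i) • u = 0 := by
    interval_cases m
    · rw [y_stdDeg_zero _ hu, smul_zero]
    · exact y_stdDeg_zero _ (y_mem_stdDeg _ hu)
  rw [map_smul, LinearMap.smul_apply, KAct_tmul_tmul, sq, mul_smul, this, TensorProduct.zero_tmul,
    smul_zero]

theorem opE2p_mem {m l : ℕ} {u : KMod c τ} (hu : u ∈ KDeg c τ (m + 1) l) :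
    KAct c τ (opE2p c) u ∈ KDeg c τ m (l + 1) := by
  refine KAct_mem_of_tmul (fun u hu ω hω => ?_) hu
  rw [opE2p, map_sum, LinearMap.sum_apply]
  refine Submodule.sum_mem _ fun i _ => ?_
  rw [KAct_tmul_tmul]
  exact tmul_mem_KDeg (y_mem_stdDeg _ hu) (cx_mem_exteriorPower _ hω)

theorem opE2p_eq_zero {l : ℕ} {u : KMod c τ} (hu : u ∈ KDeg c τ 0 l) :
    KAct c τ (opE2p c) u = 0 := by
  rw [← zero_smul ℂ u]
  refine KAct_eq_of_tmul (fun u hu ω hω => ?_) hu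
  rw [opE2p, map_sum, LinearMap.sum_apply, zero_smul]
  refine Finset.sum_eq_zero fun i _ => ?_
  rw [KAct_tmul_tmul, y_stdDeg_zero _ hu, TensorProduct.zero_tmul]

theorem opE2m_mem {m l : ℕ} {u : KMod c τ} (hu : u ∈ KDeg c τ m (l + 1)) :
    KAct c τ (opE2m c) u ∈ KDeg c τ (m + 1) l := by
  refine KAct_mem_of_tmul (fun u hu ω hω => ?_) hu
  rw [opE2m, map_sum, LinearMap.sum_apply]
  refine Submodule.sum_mem _ fun i _ => ?_
  rw [KAct_tmul_tmul]
  exact tmul_mem_KDeg (x_mem_stdDeg _ hu) ((cy_mem_exteriorPower _ hω).2 l rfl)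

theorem opE2m_eq_zero {m : ℕ} {u : KMod c τ} (hu : u ∈ KDeg c τ m 0) :
    KAct c τ (opE2m c) u = 0 := by
  rw [← zero_smul ℂ u]
  refine KAct_eq_of_tmul (fun u hu ω hω => ?_) hu
  rw [opE2m, map_sum, LinearMap.sum_apply, zero_smul]
  refine Finset.sum_eq_zero fun i _ => ?_
  rw [KAct_tmul_tmul, (cy_mem_exteriorPower _ hω).1 rfl, TensorProduct.tmul_zero]

theorem opE3p_mem {m l : ℕ} {u : KMod c τ} (hu : u ∈ KDeg c τ m l) :
    KAct c τ (opE3p c) u ∈ KDeg c τ (m + 1) (l + 1) := by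
  refine KAct_mem_of_tmul (fun u hu ω hω => ?_) hu
  rw [opE3p, map_neg, map_sum, LinearMap.neg_apply, LinearMap.sum_apply]
  refine Submodule.neg_mem _ (Submodule.sum_mem _ fun i _ => ?_)
  rw [KAct_tmul_tmul]
  exact tmul_mem_KDeg (x_mem_stdDeg _ hu) (cx_mem_exteriorPower _ hω)

theorem opE3m_mem {m l : ℕ} {u : KMod c τ} (hu : u ∈ KDeg c τ (m + 1) (l + 1)) :
    KAct c τ (opE3m c) u ∈ KDeg c τ m l := by
  refine KAct_mem_of_tmul (fun u hu ω hω => ?_) hu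
  rw [opE3m, map_neg, map_sum, LinearMap.neg_apply, LinearMap.sum_apply]
  refine Submodule.neg_mem _ (Submodule.sum_mem _ fun i _ => ?_)
  rw [KAct_tmul_tmul]
  exact tmul_mem_KDeg (y_mem_stdDeg _ hu) ((cy_mem_exteriorPower _ hω).2 l rfl)

theorem opE3m_eq_zero {m l : ℕ} (h : m = 0 ∨ l = 0) {u : KMod c τ} (hu : u ∈ KDeg c τ m l) :
    KAct c τ (opE3m c) u = 0 := by
  rw [← zero_smul ℂ u]
  refine KAct_eq_of_tmul (fun u hu ω hω => ?_) hu
  rw [opE3m, map_neg, map_sum, LinearMap.neg_apply, LinearMap.sum_apply, zero_smul, neg_eq_zero]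
  refine Finset.sum_eq_zero fun i _ => ?_
  rw [KAct_tmul_tmul]
  rcases h with rfl | rfl
  · rw [y_stdDeg_zero _ hu, TensorProduct.zero_tmul]
  · rw [(cy_mem_exteriorPower _ hω).1 rfl, TensorProduct.tmul_zero]

/-! The top exterior degree. -/

theorem KAct_Omega_top (hτ : τ.IsIrreducible) {u : KMod c τ} (hu : u ∈ KDeg c τ 0 r) :
    KAct c τ (Omega c) u = -Nc c τ • u := by
  refine KAct_eq_of_tmul (fun u hu ω hω => ?_) hu
  have hcx : ∀ v, spinAct r (cx v) ω = 0 := fun v =>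
    exteriorPower_eq_zero (Nat.lt_succ_self r) (cx_mem_exteriorPower v hω)
  rw [TensorProduct.smul_tmul', neg_smul, ← cs_smul_stdDeg_zero hτ hu, Omega, map_sum,
    LinearMap.sum_apply, RCA.cs, Finset.sum_smul, ← Finset.sum_neg_distrib,
    TensorProduct.sum_tmul]
  refine Finset.sum_congr rfl fun α _ => ?_
  -- In the top degree `α ∧ -` is zero, so `α α^∨ = 2 - α^∨ α` acts by `2`: the reflection acts by
  -- its determinant.
  have h2 : spinAct r (1 - cx (rt α.1) * cy (cort α.1)) ω = -ω := by
    have e : cx (rt α.1) * cy (cort α.1) = (2 : ℂ) • 1 - cy (cort α.1) * cx (rt α.1) := by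
      rw [← rt_dotProduct_cort (RootSys.pos_ne_zero α), ← cx_cy, add_sub_cancel_right]
    rw [e, map_sub, map_sub, map_smul, map_mul, map_one, LinearMap.sub_apply, LinearMap.sub_apply,
      LinearMap.smul_apply, Module.End.one_apply, Module.End.mul_apply, hcx, map_zero, sub_zero]
    module
  rw [map_smul, LinearMap.smul_apply, KAct_tmul_tmul, h2, TensorProduct.tmul_neg, smul_neg,
    TensorProduct.smul_tmul', smul_assoc, TensorProduct.neg_tmul]

theorem KAct_opZ_top (hτ : τ.IsIrreducible) {u : KMod c τ} (hu : u ∈ KDeg c τ 0 r) :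
    KAct c τ (opZ c) u = (r / 2 - Nc c τ) • u := by
  rw [opZ_eq, map_add, map_sub, map_smul, map_one, LinearMap.add_apply, LinearMap.sub_apply,
    KAct_hcN hu, KAct_Omega_top hτ hu, LinearMap.smul_apply, Module.End.one_apply]
  module

/-- In the top exterior degree, a vector killed by `e₃⁻` is killed by all of `𝔥 ⊗ 1`. -/
theorem y_eq_zero_of_top {m : ℕ} {u : KMod c τ} (hu : u ∈ KDeg c τ m r)
    (h : KAct c τ (opE3m c) u = 0) (j : Fin r) :
    KAct c τ (RCA.y c (bv j) ⊗ₜ 1) u = 0 := by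
  -- Multiplying `e_3^- u` by `x_j` isolates one term: `x_j y_i = δ_{ij} - y_i x_j` in the Clifford
  -- algebra, and `x_j` kills the top degree.
  have key : ∀ i : Fin r, KAct c τ (1 ⊗ₜ cx (bv j) * RCA.y c (bv i) ⊗ₜ cy (bv i)) u =
      if j = i then KAct c τ (RCA.y c (bv j) ⊗ₜ 1) u else 0 := fun i => by
    have : KDeg c τ m r ≤ LinearMap.ker
        (KAct c τ (1 ⊗ₜ cx (bv j) * RCA.y c (bv i) ⊗ₜ cy (bv i)) -
          (if j = i then KAct c τ (RCA.y c (bv j) ⊗ₜ 1) else 0)) := by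
      refine KDeg_le fun u _ ω hω => ?_
      have hcx : spinAct r (cx (bv j)) ω = 0 :=
        exteriorPower_eq_zero (Nat.lt_succ_self r) (cx_mem_exteriorPower _ hω)
      have e : cx (bv j) * cy (bv i) = (if j = i then (1 : ℂ) else 0) • 1 -
          cy (bv i) * cx (bv j) := by
        rw [← bv_dotProduct_bv, ← cx_cy, add_sub_cancel_right]
      rw [LinearMap.mem_ker, LinearMap.sub_apply, Algebra.TensorProduct.tmul_mul_tmul, one_mul,
        KAct_tmul_tmul, e, map_sub, map_smul, map_mul, map_one, LinearMap.sub_apply,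
        Module.End.mul_apply, hcx, map_zero, sub_zero, LinearMap.smul_apply, Module.End.one_apply]
      by_cases hij : j = i
      · subst hij
        rw [if_pos rfl, if_pos rfl, one_smul, KAct_tmul_tmul, map_one, Module.End.one_apply,
          sub_self]
      · rw [if_neg hij, if_neg hij, zero_smul, TensorProduct.tmul_zero, LinearMap.zero_apply,
          sub_self]
    have h2 := this hu
    rw [LinearMap.mem_ker, LinearMap.sub_apply, sub_eq_zero] at h2
    rw [h2]
    split_ifs <;> rfl
  have h2 : KAct c τ (1 ⊗ₜ cx (bv j)) (KAct c τ (opE3m c) u) = 0 := by rw [h, map_zero]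
  rw [← KAct_mul, opE3m, mul_neg, Finset.mul_sum, map_neg, map_sum, LinearMap.neg_apply,
    LinearMap.sum_apply, neg_eq_zero, Finset.sum_congr rfl fun i _ => key i,
    Finset.sum_ite_eq Finset.univ j, if_pos (Finset.mem_univ j)] at h2
  exact h2

theorem KDeg_succ_induction {m l : ℕ} {p : Submodule ℂ (KMod c τ)}
    (h : ∀ (i : Fin r), ∀ u : KMod c τ, KAct c τ (RCA.x c (bv i) ⊗ₜ 1) u ∈ p) {u : KMod c τ}
    (hu : u ∈ KDeg c τ (m + 1) l) : u ∈ p := by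
  refine (KDeg_le fun u hu ω _ => ?_ : KDeg c τ (m + 1) l ≤ p) hu
  refine stdDeg_induction (p := p.comap ((TensorProduct.mk ℂ (StdMod c τ) (Spin r)).flip ω))
    (fun ξ u _ => ?_) hu
  change (RCA.x c ξ • u) ⊗ₜ[ℂ] ω ∈ p
  rw [RCA.x_eq_sum, Finset.sum_smul, TensorProduct.sum_tmul]
  refine Submodule.sum_mem _ fun i _ => ?_
  rw [smul_assoc, ← TensorProduct.smul_tmul']
  have := h i (u ⊗ₜ ω)
  rw [KAct_tmul_tmul, map_one, Module.End.one_apply] at this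
  exact p.smul_mem _ this

end kdeg

/-! ## Lowest weight vectors of `K_c(τ)` -/

section lowest

variable {c : Param D} {V : Type} [AddCommGroup V] [Module ℂ V] {τ : Representation ℂ D.W V}

theorem exteriorMap_mem {l : ℕ} (f : Vec r →ₗ[ℂ] Vec r) {ω : Spin r} (hω : ω ∈ ⋀[ℂ]^l (Vec r)) :
    ExteriorAlgebra.map f ω ∈ ⋀[ℂ]^l (Vec r) := by
  induction l generalizing ω with
  | zero =>
    rw [ExteriorAlgebra.exteriorPower, pow_zero, Submodule.mem_one] at hω ⊢
    obtain ⟨z, rfl⟩ := hω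
    exact ⟨z, (AlgHom.commutes _ _).symm⟩
  | succ l ih =>
    refine exteriorPower_induction
      (p := (⋀[ℂ]^(l + 1) (Vec r)).comap (ExteriorAlgebra.map f).toLinearMap) (fun v ω h => ?_) hω
    rw [Submodule.mem_comap, AlgHom.toLinearMap_apply, spinAct_cx, map_mul,
      ExteriorAlgebra.map_apply_ι, ← spinAct_cx]
    exact cx_mem_exteriorPower _ (ih h)

theorem KW_mem_KDeg {m l : ℕ} (w : D.W) {u : KMod c τ} (hu : u ∈ KDeg c τ m l) :
    KW c τ w u ∈ KDeg c τ m l := by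
  refine (KDeg_le fun u hu ω hω => ?_ : KDeg c τ m l ≤ (KDeg c τ m l).comap (KW c τ w)) hu
  rw [Submodule.mem_comap, KW_tmul]
  exact tmul_mem_KDeg (g_mem_stdDeg w hu) (exteriorMap_mem _ hω)

/-- A subspace stable under the bigrading operators and under `W` is spanned by its parts of given
bidegree and `W`-type. -/
theorem le_iSup_inf (hτ : τ.IsIrreducible) (I : IrrReps D.W) {S : Submodule ℂ (KMod c τ)}
    (hH : ∀ u ∈ S, KAct c τ (opH c) u ∈ S) (hN : ∀ u ∈ S, KAct c τ (hcN c) u ∈ S)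
    (hW : ∀ w, ∀ u ∈ S, KW c τ w u ∈ S) :
    S ≤ ⨆ m, ⨆ l, ⨆ i, S ⊓ KDeg c τ m l ⊓ KIso c τ (I.ρ i) := by
  have h1 : S ≤ ⨆ m, S ⊓ ⨆ l, KDeg c τ m l := by
    refine le_iSup_inf_eigen (KAct c τ (opH c)) S hH (fun m : ℕ => (m + r / 2 - Nc c τ : ℂ))
      (fun a b h => by simpa using h) _ (fun m u hu => ?_) (fun u _ => mem_iSup_KDeg u)
    have : ⨆ l, KDeg c τ m l ≤
        LinearMap.ker (KAct c τ (opH c) - (m + r / 2 - Nc c τ : ℂ) • 1) := iSup_le fun l u hu => by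
      rw [LinearMap.mem_ker, LinearMap.sub_apply, KAct_opH hτ hu]; exact sub_self _
    simpa [sub_eq_zero] using this hu
  refine h1.trans (iSup_mono fun m => ?_)
  -- The number operator is used in place of `z`, whose eigenvalues mix the exterior degree with
  -- `N_c(σ)`.
  have h2 : S ⊓ ⨆ l, KDeg c τ m l ≤ ⨆ l, (S ⊓ ⨆ l, KDeg c τ m l) ⊓ KDeg c τ m l := by
    refine le_iSup_inf_eigen (KAct c τ (hcN c)) (S ⊓ ⨆ l, KDeg c τ m l) (fun u hu => ⟨hN u hu.1, ?_⟩)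
      (fun l : ℕ => (l : ℂ)) Nat.cast_injective _ (fun l u hu => KAct_hcN hu) inf_le_right
    have : ⨆ l, KDeg c τ m l ≤ (⨆ l, KDeg c τ m l).comap (KAct c τ (hcN c)) :=
      iSup_le fun l u hu => Submodule.mem_iSup_of_mem l (by
        rw [KAct_hcN hu]; exact Submodule.smul_mem _ _ hu)
    exact this hu.2
  refine h2.trans (iSup_mono fun l => ?_)
  refine (le_trans (inf_le_inf_right _ inf_le_left) ?_ :
    (S ⊓ ⨆ l, KDeg c τ m l) ⊓ KDeg c τ m l ≤ _)
  exact le_iSup_inf_isoComp I (KWrep c τ) fun w u hu => ⟨hW w u hu.1, KW_mem_KDeg w hu.2⟩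

theorem KAct_Omega_KW (w : D.W) (u : KMod c τ) :
    KAct c τ (Omega c) (KW c τ w u) = KW c τ w (KAct c τ (Omega c) u) := by
  rw [KAct_Omega, KAct_Omega, map_sum, ← KWrep_apply]
  have := sum_conj c (fun g => KWrep c τ g (KWrep c τ w u)) w
  rw [← this]
  refine Finset.sum_congr rfl fun β _ => ?_
  rw [map_smul, ← Module.End.mul_apply, ← map_mul, ← Module.End.mul_apply, ← map_mul,
    inv_mul_cancel_right]

theorem KAct_opZ_KW (w : D.W) (u : KMod c τ) :
    KAct c τ (opZ c) (KW c τ w u) = KW c τ w (KAct c τ (opZ c) u) := by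
  rw [opZ_eq, map_add, map_sub, map_smul, map_one, LinearMap.add_apply, LinearMap.add_apply,
    LinearMap.sub_apply, LinearMap.sub_apply, KAct_Omega_KW, KAct_KW τ (hcRefl_comm_N c),
    map_add, map_sub, LinearMap.smul_apply, LinearMap.smul_apply, map_smul]
  rfl

theorem gAct_apply (X : spo) (u : KMod c τ) : gAct c τ X u =
    X.1 0 0 • KAct c τ (opH c) u + X.1 2 2 • KAct c τ (opZ c) u + X.1 0 1 • KAct c τ (opE1p c) u +
    X.1 1 0 • KAct c τ (opE1m c) u + X.1 2 0 • KAct c τ (opE2p c) u +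
    X.1 0 2 • KAct c τ (opE2m c) u + X.1 0 3 • KAct c τ (opE3p c) u +
    X.1 3 0 • KAct c τ (opE3m c) u := by
  have : realise c X = X.1 0 0 • opH c + X.1 2 2 • opZ c + X.1 0 1 • opE1p c + X.1 1 0 • opE1m c +
    X.1 2 0 • opE2p c + X.1 0 2 • opE2m c + X.1 0 3 • opE3p c + X.1 3 0 • opE3m c := rfl
  rw [gAct, this]
  simp only [map_add, map_smul, LinearMap.add_apply, LinearMap.smul_apply]

theorem gAct_KW (X : spo) (w : D.W) (u : KMod c τ) :
    gAct c τ X (KW c τ w u) = KW c τ w (gAct c τ X u) := by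
  rw [gAct_apply, gAct_apply, KAct_opZ_KW, KAct_KW τ (hcRefl_comm_H c),
    KAct_KW τ (hcRefl_comm_E1p c), KAct_KW τ (hcRefl_comm_E1m c), KAct_KW τ (hcRefl_comm_E2p c),
    KAct_KW τ (hcRefl_comm_E2m c), KAct_KW τ (hcRefl_comm_E3p c), KAct_KW τ (hcRefl_comm_E3m c)]
  simp only [map_add, map_smul]

theorem toU_smul_mem_KIso {U : Type} [AddCommGroup U] [Module ℂ U] {σ : Representation ℂ D.W U}
    (X : spo) {u : KMod c τ} (hu : u ∈ KIso c τ σ) : toU X • u ∈ KIso c τ σ := by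
  rw [toU_smul]
  exact isoComp_le_comap (KWrep c τ) σ (gAct c τ X) (gAct_KW X) hu

theorem smul_mem_KIso {U : Type} [AddCommGroup U] [Module ℂ U] {σ : Representation ℂ D.W U}
    (a : Ug) {u : KMod c τ} (hu : u ∈ KIso c τ σ) : a • u ∈ KIso c τ σ :=
  smul_mem_of_toU (p := KIso c τ σ) (fun X _ h => toU_smul_mem_KIso X h) a u hu

theorem toU_gh (u : KMod c τ) : toU gh • u = KAct c τ (opH c) u := by
  rw [toU_smul, gAct, realise_gh]
theorem toU_gz (u : KMod c τ) : toU gz • u = KAct c τ (opZ c) u := by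
  rw [toU_smul, gAct, realise_gz]
theorem toU_e1p (u : KMod c τ) : toU e1p • u = KAct c τ (opE1p c) u := by
  rw [toU_smul, gAct, realise_e1p]
theorem toU_e1m (u : KMod c τ) : toU e1m • u = KAct c τ (opE1m c) u := by
  rw [toU_smul, gAct, realise_e1m]
theorem toU_e2p (u : KMod c τ) : toU e2p • u = KAct c τ (opE2p c) u := by
  rw [toU_smul, gAct, realise_e2p]
theorem toU_e2m (u : KMod c τ) : toU e2m • u = KAct c τ (opE2m c) u := by
  rw [toU_smul, gAct, realise_e2m]
theorem toU_e3p (u : KMod c τ) : toU e3p • u = KAct c τ (opE3p c) u := by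
  rw [toU_smul, gAct, realise_e3p]
theorem toU_e3m (u : KMod c τ) : toU e3m • u = KAct c τ (opE3m c) u := by
  rw [toU_smul, gAct, realise_e3m]

theorem mem_lw {u : KMod c τ} : u ∈ lw c τ ↔ KAct c τ (opE1m c) u = 0 ∧
    KAct c τ (opE2m c) u = 0 ∧ KAct c τ (opE3m c) u = 0 := by
  rw [lw, Submodule.mem_inf, Submodule.mem_inf, LinearMap.mem_ker, LinearMap.mem_ker,
    LinearMap.mem_ker, gAct, gAct, gAct, realise_e1m, realise_e2m, realise_e3m, and_assoc]

theorem KAct_eq_zero_of_comm {X Y : HC c} {k : ℂ} (h : X * Y - Y * X = k • Y) {u : KMod c τ}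
    (hu : KAct c τ Y u = 0) : KAct c τ Y (KAct c τ X u) = 0 := by
  have h' : Y * X = X * Y - k • Y := by rw [← h]; abel
  rw [← KAct_mul, h', map_sub, map_smul, LinearMap.sub_apply, LinearMap.smul_apply, KAct_mul, hu,
    map_zero, smul_zero, sub_zero]

theorem lw_opH {u : KMod c τ} (hu : u ∈ lw c τ) : KAct c τ (opH c) u ∈ lw c τ := by
  rw [mem_lw] at hu ⊢
  exact ⟨KAct_eq_zero_of_comm (H_E1m c) hu.1, KAct_eq_zero_of_comm (H_E2m c) hu.2.1,
    KAct_eq_zero_of_comm (H_E3m c) hu.2.2⟩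

theorem lw_hcN {u : KMod c τ} (hu : u ∈ lw c τ) : KAct c τ (hcN c) u ∈ lw c τ := by
  rw [mem_lw] at hu ⊢
  exact ⟨KAct_eq_zero_of_comm (N_E1m c) hu.1, KAct_eq_zero_of_comm (N_E2m c) hu.2.1,
    KAct_eq_zero_of_comm (N_E3m c) hu.2.2⟩

theorem lw_KW (w : D.W) {u : KMod c τ} (hu : u ∈ lw c τ) : KW c τ w u ∈ lw c τ := by
  obtain ⟨⟨h1, h2⟩, h3⟩ := hu
  simp only [SetLike.mem_coe, LinearMap.mem_ker] at h1 h2 h3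
  exact ⟨⟨by simp [gAct_KW, h1], by simp [gAct_KW, h2]⟩, by simp [gAct_KW, h3]⟩

variable (hτ : τ.IsIrreducible) {U : Type} [AddCommGroup U] [Module ℂ U]
  {σ : Representation ℂ D.W U} (hσ : σ.IsIrreducible)

include hτ hσ

theorem isLW_of_mem {m l : ℕ} {θ : KMod c τ} (h : θ ∈ lwDeg c τ σ m l) :
    IsLW (wtOf c τ σ m l) θ := by
  obtain ⟨h1, h2, h3⟩ := mem_lw.1 h.1
  exact ⟨by rw [toU_gh, KAct_opH hτ h.2.1]; rfl, by rw [toU_gz, KAct_opZ h.2.1 hσ h.2.2]; rfl,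
    by rw [toU_e1m, h1], by rw [toU_e2m, h2], by rw [toU_e3m, h3]⟩

/-- The anticommutator of `e_2^-` and `e_2^+` is `h + z`, whose value on `θ` is the sum of the two
weight components; the shifts `±r/2` cancel. Through this scalar the assumption on `N_c(τ) - N_c(σ)`
enters. -/
theorem e2m_e2p_of_mem {m l : ℕ} {θ : KMod c τ} (h : θ ∈ lwDeg c τ σ m l) :
    KAct c τ (opE2m c) (KAct c τ (opE2p c) θ) = (m + l + (Nc c σ - Nc c τ)) • θ := by
  have hLW := isLW_of_mem hτ hσ h
  have := hLW.e2m_vB 0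
  rw [vB, vA_zero, toU_e2m, toU_e2p] at this
  rw [this, wtOf]
  congr 1
  push_cast
  ring

/-- The anticommutator of `e_3^-` and `e_2^+` is a multiple of `e_1^-`, and both lowering operators
kill `θ`. -/
theorem e3m_e2p_of_mem {m l : ℕ} {θ : KMod c τ} (h : θ ∈ lwDeg c τ σ m l) :
    KAct c τ (opE3m c) (KAct c τ (opE2p c) θ) = 0 := by
  have hLW := isLW_of_mem hτ hσ h
  have := hLW.e3m_vB 0
  rwa [vB, vA_zero, toU_e3m, toU_e2p, hLW.m1, smul_zero] at this

end lowest

/-- By unitarity, a vector of positive degree is not killed by `𝔥`. -/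
theorem eq_zero_of_y_eq_zero {c : Param D} {V : Type} [AddCommGroup V] [Module ℂ V]
    {τ : Representation ℂ D.W V} {β : StdMod c τ →ₗ⋆[ℂ] StdMod c τ →ₗ[ℂ] ℂ}
    (h1 : ∀ u v, conj (β u v) = β v u) (h2 : ∀ u, u ≠ 0 → 0 < (β u u).re)
    (h3 : ∀ a u v, β (stdAct c τ a u) v = β u (stdAct c τ (RCA.star c a) v)) {m l : ℕ}
    {u : KMod c τ} (hu : u ∈ KDeg c τ (m + 1) l)
    (hy : ∀ j, KAct c τ (RCA.y c (bv j) ⊗ₜ 1) u = 0) : u = 0 := by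
  have hc := kForm_isContra h1 h2 h3
  have horth : u ∈ LinearMap.ker (kForm β u) := by
    refine KDeg_succ_induction (p := LinearMap.ker (kForm β u)) (fun i w => ?_) hu
    have h := kForm_adj h3 (RCA.x c (bv i) ⊗ₜ 1) w u
    rw [HCstar_tmul, RCA.star_x, cj_bv, cliffStar_one, hy, map_zero] at h
    exact LinearMap.mem_ker.2 (hc.symm_zero h)
  exact hc.eq_zero horth

/-! ### Bidegrees and weights that can occur -/

section generic

variable {c : Param D} {I : IrrReps D.W} {τ : I.ι}
  (hgen₂ : ∀ σ : I.ι, σ ≠ τ → ∀ n : ℕ, Nc c (I.ρ τ) - Nc c (I.ρ σ) ≠ (n : ℂ))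

include hgen₂

theorem eq_zero_of_add_Nc {m l : ℕ} {σ : I.ι}
    (h : (m + l + (Nc c (I.ρ σ) - Nc c (I.ρ τ)) : ℂ) = 0) : σ = τ ∧ m = 0 ∧ l = 0 := by
  by_cases hσ : σ = τ
  · subst hσ
    rw [sub_self, add_zero] at h
    have : m + l = 0 := by exact_mod_cast h
    exact ⟨rfl, by omega, by omega⟩
  · exact absurd (by push_cast; linear_combination -h) (hgen₂ σ hσ (m + l))

theorem eq_zero_of_e2p_eq_zero {m l : ℕ} {σ : I.ι} {θ : KMod c (I.ρ τ)}
    (hθ : θ ∈ lwDeg c (I.ρ τ) (I.ρ σ) m l) (h0 : θ ≠ 0) (h : KAct c (I.ρ τ) (opE2p c) θ = 0) :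
    σ = τ ∧ m = 0 ∧ l = 0 := by
  have := e2m_e2p_of_mem (I.irreducible τ) (I.irreducible σ) hθ
  rw [h, map_zero] at this
  exact eq_zero_of_add_Nc hgen₂ ((smul_eq_zero.1 this.symm).resolve_right h0)

variable {β : StdMod c (I.ρ τ) →ₗ⋆[ℂ] StdMod c (I.ρ τ) →ₗ[ℂ] ℂ}
  (h1 : ∀ u v, conj (β u v) = β v u) (h2 : ∀ u, u ≠ 0 → 0 < (β u u).re)
  (h3 : ∀ a u v, β (stdAct c (I.ρ τ) a u) v = β u (stdAct c (I.ρ τ) (RCA.star c a) v))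

include h1 h2 h3

/-- Lowest weight vectors only occur in the bidegrees of `B(r)`. -/
theorem mem_B_of_ne_zero {m l : ℕ} {σ : I.ι} {θ : KMod c (I.ρ τ)}
    (hθ : θ ∈ lwDeg c (I.ρ τ) (I.ρ σ) m l) (h0 : θ ≠ 0) : (m, l) ∈ B r := by
  have hlr : l ≤ r := by
    by_contra! h
    exact h0 (KDeg_eq_zero h hθ.2.1)
  rcases Nat.eq_zero_or_pos m with rfl | hm
  -- Since `e_2^+` lowers `m`, it kills the whole of `m = 0`.
  · obtain ⟨-, -, rfl⟩ := eq_zero_of_e2p_eq_zero hgen₂ hθ h0 (opE2p_eq_zero hθ.2.1)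
    exact Or.inl rfl
  obtain ⟨k, rfl⟩ : ∃ k, m = k + 1 := ⟨m - 1, by omega⟩
  have hκ := opE2p_mem hθ.2.1
  -- For `l = r` the vector `e_2^+ θ` would have exterior degree `r + 1`.
  have hl : l < r := by
    by_contra! h
    have := eq_zero_of_e2p_eq_zero hgen₂ hθ h0 (KDeg_eq_zero (by omega) hκ)
    omega
  by_cases hr : l + 2 ≤ r
  · exact Or.inr (Or.inr ⟨hm, hr⟩)
  have hlr : l + 1 = r := by omega
  rcases Nat.eq_zero_or_pos k with rfl | hk
  · exact Or.inr (Or.inl ⟨rfl, hlr⟩)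
  exfalso
  obtain ⟨j, rfl⟩ : ∃ j, k = j + 1 := ⟨k - 1, by omega⟩
  rw [hlr] at hκ
  -- Here `l = r - 1` and `m ≥ 2`, so `e_2^+ θ` has top exterior degree and positive polynomial
  -- degree `m - 1`. Being killed by `𝔥`, it vanishes by unitarity.
  have hy := y_eq_zero_of_top hκ (e3m_e2p_of_mem (I.irreducible τ) (I.irreducible σ) hθ)
  have hκ0 := eq_zero_of_y_eq_zero h1 h2 h3 hκ hy
  have := eq_zero_of_e2p_eq_zero hgen₂ hθ h0 hκ0
  omega

/-! The structure of the lowest weight modules that occur. -/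

omit h1 h2 h3 in
theorem wt_zero {σ : I.ι} {θ : KMod c (I.ρ τ)} (hθ : θ ∈ lwDeg c (I.ρ τ) (I.ρ σ) 0 0)
    (h0 : θ ≠ 0) : (wtOf c (I.ρ τ) (I.ρ σ) 0 0).1 + (wtOf c (I.ρ τ) (I.ρ σ) 0 0).2 = 0 := by
  obtain ⟨rfl, -⟩ := eq_zero_of_e2p_eq_zero hgen₂ hθ h0 (opE2p_eq_zero hθ.2.1)
  rw [wtOf]
  ring

omit h1 h2 h3 in
-- The nonzero vector `e_2^+ θ` lies in `K_0^r`, where `W` acts through the twist of `τ` by the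
-- determinant, so `z = r/2 - N_c(τ)` there. Comparison with its `z`-weight `b + 1` gives `b`, while
-- `a = 1 + r/2 - N_c(τ)`.
theorem wt_one {l : ℕ} (hl : l + 1 = r) {σ : I.ι} {θ : KMod c (I.ρ τ)}
    (hθ : θ ∈ lwDeg c (I.ρ τ) (I.ρ σ) 1 l) (h0 : θ ≠ 0) :
    (wtOf c (I.ρ τ) (I.ρ σ) 1 l).1 - (wtOf c (I.ρ τ) (I.ρ σ) 1 l).2 - 2 = 0 := by
  have hκ : KAct c (I.ρ τ) (opE2p c) θ ∈ KDeg c (I.ρ τ) 0 (l + 1) := opE2p_mem hθ.2.1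
  rw [hl] at hκ
  have hLW := isLW_of_mem (I.irreducible τ) (I.irreducible σ) hθ
  have hz := hLW.z_vB 0
  rw [vB, vA_zero, toU_gz, toU_e2p, KAct_opZ_top (I.irreducible τ) hκ] at hz
  have hκ0 : KAct c (I.ρ τ) (opE2p c) θ ≠ 0 := fun h => by
    have := eq_zero_of_e2p_eq_zero hgen₂ hθ h0 h
    omega
  have := smul_left_injective ℂ hκ0 hz
  have e : (wtOf c (I.ρ τ) (I.ρ σ) 1 l).1 = ((1 : ℕ) : ℂ) + r / 2 - Nc c (I.ρ τ) := rfl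
  rw [e]
  push_cast
  linear_combination this

omit h1 h2 h3 in
-- The first number is the scalar of `e2m_e2p_of_mem`. If the second vanished, the twist `σ'` of `σ`
-- by the determinant would satisfy `N_c(τ) - N_c(σ') = m + r - l - 2`, a natural number that is at
-- least `m ≥ 1`. This is excluded both for `σ' ≠ τ` and for `σ' = τ`.
theorem wt_typical {m l : ℕ} (hm : 1 ≤ m) (hl : l + 2 ≤ r) (σ : I.ι) :
    (wtOf c (I.ρ τ) (I.ρ σ) m l).1 + (wtOf c (I.ρ τ) (I.ρ σ) m l).2 ≠ 0 ∧
    (wtOf c (I.ρ τ) (I.ρ σ) m l).1 - (wtOf c (I.ρ τ) (I.ρ σ) m l).2 - 2 ≠ 0 := by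
  refine ⟨fun h => ?_, fun h => ?_⟩
  · rw [wtOf] at h
    have := eq_zero_of_add_Nc hgen₂ (m := m) (l := l) (σ := σ) (by linear_combination h)
    omega
  · rw [wtOf] at h
    have hirr := twist_irreducible (detChar D) (I.irreducible σ)
    obtain ⟨σ', ⟨e⟩⟩ := I.complete _ _ hirr
    have hN : Nc c (I.ρ σ') = -Nc c (I.ρ σ) := by
      rw [Nc_equiv c (I.irreducible σ') hirr e, Nc_twist c (I.irreducible σ)]
    obtain ⟨k, hk⟩ : ∃ k : ℕ, m + r = l + 2 + k := ⟨m + r - l - 2, by omega⟩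
    have hk' : (m + r : ℂ) = l + 2 + k := by exact_mod_cast hk
    have hd : Nc c (I.ρ τ) - Nc c (I.ρ σ') = k := by
      rw [hN]
      linear_combination -h + hk'
    by_cases hs : σ' = τ
    · rw [hs, sub_self] at hd
      have : k = 0 := by exact_mod_cast hd.symm
      omega
    · exact hgen₂ σ' hs k hd

end generic

/-! ## Positive definite forms -/

section posdef

variable {N : Type*} [AddCommGroup N] [Module ℂ N] {β : N →ₗ⋆[ℂ] N →ₗ[ℂ] ℂ}

/-- The inner product space structure given by a positive definite Hermitian form. -/
@[reducible]
def formCore (h1 : ∀ u v, conj (β u v) = β v u) (h2 : ∀ u, u ≠ 0 → 0 < (β u u).re) :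
    InnerProductSpace.Core ℂ N where
  inner u v := β u v
  conj_inner_symm u v := h1 v u
  re_inner_nonneg u := by
    by_cases h : u = 0
    · simp [h]
    · exact (h2 u h).le
  add_left u v w := by rw [map_add, LinearMap.add_apply]
  smul_left u v z := by rw [LinearMap.map_smulₛₗ, LinearMap.smul_apply, smul_eq_mul]
  definite u hu := by
    by_contra h
    have := h2 u h
    rw [hu] at this
    simp at this

theorem exists_orth_proj (h1 : ∀ u v, conj (β u v) = β v u) (h2 : ∀ u, u ≠ 0 → 0 < (β u u).re)
    (p : Submodule ℂ N) [FiniteDimensional ℂ p] (u : N) :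
    ∃ a ∈ p, ∀ w ∈ p, β w (u - a) = 0 := by
  let core := formCore h1 h2
  let : NormedAddCommGroup N := core.toNormedAddCommGroup
  let : InnerProductSpace ℂ N := InnerProductSpace.ofCore core.toCore
  obtain ⟨a, ha, b, hb, hu⟩ := p.exists_add_mem_mem_orthogonal u
  refine ⟨a, ha, fun w hw => ?_⟩
  rw [hu, add_sub_cancel_left]
  exact (Submodule.mem_orthogonal p b).1 hb w hw

theorem exists_orth_basis (h1 : ∀ u v, conj (β u v) = β v u)
    (h2 : ∀ u, u ≠ 0 → 0 < (β u u).re) (p : Submodule ℂ N) [FiniteDimensional ℂ p] :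
    ∃ (n : ℕ) (b : Module.Basis (Fin n) ℂ p), ∀ i j, i ≠ j → β (b i) (b j) = 0 := by
  let core := formCore h1 h2
  let : NormedAddCommGroup N := core.toNormedAddCommGroup
  let : InnerProductSpace ℂ N := InnerProductSpace.ofCore core.toCore
  refine ⟨_, (stdOrthonormalBasis ℂ p).toBasis, fun i j hij => ?_⟩
  have := (stdOrthonormalBasis ℂ p).orthonormal.2 hij
  rwa [OrthonormalBasis.coe_toBasis]

theorem orth_of_eigen (h2 : ∀ u, u ≠ 0 → 0 < (β u u).re)
    {T : N →ₗ[ℂ] N} (hT : ∀ u v, β (T u) v = β u (T v)) {μ μ' : ℂ} (hμ : μ ≠ μ') {u v : N}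
    (hu : T u = μ • u) (hv : T v = μ' • v) : β u v = 0 := by
  by_cases h0 : u = 0
  · simp [h0]
  -- A self-adjoint operator has real eigenvalues on nonzero vectors; the weights are not assumed to
  -- be real.
  have hr : conj μ = μ := by
    have := hT u u
    rw [hu, LinearMap.map_smulₛₗ, LinearMap.smul_apply, map_smul] at this
    refine mul_right_cancel₀ (fun h => ?_) this
    have := h2 u h0
    rw [h] at this
    simp at this
  have := hT u v
  rw [hu, hv, LinearMap.map_smulₛₗ, LinearMap.smul_apply, map_smul, hr, smul_eq_mul, smul_eq_mul,
    ← sub_eq_zero, ← sub_mul] at this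
  exact (mul_eq_zero.1 this).resolve_left (sub_ne_zero.2 hμ)

end posdef

/-! ## Sums of families of modules -/

section family

variable {P J : Type*} [DecidableEq P] {A : P → Type*} [∀ p, AddCommGroup (A p)]
  [∀ p, Module ℂ (A p)] {N : Type*} [AddCommGroup N] [Module ℂ N] (φ : ∀ p, A p →ₗ[ℂ] N)
  (f : P → J) {T : J → Submodule ℂ N} (hT : ∀ p x, φ p x ∈ T (f p))
  (hdisj : ∀ j, Disjoint (T j) (⨆ k ∈ {k | k ≠ j}, T k))

theorem toModule_eq_sum (x : ⨁ p, A p) :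
    ∃ s : Finset P, x = ∑ p ∈ s, DirectSum.lof ℂ P A p (x p) ∧
      DirectSum.toModule ℂ P N φ x = ∑ p ∈ s, φ p (x p) := by
  classical
  have h : x = ∑ p ∈ DFinsupp.support x, DirectSum.lof ℂ P A p (x p) :=
    (DirectSum.sum_support_of x).symm
  refine ⟨_, h, ?_⟩
  conv_lhs => rw [h]
  rw [map_sum]
  exact Finset.sum_congr rfl fun p _ => DirectSum.toModule_lof ℂ p _

include hT hdisj

theorem sum_filter_eq [DecidableEq J] {j : J} {s : Finset P} {x : ∀ p, A p}
    (h : ∑ p ∈ s, φ p (x p) ∈ T j) :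
    ∑ p ∈ s with f p = j, φ p (x p) = ∑ p ∈ s, φ p (x p) := by
  rw [← Finset.sum_filter_add_sum_filter_not s (fun p => f p = j)] at h ⊢
  have ha : ∑ p ∈ s with f p = j, φ p (x p) ∈ T j := Submodule.sum_mem _ fun p hp => by
    rw [← (Finset.mem_filter.1 hp).2]
    exact hT p _
  have hb : ∑ p ∈ s with ¬ f p = j, φ p (x p) ∈ ⨆ k ∈ {k | k ≠ j}, T k :=
    Submodule.sum_mem _ fun p hp =>
      Submodule.mem_iSup_of_mem (f p) (Submodule.mem_iSup_of_mem (Finset.mem_filter.1 hp).2 (hT p _))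
  have hb' := (Submodule.add_mem_iff_right _ ha).1 h
  rw [Submodule.disjoint_def.1 (hdisj j) _ hb' hb, add_zero]

/-- Two mechanisms are combined: independence of the subspaces `T j` separates different labels, and
orthogonality separates the summands with the same label. Orthogonality between different labels is
not required, which matters because equal weights may occur for different `W`-types. -/
theorem toModule_injective (hinj : ∀ p, Function.Injective (φ p)) {β : N →ₗ⋆[ℂ] N →ₗ[ℂ] ℂ}
    (hβ : ∀ u, β u u = 0 → u = 0)
    (horth : ∀ p q, p ≠ q → f p = f q → ∀ x y, β (φ p x) (φ q y) = 0) :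
    Function.Injective (DirectSum.toModule ℂ P N φ) := by
  classical
  rw [injective_iff_map_eq_zero]
  intro x hx
  obtain ⟨s, hs, hsum⟩ := toModule_eq_sum φ x
  rw [hsum] at hx
  rw [hs]
  refine Finset.sum_eq_zero fun p hp => ?_
  have h1 := sum_filter_eq φ f hT hdisj (j := f p) (s := s) (x := x)
    (by rw [hx]; exact zero_mem _)
  rw [hx] at h1
  have h2 : β (φ p (x p)) (∑ q ∈ s with f q = f p, φ q (x q)) = β (φ p (x p)) (φ p (x p)) := by
    rw [map_sum, Finset.sum_eq_single p]
    · intro q hq hqp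
      exact horth p q hqp.symm (Finset.mem_filter.1 hq).2.symm _ _
    · intro h
      exact absurd (by simp [hp]) h
  rw [h1, map_zero] at h2
  have h3 := hβ _ h2.symm
  rw [(injective_iff_map_eq_zero (φ p)).1 (hinj p) _ h3, map_zero]

theorem mem_iSup_range {j : J} {x : ⨁ p, A p} (h : DirectSum.toModule ℂ P N φ x ∈ T j) :
    DirectSum.toModule ℂ P N φ x ∈ ⨆ (p : P) (_ : f p = j), LinearMap.range (φ p) := by
  classical
  obtain ⟨s, hs, hsum⟩ := toModule_eq_sum φ x
  rw [hsum] at h ⊢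
  rw [← sum_filter_eq φ f hT hdisj h]
  exact Submodule.sum_mem _ fun p hp => Submodule.mem_iSup_of_mem p
    (Submodule.mem_iSup_of_mem (Finset.mem_filter.1 hp).2 ⟨_, rfl⟩)

end family

/-! ## Multiplicity spaces -/

namespace IsContra

variable {N : Type*} [AddCommGroup N] [Module ℂ N] [Module Ug N] [IsScalarTower ℂ Ug N]
  {β : N →ₗ⋆[ℂ] N →ₗ[ℂ] ℂ} (hβ : IsContra β) {wt : ℂ × ℂ} {p : Submodule ℂ N}
  (hp : ∀ θ ∈ p, IsLW wt θ)

/-- The map `p ⊗ L(λ) → N` for a space `p` of lowest weight vectors of weight `λ`. -/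
def multMap : p ⊗[ℂ] Irr wt →ₗ[ℂ] N :=
  TensorProduct.lift (LinearMap.mk₂ ℂ (fun (θ : p) (u : Irr wt) => hβ.irrLift (hp θ.1 θ.2) u)
    (fun θ θ' u => by
      obtain ⟨a, rfl⟩ := exists_smul_lwVec u
      rw [irrLift_smul, irrLift_smul, irrLift_smul, Submodule.coe_add, smul_add])
    (fun z θ u => by
      obtain ⟨a, rfl⟩ := exists_smul_lwVec u
      rw [irrLift_smul, irrLift_smul, Submodule.coe_smul]
      exact (ugLin N a).map_smul z θ.1)
    (fun θ u u' => map_add _ u u')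
    (fun z θ u => LinearMap.map_smul_of_tower _ z u))

theorem multMap_tmul (θ : p) (u : Irr wt) :
    hβ.multMap hp (θ ⊗ₜ u) = hβ.irrLift (hp θ.1 θ.2) u := rfl

theorem multMap_tmul_lwVec (θ : p) : hβ.multMap hp (θ ⊗ₜ lwVec wt) = θ := by
  rw [multMap_tmul]; exact irrLift_lwVec hβ (hp θ.1 θ.2)

theorem multMap_tmul_smul (θ : p) (a : Ug) (u : Irr wt) :
    hβ.multMap hp (θ ⊗ₜ (a • u)) = a • hβ.multMap hp (θ ⊗ₜ u) := by
  rw [multMap_tmul, multMap_tmul, map_smul]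

/-- The image of `multMap` is spanned by the vectors `a • θ`. -/
theorem multMap_mem {q : Submodule ℂ N} (h : ∀ θ ∈ p, ∀ a : Ug, a • θ ∈ q)
    (x : p ⊗[ℂ] Irr wt) : hβ.multMap hp x ∈ q := by
  induction x using TensorProduct.induction_on with
  | zero => rw [map_zero]; exact zero_mem _
  | add x y hx hy => rw [map_add]; exact q.add_mem hx hy
  | tmul θ u =>
    obtain ⟨a, rfl⟩ := exists_smul_lwVec u
    rw [multMap_tmul, irrLift_smul]
    exact h _ θ.2 a

theorem multMap_orth {wt' : ℂ × ℂ} {p' : Submodule ℂ N} (hp' : ∀ θ ∈ p', IsLW wt' θ)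
    (h : ∀ θ ∈ p, ∀ θ' ∈ p', β θ θ' = 0) (x : p ⊗[ℂ] Irr wt) (y : p' ⊗[ℂ] Irr wt') :
    β (hβ.multMap hp x) (hβ.multMap hp' y) = 0 := by
  have h1 : ∀ θ ∈ p, ∀ a : Ug, β (a • θ) (hβ.multMap hp' y) = 0 := fun θ hθ a =>
    hβ.multMap_mem hp' (q := LinearMap.ker (β (a • θ))) (fun θ' hθ' b =>
      hβ.smul_smul_eq_zero (hp θ hθ) (hp' θ' hθ') (h θ hθ θ' hθ') a b) y
  refine hβ.symm_zero (hβ.multMap_mem hp (q := LinearMap.ker (β (hβ.multMap hp' y)))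
    (fun θ hθ a => hβ.symm_zero (h1 θ hθ a)) x)

/-- Along an orthogonal basis of `p` the image splits into pairwise orthogonal copies of `L(λ)`.
Pairing the image of `x` with its `i`-th part leaves the norm of that part. -/
theorem multMap_injective [FiniteDimensional ℂ p] : Function.Injective (hβ.multMap hp) := by
  rw [injective_iff_map_eq_zero]
  intro x hx
  obtain ⟨n, b, hb⟩ := exists_orth_basis hβ.herm hβ.pos p
  obtain ⟨u, rfl⟩ := TensorProduct.eq_repr_basis_left b x
  rw [Finsupp.sum_fintype _ _ (by simp)] at hx ⊢
  refine Finset.sum_eq_zero fun i _ => ?_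
  have hi : hβ.irrLift (hp (b i).1 (b i).2) (u i) = 0 := by
    refine hβ.eq_zero ?_
    have h2 : β (hβ.irrLift (hp (b i).1 (b i).2) (u i))
        (hβ.multMap hp (∑ j, b j ⊗ₜ[ℂ] u j)) =
        β (hβ.irrLift (hp (b i).1 (b i).2) (u i)) (hβ.irrLift (hp (b i).1 (b i).2) (u i)) := by
      rw [map_sum, map_sum, Finset.sum_eq_single i]
      · rfl
      · intro j _ hj
        rw [multMap_tmul]
        obtain ⟨a, ha⟩ := exists_smul_lwVec (u i)
        obtain ⟨a', ha'⟩ := exists_smul_lwVec (u j)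
        rw [ha, ha', irrLift_smul, irrLift_smul]
        exact hβ.smul_smul_eq_zero (hp _ (b i).2) (hp _ (b j).2) (hb i j hj.symm) a a'
      · simp
    rw [← h2, hx, map_zero]
  have hb0 : (b i : N) ≠ 0 := fun h => b.ne_zero i (Subtype.ext h)
  rw [(injective_iff_map_eq_zero _).1 (hβ.irrLift_injective _ hb0) _ hi, TensorProduct.tmul_zero]

end IsContra

/-! ## Spaces of lowest weight vectors -/

section spaces

variable {c : Param D} {V : Type} [AddCommGroup V] [Module ℂ V] {τ : Representation ℂ D.W V}
  (hτ : τ.IsIrreducible) (I : IrrReps D.W)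

theorem mem_lwWeight {wt : ℂ × ℂ} {u : KMod c τ} : u ∈ lwWeight c τ wt ↔ IsLW wt u := by
  rw [lwWeight, lw, Submodule.mem_inf, Submodule.mem_inf, Submodule.mem_inf, Submodule.mem_inf,
    LinearMap.mem_ker, LinearMap.mem_ker, LinearMap.mem_ker, LinearMap.mem_ker, LinearMap.mem_ker,
    LinearMap.sub_apply, LinearMap.sub_apply, LinearMap.smul_apply, LinearMap.smul_apply,
    Module.End.one_apply, sub_eq_zero, sub_eq_zero, ← toU_smul, ← toU_smul, ← toU_smul,
    ← toU_smul, ← toU_smul]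
  exact ⟨fun ⟨⟨⟨h1, h2⟩, h3⟩, h4, h5⟩ => ⟨h4, h5, h1, h2, h3⟩,
    fun h => ⟨⟨⟨h.m1, h.m2⟩, h.m3⟩, h.h, h.z⟩⟩

include hτ

theorem lw_inf_KDeg_le {m l : ℕ} {R : Submodule ℂ (KMod c τ)}
    (h : ∀ i, lwDeg c τ (I.ρ i) m l ≤ R) : lw c τ ⊓ KDeg c τ m l ≤ R := by
  refine (le_iSup_inf hτ I (S := lw c τ ⊓ KDeg c τ m l) (fun u hu => ⟨lw_opH hu.1, ?_⟩)
    (fun u hu => ⟨lw_hcN hu.1, ?_⟩) (fun w u hu => ⟨lw_KW w hu.1, KW_mem_KDeg w hu.2⟩)).trans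
    (iSup_le fun m' => iSup_le fun l' => iSup_le fun i u hu => h i ⟨hu.1.1.1, hu.1.1.2, hu.2⟩)
  · rw [KAct_opH hτ hu.2]
    exact Submodule.smul_mem _ _ hu.2
  · rw [KAct_hcN hu.2]
    exact Submodule.smul_mem _ _ hu.2

theorem lw_le : lw c τ ≤ ⨆ m, ⨆ l, ⨆ i, lwDeg c τ (I.ρ i) m l := by
  refine (le_iSup_inf hτ I (S := lw c τ) (fun u hu => lw_opH hu) (fun u hu => lw_hcN hu)
    (fun w u hu => lw_KW w hu)).trans
    (iSup_mono fun m => iSup_mono fun l => iSup_mono fun i u hu => ⟨hu.1.1, hu.1.2, hu.2⟩)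

theorem finiteDimensional_KDeg_of_irreducible (m l : ℕ) : FiniteDimensional ℂ (KDeg c τ m l) := by
  have := finiteDimensional_of_irreducible τ hτ
  exact finiteDimensional_KDeg m l

theorem finiteDimensional_lwDeg {U : Type} [AddCommGroup U] [Module ℂ U]
    (σ : Representation ℂ D.W U) (m l : ℕ) : FiniteDimensional ℂ (lwDeg c τ σ m l) := by
  have := finiteDimensional_KDeg_of_irreducible (c := c) hτ m l
  exact Submodule.finiteDimensional_of_le (S₂ := KDeg c τ m l) fun u hu => hu.2.1

variable {β : StdMod c τ →ₗ⋆[ℂ] StdMod c τ →ₗ[ℂ] ℂ} (hβ : IsContra (kForm β))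

include hβ

/-- The operators `e_1^-`, `e_2^-`, `e_3^-` lower `m + 2l` by `2`, `1`, `3`, although `e_2^-` raises
`m`. Finite dimension allows an orthogonal projection onto `R ∩ K_m^l`, and the remainder of the
projection turns out to be a lowest weight vector. -/
theorem KDeg_le_of_lwDeg_le {R : Submodule ℂ (KMod c τ)}
    (h1 : ∀ u ∈ R, KAct c τ (opE1p c) u ∈ R) (h2 : ∀ u ∈ R, KAct c τ (opE2p c) u ∈ R)
    (h3 : ∀ u ∈ R, KAct c τ (opE3p c) u ∈ R) (h : ∀ m l i, lwDeg c τ (I.ρ i) m l ≤ R)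
    (n : ℕ) : ∀ m l, m + 2 * l ≤ n → KDeg c τ m l ≤ R := by
  induction n using Nat.strong_induction_on with
  | _ n ih =>
  intro m l hml u hu
  have := finiteDimensional_KDeg_of_irreducible (c := c) hτ m l
  have hfd : FiniteDimensional ℂ (R ⊓ KDeg c τ m l : Submodule ℂ (KMod c τ)) :=
    Submodule.finiteDimensional_of_le (S₂ := KDeg c τ m l) inf_le_right
  obtain ⟨a, ha, hperp⟩ := exists_orth_proj hβ.herm hβ.pos (R ⊓ KDeg c τ m l) u
  have hv : u - a ∈ KDeg c τ m l := Submodule.sub_mem _ hu ha.2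
  have hlw : u - a ∈ lw c τ := by
    generalize u - a = v at hv hperp
    refine mem_lw.2 ⟨?_, ?_, ?_⟩
    · by_cases hm : m < 2
      · exact opE1m_eq_zero hm hv
      obtain ⟨k, rfl⟩ : ∃ k, m = k + 2 := ⟨m - 2, by omega⟩
      have he := opE1m_mem hv
      -- By induction `e_1^- v` lies in `R`, so `e_1^+ e_1^- v` lies in `R ∩ K_m^l` and is
      -- orthogonal to `v`. By adjunction the norm of `e_1^- v` is zero. The other two operators are
      -- treated in the same way.
      have hz := hperp _ ⟨h1 _ (ih (k + 2 * l) (by omega) k l le_rfl he), opE1p_mem he⟩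
      have := hβ.adj1 v (KAct c τ (opE1m c) v)
      rw [toU_e1p, toU_e1m, hβ.symm_zero hz] at this
      exact hβ.eq_zero (neg_eq_zero.1 this.symm)
    · rcases l with _ | k
      · exact opE2m_eq_zero hv
      have he := opE2m_mem hv
      have hz := hperp _ ⟨h2 _ (ih (m + 1 + 2 * k) (by omega) (m + 1) k le_rfl he), opE2p_mem he⟩
      have := hβ.adj2 v (KAct c τ (opE2m c) v)
      rw [toU_e2p, toU_e2m, hβ.symm_zero hz] at this
      exact hβ.eq_zero this.symm
    · by_cases h0 : m = 0 ∨ l = 0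
      · exact opE3m_eq_zero h0 hv
      obtain ⟨k, rfl⟩ : ∃ k, m = k + 1 := ⟨m - 1, by omega⟩
      obtain ⟨j, rfl⟩ : ∃ j, l = j + 1 := ⟨l - 1, by omega⟩
      have he := opE3m_mem hv
      have hz := hperp _ ⟨h3 _ (ih (k + 2 * j) (by omega) k j le_rfl he), opE3p_mem he⟩
      have := hβ.adj3 v (KAct c τ (opE3m c) v)
      rw [toU_e3p, toU_e3m, hβ.symm_zero hz] at this
      exact hβ.eq_zero this.symm
  have : u - a ∈ R := lw_inf_KDeg_le hτ I (h m l) ⟨hlw, hv⟩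
  simpa using R.add_mem this ha.1

/-- `K_c(τ)` is generated by its lowest weight vectors. -/
theorem eq_top_of_lwDeg_le {R : Submodule ℂ (KMod c τ)}
    (h1 : ∀ u ∈ R, KAct c τ (opE1p c) u ∈ R) (h2 : ∀ u ∈ R, KAct c τ (opE2p c) u ∈ R)
    (h3 : ∀ u ∈ R, KAct c τ (opE3p c) u ∈ R) (h : ∀ m l i, lwDeg c τ (I.ρ i) m l ≤ R) :
    R = ⊤ :=
  eq_top_iff.2 fun u _ => (iSup_le fun m => iSup_le fun l =>
    KDeg_le_of_lwDeg_le hτ I hβ h1 h2 h3 h _ m l le_rfl : ⨆ m, ⨆ l, KDeg c τ m l ≤ R)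
    (mem_iSup_KDeg u)

end spaces

/-! ### Orthogonality of weights and the action of the centraliser -/

section weights

variable {c : Param D} {V : Type} [AddCommGroup V] [Module ℂ V] {τ : Representation ℂ D.W V}

/-- Lowest weight vectors of different weights are orthogonal. -/
theorem kForm_eq_zero_of_wt_ne {β : StdMod c τ →ₗ⋆[ℂ] StdMod c τ →ₗ[ℂ] ℂ}
    (h1 : ∀ u v, conj (β u v) = β v u) (h2 : ∀ u, u ≠ 0 → 0 < (β u u).re)
    (h3 : ∀ a u v, β (stdAct c τ a u) v = β u (stdAct c τ (RCA.star c a) v)) {wt wt' : ℂ × ℂ}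
    (hwt : wt ≠ wt') {u v : KMod c τ} (hu : IsLW wt u) (hv : IsLW wt' v) : kForm β u v = 0 := by
  have hc := kForm_isContra h1 h2 h3
  have hH : ∀ u v, kForm β (KAct c τ (opH c) u) v = kForm β u (KAct c τ (opH c) v) := fun u v => by
    rw [kForm_adj h3, HCstar_opH]
  have hZ : ∀ u v, kForm β (KAct c τ (opZ c) u) v = kForm β u (KAct c τ (opZ c) v) := fun u v => by
    rw [kForm_adj h3, HCstar_opZ]
  by_cases h : wt.1 = wt'.1
  · have h' : wt.2 ≠ wt'.2 := fun h' => hwt (Prod.ext h h')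
    exact orth_of_eigen hc.pos hZ h' (by rw [← toU_gz, hu.z]) (by rw [← toU_gz, hv.z])
  · exact orth_of_eigen hc.pos hH h (by rw [← toU_gh, hu.h]) (by rw [← toU_gh, hv.h])

theorem KAct_ug_smul {X : HC c} (hX : X ∈ Rc c) (a : Ug) (u : KMod c τ) :
    KAct c τ X (a • u) = a • KAct c τ X u := by
  induction a using Ug_induction generalizing u with
  | h1 z => rw [algebraMap_smul, algebraMap_smul, map_smul]
  | hadd a b ha hb => rw [add_smul, add_smul, map_add, ha, hb]
  | hmul a b ha hb => rw [mul_smul, mul_smul, ha, hb]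
  | h Y =>
    rw [Rc, Subalgebra.mem_centralizer_iff] at hX
    rw [toU_smul, toU_smul, gAct, ← KAct_mul, ← KAct_mul, hX _ ⟨Y, rfl⟩]

theorem lwWeight_stable {X : HC c} (hX : X ∈ Rc c) {wt : ℂ × ℂ} {u : KMod c τ}
    (hu : u ∈ lwWeight c τ wt) : KAct c τ X u ∈ lwWeight c τ wt := by
  rw [mem_lwWeight] at hu ⊢
  exact ⟨by rw [← KAct_ug_smul hX, hu.h, map_smul], by rw [← KAct_ug_smul hX, hu.z, map_smul],
    by rw [← KAct_ug_smul hX, hu.m1, map_zero], by rw [← KAct_ug_smul hX, hu.m2, map_zero],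
    by rw [← KAct_ug_smul hX, hu.m3, map_zero]⟩

end weights

/-! ### Spaces of lowest weight vectors of a given weight -/

section genericWeights

variable {c : Param D} {I : IrrReps D.W} {τ : I.ι}
  (hgen₂ : ∀ σ : I.ι, σ ≠ τ → ∀ n : ℕ, Nc c (I.ρ τ) - Nc c (I.ρ σ) ≠ (n : ℂ))
  (hU : StdUnitary c (I.ρ τ))

include hgen₂ hU

theorem lwDeg_eq_bot {m l : ℕ} (h : (m, l) ∉ B r) (σ : I.ι) :
    lwDeg c (I.ρ τ) (I.ρ σ) m l = ⊥ := by
  obtain ⟨β, h1, h2, h3⟩ := hU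
  refine (Submodule.eq_bot_iff _).2 fun θ hθ => ?_
  by_contra h0
  exact h (mem_B_of_ne_zero hgen₂ h1 h2 h3 hθ h0)

/-- Every lowest weight vector is a sum of bihomogeneous ones of fixed `W`-type, and those of
another weight are orthogonal to the weight space. What remains after subtracting the parts of the
right weight lies in the weight space and is orthogonal to it. -/
theorem lwWeight_eq (wt : ℂ × ℂ) : lwWeight c (I.ρ τ) wt =
    ⨆ (p : B r × I.ι) (_ : wtOf c (I.ρ τ) (I.ρ p.2) p.1.1.1 p.1.1.2 = wt),
      lwDeg c (I.ρ τ) (I.ρ p.2) p.1.1.1 p.1.1.2 := by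
  have hbot := fun m l => lwDeg_eq_bot hgen₂ hU (m := m) (l := l)
  obtain ⟨β, h1, h2, h3⟩ := hU
  have hc := kForm_isContra h1 h2 h3
  set A := ⨆ (p : B r × I.ι) (_ : wtOf c (I.ρ τ) (I.ρ p.2) p.1.1.1 p.1.1.2 = wt),
    lwDeg c (I.ρ τ) (I.ρ p.2) p.1.1.1 p.1.1.2
  have hA : A ≤ lwWeight c (I.ρ τ) wt := iSup₂_le fun p hp θ hθ =>
    mem_lwWeight.2 (hp ▸ isLW_of_mem (I.irreducible τ) (I.irreducible p.2) hθ)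
  refine le_antisymm (fun u hu => ?_) hA
  let C : Submodule ℂ (KMod c (I.ρ τ)) := {
    carrier := {v | ∀ u ∈ lwWeight c (I.ρ τ) wt, kForm β u v = 0}
    add_mem' := fun hv hv' u hu => by rw [map_add, hv u hu, hv' u hu, add_zero]
    zero_mem' := fun u _ => map_zero _
    smul_mem' := fun z v hv u hu => by rw [map_smul, hv u hu, smul_zero] }
  have hlw : lw c (I.ρ τ) ≤ A ⊔ C := by
    refine (lw_le (I.irreducible τ) I).trans
      (iSup_le fun m => iSup_le fun l => iSup_le fun σ => ?_)
    by_cases hB : (m, l) ∈ B r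
    · by_cases hw : wtOf c (I.ρ τ) (I.ρ σ) m l = wt
      · exact le_trans (le_iSup₂_of_le (⟨⟨(m, l), hB⟩, σ⟩ : B r × I.ι) hw le_rfl) le_sup_left
      · refine le_trans (fun θ hθ u hu => ?_ : _ ≤ C) le_sup_right
        exact kForm_eq_zero_of_wt_ne h1 h2 h3 (Ne.symm hw) (mem_lwWeight.1 hu)
          (isLW_of_mem (I.irreducible τ) (I.irreducible σ) hθ)
    · rw [hbot m l hB σ]
      exact bot_le
  obtain ⟨a, ha, b, hb, rfl⟩ := Submodule.mem_sup.1 (hlw hu.1)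
  have hbw : b ∈ lwWeight c (I.ρ τ) wt := (Submodule.add_mem_iff_right _ (hA ha)).1 hu
  rw [hc.eq_zero (hb b hbw), add_zero]
  exact ha

/-- The `h`-weight determines `m`, and `l ≤ r` on `B(r)`, so the space lies in a finite sum of the
`K_m^l`. Finiteness of the set of `W`-types is not needed. -/
theorem finiteDimensional_lwWeight (wt : ℂ × ℂ) :
    FiniteDimensional ℂ (lwWeight c (I.ρ τ) wt) := by
  rw [lwWeight_eq hgen₂ hU]
  by_cases h : ∃ p : B r × I.ι, wtOf c (I.ρ τ) (I.ρ p.2) p.1.1.1 p.1.1.2 = wt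
  · obtain ⟨p, hp⟩ := h
    have := fun l => finiteDimensional_KDeg_of_irreducible (c := c) (I.irreducible τ) p.1.1.1 l
    have hle : (⨆ (q : B r × I.ι) (_ : wtOf c (I.ρ τ) (I.ρ q.2) q.1.1.1 q.1.1.2 = wt),
        lwDeg c (I.ρ τ) (I.ρ q.2) q.1.1.1 q.1.1.2) ≤
        (Finset.range (r + 1)).sup fun l => KDeg c (I.ρ τ) p.1.1.1 l := by
      refine iSup₂_le fun q hq θ hθ => ?_
      have hm : q.1.1.1 = p.1.1.1 := by
        have := congrArg Prod.fst (hq.trans hp.symm)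
        simpa [wtOf] using this
      have hl : q.1.1.2 ∈ Finset.range (r + 1) := by
        rw [Finset.mem_range]
        rcases q.1.2 with h | h | h
        · rw [h]; exact Nat.succ_pos _
        · omega
        · omega
      have hd := hθ.2.1
      rw [hm] at hd
      exact Finset.le_sup (f := fun l => KDeg c (I.ρ τ) p.1.1.1 l) hl hd
    exact Submodule.finiteDimensional_of_le hle
  · push Not at h
    rw [show (⨆ (q : B r × I.ι) (_ : wtOf c (I.ρ τ) (I.ρ q.2) q.1.1.1 q.1.1.2 = wt),
        lwDeg c (I.ρ τ) (I.ρ q.2) q.1.1.1 q.1.1.2) = ⊥ from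
      (iSup₂_eq_bot).2 fun q hq => absurd hq (h q)]
    infer_instance

/-- The centraliser is only known to preserve weights. Two labels of equal weight have the same `m`,
and their `N_c` differ by the integer `l' - l`; separation then forces equal types and equal `l`. -/
theorem lwDeg_stable {σ : I.ι}
    (hσ : ∀ σ' : I.ι, σ' ≠ σ → ∀ n : ℤ, Nc c (I.ρ σ) - Nc c (I.ρ σ') ≠ (n : ℂ)) {m l : ℕ}
    {X : HC c} (hX : X ∈ Rc c) {θ : KMod c (I.ρ τ)} (hθ : θ ∈ lwDeg c (I.ρ τ) (I.ρ σ) m l) :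
    KAct c (I.ρ τ) X θ ∈ lwDeg c (I.ρ τ) (I.ρ σ) m l := by
  have hw : KAct c (I.ρ τ) X θ ∈ lwWeight c (I.ρ τ) (wtOf c (I.ρ τ) (I.ρ σ) m l) :=
    lwWeight_stable hX (mem_lwWeight.2 (isLW_of_mem (I.irreducible τ) (I.irreducible σ) hθ))
  rw [lwWeight_eq hgen₂ hU] at hw
  refine (iSup₂_le fun p hp => ?_ : _ ≤ lwDeg c (I.ρ τ) (I.ρ σ) m l) hw
  obtain ⟨⟨⟨m', l'⟩, hB⟩, σ'⟩ := p
  have e1 := congrArg Prod.fst hp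
  have e2 := congrArg Prod.snd hp
  simp only [wtOf, sub_left_inj, add_left_inj, Nat.cast_inj] at e1 e2
  have hs : σ' = σ := by
    by_contra hne
    exact hσ σ' hne ((l' : ℤ) - l) (by push_cast; linear_combination -e2)
  subst hs
  simp only [add_left_inj, sub_left_inj, Nat.cast_inj] at e2
  subst e1 e2
  exact le_rfl

end genericWeights

/-! ## Decomposition with respect to lowest weight vectors -/

namespace IsContra

variable {N : Type*} [AddCommGroup N] [Module ℂ N] [Module Ug N] [IsScalarTower ℂ Ug N]
  {β : N →ₗ⋆[ℂ] N →ₗ[ℂ] ℂ} (hβ : IsContra β)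

theorem multMap_comm {wt : ℂ × ℂ} {p : Submodule ℂ N} (hp : ∀ θ ∈ p, IsLW wt θ)
    (f : N →ₗ[ℂ] N) (hf : ∀ (a : Ug) u, f (a • u) = a • f u) (θ θ' : p) (u : Irr wt)
    (h : (θ' : N) = f θ) : hβ.multMap hp (θ' ⊗ₜ u) = f (hβ.multMap hp (θ ⊗ₜ u)) := by
  obtain ⟨a, rfl⟩ := exists_smul_lwVec u
  rw [multMap_tmul_smul, multMap_tmul_smul, multMap_tmul_lwVec, multMap_tmul_lwVec, hf, h]

theorem smul_mem_range_multMap {wt : ℂ × ℂ} {p : Submodule ℂ N} (hp : ∀ θ ∈ p, IsLW wt θ)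
    (a : Ug) (x : p ⊗[ℂ] Irr wt) : a • hβ.multMap hp x ∈ LinearMap.range (hβ.multMap hp) := by
  induction x using TensorProduct.induction_on with
  | zero => rw [map_zero, smul_zero]; exact zero_mem _
  | add x y hx hy => rw [map_add, smul_add]; exact Submodule.add_mem _ hx hy
  | tmul θ u => exact ⟨θ ⊗ₜ (a • u), multMap_tmul_smul hβ hp θ a u⟩

variable {P J : Type*} [DecidableEq P] {wt : P → ℂ × ℂ} {M : P → Submodule ℂ N}
  (hM : ∀ p, ∀ θ ∈ M p, IsLW (wt p) θ) (f : P → J) {T : J → Submodule ℂ N}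
  (hT : ∀ p, M p ≤ T (f p)) (hTs : ∀ j, ∀ a : Ug, ∀ u ∈ T j, a • u ∈ T j)
  (hdisj : ∀ j, Disjoint (T j) (⨆ k ∈ {k | k ≠ j}, T k)) [∀ p, FiniteDimensional ℂ (M p)]
  (horth : ∀ p q, p ≠ q → f p = f q → ∀ θ ∈ M p, ∀ θ' ∈ M q, β θ θ' = 0)
  (hgen : ∀ R : Submodule ℂ N, (∀ a : Ug, ∀ u ∈ R, a • u ∈ R) → (∀ p, M p ≤ R) → R = ⊤)

include hβ hM hT hTs hdisj horth hgen

/-- A module with a contravariant form that is generated by lowest weight vectors is the direct sum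
of the products of its multiplicity spaces with irreducible modules. -/
theorem exists_decomposition : ∃ Φ : (⨁ p, M p ⊗[ℂ] Irr (wt p)) ≃ₗ[ℂ] N,
    (∀ p θ, Φ (DirectSum.lof ℂ P _ p (θ ⊗ₜ[ℂ] lwVec _)) = θ) ∧
    (∀ p θ (a : Ug) u, Φ (DirectSum.lof ℂ P _ p (θ ⊗ₜ[ℂ] (a • u))) =
      a • Φ (DirectSum.lof ℂ P _ p (θ ⊗ₜ[ℂ] u))) ∧
    (∀ j, T j = ⨆ (p : P) (_ : f p = j),
      LinearMap.range (Φ.toLinearMap ∘ₗ DirectSum.lof ℂ P (fun p => M p ⊗[ℂ] Irr (wt p)) p)) ∧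
    ∀ X : N →ₗ[ℂ] N, (∀ (a : Ug) u, X (a • u) = a • X u) → ∀ p (θ θ' : M p) (u : Irr (wt p)),
      (θ' : N) = X θ → Φ (DirectSum.lof ℂ P _ p (θ' ⊗ₜ[ℂ] u)) =
        X (Φ (DirectSum.lof ℂ P _ p (θ ⊗ₜ[ℂ] u))) := by
  let φ := fun p => hβ.multMap (hM p)
  have hφT : ∀ p x, φ p x ∈ T (f p) := fun p x =>
    hβ.multMap_mem (hM p) (fun θ hθ a => hTs _ a _ (hT p hθ)) x
  have hlof : ∀ p x, DirectSum.toModule ℂ P N φ (DirectSum.lof ℂ P _ p x) = φ p x :=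
    fun p x => DirectSum.toModule_lof ℂ (φ := φ) p x
  have hinj : Function.Injective (DirectSum.toModule ℂ P N φ) :=
    toModule_injective φ f hφT hdisj (fun p => hβ.multMap_injective (hM p))
      (fun u hu => hβ.eq_zero hu)
      (fun p q hne hf => hβ.multMap_orth (hM p) (hM q) (horth p q hne hf))
  have hsurj : Function.Surjective (DirectSum.toModule ℂ P N φ) := by
    refine LinearMap.range_eq_top.1 (hgen _ ?_ fun p θ hθ => ?_)
    · rintro a _ ⟨x, rfl⟩
      induction x using DirectSum.induction_on with
      | zero => rw [map_zero, smul_zero]; exact zero_mem _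
      | add x y hx hy => rw [map_add, smul_add]; exact Submodule.add_mem _ hx hy
      | of p x =>
        obtain ⟨y, hy⟩ := hβ.smul_mem_range_multMap (hM p) a x
        refine ⟨DirectSum.lof ℂ P _ p y, ?_⟩
        rw [hlof]
        exact hy.trans (congrArg (a • ·) (hlof p x).symm)
    · exact ⟨DirectSum.lof ℂ P _ p (⟨θ, hθ⟩ ⊗ₜ lwVec _),
        (hlof _ _).trans (hβ.multMap_tmul_lwVec (hM p) ⟨θ, hθ⟩)⟩
  obtain ⟨Φ, hΦ'⟩ : ∃ Φ : (⨁ p, M p ⊗[ℂ] Irr (wt p)) ≃ₗ[ℂ] N,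
      ∀ x, Φ x = DirectSum.toModule ℂ P N φ x :=
    ⟨LinearEquiv.ofBijective _ ⟨hinj, hsurj⟩, fun _ => rfl⟩
  have hΦ : ∀ p x, Φ (DirectSum.lof ℂ P _ p x) = φ p x := fun p x => (hΦ' _).trans (hlof p x)
  have hr : ∀ p, LinearMap.range (Φ.toLinearMap ∘ₗ
      DirectSum.lof ℂ P (fun p => M p ⊗[ℂ] Irr (wt p)) p) = LinearMap.range (φ p) := fun p =>
    congrArg _ (LinearMap.ext (hΦ p))
  refine ⟨Φ, fun p θ => ?_, fun p θ a u => ?_, fun j => ?_, fun X hX p θ θ' u h => ?_⟩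
  · rw [hΦ]
    exact hβ.multMap_tmul_lwVec (hM p) θ
  · rw [hΦ, hΦ]
    exact hβ.multMap_tmul_smul (hM p) θ a u
  · simp only [hr]
    refine le_antisymm (fun u hu => ?_) (iSup₂_le fun p hp => ?_)
    · obtain ⟨x, rfl⟩ := hsurj u
      exact mem_iSup_range φ f hφT hdisj hu
    · rintro _ ⟨y, rfl⟩
      exact hp ▸ hφT p y
  · rw [hΦ, hΦ]
    exact hβ.multMap_comm (hM p) X hX θ θ' u h

end IsContra

/-! ### The decomposition of `K_c(τ)` -/

section decomposition

variable {c : Param D} {I : IrrReps D.W} {τ : I.ι}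

theorem wtOf_injective {σ : I.ι} {m l m' l' : ℕ}
    (h : wtOf c (I.ρ τ) (I.ρ σ) m l = wtOf c (I.ρ τ) (I.ρ σ) m' l') : m = m' ∧ l = l' := by
  have e1 := congrArg Prod.fst h
  have e2 := congrArg Prod.snd h
  simpa only [wtOf, sub_left_inj, add_left_inj, Nat.cast_inj] using And.intro e1 e2

theorem disjoint_KIso (σ : I.ι) : Disjoint (KIso c (I.ρ τ) (I.ρ σ))
    (⨆ k ∈ {k | k ≠ σ}, KIso c (I.ρ τ) (I.ρ k)) :=
  disjoint_isoComp I (KWrep c (I.ρ τ)) σ {k | k ≠ σ} (fun h => h rfl)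

theorem lwDeg_orth {β : StdMod c (I.ρ τ) →ₗ⋆[ℂ] StdMod c (I.ρ τ) →ₗ[ℂ] ℂ}
    (h1 : ∀ u v, conj (β u v) = β v u) (h2 : ∀ u, u ≠ 0 → 0 < (β u u).re)
    (h3 : ∀ a u v, β (stdAct c (I.ρ τ) a u) v = β u (stdAct c (I.ρ τ) (RCA.star c a) v))
    (p q : B r × I.ι) (hne : p ≠ q) (hs : p.2 = q.2)
    (θ : KMod c (I.ρ τ)) (hθ : θ ∈ lwDeg c (I.ρ τ) (I.ρ p.2) p.1.1.1 p.1.1.2)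
    (θ' : KMod c (I.ρ τ)) (hθ' : θ' ∈ lwDeg c (I.ρ τ) (I.ρ q.2) q.1.1.1 q.1.1.2) :
    kForm β θ θ' = 0 := by
  obtain ⟨⟨⟨m, l⟩, hB⟩, σ⟩ := p
  obtain ⟨⟨⟨m', l'⟩, hB'⟩, σ'⟩ := q
  obtain rfl : σ = σ' := hs
  refine kForm_eq_zero_of_wt_ne h1 h2 h3 (fun h => hne ?_)
    (isLW_of_mem (I.irreducible τ) (I.irreducible σ) hθ)
    (isLW_of_mem (I.irreducible τ) (I.irreducible σ) hθ')
  obtain ⟨rfl, rfl⟩ := wtOf_injective h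
  rfl

variable (hgen₂ : ∀ σ : I.ι, σ ≠ τ → ∀ n : ℕ, Nc c (I.ρ τ) - Nc c (I.ρ σ) ≠ (n : ℂ))
  (hU : StdUnitary c (I.ρ τ))
include hgen₂ hU

theorem generated_by_lwDeg (R : Submodule ℂ (KMod c (I.ρ τ)))
    (h : ∀ a : Ug, ∀ u ∈ R, a • u ∈ R)
    (hR : ∀ p : B r × I.ι, lwDeg c (I.ρ τ) (I.ρ p.2) p.1.1.1 p.1.1.2 ≤ R) : R = ⊤ := by
  have hbot := fun m l => lwDeg_eq_bot hgen₂ hU (m := m) (l := l)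
  obtain ⟨β, h1, h2, h3⟩ := hU
  refine eq_top_of_lwDeg_le (I.irreducible τ) I (kForm_isContra h1 h2 h3)
    (fun u hu => ?_) (fun u hu => ?_) (fun u hu => ?_) fun m l σ => ?_
  · rw [← toU_e1p]; exact h _ u hu
  · rw [← toU_e2p]; exact h _ u hu
  · rw [← toU_e3p]; exact h _ u hu
  · by_cases hB : (m, l) ∈ B r
    · exact hR ⟨⟨(m, l), hB⟩, σ⟩
    · rw [hbot m l hB]
      exact bot_le

/-- The decomposition of `K_c(τ)` with respect to `ℛ_c` and `𝔤`. -/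
theorem exists_KMod_decomposition [DecidableEq I.ι] :
    ∃ Φ : (⨁ p : B r × I.ι, lwDeg c (I.ρ τ) (I.ρ p.2) p.1.1.1 p.1.1.2 ⊗[ℂ]
          Irr (wtOf c (I.ρ τ) (I.ρ p.2) p.1.1.1 p.1.1.2)) ≃ₗ[ℂ] KMod c (I.ρ τ),
      (∀ p θ, Φ (DirectSum.lof ℂ _ _ p (θ ⊗ₜ[ℂ] lwVec _)) = θ) ∧
      (∀ p θ (X : spo) u, Φ (DirectSum.lof ℂ _ _ p (θ ⊗ₜ[ℂ] (toU X • u))) =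
        gAct c (I.ρ τ) X (Φ (DirectSum.lof ℂ _ _ p (θ ⊗ₜ[ℂ] u)))) ∧
      (∀ σ : I.ι, KIso c (I.ρ τ) (I.ρ σ) = ⨆ b : B r, LinearMap.range
        (Φ.toLinearMap ∘ₗ DirectSum.lof ℂ (B r × I.ι) (fun p =>
          lwDeg c (I.ρ τ) (I.ρ p.2) p.1.1.1 p.1.1.2 ⊗[ℂ]
            Irr (wtOf c (I.ρ τ) (I.ρ p.2) p.1.1.1 p.1.1.2)) (b, σ))) ∧
      (∀ X ∈ Rc c, ∀ (p : B r × I.ι) (θ θ' : lwDeg c (I.ρ τ) (I.ρ p.2) p.1.1.1 p.1.1.2)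
        (u : Irr (wtOf c (I.ρ τ) (I.ρ p.2) p.1.1.1 p.1.1.2)),
        (θ' : KMod c (I.ρ τ)) = KAct c (I.ρ τ) X θ →
        Φ (DirectSum.lof ℂ _ _ p (θ' ⊗ₜ[ℂ] u)) =
          KAct c (I.ρ τ) X (Φ (DirectSum.lof ℂ _ _ p (θ ⊗ₜ[ℂ] u)))) := by
  have hgen := generated_by_lwDeg hgen₂ hU
  obtain ⟨β, h1, h2, h3⟩ := hU
  have hc := kForm_isContra h1 h2 h3
  have hM : ∀ p : B r × I.ι, ∀ θ ∈ lwDeg c (I.ρ τ) (I.ρ p.2) p.1.1.1 p.1.1.2,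
      IsLW (wtOf c (I.ρ τ) (I.ρ p.2) p.1.1.1 p.1.1.2) θ := fun p θ hθ =>
    isLW_of_mem (I.irreducible τ) (I.irreducible p.2) hθ
  have hfd : ∀ p : B r × I.ι,
      FiniteDimensional ℂ (lwDeg c (I.ρ τ) (I.ρ p.2) p.1.1.1 p.1.1.2) := fun p =>
    finiteDimensional_lwDeg (I.irreducible τ) _ _ _
  have key := hc.exists_decomposition hM Prod.snd
    (T := fun σ => KIso c (I.ρ τ) (I.ρ σ)) (fun p θ hθ => hθ.2.2)
    (fun σ a u hu => smul_mem_KIso a hu) disjoint_KIso (lwDeg_orth h1 h2 h3) hgen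
  refine key.imp fun Φ h => And.intro h.1 (And.intro (fun p θ X u => ?_) (And.intro (fun σ => ?_)
    fun X hX => h.2.2.2 (KAct c (I.ρ τ) X) (KAct_ug_smul hX)))
  · exact (h.2.1 p θ (toU X) u).trans (toU_smul c _ X _)
  · refine (h.2.2.1 σ).trans (le_antisymm (iSup₂_le fun p hp => ?_) (iSup_le fun b => ?_))
    · subst hp
      exact le_iSup_of_le p.1 le_rfl
    · exact le_iSup₂_of_le (b, σ) rfl le_rfl

end decomposition

/-! ### The types of the irreducible modules -/

section types

variable {c : Param D} {I : IrrReps D.W} {τ : I.ι}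
  (hgen₁ : ∀ n : ℕ, (r : ℂ) / 2 - Nc c (I.ρ τ) ≠ -(n : ℂ))
  (hgen₂ : ∀ σ : I.ι, σ ≠ τ → ∀ n : ℕ, Nc c (I.ρ τ) - Nc c (I.ρ σ) ≠ (n : ℂ))
  (hU : StdUnitary c (I.ρ τ))

include hgen₁ hgen₂ hU

theorem irr_wtOf_types (m l : ℕ) (σ : I.ι) (hB : (m, l) ∈ B r)
    (h : lwDeg c (I.ρ τ) (I.ρ σ) m l ≠ ⊥) :
    IsSimpleModule Ug (Irr (wtOf c (I.ρ τ) (I.ρ σ) m l)) ∧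
    ((m, l) = (0, 0) → IsFlash (wtOf c (I.ρ τ) (I.ρ σ) m l) 0) ∧
    ((m, l + 1) = (1, r) → IsFlash (wtOf c (I.ρ τ) (I.ρ σ) m l) 1) ∧
    ((m, l) ≠ (0, 0) → (m, l + 1) ≠ (1, r) →
      IsFreeGam (wtOf c (I.ρ τ) (I.ρ σ) m l) ∧
      Nonempty (Irr (wtOf c (I.ρ τ) (I.ρ σ) m l) ≃ₗ[Ug] Verma (wtOf c (I.ρ τ) (I.ρ σ) m l))) := by
  obtain ⟨θ, hθ, h0⟩ := Submodule.exists_mem_ne_zero_of_ne_bot h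
  have hv : vermaVec (wtOf c (I.ρ τ) (I.ρ σ) m l) ≠ 0 := by
    obtain ⟨β, h1, h2, h3⟩ := hU
    exact IsContra.vermaVec_ne_zero
      (isLW_of_mem (I.irreducible τ) (I.irreducible σ) hθ) h0
  have ha : ∀ n : ℕ, (wtOf c (I.ρ τ) (I.ρ σ) m l).1 ≠ -n := fun n hn =>
    hgen₁ (m + n) (by
      rw [wtOf] at hn
      push_cast
      linear_combination hn)
  refine ⟨irr_simple hv, fun e => ?_, fun e => ?_, fun e0 e1 => ?_⟩
  · obtain ⟨rfl, rfl⟩ := Prod.mk.inj e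
    exact isFlash_zero hv ha (wt_zero hgen₂ hθ h0)
  · obtain ⟨rfl, hl⟩ := Prod.mk.inj e
    -- For `m = 1` the number `λ(h) - 1` is exactly `r/2 - N_c(τ)`.
    refine isFlash_one hv (fun n hn => hgen₁ n ?_) (wt_one hgen₂ hl hθ h0)
    rw [wtOf] at hn
    push_cast at hn
    linear_combination hn
  · rcases hB with hB | ⟨hm, hl⟩ | ⟨hm, hl⟩
    · exact absurd hB e0
    · exact absurd (Prod.ext hm hl) e1
    · exact isFreeGam_of hv ha (wt_typical hgen₂ hm hl σ).1 (wt_typical hgen₂ hm hl σ).2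

end types

/-! ## Hook partitions -/

/-- The hook with arm `m` and leg `l` below its first row. -/
def hookDiagram (m l : ℕ) : YoungDiagram where
  -- The leg is suppressed for `m = 0`, so that the diagram is empty whatever `l` is.
  cells := ({0} ×ˢ Finset.range m) ∪ (Finset.range (if m = 0 then 0 else l + 1) ×ˢ {0})
  isLowerSet := by
    rintro ⟨i, j⟩ ⟨i', j'⟩ ⟨hi, hj⟩ h
    simp only [Finset.coe_union, Finset.coe_product, Set.mem_union, Set.mem_prod, Finset.mem_coe,
      Finset.mem_singleton, Finset.mem_range] at h hi hj ⊢
    split_ifs at h ⊢ <;> omega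

theorem mem_hookDiagram {m l i j : ℕ} :
    (i, j) ∈ hookDiagram m l ↔ m ≠ 0 ∧ ((i = 0 ∧ j < m) ∨ (i ≤ l ∧ j = 0)) := by
  rw [← YoungDiagram.mem_cells]
  simp only [hookDiagram, Finset.mem_union, Finset.mem_product, Finset.mem_singleton,
    Finset.mem_range]
  split_ifs <;> omega

theorem rowLen_hookDiagram_zero (m l : ℕ) : (hookDiagram m l).rowLen 0 = m := by
  refine eq_of_forall_lt_iff fun j => ?_
  rw [← YoungDiagram.mem_iff_lt_rowLen, mem_hookDiagram]
  omega

theorem rowLen_hookDiagram_le {m l i : ℕ} (hi : 1 ≤ i) : (hookDiagram m l).rowLen i ≤ 1 := by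
  by_contra! h
  rw [← YoungDiagram.mem_iff_lt_rowLen, mem_hookDiagram] at h
  omega

theorem colLen_hookDiagram_zero {m l : ℕ} (hm : m ≠ 0) : (hookDiagram m l).colLen 0 = l + 1 := by
  refine eq_of_forall_lt_iff fun j => ?_
  rw [← YoungDiagram.mem_iff_lt_colLen, mem_hookDiagram]
  omega

theorem colLen_hookDiagram_one {m l : ℕ} :
    (hookDiagram m l).colLen 1 = if 2 ≤ m then 1 else 0 := by
  refine eq_of_forall_lt_iff fun j => ?_
  rw [← YoungDiagram.mem_iff_lt_colLen, mem_hookDiagram]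
  split_ifs <;> simp <;> omega

theorem hookDiagram_zero (l : ℕ) : hookDiagram 0 l = ⊥ := by
  ext ⟨i, j⟩
  rw [YoungDiagram.mem_cells, mem_hookDiagram]
  simp

theorem colLen_bot (j : ℕ) : (⊥ : YoungDiagram).colLen j = 0 := by
  refine eq_of_forall_lt_iff fun i => ?_
  rw [← YoungDiagram.mem_iff_lt_colLen]
  simp

theorem rowLen_bot (i : ℕ) : (⊥ : YoungDiagram).rowLen i = 0 := by
  refine eq_of_forall_lt_iff fun j => ?_
  rw [← YoungDiagram.mem_iff_lt_rowLen]
  simp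

/-- Below the first row only the first column can be occupied, so the first row and the first column
determine the diagram. For the empty diagram the truncated difference gives `l = 0`, in accordance
with `(0) ↦ (0,0)`. -/
theorem eq_hookDiagram {μ : YoungDiagram} (h : ∀ i, 1 ≤ i → μ.rowLen i ≤ 1) :
    μ = hookDiagram (μ.rowLen 0) (μ.colLen 0 - 1) := by
  have key : ∀ i j, (i, j) ∈ μ ↔ (i, j) ∈ hookDiagram (μ.rowLen 0) (μ.colLen 0 - 1) := by
    intro i j
    have h0 : (0, 0) ∈ μ ↔ μ.rowLen 0 ≠ 0 := by
      rw [YoungDiagram.mem_iff_lt_rowLen, Nat.pos_iff_ne_zero]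
    have h0' : (0, 0) ∈ μ ↔ 0 < μ.colLen 0 := YoungDiagram.mem_iff_lt_colLen
    rw [mem_hookDiagram]
    refine ⟨fun hij => ?_, ?_⟩
    · refine ⟨h0.1 (μ.up_left_mem (Nat.zero_le i) (Nat.zero_le j) hij), ?_⟩
      rcases Nat.eq_zero_or_pos i with rfl | hi
      · exact Or.inl ⟨rfl, YoungDiagram.mem_iff_lt_rowLen.1 hij⟩
      · have := YoungDiagram.mem_iff_lt_rowLen.1 hij
        have := h i hi
        obtain rfl : j = 0 := by omega
        have := YoungDiagram.mem_iff_lt_colLen.1 hij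
        exact Or.inr ⟨by omega, rfl⟩
    · rintro ⟨hm, ⟨rfl, hj⟩ | ⟨hi, rfl⟩⟩
      · exact YoungDiagram.mem_iff_lt_rowLen.2 hj
      · have := h0'.1 (h0.2 hm)
        exact YoungDiagram.mem_iff_lt_colLen.2 (by omega)
  ext ⟨i, j⟩
  exact key i j

/-- Hook partitions correspond to bidegrees. -/
theorem hook_bijOn (r : ℕ) :
    Set.BijOn (fun μ : YoungDiagram => (μ.rowLen 0, μ.colLen 0 - 1)) (Hook r) (B r) := by
  refine ⟨fun μ hμ => ?_, fun μ hμ ν hν h => ?_, fun p hp => ?_⟩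
  · obtain ⟨h, hr⟩ := hμ
    have e := eq_hookDiagram h
    by_cases hm : μ.rowLen 0 = 0
    · rw [hm, hookDiagram_zero] at e
      subst e
      left
      simp [hm, colLen_bot]
    · have h1 : 0 < μ.colLen 0 := by
        rw [← YoungDiagram.mem_iff_lt_colLen, YoungDiagram.mem_iff_lt_rowLen]
        omega
      -- The second column of a nonempty hook has length one exactly if `m ≥ 2`. Hence the bound
      -- reads `l + 1 ≤ r` for `m = 1` and `l + 2 ≤ r` for `m ≥ 2`, and the extra label `(1, r-1)`
      -- is a single column.
      have h2 : μ.colLen 1 = if 2 ≤ μ.rowLen 0 then 1 else 0 := by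
        conv_lhs => rw [e]
        exact colLen_hookDiagram_one
      change _ ∨ (μ.rowLen 0 = 1 ∧ μ.colLen 0 - 1 + 1 = r) ∨
        (1 ≤ μ.rowLen 0 ∧ μ.colLen 0 - 1 + 2 ≤ r)
      split_ifs at h2 <;> omega
  · rw [eq_hookDiagram hμ.1, eq_hookDiagram hν.1]
    obtain ⟨h1, h2⟩ := Prod.mk.inj h
    rw [h1, h2]
  · obtain ⟨m, l⟩ := p
    refine ⟨hookDiagram m l, ⟨fun i hi => rowLen_hookDiagram_le hi, ?_⟩, ?_⟩
    · by_cases hm : m = 0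
      · subst hm
        rw [colLen_hookDiagram_one, hookDiagram_zero, colLen_bot]
        simp
      · rw [colLen_hookDiagram_zero hm, colLen_hookDiagram_one]
        rcases hp with h | ⟨h, h'⟩ | ⟨h, h'⟩
        · exact absurd (Prod.mk.inj h).1 hm
        · simp only at h h'
          split_ifs <;> omega
        · simp only at h h'
          split_ifs <;> omega
    · by_cases hm : m = 0
      · subst hm
        have hl : l = 0 := by
          rcases hp with h | ⟨h, h'⟩ | ⟨h, h'⟩
          · exact (Prod.mk.inj h).2
          · exact absurd h (by simp)
          · exact absurd h (by simp)
        simp [hookDiagram_zero, colLen_bot, rowLen_bot, hl]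
      · simp [rowLen_hookDiagram_zero, colLen_hookDiagram_zero hm]

end DunklHowe

end

/-! ### The main theorem -/

theorem mainTheorem2 {r : ℕ} (D : RootSys r) (c : Param D) (I : IrrReps D.W) [DecidableEq I.ι]
    (τ : I.ι)
    (hU : StdUnitary c (I.ρ τ))
    (hgen₁ : ∀ n : ℕ, (r : ℂ) / 2 - Nc c (I.ρ τ) ≠ -(n : ℂ))
    (hgen₂ : ∀ σ : I.ι, σ ≠ τ → ∀ n : ℕ, Nc c (I.ρ τ) - Nc c (I.ρ σ) ≠ (n : ℂ)) :
    -- labels: hook partitions correspond to bidegrees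
    Set.BijOn (fun μ : YoungDiagram => (μ.rowLen 0, μ.colLen 0 - 1)) (Hook r) (B r) ∧
    -- the multiplicity spaces are finite-dimensional
    (∀ (m l : ℕ) (σ : I.ι), FiniteDimensional ℂ (lwDeg c (I.ρ τ) (I.ρ σ) m l)) ∧
    -- the decomposition, as modules for `𝔤` and for its centraliser
    (∃ Φ : (⨁ p : B r × I.ι, lwDeg c (I.ρ τ) (I.ρ p.2) p.1.1.1 p.1.1.2 ⊗[ℂ]
          Irr (wtOf c (I.ρ τ) (I.ρ p.2) p.1.1.1 p.1.1.2)) ≃ₗ[ℂ] KMod c (I.ρ τ),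
      (∀ p θ, Φ (DirectSum.lof ℂ _ _ p (θ ⊗ₜ[ℂ] lwVec _)) = θ) ∧
      (∀ p θ (X : spo) u, Φ (DirectSum.lof ℂ _ _ p (θ ⊗ₜ[ℂ] (toU X • u))) =
        gAct c (I.ρ τ) X (Φ (DirectSum.lof ℂ _ _ p (θ ⊗ₜ[ℂ] u)))) ∧
      (∀ σ : I.ι, KIso c (I.ρ τ) (I.ρ σ) = ⨆ b : B r, LinearMap.range
        (Φ.toLinearMap ∘ₗ DirectSum.lof ℂ (B r × I.ι) (fun p =>
          lwDeg c (I.ρ τ) (I.ρ p.2) p.1.1.1 p.1.1.2 ⊗[ℂ]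
            Irr (wtOf c (I.ρ τ) (I.ρ p.2) p.1.1.1 p.1.1.2)) (b, σ))) ∧
      (∀ X ∈ Rc c, ∀ (p : B r × I.ι) (θ θ' : lwDeg c (I.ρ τ) (I.ρ p.2) p.1.1.1 p.1.1.2)
        (u : Irr (wtOf c (I.ρ τ) (I.ρ p.2) p.1.1.1 p.1.1.2)),
        (θ' : KMod c (I.ρ τ)) = KAct c (I.ρ τ) X θ →
        Φ (DirectSum.lof ℂ _ _ p (θ' ⊗ₜ[ℂ] u)) =
          KAct c (I.ρ τ) X (Φ (DirectSum.lof ℂ _ _ p (θ ⊗ₜ[ℂ] u))))) ∧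
    -- the modules that occur are irreducible, of the following types
    (∀ (m l : ℕ) (σ : I.ι), (m, l) ∈ B r → lwDeg c (I.ρ τ) (I.ρ σ) m l ≠ ⊥ →
      IsSimpleModule Ug (Irr (wtOf c (I.ρ τ) (I.ρ σ) m l)) ∧
      ((m, l) = (0, 0) → IsFlash (wtOf c (I.ρ τ) (I.ρ σ) m l) 0) ∧
      ((m, l + 1) = (1, r) → IsFlash (wtOf c (I.ρ τ) (I.ρ σ) m l) 1) ∧
      ((m, l) ≠ (0, 0) → (m, l + 1) ≠ (1, r) →
        IsFreeGam (wtOf c (I.ρ τ) (I.ρ σ) m l) ∧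
        Nonempty (Irr (wtOf c (I.ρ τ) (I.ρ σ) m l) ≃ₗ[Ug] Verma (wtOf c (I.ρ τ) (I.ρ σ) m l)))) ∧
    -- unitarity over the centraliser, for `σ` separated from the other types
    (∀ σ : I.ι, (∀ σ' : I.ι, σ' ≠ σ → ∀ n : ℤ, Nc c (I.ρ σ) - Nc c (I.ρ σ') ≠ (n : ℂ)) →
      ∀ m l : ℕ, IsUnitaryRc c (I.ρ τ) (lwDeg c (I.ρ τ) (I.ρ σ) m l)) ∧
    -- in general: the same for the sum of the multiplicity spaces of a given weight
    (∀ wt : ℂ × ℂ,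
      lwWeight c (I.ρ τ) wt =
        (⨆ (p : B r × I.ι) (_ : wtOf c (I.ρ τ) (I.ρ p.2) p.1.1.1 p.1.1.2 = wt),
          lwDeg c (I.ρ τ) (I.ρ p.2) p.1.1.1 p.1.1.2) ∧
      FiniteDimensional ℂ (lwWeight c (I.ρ τ) wt) ∧
      IsUnitaryRc c (I.ρ τ) (lwWeight c (I.ρ τ) wt)) := by
  exact ⟨hook_bijOn r, fun m l σ => finiteDimensional_lwDeg (I.irreducible τ) (I.ρ σ) m l,
    exists_KMod_decomposition hgen₂ hU, irr_wtOf_types hgen₁ hgen₂ hU,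
    fun σ hσ m l => isUnitaryRc_of_stable hU fun X hX θ hθ => lwDeg_stable hgen₂ hU hσ hX hθ,
    fun wt => ⟨lwWeight_eq hgen₂ hU wt, finiteDimensional_lwWeight hgen₂ hU wt,
      isUnitaryRc_of_stable hU fun X hX θ hθ => lwWeight_stable hX hθ⟩⟩
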